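/- **Setting.** Let $r\ge 1$ be an integer and $\alpha>0$. Let $D$ be a closed region in $\mathbb R^d$ (compact, or the periodic lift of a region of a torus; compactness is not needed), whose boundary is a finite union of pieces $\Gamma_1,\dots,\Gamma_n$ which, off a closed corner set $\Gamma^*\subset\partial D$, are $C^{r+1}$ hypersurfaces with $D$ on one side. For $0<\varepsilon\le\varepsilon_0$ let $V(\cdot;\varepsilon)$ be a potential which is finite and $C^{r+1}$ on an open set $\Omega_\varepsilon$ and $+\infty$ elsewhere, and consider the Hamiltonian flow $h^\varepsilon_t$ of $H=\frac{p^2}{2}+V(q;\varepsilon)$. Assume: * (I) Every compact $K\subset\operatorname{int}D$ lies in $\Omega_\varepsilon$ for small $\varepsilon$, and $\|V(\cdot;\varepsilon)|_K\|_{C^{r+1}}\to0$ as $\varepsilon\to0^+$. * (II) There is a pattern function $Q(q;\varepsilon)$, $0\le\varepsilon\le\varepsilon_0$, defined for $q$ in an open set $\tilde D\supset D\setminus\Gamma^*$, of class $C^{r+1}$ in $q$ and depending continuously on $\varepsilon\ge0$ in the $C^{r+1}$ topology (uniformly on compact sets). There are open neighbourhoods $N_i\subset\tilde D$ of $\Gamma_i\setminus\Gamma^*$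 and constants $Q_i$ such that $Q(\cdot;0)=Q_i$ on $\Gamma_i\setminus\Gamma^*$, $\nabla Q\ne0$ on $N_i$, the derivatives of $Q$ of orders $0,\dots,r+1$ are bounded on the $N_i$ uniformly in $\varepsilon$, and, near each point of $\Gamma_i\setminus\Gamma^*$, the derivatives of $Q(\cdot;\varepsilon)$ of order $r+1$ are Lipschitz in $q$ uniformly in $\varepsilon$. On $N_i\cap\Omega_\varepsilon$ the potential is given by the power-law barrier $V(q;\varepsilon)=W(Q(q;\varepsilon)-Q_i;\varepsilon)$, $W(Q;\varepsilon)=(\varepsilon/Q)^\alpha$. * (III) A point $q\in N_i$ lies in $D$ iff $Q(q;0)\ge Q_i$, and in $\Omega_\varepsilon$ iff $Q(q;\varepsilon)>Q_i$; moreover $Q(\cdot;0)>Q_i$ on $\overline{N_i}\cap\operatorname{int}D$, and $\Omega_\varepsilon\subset D\cup\bigcup_iN_i$. * (Boundary domination) For all sufficiently small $\varepsilon,\delta>0$, the supremum of $\|\partial^lV(q;\varepsilon)\|$ over $1\le l\le r+1$ and $q$ in the region $\{q\in\Omega_\varepsilon: Q(q;\varepsilon)\ge Q_i+\delta\text{ whenever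 }q\in N_i\}$ equals its supremum over $1\le l\le r+1$ and $q$ in the bounding surfaces $\bigcup_i\{q\in N_i: Q(q;\varepsilon)=Q_i+\delta\}$. Put $\nu(\varepsilon)=\varepsilon^{1/(r+2+1/\alpha)}$ and let $\eta(\varepsilon)=\varepsilon\,\nu(\varepsilon)^{-1/\alpha}$, so that $W(\eta;\varepsilon)=\nu$. Let $D^\varepsilon=\{q\in\Omega_\varepsilon: Q(q;\varepsilon)\ge Q_i+\eta(\varepsilon)\text{ whenever }q\in N_i\}$ be the auxiliary billiard table, bounded by the level surfaces $Q=Q_i+\eta$. Let $b^\varepsilon_t$ be its billiard flow and $B^\varepsilon$ its billiard map on the cross-section $S_\varepsilon=\{(q,p): q\in\partial D^\varepsilon,\ \langle p,n(q)\rangle>0\}$, $n$ being the inward unit normal (defined at smooth boundary points). Let $\lambda(\varepsilon)=\nu(\varepsilon)$ if $\alpha\ge1$ and $\lambda(\varepsilon)=\nu(\varepsilon)^{\alpha(r+2)/(\alpha+r+1)}$ if $\alpha\le1$. **Proposition.** 1. $\eta(\varepsilon)=O(\nu(\varepsilon)^{r+2})$ as $\varepsilon\to0^+$. 2. Let $T>0$,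 and let $\rho_0=(q_0,p_0)$, $|p_0|=1$, be an inner phase point whose billiard orbit in $D$ on $[0,T]$ ends at an inner point and has finitely many collisions, all of them non-tangent and off $\Gamma^*$. Then there are an open neighbourhood $U$ of $\rho_0$ in phase space and $C,\varepsilon_1>0$ such that for all $0<\varepsilon<\varepsilon_1$ and $\rho\in U$ both orbits $h^\varepsilon_t\rho$ and $b^\varepsilon_t\rho$ are defined on $[0,T]$, the latter has only regular collisions, as many as the orbit of $\rho_0$ in $D$, and, for every $t\in[0,T]$ outside the impact intervals $[s-C\lambda(\varepsilon),s+C\lambda(\varepsilon)]$ around the collision times $s$ of $b^\varepsilon_t\rho$, the maps $h^\varepsilon_t$ and $b^\varepsilon_t$ are $C^r$ at $\rho$, and all derivatives of $h^\varepsilon_t-b^\varepsilon_t$ at $\rho$ of order $\le r$ (in $(q,p)$) are bounded by $C\nu(\varepsilon)$. In particular the impact intervals have length $O(\nu)$ for $\alpha\ge1$ and $O(\nu^{\alpha(r+2)/(\alpha+r+1)})$ for $\alpha\le1$. 3. Let $K$ be a compact set of phase points $(q,p)$, $|p|=1$, $q\in\partial D\setminus\Gamma^*$, $\langle p,n(q)\rangle>0$,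 whose next collision with $\partial D$ exists, is non-tangent and off $\Gamma^*$. Then there are an open neighbourhood $U$ of $K$ and $C,\varepsilon_1>0$ such that for $0<\varepsilon<\varepsilon_1$ the billiard map $B^\varepsilon$ (with non-tangent collision) and the Poincaré map $\Phi^\varepsilon$ of $h^\varepsilon_t$ are defined on $S_\varepsilon\cap U$. Here $\Phi^\varepsilon$ follows the orbit through the interior of $D^\varepsilon$ to $\partial D^\varepsilon$, and then outside $D^\varepsilon$ until it returns to $S_\varepsilon$. Moreover $\Phi^\varepsilon$ and $B^\varepsilon$ are $C\nu(\varepsilon)$-close in the $C^r$ topology on $S_\varepsilon\cap U$, in the following sense: for every $C^r$ germ $\varphi$ into $S_\varepsilon$ based at a point of $S_\varepsilon\cap U$, with derivatives of orders $1,\dots,r$ of norm $\le1$ at the base point, $\Phi^\varepsilon\circ\varphi$ and $B^\varepsilon\circ\varphi$ are $C^r$ there and the derivatives of their difference of orders $0,\dots,r$ are bounded by $C\nu(\varepsilon)$. -/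

import Mathlib

open Filter Topology Asymptotics

noncomputable section

open Set
open scoped ENNReal InnerProductSpace

namespace SteepBilliard

/-- Configuration space `ℝ^d`. -/
abbrev Conf (d : ℕ) : Type := EuclideanSpace ℝ (Fin d)

/-- Phase points `(q, p)`: position and momentum. -/
abbrev Phase (d : ℕ) : Type := Conf d × Conf d

/-! ### Billiards -/

/-- `n` is the inward unit normal at `q` of the region `A`: near `q` the region is `{g ≥ 0}` for a
`C¹` function `g` with `g q = 0` whose (nonzero) gradient at `q` is a positive multiple of `n`.
There is at most one such `n`, and its existence forces `q` to be a smooth point of `∂A`. -/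
def IsInwardNormal {d : ℕ} (A : Set (Conf d)) (q n : Conf d) : Prop :=
  ‖n‖ = 1 ∧ ∃ g : Conf d → ℝ, ContDiffAt ℝ 1 g q ∧ g q = 0 ∧
    (∃ c : ℝ, 0 < c ∧ gradient g q = c • n) ∧ ∀ᶠ x in 𝓝 q, (x ∈ A ↔ 0 ≤ g x)

/-- Elastic reflection `p ↦ p - 2⟨p,n⟩n`. -/
def reflect {d : ℕ} (n p : Conf d) : Conf d := p - (2 * ⟪p, n⟫_ℝ) • n

/-- Phase points at the boundary of `A` with momentum pointing strictly inwards. -/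
def inwardSection {d : ℕ} (A : Set (Conf d)) : Set (Phase d) :=
  {ρ | ∃ n, IsInwardNormal A ρ.1 n ∧ 0 < ⟪ρ.2, n⟫_ℝ}

/-- Phase points at the boundary of `A` with momentum pointing strictly outwards. -/
def outwardSection {d : ℕ} (A : Set (Conf d)) : Set (Phase d) :=
  {ρ | ∃ n, IsInwardNormal A ρ.1 n ∧ ⟪ρ.2, n⟫_ℝ < 0}

/-- `ρ`, restricted to `[0,T]`, is a billiard orbit in `A` between two inner points all of whose
collisions are regular (at smooth boundary points, and not tangent), and `S` is the set of its
collision times. At a collision time `ρ` takes the outgoing momentum. -/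
structure IsRegularBilliardOrbit {d : ℕ} (A : Set (Conf d)) (T : ℝ) (S : Finset ℝ)
    (ρ : ℝ → Phase d) : Prop where
  times : ∀ s ∈ S, 0 < s ∧ s < T
  continuous_pos : ContinuousOn (fun t => (ρ t).1) (Icc 0 T)
  inner : ∀ t ∈ Icc 0 T, t ∉ S → (ρ t).1 ∈ interior A
  free : ∀ a b : ℝ, 0 ≤ a → a ≤ b → b ≤ T → (∀ s ∈ S, ¬ (a < s ∧ s ≤ b)) →
    ρ b = ((ρ a).1 + (b - a) • (ρ a).2, (ρ a).2)
  collision : ∀ s ∈ S, ∃ n pin : Conf d, IsInwardNormal A (ρ s).1 n ∧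
    (∀ᶠ t in 𝓝[<] s, (ρ t).2 = pin) ∧ ⟪pin, n⟫_ℝ < 0 ∧ (ρ s).2 = reflect n pin

/-- `ρ'` is the image of `ρ` under the billiard map of `A` (free flight through the interior up to
the boundary, then elastic reflection), the collision being regular. -/
def IsBilliardStep {d : ℕ} (A : Set (Conf d)) (ρ ρ' : Phase d) : Prop :=
  ∃ τ : ℝ, 0 < τ ∧ (∀ s ∈ Ioo 0 τ, ρ.1 + s • ρ.2 ∈ interior A) ∧
    ∃ n, IsInwardNormal A (ρ.1 + τ • ρ.2) n ∧ ⟪ρ.2, n⟫_ℝ < 0 ∧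
      ρ' = (ρ.1 + τ • ρ.2, reflect n ρ.2)

/-! ### Hamiltonian motion -/

/-- On `[0,T]`, `ρ` solves the equations `q' = p`, `p' = -∇U(q)` of the Hamiltonian `p²/2 + U(q)`,
where the potential `U` is finite on `Ω` (so that `q` has to stay in `Ω`). -/
def IsHamiltonianOrbit {d : ℕ} (Ω : Set (Conf d)) (U : Conf d → ℝ) (T : ℝ)
    (ρ : ℝ → Phase d) : Prop :=
  ∀ t ∈ Icc 0 T, (ρ t).1 ∈ Ω ∧
    HasDerivWithinAt ρ ((ρ t).2, -gradient U (ρ t).1) (Icc 0 T) t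

/-- The free-flight map of the Hamiltonian flow: the orbit of `ρ` runs through the interior of `A`
until it reaches `∂A` for the first time, at `σ`, with outward momentum. -/
def IsHamiltonianFlight {d : ℕ} (Ω : Set (Conf d)) (U : Conf d → ℝ) (A : Set (Conf d))
    (ρ σ : Phase d) : Prop :=
  ∃ (γ : ℝ → Phase d) (τ : ℝ), 0 < τ ∧ IsHamiltonianOrbit Ω U τ γ ∧ γ 0 = ρ ∧ γ τ = σ ∧
    (∀ s ∈ Ioo 0 τ, (γ s).1 ∈ interior A) ∧ σ ∈ outwardSection A

/-- The reflection map of the Hamiltonian flow: the orbit of `σ` runs outside `A` until it returns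
to `∂A`, at `ρ'`, with inward momentum. -/
def IsHamiltonianReflection {d : ℕ} (Ω : Set (Conf d)) (U : Conf d → ℝ) (A : Set (Conf d))
    (σ ρ' : Phase d) : Prop :=
  ∃ (γ : ℝ → Phase d) (τ : ℝ), 0 < τ ∧ IsHamiltonianOrbit Ω U τ γ ∧ γ 0 = σ ∧ γ τ = ρ' ∧
    (∀ s ∈ Ioo 0 τ, (γ s).1 ∉ A) ∧ ρ' ∈ inwardSection A

/-- `ρ'` is the image of `ρ` under the Poincaré map (flight followed by reflection) of the
Hamiltonian flow on the cross-section `inwardSection A`. -/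
def IsPoincareStep {d : ℕ} (Ω : Set (Conf d)) (U : Conf d → ℝ) (A : Set (Conf d))
    (ρ ρ' : Phase d) : Prop :=
  ∃ σ, IsHamiltonianFlight Ω U A ρ σ ∧ IsHamiltonianReflection Ω U A σ ρ'

/-! ### Closeness in the `C^r` topology -/

/-- At the point `x` the maps `f`, `g` are `C^r`, and all derivatives of `f - g` of order `≤ r`
(the value included) have norm at most `c`. -/
def CrCloseAt {X Y : Type*} [NormedAddCommGroup X] [NormedSpace ℝ X] [NormedAddCommGroup Y]
    [NormedSpace ℝ Y] (r : ℕ) (f g : X → Y) (x : X) (c : ℝ) : Prop :=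
  ContDiffAt ℝ r f x ∧ ContDiffAt ℝ r g x ∧
    ∀ k ≤ r, ‖iteratedFDeriv ℝ k (fun y => f y - g y) x‖ ≤ c

/-- The same for maps on a (smooth, not necessarily open) subset `M` of `X`, without a choice of
charts: the compositions of `f`, `g` with any `C^r` germ `φ` into `M` based at `x`, normalised so
that its derivatives of orders `1, …, r` at the base point have norm at most `1`, are `C^r` with
derivatives `c`-close. In local charts of bounded geometry for `M` this is, up to a constant factor,
closeness of all derivatives of order `≤ r`. -/
def CrCloseAlong {X Y : Type*} [NormedAddCommGroup X] [NormedSpace ℝ X] [NormedAddCommGroup Y]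
    [NormedSpace ℝ Y] (r : ℕ) (M : Set X) (f g : X → Y) (x : X) (c : ℝ) : Prop :=
  ∀ φ : X → X, ContDiffAt ℝ r φ 0 → φ 0 = x → (∀ᶠ y in 𝓝 (0 : X), φ y ∈ M) →
    (∀ k, 1 ≤ k → k ≤ r → ‖iteratedFDeriv ℝ k φ 0‖ ≤ 1) →
      CrCloseAt r (f ∘ φ) (g ∘ φ) 0 c

/-! ### Billiard tables and steep power-law potentials -/

/-- A billiard table: a closed region `D` of `ℝ^d` whose boundary is the union of finitely many
pieces `Γ i`, which are `C^{r+1}` hypersurfaces with `D` on one side of them, except at the points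
of a closed corner set. Compactness of `D` is not needed; in particular a table in a torus is
covered through its periodic lift to `ℝ^d`. -/
structure BilliardTable (d n r : ℕ) where
  D : Set (Conf d)
  Γ : Fin n → Set (Conf d)
  corners : Set (Conf d)
  isClosed_D : IsClosed D
  frontier_eq : frontier D = ⋃ i, Γ i
  isClosed_corners : IsClosed corners
  corners_subset : corners ⊆ frontier D
  smooth : ∀ i, ∀ q ∈ Γ i \ corners, ∃ g : Conf d → ℝ,
    ContDiffAt ℝ ((r + 1 : ℕ) : ℕ∞) g q ∧ gradient g q ≠ 0 ∧
      ∀ᶠ x in 𝓝 q, (x ∈ D ↔ 0 ≤ g x) ∧ (x ∈ Γ i ↔ g x = 0)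

/-- The power-law barrier function `W(Q;ε) = (ε/Q)^α`, `Q > 0`. -/
def barrier (α ε Q : ℝ) : ℝ := (ε / Q) ^ α

/-- The inverse barrier function `𝒬(W;ε) = ε / W^{1/α}`. -/
def invBarrier (α ε w : ℝ) : ℝ := ε / w ^ (1 / α)

/-- A family of potentials `V(·;ε)`, `0 < ε ≤ ε₀`, on a billiard table with the power-law barrier
`(ε/Q)^α` at every boundary surface. `V ε` is finite on the open set `Ω ε` (and `+∞` elsewhere);
`Q ε`, `0 ≤ ε ≤ ε₀`, is the pattern function; `N i` is the neighbourhood of the surface `Γ i` in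
which the potential is a function of `Q - Qc i`. -/
structure PowerLawPotential {d n r : ℕ} (B : BilliardTable d n r) (α : ℝ) where
  ε₀ : ℝ
  ε₀_pos : 0 < ε₀
  Ω : ℝ → Set (Conf d)
  V : ℝ → Conf d → ℝ
  Dt : Set (Conf d)
  Q : ℝ → Conf d → ℝ
  Qc : Fin n → ℝ
  N : Fin n → Set (Conf d)
  /- The potential is `C^{r+1}` where it is finite. -/
  isOpen_Ω : ∀ ε ∈ Ioc 0 ε₀, IsOpen (Ω ε)
  contDiff_V : ∀ ε ∈ Ioc 0 ε₀, ContDiffOn ℝ ((r + 1 : ℕ) : ℕ∞) (V ε) (Ω ε)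
  /- Condition I: on compact subsets of the open region, `V` vanishes in `C^{r+1}` as `ε → 0`. -/
  interior_domain : ∀ K ⊆ interior B.D, IsCompact K → ∀ᶠ ε in 𝓝[>] (0 : ℝ), K ⊆ Ω ε
  interior_limit : ∀ K ⊆ interior B.D, IsCompact K → ∀ l ≤ r + 1,
    TendstoUniformlyOn (fun ε q => iteratedFDeriv ℝ l (V ε) q) 0 (𝓝[>] (0 : ℝ)) K
  /- The pattern function: `C^{r+1}` near `D` minus the corners, depending continuously on
  `ε ≥ 0` in the `C^{r+1}` topology. -/
  isOpen_Dt : IsOpen Dt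
  diff_subset_Dt : B.D \ B.corners ⊆ Dt
  contDiff_Q : ∀ ε ∈ Icc 0 ε₀, ContDiffOn ℝ ((r + 1 : ℕ) : ℕ∞) (Q ε) Dt
  continuous_Q : ∀ l ≤ r + 1,
    ContinuousOn (fun x : ℝ × Conf d => iteratedFDeriv ℝ l (Q x.1) x.2) (Icc 0 ε₀ ×ˢ Dt)
  /- The neighbourhoods of the boundary surfaces. -/
  isOpen_N : ∀ i, IsOpen (N i)
  Γ_subset_N : ∀ i, B.Γ i \ B.corners ⊆ N i
  N_subset : ∀ i, N i ⊆ Dt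
  /- The pattern function is bounded with its derivatives, and its highest derivatives are
  locally Lipschitz at the boundary surfaces, uniformly in `ε`. -/
  bounded_Q : ∃ C : ℝ, ∀ ε ∈ Icc 0 ε₀, ∀ i, ∀ q ∈ N i, ∀ l ≤ r + 1,
    ‖iteratedFDeriv ℝ l (Q ε) q‖ ≤ C
  lipschitz_Q : ∀ i, ∀ q ∈ B.Γ i \ B.corners, ∃ L, ∃ O ∈ 𝓝 q, ∀ ε ∈ Icc 0 ε₀,
    LipschitzOnWith L (iteratedFDeriv ℝ (r + 1) (Q ε)) O
  /- Condition II: the surfaces are level sets of `Q(·;0)`, the potential is `(ε/(Q - Qc i))^α`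
  near them, and `∇Q` does not vanish there. -/
  level : ∀ i, ∀ q ∈ B.Γ i \ B.corners, Q 0 q = Qc i
  barrier_eq : ∀ ε ∈ Ioc 0 ε₀, ∀ i, ∀ q ∈ N i, q ∈ Ω ε → V ε q = barrier α ε (Q ε q - Qc i)
  grad_ne : ∀ ε ∈ Icc 0 ε₀, ∀ i, ∀ q ∈ N i, gradient (Q ε) q ≠ 0
  /- Condition III: `Q > Qc i` on the inner side and `Q < Qc i` on the outer side of `Γ i`; the
  potential is infinite for `Q ≤ Qc i`, and outside of the table. -/
  side : ∀ i, ∀ q ∈ N i, (q ∈ B.D ↔ Qc i ≤ Q 0 q)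
  inner_side : ∀ i, ∀ q ∈ closure (N i), q ∈ interior B.D → Qc i < Q 0 q
  finite_iff : ∀ ε ∈ Ioc 0 ε₀, ∀ i, ∀ q ∈ N i, (q ∈ Ω ε ↔ Qc i < Q ε q)
  finite_subset : ∀ ε ∈ Ioc 0 ε₀, Ω ε ⊆ B.D ∪ ⋃ i, N i

namespace PowerLawPotential

variable {d n r : ℕ} {B : BilliardTable d n r} {α : ℝ} (P : PowerLawPotential B α)

/-- The region bounded by the surfaces `Q(q;ε) = Qc i + c`. -/
def innerRegion (ε c : ℝ) : Set (Conf d) :=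
  {q | q ∈ P.Ω ε ∧ ∀ i, q ∈ P.N i → P.Qc i + c ≤ P.Q ε q}

/-- The surfaces `Q(q;ε) = Qc i + c`. -/
def levelSurface (ε c : ℝ) : Set (Conf d) :=
  {q | ∃ i, q ∈ P.N i ∧ P.Q ε q = P.Qc i + c}

/-- Supremum over `q ∈ A` and `1 ≤ l ≤ r+1` of the norm of the `l`-th derivative of `V(·;ε)`. -/
def derivSup (ε : ℝ) (A : Set (Conf d)) : ℝ≥0∞ :=
  ⨆ q ∈ A, ⨆ l ∈ Finset.Icc 1 (r + 1), ‖iteratedFDeriv ℝ l (P.V ε) q‖ₑ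

/-- The potential is boundary dominated: for small `ε` and `δ`, the derivatives of `V` in the region
bounded by the surfaces `Q = Qc i + δ` are controlled by their values on these surfaces. -/
def BoundaryDominated : Prop :=
  ∃ ε₁ > 0, ∃ δ₁ > 0, ∀ ε ∈ Ioo 0 ε₁, ∀ δ ∈ Ioo 0 δ₁,
    P.derivSup ε (P.innerRegion ε δ) = P.derivSup ε (P.levelSurface ε δ)

end PowerLawPotential

/-! ### The scales -/

/-- The accuracy `ν(ε) = ε^{1/(r+2+1/α)}`. -/
def nu (r : ℕ) (α ε : ℝ) : ℝ := ε ^ (1 / ((r : ℝ) + 2 + 1 / α))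

/-- The level `η(ε) = 𝒬(ν(ε);ε)` that defines the auxiliary billiard. -/
def eta (r : ℕ) (α ε : ℝ) : ℝ := invBarrier α ε (nu r α ε)

/-- The order of the lengths of the impact intervals: `ν` if `α ≥ 1`, and
`ν^{α(r+2)/(α+r+1)}` if `α ≤ 1` (both are `ν` for `α = 1`). -/
def impactScale (r : ℕ) (α ε : ℝ) : ℝ :=
  if 1 ≤ α then nu r α ε else nu r α ε ^ (α * ((r : ℝ) + 2) / (α + (r : ℝ) + 1))

/-- The auxiliary billiard table `D^ε`, bounded by the surfaces `Q(q;ε) = Qc i + η(ε)`. -/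
def PowerLawPotential.auxTable {d n r : ℕ} {B : BilliardTable d n r} {α : ℝ}
    (P : PowerLawPotential B α) (ε : ℝ) : Set (Conf d) :=
  P.innerRegion ε (eta r α ε)

end SteepBilliard

end

noncomputable section

open Set
open scoped ENNReal InnerProductSpace ContDiff

namespace SteepBilliard

/-! ### Quantitative closeness of families of maps -/

section Close

variable {I : Type} {l : Filter I} {β : I → ℝ}

/-- The tangent map `(x, v) ↦ (f x, Df(x) v)`. -/
def tmap {E F : Type} [NormedAddCommGroup E] [NormedSpace ℝ E] [NormedAddCommGroup F]
    [NormedSpace ℝ F] (f : E → F) (z : E × E) : F × F := (f z.1, fderiv ℝ f z.1 z.2)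

/-- The families `f`, `g` are locally bounded and `β`-close, in a coarsely Lipschitz sense. -/
def CloseZero {E F : Type} [NormedAddCommGroup E] [NormedAddCommGroup F]
    (l : Filter I) (β : I → ℝ) (f g : I → E → F) : Prop :=
  ∀ R : ℝ, ∃ K : ℝ, 0 ≤ K ∧ ∀ᶠ i in l, ∀ x y, ‖x‖ ≤ R → ‖y‖ ≤ R →
    ‖f i x‖ ≤ K ∧ ‖g i x‖ ≤ K ∧ ‖f i x - g i y‖ ≤ K * (‖x - y‖ + β i)

/-- The families `f`, `g` are `β`-close together with their derivatives up to the order `r`. -/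
def Close (l : Filter I) (β : I → ℝ) : (r : ℕ) → ∀ {E F : Type} [NormedAddCommGroup E]
    [NormedSpace ℝ E] [NormedAddCommGroup F] [NormedSpace ℝ F], (f g : I → E → F) → Prop
  | 0, _, _, _, _, _, _, f, g => CloseZero l β f g
  | r + 1, _, _, _, _, _, _, f, g => CloseZero l β f g ∧
      (∀ᶠ i in l, ContDiff ℝ 1 (f i) ∧ ContDiff ℝ 1 (g i)) ∧
      Close l β r (fun i => tmap (f i)) (fun i => tmap (g i))

variable {E F G : Type} [NormedAddCommGroup E] [NormedSpace ℝ E] [NormedAddCommGroup F]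
  [NormedSpace ℝ F] [NormedAddCommGroup G] [NormedSpace ℝ G]

theorem Close.closeZero {r : ℕ} {f g : I → E → F} (h : Close l β r f g) : CloseZero l β f g := by
  cases r with
  | zero => exact h
  | succ r => exact h.1

theorem Close.of_succ {r : ℕ} {f g : I → E → F} (h : Close l β (r + 1) f g) : Close l β r f g := by
  induction r generalizing E F with
  | zero => exact h.1
  | succ r ih => exact ⟨h.1, h.2.1, ih h.2.2⟩

theorem Close.of_le {r s : ℕ} (hrs : r ≤ s) {f g : I → E → F} (h : Close l β s f g) :
    Close l β r f g := by
  induction s, hrs using Nat.le_induction with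
  | base => exact h
  | succ s _ ih => exact ih h.of_succ

theorem Close.contDiff_one {r : ℕ} (hr : 1 ≤ r) {f g : I → E → F} (h : Close l β r f g) :
    ∀ᶠ i in l, ContDiff ℝ 1 (f i) ∧ ContDiff ℝ 1 (g i) :=
  (h.of_le hr).2.1

theorem CloseZero.comap {J : Type} {l' : Filter J} {π : J → I} (hπ : Tendsto π l' l)
    {f g : I → E → F} (h : CloseZero l β f g) :
    CloseZero l' (β ∘ π) (fun j => f (π j)) (fun j => g (π j)) := by
  intro R
  obtain ⟨K, hK, h⟩ := h R
  exact ⟨K, hK, hπ.eventually h⟩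

theorem Close.comap {J : Type} {l' : Filter J} {π : J → I} (hπ : Tendsto π l' l) {r : ℕ}
    {f g : I → E → F} (h : Close l β r f g) :
    Close l' (β ∘ π) r (fun j => f (π j)) (fun j => g (π j)) := by
  induction r generalizing E F with
  | zero => exact CloseZero.comap hπ h
  | succ r ih => exact ⟨h.1.comap hπ, hπ.eventually h.2.1, ih h.2.2⟩

theorem CloseZero.congr {f f' g g' : I → E → F} (hf : ∀ᶠ i in l, f i = f' i)
    (hg : ∀ᶠ i in l, g i = g' i) (h : CloseZero l β f g) : CloseZero l β f' g' := by
  intro R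
  obtain ⟨K, hK, h⟩ := h R
  refine ⟨K, hK, ?_⟩
  filter_upwards [h, hf, hg] with i hi h1 h2
  rwa [← h1, ← h2]

theorem Close.congr {r : ℕ} {f f' g g' : I → E → F} (hf : ∀ᶠ i in l, f i = f' i)
    (hg : ∀ᶠ i in l, g i = g' i) (h : Close l β r f g) : Close l β r f' g' := by
  induction r generalizing E F with
  | zero => exact CloseZero.congr hf hg h
  | succ r ih =>
    refine ⟨h.1.congr hf hg, ?_, ih ?_ ?_ h.2.2⟩
    · filter_upwards [h.2.1, hf, hg] with i hi h1 h2
      rwa [← h1, ← h2]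
    · filter_upwards [hf] with i h1
      rw [h1]
    · filter_upwards [hg] with i h1
      rw [h1]

theorem CloseZero.comp (hβ : ∀ᶠ i in l, 0 ≤ β i) {f f' : I → E → F} {g g' : I → F → G}
    (hg : CloseZero l β g g') (hf : CloseZero l β f f') :
    CloseZero l β (fun i x => g i (f i x)) (fun i x => g' i (f' i x)) := by
  intro R
  obtain ⟨K, hK, hf⟩ := hf R
  obtain ⟨K', hK', hg⟩ := hg K
  refine ⟨K' * (K + 1), by positivity, ?_⟩
  filter_upwards [hf, hg, hβ] with i hf hg hb x y hx hy
  obtain ⟨a1, a2, a3⟩ := hf x y hx hy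
  obtain ⟨c1, c2, c3⟩ := hf y x hy hx
  obtain ⟨b1, b2, b3⟩ := hg (f i x) (f' i y) a1 c2
  obtain ⟨d1, d2, d3⟩ := hg (f' i x) (f i x) a2 a1
  refine ⟨by nlinarith, by nlinarith, b3.trans ?_⟩
  have := norm_nonneg (x - y)
  calc K' * (‖f i x - f' i y‖ + β i) ≤ K' * (K * (‖x - y‖ + β i) + β i) := by gcongr
    _ ≤ K' * (K + 1) * (‖x - y‖ + β i) := by nlinarith [mul_nonneg hK' this]

theorem tmap_comp {f : E → F} {g : F → G} (hf : Differentiable ℝ f) (hg : Differentiable ℝ g) :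
    tmap (fun x => g (f x)) = fun z => tmap g (tmap f z) := by
  ext z
  · rfl
  · simp only [tmap]
    rw [fderiv_fun_comp z.1 (hg _) (hf _)]
    rfl

theorem Close.comp (hβ : ∀ᶠ i in l, 0 ≤ β i) {r : ℕ} {f f' : I → E → F} {g g' : I → F → G}
    (hg : Close l β r g g') (hf : Close l β r f f') :
    Close l β r (fun i x => g i (f i x)) (fun i x => g' i (f' i x)) := by
  induction r generalizing E F G with
  | zero => exact CloseZero.comp hβ hg hf
  | succ r ih =>
    refine ⟨hg.1.comp hβ hf.1, ?_, ?_⟩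
    · filter_upwards [hg.2.1, hf.2.1] with i h1 h2
      exact ⟨h1.1.comp h2.1, h1.2.comp h2.2⟩
    · refine Close.congr ?_ ?_ (ih hg.2.2 hf.2.2)
      · filter_upwards [hg.2.1, hf.2.1] with i h1 h2
        rw [tmap_comp (h2.1.differentiable one_ne_zero) (h1.1.differentiable one_ne_zero)]
      · filter_upwards [hg.2.1, hf.2.1] with i h1 h2
        rw [tmap_comp (h2.2.differentiable one_ne_zero) (h1.2.differentiable one_ne_zero)]

theorem ContDiff.tmap {f : E → F} (hf : ContDiff ℝ ∞ f) : ContDiff ℝ ∞ (tmap f) := by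
  have h : ContDiff ℝ ∞ (fderiv ℝ f) := hf.fderiv_right (m := ∞) (by simp)
  exact (hf.comp contDiff_fst).prodMk ((h.comp contDiff_fst).clm_apply contDiff_snd)

theorem exists_lipschitz_ball [FiniteDimensional ℝ E] {f : E → F} (hf : ContDiff ℝ 1 f) (R : ℝ) :
    ∃ K : ℝ, 0 ≤ K ∧ ∀ x y, ‖x‖ ≤ R → ‖y‖ ≤ R →
      ‖f x‖ ≤ K ∧ ‖fderiv ℝ f x‖ ≤ K ∧ ‖f x - f y‖ ≤ K * ‖x - y‖ := by
  have := FiniteDimensional.proper_real E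
  have hc := isCompact_closedBall (0 : E) R
  obtain ⟨K₁, h₁⟩ := hc.exists_bound_of_continuousOn hf.continuous.continuousOn
  obtain ⟨K₂, h₂⟩ := hc.exists_bound_of_continuousOn
    (hf.continuous_fderiv one_ne_zero).continuousOn
  refine ⟨max 0 (max K₁ K₂), le_max_left _ _, fun x y hx hy => ⟨?_, ?_, ?_⟩⟩
  · exact (h₁ x (by simpa using hx)).trans (by simp)
  · exact (h₂ x (by simpa using hx)).trans (by simp)
  · refine (convex_closedBall (0 : E) R).norm_image_sub_le_of_norm_fderiv_le (𝕜 := ℝ)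
      (fun z _ => (hf.differentiable one_ne_zero).differentiableAt)
      (fun z hz => (h₂ z hz).trans (by simp)) (by simpa using hy) (by simpa using hx)

theorem CloseZero.of_contDiff [FiniteDimensional ℝ E] (hβ : ∀ᶠ i in l, 0 ≤ β i) {f : E → F}
    (hf : ContDiff ℝ 1 f) : CloseZero l β (fun _ => f) (fun _ => f) := by
  intro R
  obtain ⟨K, hK, h⟩ := exists_lipschitz_ball hf R
  refine ⟨K, hK, ?_⟩
  filter_upwards [hβ] with i hi x y hx hy
  obtain ⟨h1, -, h3⟩ := h x y hx hy
  exact ⟨h1, h1, h3.trans (by gcongr; linarith)⟩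

theorem Close.of_contDiff [FiniteDimensional ℝ E] (hβ : ∀ᶠ i in l, 0 ≤ β i) (r : ℕ) {f : E → F}
    (hf : ContDiff ℝ ∞ f) : Close l β r (fun _ => f) (fun _ => f) := by
  induction r generalizing E F with
  | zero => exact CloseZero.of_contDiff hβ (hf.of_le (by norm_cast))
  | succ r ih =>
    have h1 : ContDiff ℝ 1 f := hf.of_le (by norm_cast)
    exact ⟨CloseZero.of_contDiff hβ h1, .of_forall fun _ => ⟨h1, h1⟩, ih (ContDiff.tmap hf)⟩

theorem CloseZero.prodMk {f f' : I → E → F} {g g' : I → E → G}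
    (hf : CloseZero l β f f') (hg : CloseZero l β g g') (hβ : ∀ᶠ i in l, 0 ≤ β i) :
    CloseZero l β (fun i x => (f i x, g i x)) (fun i x => (f' i x, g' i x)) := by
  intro R
  obtain ⟨K, hK, hf⟩ := hf R
  obtain ⟨K', hK', hg⟩ := hg R
  refine ⟨max K K', by positivity, ?_⟩
  filter_upwards [hf, hg, hβ] with i hf hg hb x y hx hy
  obtain ⟨a1, a2, a3⟩ := hf x y hx hy
  obtain ⟨b1, b2, b3⟩ := hg x y hx hy
  refine ⟨max_le_max a1 b1, max_le_max a2 b2, max_le (a3.trans ?_) (b3.trans ?_)⟩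
  · gcongr; exact le_max_left _ _
  · gcongr; exact le_max_right _ _

/-- The interchange of the two inner factors of `(F × F) × (G × G)`. -/
def shuffle (z : (F × F) × (G × G)) : (F × G) × (F × G) := ((z.1.1, z.2.1), (z.1.2, z.2.2))

theorem contDiff_shuffle : ContDiff ℝ ∞ (shuffle (F := F) (G := G)) := by
  unfold shuffle; fun_prop

theorem tmap_prodMk {f : E → F} {g : E → G} (hf : Differentiable ℝ f) (hg : Differentiable ℝ g) :
    tmap (fun x => (f x, g x)) = fun z => shuffle (tmap f z, tmap g z) := by
  ext z
  · rfl
  · rfl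
  all_goals
    simp only [tmap, shuffle]
    rw [(hf z.1).fderiv_prodMk (hg z.1)]
    rfl

variable [FiniteDimensional ℝ F] [FiniteDimensional ℝ G]

theorem Close.prodMk (hβ : ∀ᶠ i in l, 0 ≤ β i) {r : ℕ} {f f' : I → E → F} {g g' : I → E → G}
    (hf : Close l β r f f') (hg : Close l β r g g') :
    Close l β r (fun i x => (f i x, g i x)) (fun i x => (f' i x, g' i x)) := by
  induction r generalizing E F G with
  | zero => exact CloseZero.prodMk hf hg hβ
  | succ r ih =>
    refine ⟨hf.1.prodMk hg.1 hβ, ?_, ?_⟩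
    · filter_upwards [hg.2.1, hf.2.1] with i h1 h2
      exact ⟨h2.1.prodMk h1.1, h2.2.prodMk h1.2⟩
    · refine Close.congr ?_ ?_ ((Close.of_contDiff hβ r contDiff_shuffle).comp hβ
        (ih hf.2.2 hg.2.2))
      · filter_upwards [hg.2.1, hf.2.1] with i h1 h2
        rw [tmap_prodMk (h2.1.differentiable one_ne_zero) (h1.1.differentiable one_ne_zero)]
      · filter_upwards [hg.2.1, hf.2.1] with i h1 h2
        rw [tmap_prodMk (h2.2.differentiable one_ne_zero) (h1.2.differentiable one_ne_zero)]

/-- Closeness of families built by a fixed smooth map from one close family. -/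
theorem Close.map (hβ : ∀ᶠ i in l, 0 ≤ β i) {r : ℕ} {f f' : I → E → F} {φ : F → G}
    (hφ : ContDiff ℝ ∞ φ) (hf : Close l β r f f') :
    Close l β r (fun i x => φ (f i x)) (fun i x => φ (f' i x)) :=
  (Close.of_contDiff hβ r hφ).comp hβ hf

theorem Close.map₂ (hβ : ∀ᶠ i in l, 0 ≤ β i) {H : Type} [NormedAddCommGroup H] [NormedSpace ℝ H]
    {r : ℕ} {f f' : I → E → F} {g g' : I → E → G} {φ : F × G → H}
    (hφ : ContDiff ℝ ∞ φ) (hf : Close l β r f f') (hg : Close l β r g g') :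
    Close l β r (fun i x => φ (f i x, g i x)) (fun i x => φ (f' i x, g' i x)) :=
  (Close.of_contDiff hβ r hφ).comp hβ (hf.prodMk hβ hg)

theorem Close.add (hβ : ∀ᶠ i in l, 0 ≤ β i) {r : ℕ} {f f' g g' : I → E → F}
    (hf : Close l β r f f') (hg : Close l β r g g') :
    Close l β r (fun i x => f i x + g i x) (fun i x => f' i x + g' i x) :=
  Close.map₂ hβ (φ := fun z : F × F => z.1 + z.2) (by fun_prop) hf hg

theorem Close.smul (hβ : ∀ᶠ i in l, 0 ≤ β i) {r : ℕ} {f f' : I → E → ℝ} {g g' : I → E → F}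
    (hf : Close l β r f f') (hg : Close l β r g g') :
    Close l β r (fun i x => f i x • g i x) (fun i x => f' i x • g' i x) :=
  Close.map₂ hβ (φ := fun z : ℝ × F => z.1 • z.2) (by fun_prop) hf hg

theorem Close.inner {V : Type} [NormedAddCommGroup V] [InnerProductSpace ℝ V]
    [FiniteDimensional ℝ V] (hβ : ∀ᶠ i in l, 0 ≤ β i) {r : ℕ} {f f' g g' : I → E → V}
    (hf : Close l β r f f') (hg : Close l β r g g') :
    Close l β r (fun i x => ⟪f i x, g i x⟫_ℝ) (fun i x => ⟪f' i x, g' i x⟫_ℝ) :=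
  Close.map₂ hβ (φ := fun z : V × V => ⟪z.1, z.2⟫_ℝ) (contDiff_fst.inner ℝ contDiff_snd) hf hg

theorem Close.fst (hβ : ∀ᶠ i in l, 0 ≤ β i) {r : ℕ} {f f' : I → E → F × G}
    (hf : Close l β r f f') : Close l β r (fun i x => (f i x).1) (fun i x => (f' i x).1) :=
  hf.map hβ contDiff_fst

theorem Close.snd (hβ : ∀ᶠ i in l, 0 ≤ β i) {r : ℕ} {f f' : I → E → F × G}
    (hf : Close l β r f f') : Close l β r (fun i x => (f i x).2) (fun i x => (f' i x).2) :=
  hf.map hβ contDiff_snd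

/-- Families of constant maps. -/
theorem Close.const {c c' : I → F} (K : ℝ) (hK : 0 ≤ K)
    (hc : ∀ᶠ i in l, ‖c i‖ ≤ K ∧ ‖c' i‖ ≤ K ∧ ‖c i - c' i‖ ≤ K * β i) (r : ℕ) :
    Close l β r (fun i (_ : E) => c i) (fun i (_ : E) => c' i) := by
  have h0 : ∀ {E F : Type} [NormedAddCommGroup E] [NormedAddCommGroup F] {c c' : I → F} {K : ℝ},
      0 ≤ K → (∀ᶠ i in l, ‖c i‖ ≤ K ∧ ‖c' i‖ ≤ K ∧ ‖c i - c' i‖ ≤ K * β i) →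
      CloseZero l β (fun i (_ : E) => c i) (fun i (_ : E) => c' i) := by
    intro E F _ _ c c' K hK hc R
    refine ⟨K, hK, ?_⟩
    filter_upwards [hc] with i hi x y _ _
    exact ⟨hi.1, hi.2.1, hi.2.2.trans (by gcongr; linarith [norm_nonneg (x - y)])⟩
  induction r generalizing E F with
  | zero => exact h0 hK hc
  | succ r ih =>
    refine ⟨h0 hK hc, .of_forall fun i => ⟨contDiff_const, contDiff_const⟩, ?_⟩
    have := ih (E := E × E) (c := fun i => (c i, (0 : F))) (c' := fun i => (c' i, (0 : F))) (by
      filter_upwards [hc] with i hi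
      simpa [Prod.norm_def] using hi)
    refine this.congr ?_ ?_ <;> refine .of_forall fun i => ?_ <;> ext z <;> simp [tmap]

theorem Close.const_self (hβ : ∀ᶠ i in l, 0 ≤ β i) {c : I → F} (K : ℝ)
    (hc : ∀ᶠ i in l, ‖c i‖ ≤ K) (r : ℕ) :
    Close l β r (fun i (_ : E) => c i) (fun i (_ : E) => c i) := by
  refine Close.const (max K 0) (le_max_right _ _) ?_ r
  filter_upwards [hc, hβ] with i hi hb
  simp only [sub_self, norm_zero]
  exact ⟨hi.trans (le_max_left _ _), hi.trans (le_max_left _ _), by positivity⟩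

end Close

/-! ### Smooth retractions onto balls -/

section Retraction

variable {E F : Type} [NormedAddCommGroup E] [NormedSpace ℝ E] [FiniteDimensional ℝ E]
  [NormedAddCommGroup F] [NormedSpace ℝ F]

/-- A smooth map into the ball of radius `R` about `c` which is the identity on the concentric ball
of radius `R / 2`. -/
def retr (c : E) (R : ℝ) (x : E) : E :=
  if h : 0 < R then
    c + (⟨R / 2, R, half_pos h, half_lt_self h⟩ : ContDiffBump c) x • (x - c) else x

theorem contDiff_retr (c : E) {R : ℝ} (hR : 0 < R) : ContDiff ℝ ∞ (retr c R) := by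
  unfold retr
  simp only [hR, dite_true]
  exact contDiff_const.add ((ContDiffBump.contDiff _).smul (contDiff_id.sub contDiff_const))

theorem retr_eq_self {c x : E} {R : ℝ} (h : ‖x - c‖ ≤ R / 2) : retr c R x = x := by
  unfold retr
  split_ifs with hR
  · rw [ContDiffBump.one_of_mem_closedBall _ (by simpa [dist_eq_norm] using h)]
    simp
  · rfl

theorem retr_eq_center {c x : E} {R : ℝ} (hR : 0 < R) (h : R ≤ ‖x - c‖) : retr c R x = c := by
  unfold retr
  simp only [hR, dite_true]
  rw [ContDiffBump.zero_of_le_dist _ (by simpa [dist_eq_norm] using h)]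
  simp

theorem norm_retr_sub_lt (c x : E) {R : ℝ} (hR : 0 < R) : ‖retr c R x - c‖ < R := by
  by_cases h : R ≤ ‖x - c‖
  · rw [retr_eq_center hR h]; simpa using hR
  · push Not at h
    unfold retr
    simp only [hR, dite_true]
    rw [add_sub_cancel_left, norm_smul, Real.norm_of_nonneg (ContDiffBump.nonneg _)]
    exact (mul_le_of_le_one_left (norm_nonneg _) (ContDiffBump.le_one _)).trans_lt h

theorem retr_mem_ball (c x : E) {R : ℝ} (hR : 0 < R) : retr c R x ∈ Metric.ball c R := by
  rw [Metric.mem_ball, dist_eq_norm]; exact norm_retr_sub_lt c x hR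

theorem exists_bound_comp_retr {f : E → F} (hf : ContDiff ℝ 1 f) (c : E) {R : ℝ} (hR : 0 < R) :
    ∃ K : NNReal, (∀ x, ‖f (retr c R x)‖ ≤ K) ∧ LipschitzWith K (fun x => f (retr c R x)) := by
  have := FiniteDimensional.proper_real E
  have hρ : ContDiff ℝ 1 (retr c R) := (contDiff_retr c hR).of_le (by norm_cast)
  have hfr : ContDiff ℝ 1 (fun x => f (retr c R x)) := hf.comp hρ
  have hc := isCompact_closedBall c R
  obtain ⟨K₁, h₁⟩ := hc.exists_bound_of_continuousOn hf.continuous.continuousOn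
  obtain ⟨K₂, h₂⟩ := hc.exists_bound_of_continuousOn
    (hfr.continuous_fderiv one_ne_zero).continuousOn
  refine ⟨(max K₁ K₂).toNNReal, fun x => ?_, ?_⟩
  · refine (h₁ _ (Metric.ball_subset_closedBall (retr_mem_ball c x hR))).trans ?_
    exact (le_max_left _ _).trans (Real.le_coe_toNNReal _)
  · refine lipschitzWith_of_nnnorm_fderiv_le (𝕜 := ℝ) (hfr.differentiable one_ne_zero) fun x => ?_
    rw [← NNReal.coe_le_coe, coe_nnnorm]
    by_cases hx : x ∈ Metric.closedBall c R
    · exact (h₂ x hx).trans ((le_max_right _ _).trans (Real.le_coe_toNNReal _))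
    · have : (fun x => f (retr c R x)) =ᶠ[𝓝 x] fun _ => f c := by
        filter_upwards [Metric.isClosed_closedBall.isOpen_compl.mem_nhds hx] with y hy
        rw [retr_eq_center hR]
        simp only [mem_compl_iff, Metric.mem_closedBall, dist_eq_norm, not_le] at hy
        exact hy.le
      rw [this.fderiv_eq]
      simp

end Retraction

/-! ### Gronwall's inequality, and existence of solutions -/

section ODE

variable {E : Type} [NormedAddCommGroup E] [NormedSpace ℝ E]

theorem hasDerivWithinAt_Ici_of_Icc {F : Type} [NormedAddCommGroup F] [NormedSpace ℝ F]
    {a b t : ℝ} {x : ℝ → F} {v : F} (ht : t ∈ Ico a b) (h : HasDerivWithinAt x v (Icc a b) t) :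
    HasDerivWithinAt x v (Ici t) t :=
  h.mono_of_mem_nhdsWithin (Icc_mem_nhdsGE_of_mem ht)

/-- Gronwall's inequality with time-dependent coefficients. -/
theorem gronwall_integral {x x' : ℝ → E} {κ b : ℝ → ℝ} {c : ℝ}
    (hx : ∀ t ∈ Icc (0 : ℝ) 1, HasDerivWithinAt x (x' t) (Icc 0 1) t) (hκ : Continuous κ)
    (hκ0 : ∀ t, 0 ≤ κ t) (hb : Continuous b) (hb0 : ∀ t, 0 ≤ b t) (h0 : ‖x 0‖ ≤ c)
    (bound : ∀ t ∈ Icc (0 : ℝ) 1, ‖x' t‖ ≤ κ t * ‖x t‖ + b t) :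
    ∀ t ∈ Icc (0 : ℝ) 1,
      ‖x t‖ ≤ Real.exp (1 + ∫ s in (0 : ℝ)..1, κ s) * (c + ∫ s in (0 : ℝ)..1, b s) := by
  intro t ht
  have hc : 0 ≤ c := (norm_nonneg _).trans h0
  have hint : ∀ {h : ℝ → ℝ}, Continuous h → ∀ s, HasDerivAt (fun t => ∫ u in (0 : ℝ)..t, h u) (h s) s :=
    fun hh s => intervalIntegral.integral_hasDerivAt_right (hh.intervalIntegrable _ _)
      (hh.stronglyMeasurableAtFilter _ _) hh.continuousAt
  have hpos : ∀ {h : ℝ → ℝ}, (∀ s, 0 ≤ h s) → ∀ s, 0 ≤ s → 0 ≤ ∫ u in (0 : ℝ)..s, h u :=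
    fun hh s hs => intervalIntegral.integral_nonneg hs fun u _ => hh u
  have hmono : ∀ {h : ℝ → ℝ}, Continuous h → (∀ s, 0 ≤ h s) →
      ∫ u in (0 : ℝ)..t, h u ≤ ∫ u in (0 : ℝ)..1, h u := fun hh hh0 =>
    intervalIntegral.integral_mono_interval le_rfl ht.1 ht.2 (.of_forall fun s => hh0 s)
      (hh.intervalIntegrable _ _)
  have key : ∀ θ > 0, ‖x t‖ ≤
      Real.exp (1 + ∫ s in (0 : ℝ)..1, κ s) * (c + θ + ∫ s in (0 : ℝ)..1, b s) := by
    intro θ hθ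
    set A : ℝ → ℝ := fun t => t + ∫ s in (0 : ℝ)..t, κ s with hA
    set B : ℝ → ℝ := fun t => Real.exp (A t) * (c + θ + ∫ s in (0 : ℝ)..t, b s) with hB
    have hA' : ∀ s, HasDerivAt A (1 + κ s) s := fun s => (hasDerivAt_id s).add (hint hκ s)
    have hB' : ∀ s, HasDerivAt B ((1 + κ s) * B s + Real.exp (A s) * b s) s := by
      intro s
      have := (hA' s).exp.mul ((hint hb s).const_add (c + θ))
      refine HasDerivAt.congr_deriv (f := B) this ?_
      simp only [B]; ring
    have h1 : ‖x t‖ ≤ B t := by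
      refine image_norm_le_of_norm_deriv_right_lt_deriv_boundary' (a := 0) (b := 1) (f := x)
        (f' := x') (B := B) (fun s hs => (hx s hs).continuousWithinAt)
        (fun s hs => hasDerivWithinAt_Ici_of_Icc hs (hx s (Ico_subset_Icc_self hs))) ?_
        (fun s _ => (hB' s).continuousAt.continuousWithinAt)
        (fun s _ => (hB' s).hasDerivWithinAt) ?_ ht
      · have : B 0 = c + θ + 0 := by simp [B, A]
        rw [this]
        linarith
      · intro s hs heq
        have hs' := Ico_subset_Icc_self hs
        have hBpos : 0 < B s := by
          have := hpos hb0 s hs.1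
          simp only [hB]; positivity
        have hexp : 1 ≤ Real.exp (A s) := Real.one_le_exp (add_nonneg hs.1 (hpos hκ0 s hs.1))
        have := bound s hs'
        rw [heq] at this
        nlinarith [hb0 s]
    refine h1.trans ?_
    simp only [hB, hA]
    have h2 := hmono hκ hκ0
    have h3 := hmono hb hb0
    have h4 := hpos hb0 t ht.1
    gcongr
    exact ht.2
  refine le_of_forall_pos_le_add fun θ hθ => ?_
  have hE := Real.exp_pos (1 + ∫ s in (0 : ℝ)..1, κ s)
  refine (key (θ / Real.exp (1 + ∫ s in (0 : ℝ)..1, κ s)) (by positivity)).trans (le_of_eq ?_)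
  field_simp
  ring

/-- `φ t x`, `0 ≤ t ≤ 1`, is the solution of `x' = F t x` which starts at `x`. -/
structure IsFlow (F : ℝ → E → E) (φ : ℝ → E → E) : Prop where
  init : ∀ x, φ 0 x = x
  deriv : ∀ x, ∀ t ∈ Icc (0 : ℝ) 1,
    HasDerivWithinAt (fun s => φ s x) (F t (φ t x)) (Icc 0 1) t

theorem exists_solution [CompleteSpace E] {F : ℝ → E → E} {K : NNReal}
    (hL : ∀ t ∈ Icc (0 : ℝ) 1, LipschitzWith K (F t))
    (hc : ∀ x, ContinuousOn (fun t => F t x) (Icc 0 1)) (hb : ∀ t ∈ Icc (0 : ℝ) 1, ∀ x, ‖F t x‖ ≤ K)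
    (x : E) : ∃ α : ℝ → E, α 0 = x ∧
      ∀ t ∈ Icc (0 : ℝ) 1, HasDerivWithinAt α (F t (α t)) (Icc 0 1) t := by
  have h : IsPicardLindelof F (⟨0, by simp⟩ : Icc (0 : ℝ) 1) x K 0 K K :=
    ⟨fun t ht => (hL t ht).lipschitzOnWith, fun y _ => hc y, fun t ht y _ => hb t ht y, by simp⟩
  exact h.exists_eq_forall_mem_Icc_hasDerivWithinAt₀

theorem exists_isFlow [CompleteSpace E] {F : ℝ → E → E} {K : NNReal}
    (hL : ∀ t ∈ Icc (0 : ℝ) 1, LipschitzWith K (F t))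
    (hc : ∀ x, ContinuousOn (fun t => F t x) (Icc 0 1))
    (hb : ∀ t ∈ Icc (0 : ℝ) 1, ∀ x, ‖F t x‖ ≤ K) : ∃ φ, IsFlow F φ := by
  choose α h0 h1 using exists_solution hL hc hb
  exact ⟨fun t x => α x t, h0, h1⟩

theorem exists_linear_solution [FiniteDimensional ℝ E] {B : ℝ → E →L[ℝ] E}
    (hB : ContinuousOn B (Icc 0 1)) :
    ∃ A : ℝ → E →L[ℝ] E, A 0 = ContinuousLinearMap.id ℝ E ∧
      ∀ t ∈ Icc (0 : ℝ) 1, HasDerivWithinAt A (B t ∘L A t) (Icc 0 1) t := by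
  obtain ⟨b, hb⟩ := isCompact_Icc.exists_bound_of_continuousOn hB
  have hb0 : 0 ≤ b := (norm_nonneg _).trans (hb 0 (by simp))
  set R : ℝ := 2 * (Real.exp (1 + b) * ‖ContinuousLinearMap.id ℝ E‖ + 1) with hR
  have hRpos : 0 < R := by positivity
  obtain ⟨K, hK1, hK2⟩ := exists_bound_comp_retr (contDiff_id (𝕜 := ℝ) (E := E →L[ℝ] E) (n := 1))
    0 hRpos
  simp only [id] at hK1 hK2
  set F : ℝ → (E →L[ℝ] E) → E →L[ℝ] E := fun t A => B t ∘L retr 0 R A with hF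
  have hbK : ∀ t ∈ Icc (0 : ℝ) 1, ‖B t‖ * K ≤ b * K := fun t ht =>
    mul_le_mul_of_nonneg_right (hb t ht) K.2
  obtain ⟨A, hA0, hA⟩ := exists_solution (F := F) (K := b.toNNReal * K) (fun t ht => by
      refine LipschitzWith.of_dist_le_mul fun A A' => ?_
      simp only [hF, dist_eq_norm]
      rw [← ContinuousLinearMap.comp_sub]
      refine (ContinuousLinearMap.opNorm_comp_le _ _).trans ?_
      have := hK2.dist_le_mul A A'
      rw [dist_eq_norm, dist_eq_norm] at this
      rw [NNReal.coe_mul, Real.coe_toNNReal _ hb0, mul_assoc]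
      exact mul_le_mul (hb t ht) this (norm_nonneg _) hb0)
    (fun A => by
      simp only [hF]
      exact hB.clm_comp continuousOn_const)
    (fun t ht A => by
      simp only [hF]
      refine (ContinuousLinearMap.opNorm_comp_le _ _).trans ?_
      rw [NNReal.coe_mul, Real.coe_toNNReal _ hb0]
      exact mul_le_mul (hb t ht) (hK1 A) (norm_nonneg _) hb0)
    (ContinuousLinearMap.id ℝ E)
  have hretr : ∀ A : E →L[ℝ] E, ‖retr 0 R A‖ ≤ ‖A‖ := by
    intro A
    unfold retr
    simp only [hRpos, dite_true, zero_add, sub_zero]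
    rw [norm_smul, Real.norm_of_nonneg (ContDiffBump.nonneg _)]
    exact mul_le_of_le_one_left (norm_nonneg _) (ContDiffBump.le_one _)
  have hbd := gronwall_integral (x := A) (κ := fun _ => b) (b := fun _ => 0) (c := ‖A 0‖) hA
    continuous_const (fun _ => hb0) continuous_const (fun _ => le_rfl) le_rfl (fun t ht => by
      simp only [hF, add_zero]
      refine (ContinuousLinearMap.opNorm_comp_le _ _).trans ?_
      exact mul_le_mul (hb t ht) (hretr _) (norm_nonneg _) hb0)
  refine ⟨A, hA0, fun t ht => ?_⟩
  have h1 := hA t ht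
  simp only [hF] at h1
  rwa [retr_eq_self] at h1
  have := hbd t ht
  simp only [intervalIntegral.integral_const, sub_zero, smul_eq_mul, one_mul, add_zero, mul_zero,
    hA0] at this
  rw [sub_zero, hR]
  linarith

/-! ### Differentiable dependence on initial conditions -/

variable [FiniteDimensional ℝ E]

theorem exists_uniform_strict {h : E → E} (hh : ContDiff ℝ 1 h) (R : ℝ) {c : ℝ} (hc : 0 < c) :
    ∃ δ > 0, ∀ z x y, ‖z‖ ≤ R → ‖x - z‖ < δ → ‖y - z‖ < δ →
      ‖h x - h y - fderiv ℝ h z (x - y)‖ ≤ c * ‖x - y‖ := by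
  have := FiniteDimensional.proper_real E
  have hcont := hh.continuous_fderiv one_ne_zero
  have hu := (isCompact_closedBall (0 : E) (R + 1)).uniformContinuousOn_of_continuous
    hcont.continuousOn
  rw [Metric.uniformContinuousOn_iff] at hu
  obtain ⟨δ, hδ, hu⟩ := hu c hc
  refine ⟨min δ 1, by positivity, fun z x y hz hx hy => ?_⟩
  have hmem : ∀ w ∈ Metric.ball z (min δ 1), w ∈ Metric.closedBall (0 : E) (R + 1) := by
    intro w hw
    rw [Metric.mem_ball, dist_eq_norm] at hw
    rw [mem_closedBall_zero_iff]
    have := norm_le_norm_add_norm_sub' w z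
    have := min_le_right δ 1
    linarith
  refine (convex_ball z (min δ 1)).norm_image_sub_le_of_norm_fderiv_le' (𝕜 := ℝ)
    (fun w _ => (hh.differentiable one_ne_zero).differentiableAt) (fun w hw => ?_)
    (by simpa [dist_eq_norm] using hy) (by simpa [dist_eq_norm] using hx)
  rw [← dist_eq_norm]
  refine (hu w (hmem w hw) z (hmem z (Metric.mem_ball_self (by positivity))) ?_).le
  exact (Metric.mem_ball.1 hw).trans_le (min_le_left _ _)

theorem IsFlow.exists_strict_fderiv {f g : E → E} {a : ℝ → ℝ} {φ : ℝ → E → E}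
    (hf : ContDiff ℝ 1 f) (hg : ContDiff ℝ 1 g) (ha : Continuous a)
    (hφ : IsFlow (fun t x => f x + a t • g x) φ)
    (hbd : ∀ R, ∃ R', ∀ t ∈ Icc (0 : ℝ) 1, ∀ x, ‖x‖ ≤ R → ‖φ t x‖ ≤ R') (x : E) :
    ∃ A : ℝ → E →L[ℝ] E, A 0 = ContinuousLinearMap.id ℝ E ∧
      (∀ t ∈ Icc (0 : ℝ) 1, HasDerivWithinAt A
        ((fderiv ℝ f (φ t x) + a t • fderiv ℝ g (φ t x)) ∘L A t) (Icc 0 1) t) ∧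
      ∀ t ∈ Icc (0 : ℝ) 1, HasStrictFDerivAt (φ t) (A t) x := by
  set D : ℝ → E →L[ℝ] E := fun t => fderiv ℝ f (φ t x) + a t • fderiv ℝ g (φ t x) with hD
  have hφc : ContinuousOn (fun t => φ t x) (Icc 0 1) := fun t ht =>
    (hφ.deriv x t ht).continuousWithinAt
  have hDc : ContinuousOn D (Icc 0 1) :=
    ((hf.continuous_fderiv one_ne_zero).comp_continuousOn hφc).add
      (ha.continuousOn.smul ((hg.continuous_fderiv one_ne_zero).comp_continuousOn hφc))
  obtain ⟨A, hA0, hA⟩ := exists_linear_solution hDc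
  refine ⟨A, hA0, hA, fun t ht => ?_⟩
  obtain ⟨R', hR'⟩ := hbd (‖x‖ + 1)
  obtain ⟨Kf, hKf, hf'⟩ := exists_lipschitz_ball hf R'
  obtain ⟨Kg, hKg, hg'⟩ := exists_lipschitz_ball hg R'
  obtain ⟨α, hα⟩ := isCompact_Icc.exists_bound_of_continuousOn (ha.continuousOn (s := Icc 0 1))
  have hα0 : 0 ≤ α := (norm_nonneg _).trans (hα 0 (by simp))
  set K : ℝ := Kf + α * Kg with hK
  have hK0 : 0 ≤ K := by positivity
  have hnear : ∀ y ∈ Metric.ball x 1, ‖y‖ ≤ ‖x‖ + 1 := by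
    intro y hy
    rw [Metric.mem_ball, dist_eq_norm] at hy
    linarith [norm_le_norm_add_norm_sub' y x]
  have hx1 : x ∈ Metric.ball x 1 := Metric.mem_ball_self one_pos
  have hDK : ∀ t ∈ Icc (0 : ℝ) 1, ‖D t‖ ≤ K := by
    intro s hs
    have hb := hR' s hs x (hnear x hx1)
    refine (norm_add_le _ _).trans (add_le_add (hf' _ 0 hb (by
      simpa using (norm_nonneg _).trans hb)).2.1 ?_)
    rw [norm_smul]
    exact mul_le_mul (hα s hs) (hg' _ 0 hb (by
      simpa using (norm_nonneg _).trans hb)).2.1 (norm_nonneg _) hα0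
  -- Lipschitz dependence near `x`
  set M : ℝ := Real.exp (1 + K) with hM
  have hlip : ∀ y ∈ Metric.ball x 1, ∀ z ∈ Metric.ball x 1, ∀ s ∈ Icc (0 : ℝ) 1,
      ‖φ s y - φ s z‖ ≤ M * ‖y - z‖ := by
    intro y hy z hz s hs
    have := gronwall_integral (x := fun s => φ s y - φ s z) (κ := fun _ => K) (b := fun _ => 0)
      (c := ‖y - z‖) (fun s hs => (hφ.deriv y s hs).sub (hφ.deriv z s hs)) continuous_const
      (fun _ => hK0) continuous_const (fun _ => le_rfl) (by simp [hφ.init]) (fun s hs => by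
        have h1 := (hf' _ _ (hR' s hs y (hnear y hy)) (hR' s hs z (hnear z hz))).2.2
        have h2 := (hg' _ _ (hR' s hs y (hnear y hy)) (hR' s hs z (hnear z hz))).2.2
        have h3 : f (φ s y) + a s • g (φ s y) - (f (φ s z) + a s • g (φ s z)) =
          (f (φ s y) - f (φ s z)) + a s • (g (φ s y) - g (φ s z)) := by
          rw [smul_sub]; abel
        rw [h3, add_zero]
        refine (norm_add_le _ _).trans ?_
        rw [norm_smul, hK, add_mul, mul_assoc]
        exact add_le_add h1 (mul_le_mul (hα s hs) h2 (norm_nonneg _) hα0)) s hs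
    simpa [hM] using this
  have hM0 : 0 < M := Real.exp_pos _
  rw [hasStrictFDerivAt_iff_isLittleO, Asymptotics.isLittleO_iff]
  intro c hc
  set c' : ℝ := c / (M * M * (1 + α)) with hc'
  have hc'0 : 0 < c' := by positivity
  obtain ⟨δ₁, hδ₁, h₁⟩ := exists_uniform_strict hf R' hc'0
  obtain ⟨δ₂, hδ₂, h₂⟩ := exists_uniform_strict hg R' hc'0
  set δ := min 1 (min δ₁ δ₂ / M) with hδdef
  have hδ : 0 < δ := by positivity
  have hnb : ∀ᶠ p : E × E in 𝓝 (x, x), p.1 ∈ Metric.ball x δ ∧ p.2 ∈ Metric.ball x δ :=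
    
    prod_mem_nhds (Metric.ball_mem_nhds x hδ) (Metric.ball_mem_nhds x hδ)
  filter_upwards [hnb] with p hp
  obtain ⟨y, z⟩ := p
  obtain ⟨hy, hz⟩ := hp
  simp only at hy hz ⊢
  have hsub : Metric.ball x δ ⊆ Metric.ball x 1 := Metric.ball_subset_ball (min_le_left _ _)
  have hclose : ∀ w ∈ Metric.ball x δ, ∀ s ∈ Icc (0 : ℝ) 1, ‖φ s w - φ s x‖ < min δ₁ δ₂ := by
    intro w hw s hs
    refine (hlip w (hsub hw) x hx1 s hs).trans_lt ?_
    rw [Metric.mem_ball, dist_eq_norm] at hw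
    have : ‖w - x‖ < min δ₁ δ₂ / M := hw.trans_le (min_le_right _ _)
    rw [lt_div_iff₀ hM0] at this
    linarith
  have := gronwall_integral (x := fun s => φ s y - φ s z - A s (y - z)) (κ := fun _ => K)
    (b := fun _ => c / M * ‖y - z‖) (c := 0)
    (fun s hs => ((hφ.deriv y s hs).sub (hφ.deriv z s hs)).sub
      ((hA s hs).clm_apply (hasDerivWithinAt_const s _ (y - z)))) continuous_const (fun _ => hK0)
    continuous_const (fun _ => by positivity) (by simp [hφ.init, hA0]) (fun s hs => by
      have e1 := h₁ (φ s x) (φ s y) (φ s z) (hR' s hs x (hnear x hx1))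
        ((hclose y hy s hs).trans_le (min_le_left _ _))
        ((hclose z hz s hs).trans_le (min_le_left _ _))
      have e2 := h₂ (φ s x) (φ s y) (φ s z) (hR' s hs x (hnear x hx1))
        ((hclose y hy s hs).trans_le (min_le_right _ _))
        ((hclose z hz s hs).trans_le (min_le_right _ _))
      have e3 := hlip y (hsub hy) z (hsub hz) s hs
      have e4 : f (φ s y) + a s • g (φ s y) - (f (φ s z) + a s • g (φ s z)) -
          ((D s ∘L A s) (y - z) + A s 0) =
          (f (φ s y) - f (φ s z) - fderiv ℝ f (φ s x) (φ s y - φ s z)) +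
          a s • (g (φ s y) - g (φ s z) - fderiv ℝ g (φ s x) (φ s y - φ s z)) +
          D s (φ s y - φ s z - A s (y - z)) := by
        simp only [hD, ContinuousLinearMap.comp_apply, add_apply, smul_apply, map_sub, smul_sub, map_zero]
        abel
      rw [e4]
      refine (norm_add_le _ _).trans ?_
      rw [add_comm]
      refine add_le_add ?_ ?_
      · exact (D s).le_of_opNorm_le (hDK s hs) _
      · refine (norm_add_le _ _).trans ?_
        rw [norm_smul]
        calc _ ≤ c' * ‖φ s y - φ s z‖ + α * (c' * ‖φ s y - φ s z‖) :=
              add_le_add e1 (mul_le_mul (hα s hs) e2 (norm_nonneg _) hα0)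
          _ = (1 + α) * c' * ‖φ s y - φ s z‖ := by ring
          _ ≤ (1 + α) * c' * (M * ‖y - z‖) := by gcongr
          _ = c / M * ‖y - z‖ := by rw [hc']; field_simp) t ht
  simp only [intervalIntegral.integral_const, sub_zero, smul_eq_mul, one_mul, zero_add,
    ← hM] at this
  refine this.trans (le_of_eq ?_)
  field_simp

end ODE

section Flow

variable {E : Type} [NormedAddCommGroup E] [NormedSpace ℝ E] [FiniteDimensional ℝ E]

theorem contDiff_one_of_hasStrictFDerivAt {f : E → E} {f' : E → E →L[ℝ] E}
    (h : ∀ x, HasStrictFDerivAt f (f' x) x) : ContDiff ℝ 1 f := by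
  rw [contDiff_one_iff_fderiv]
  refine ⟨fun x => (h x).hasFDerivAt.differentiableAt, ?_⟩
  have hf' : fderiv ℝ f = f' := funext fun x => (h x).hasFDerivAt.fderiv
  rw [hf', continuous_iff_continuousAt]
  intro x
  rw [Metric.continuousAt_iff']
  intro c hc
  have h1 := (hasStrictFDerivAt_iff_isLittleO.1 (h x))
  rw [Asymptotics.isLittleO_iff] at h1
  have h2 := h1 (half_pos hc)
  rw [nhds_prod_eq] at h2
  obtain ⟨p, hp, q, hq, hpq⟩ := Filter.eventually_prod_iff.1 h2
  have hpq' := (hp.and hq).eventually_nhds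
  filter_upwards [hpq'] with y hy
  rw [dist_eq_norm]
  refine lt_of_le_of_lt ?_ (half_lt_self hc)
  have h3 : HasFDerivAt (fun z => f z - f' x z) (f' y - f' x) y :=
    (h y).hasFDerivAt.sub (f' x).hasFDerivAt
  refine h3.le_of_lip' (half_pos hc).le ?_
  filter_upwards [hy] with z hz
  have := hpq hz.1 hy.self_of_nhds.2
  simp only [map_sub] at this
  rwa [sub_sub_sub_comm]

theorem IsFlow.contDiff {f g : E → E} {a : ℝ → ℝ} {φ : ℝ → E → E}
    (hf : ContDiff ℝ 1 f) (hg : ContDiff ℝ 1 g) (ha : Continuous a)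
    (hφ : IsFlow (fun t x => f x + a t • g x) φ)
    (hbd : ∀ R, ∃ R', ∀ t ∈ Icc (0 : ℝ) 1, ∀ x, ‖x‖ ≤ R → ‖φ t x‖ ≤ R') {t : ℝ}
    (ht : t ∈ Icc (0 : ℝ) 1) : ContDiff ℝ 1 (φ t) := by
  choose A _ _ hA using hφ.exists_strict_fderiv hf hg ha hbd
  exact contDiff_one_of_hasStrictFDerivAt fun x => hA x t ht

theorem IsFlow.tmap {f g : E → E} {a : ℝ → ℝ} {φ : ℝ → E → E}
    (hf : ContDiff ℝ 1 f) (hg : ContDiff ℝ 1 g) (ha : Continuous a)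
    (hφ : IsFlow (fun t x => f x + a t • g x) φ)
    (hbd : ∀ R, ∃ R', ∀ t ∈ Icc (0 : ℝ) 1, ∀ x, ‖x‖ ≤ R → ‖φ t x‖ ≤ R') :
    IsFlow (fun t z => tmap f z + a t • tmap g z) (fun t => tmap (φ t)) := by
  choose A h0 h1 h2 using hφ.exists_strict_fderiv hf hg ha hbd
  have hfd : ∀ x, ∀ t ∈ Icc (0 : ℝ) 1, fderiv ℝ (φ t) x = A x t := fun x t ht =>
    (h2 x t ht).hasFDerivAt.fderiv
  refine ⟨fun z => ?_, fun z t ht => ?_⟩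
  · have : φ 0 = id := funext hφ.init
    simp [SteepBilliard.tmap, this]
  · have := (hφ.deriv z.1 t ht).prodMk
      ((h1 z.1 t ht).clm_apply (hasDerivWithinAt_const t _ z.2))
    refine (this.congr_deriv ?_).congr_of_mem (fun s hs => ?_) ht
    · simp [SteepBilliard.tmap, hfd z.1 t ht, smul_apply]
    · simp [SteepBilliard.tmap, hfd z.1 s hs]

variable {I : Type} {l : Filter I} {β : I → ℝ}

theorem norm_tmap_snd_le {f : E → E} {R K : ℝ} (hR : 1 ≤ R)
    (h : ∀ z : E × E, ‖z‖ ≤ R → ‖tmap f z‖ ≤ K) {x : E} (hx : ‖x‖ ≤ R) (v : E) :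
    ‖fderiv ℝ f x v‖ ≤ K * ‖v‖ := by
  have hK : 0 ≤ K := (norm_nonneg _).trans (h 0 (by simpa using zero_le_one.trans hR))
  refine ContinuousLinearMap.le_of_opNorm_le _ ?_ v
  refine ContinuousLinearMap.opNorm_le_of_unit_norm hK fun w hw => ?_
  exact (norm_snd_le (tmap f (x, w))).trans (h (x, w) (max_le hx (hw.le.trans hR)))

theorem integral_const_mul_abs_add {a : ℝ → ℝ} (ha : Continuous a) (K b L : ℝ) :
    ∫ s in (0 : ℝ)..1, (K * b + |a s| * L) = K * b + (∫ s in (0 : ℝ)..1, |a s|) * L := by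
  rw [intervalIntegral.integral_add (f := fun _ => K * b) (g := fun s => |a s| * L) (by simp)
    ((ha.abs.mul continuous_const).intervalIntegrable _ _)]
  simp

theorem CloseZero.flow {f₁ f₂ g : I → E → E} {a : I → ℝ → ℝ} {φ ψ : I → ℝ → E → E} {τ : I → ℝ}
    (hβ : ∀ᶠ i in l, 0 ≤ β i) (hf : CloseZero l β f₁ f₂) (hg : CloseZero l β g g)
    (ha : ∀ᶠ i in l, Continuous (a i) ∧ ∫ s in (0 : ℝ)..1, |a i s| ≤ β i)
    (hφ : ∀ᶠ i in l, IsFlow (fun t x => f₁ i x + a i t • g i x) (φ i))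
    (hψ : ∀ᶠ i in l, IsFlow (fun _ => f₂ i) (ψ i))
    (hbd : ∀ R, ∃ R', ∀ᶠ i in l, ∀ t ∈ Icc (0 : ℝ) 1, ∀ x, ‖x‖ ≤ R →
      ‖φ i t x‖ ≤ R' ∧ ‖ψ i t x‖ ≤ R')
    (hτ : ∀ᶠ i in l, τ i ∈ Icc (0 : ℝ) 1) :
    CloseZero l β (fun i => φ i (τ i)) (fun i => ψ i (τ i)) := by
  intro R
  obtain ⟨R', hR'⟩ := hbd R
  obtain ⟨K, hK, hK'⟩ := hf R'
  obtain ⟨L, hL, hL'⟩ := hg R'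
  refine ⟨max R' (Real.exp (1 + K) * (1 + K + L)),
    le_max_of_le_right (by positivity), ?_⟩
  filter_upwards [hβ, ha, hφ, hψ, hR', hK', hL', hτ] with i hb ha hφ hψ hR' hK' hL' hτ x y hx hy
  refine ⟨(hR' _ hτ x hx).1.trans (le_max_left _ _),
    (hR' _ hτ x hx).2.trans (le_max_left _ _), ?_⟩
  have := gronwall_integral (x := fun s => φ i s x - ψ i s y) (κ := fun _ => K)
    (b := fun s => K * β i + |a i s| * L) (c := ‖x - y‖)
    (fun s hs => (hφ.deriv x s hs).sub (hψ.deriv y s hs)) continuous_const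
    (fun _ => hK) (continuous_const.add (ha.1.abs.mul continuous_const))
    (fun s => by have := hb; positivity) (by simp [hφ.init, hψ.init]) (fun s hs => by
      have h1 := (hK' _ _ (hR' s hs x hx).1 (hR' s hs y hy).2).2.2
      have h2 := (hL' _ _ (hR' s hs x hx).1 (hR' s hs x hx).1).1
      have h3 : f₁ i (φ i s x) + a i s • g i (φ i s x) - f₂ i (ψ i s y) =
        (f₁ i (φ i s x) - f₂ i (ψ i s y)) + a i s • g i (φ i s x) := by abel
      rw [h3]
      refine (norm_add_le _ _).trans ?_
      rw [norm_smul, Real.norm_eq_abs]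
      have := mul_le_mul_of_nonneg_left h2 (abs_nonneg (a i s))
      linarith) _ hτ
  rw [integral_const_mul_abs_add ha.1] at this
  simp only [intervalIntegral.integral_const, sub_zero, smul_eq_mul, one_mul] at this
  have hb0 := hb
  have hn := norm_nonneg (x - y)
  calc _ ≤ _ := this
    _ ≤ Real.exp (1 + K) * (‖x - y‖ + (K * β i + β i * L)) := by
      gcongr
      exact ha.2
    _ ≤ Real.exp (1 + K) * ((1 + K + L) * (‖x - y‖ + β i)) := by
      gcongr
      nlinarith [mul_nonneg hK hn, mul_nonneg hL hn]
    _ = Real.exp (1 + K) * (1 + K + L) * (‖x - y‖ + β i) := by ring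
    _ ≤ _ := by gcongr; exact le_max_right _ _

theorem norm_fderiv_flow_le {f g : E → E} {a : ℝ → ℝ} {φ : ℝ → E → E} {K L R' : ℝ} (hK : 0 ≤ K)
    (hL : 0 ≤ L) (hφ : IsFlow (fun t z => tmap f z + a t • tmap g z) (fun t => tmap (φ t)))
    (ha : Continuous a) (ha1 : ∫ s in (0 : ℝ)..1, |a s| ≤ 1)
    (hf : ∀ x, ‖x‖ ≤ R' → ∀ v, ‖fderiv ℝ f x v‖ ≤ K * ‖v‖)
    (hg : ∀ x, ‖x‖ ≤ R' → ∀ v, ‖fderiv ℝ g x v‖ ≤ L * ‖v‖) {x : E}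
    (hx : ∀ t ∈ Icc (0 : ℝ) 1, ‖φ t x‖ ≤ R') (v : E) {t : ℝ} (ht : t ∈ Icc (0 : ℝ) 1) :
    ‖fderiv ℝ (φ t) x v‖ ≤ Real.exp (1 + (K + L)) * ‖v‖ := by
  have h0 : fderiv ℝ (φ 0) x v = v := congrArg Prod.snd (hφ.init (x, v))
  have hd : ∀ t ∈ Icc (0 : ℝ) 1, HasDerivWithinAt (fun s => fderiv ℝ (φ s) x v)
      (fderiv ℝ f (φ t x) (fderiv ℝ (φ t) x v) +
        a t • fderiv ℝ g (φ t x) (fderiv ℝ (φ t) x v)) (Icc 0 1) t := fun t ht =>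
    ((ContinuousLinearMap.snd ℝ E E).hasFDerivAt.comp_hasDerivWithinAt t (hφ.deriv (x, v) t ht))
  have := gronwall_integral (κ := fun s => K * 1 + |a s| * L) (b := fun _ => 0) (c := ‖v‖) hd
    (continuous_const.add (ha.abs.mul continuous_const)) (fun s => by positivity)
    continuous_const (fun _ => le_rfl) (by rw [h0]) (fun s hs => by
      refine (norm_add_le _ _).trans ?_
      have h1 := hf _ (hx s hs) (fderiv ℝ (φ s) x v)
      have h2 := mul_le_mul_of_nonneg_left (hg _ (hx s hs) (fderiv ℝ (φ s) x v)) (abs_nonneg (a s))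
      rw [norm_smul, Real.norm_eq_abs]
      linarith) t ht
  rw [integral_const_mul_abs_add ha] at this
  simp only [intervalIntegral.integral_const, sub_zero, smul_eq_mul, mul_zero, add_zero,
    mul_one] at this
  refine this.trans ?_
  gcongr
  exact mul_le_of_le_one_left hL ha1

/-- Flows of close vector fields are close. The perturbation `a g` of the first field has to be
small in the `L¹` norm in time only. -/
theorem Close.flow {r : ℕ} {f₁ f₂ g : I → E → E} {a : I → ℝ → ℝ} {φ ψ : I → ℝ → E → E} {τ : I → ℝ}
    (hβ : ∀ᶠ i in l, 0 ≤ β i ∧ β i ≤ 1) (hf : Close l β r f₁ f₂) (hg : Close l β r g g)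
    (ha : ∀ᶠ i in l, Continuous (a i) ∧ ∫ s in (0 : ℝ)..1, |a i s| ≤ β i)
    (hφ : ∀ᶠ i in l, IsFlow (fun t x => f₁ i x + a i t • g i x) (φ i))
    (hψ : ∀ᶠ i in l, IsFlow (fun _ => f₂ i) (ψ i))
    (hbd : ∀ R, ∃ R', ∀ᶠ i in l, ∀ t ∈ Icc (0 : ℝ) 1, ∀ x, ‖x‖ ≤ R →
      ‖φ i t x‖ ≤ R' ∧ ‖ψ i t x‖ ≤ R')
    (hbd' : ∀ᶠ i in l, ∀ R, ∃ R', ∀ t ∈ Icc (0 : ℝ) 1, ∀ x, ‖x‖ ≤ R →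
      ‖φ i t x‖ ≤ R' ∧ ‖ψ i t x‖ ≤ R')
    (hτ : ∀ᶠ i in l, τ i ∈ Icc (0 : ℝ) 1) :
    Close l β r (fun i => φ i (τ i)) (fun i => ψ i (τ i)) := by
  induction r generalizing E with
  | zero => exact CloseZero.flow (hβ.mono fun _ h => h.1) hf hg ha hφ hψ hbd hτ
  | succ r ih =>
    have hC : ∀ᶠ i in l, ContDiff ℝ 1 (f₁ i) ∧ ContDiff ℝ 1 (f₂ i) ∧ ContDiff ℝ 1 (g i) := by
      filter_upwards [hf.2.1, hg.2.1] with i h1 h2 using ⟨h1.1, h1.2, h2.1⟩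
    have hψ' : ∀ᶠ i in l, IsFlow (fun t x => f₂ i x + (0 : ℝ) • f₂ i x) (ψ i) := by
      filter_upwards [hψ] with i hi
      simpa using hi
    refine ⟨?_, ?_, ?_⟩
    · exact CloseZero.flow (hβ.mono fun _ h => h.1) hf.1 hg.1 ha hφ hψ hbd hτ
    · filter_upwards [hC, ha, hφ, hψ', hbd', hτ] with i hC ha hφ hψ hbd' hτ
      exact ⟨hφ.contDiff hC.1 hC.2.2 ha.1 (fun R => (hbd' R).imp fun R' h t ht x hx =>
          (h t ht x hx).1) hτ,
        hψ.contDiff hC.2.1 hC.2.1 continuous_const (fun R => (hbd' R).imp fun R' h t ht x hx =>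
          (h t ht x hx).2) hτ⟩
    · have hTφ : ∀ᶠ i in l, IsFlow (fun t z => tmap (f₁ i) z + a i t • tmap (g i) z)
          (fun t => tmap (φ i t)) := by
        filter_upwards [hC, ha, hφ, hbd'] with i hC ha hφ hbd'
        exact hφ.tmap hC.1 hC.2.2 ha.1 fun R => (hbd' R).imp fun R' h t ht x hx => (h t ht x hx).1
      have hTψ : ∀ᶠ i in l, IsFlow (fun t z => tmap (f₂ i) z + (0 : ℝ) • tmap (f₂ i) z)
          (fun t => tmap (ψ i t)) := by
        filter_upwards [hC, hψ', hbd'] with i hC hψ hbd'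
        exact hψ.tmap hC.2.1 hC.2.1 continuous_const fun R => (hbd' R).imp
          fun R' h t ht x hx => (h t ht x hx).2
      have h01 : ∫ s in (0 : ℝ)..1, |(0 : ℝ)| ≤ 1 := by simp
      refine ih (g := fun i => tmap (g i)) (φ := fun i t => tmap (φ i t))
        (ψ := fun i t => tmap (ψ i t)) hf.2.2 hg.2.2 hTφ ?_ ?_ ?_
      · filter_upwards [hTψ] with i hi
        simpa using hi
      · intro R
        obtain ⟨R', hR'⟩ := hbd R
        obtain ⟨K, hK, hK'⟩ := hf.2.2.closeZero (max R' 1)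
        obtain ⟨L, hL, hL'⟩ := hg.2.2.closeZero (max R' 1)
        refine ⟨max R' (Real.exp (1 + (K + (K + L))) * R), ?_⟩
        filter_upwards [hβ, ha, hTφ, hTψ, hR', hK', hL'] with i hb ha hTφ hTψ hR' hK' hL' t ht z hz
        have hx := (norm_fst_le z).trans hz
        have hv := (norm_snd_le z).trans hz
        have hm := le_max_right R' 1
        have hf1 := fun x (hx : ‖x‖ ≤ R') => norm_tmap_snd_le hm
          (fun z hz => (hK' z z hz hz).1) (hx.trans (le_max_left _ 1))
        have hf2 := fun x (hx : ‖x‖ ≤ R') => norm_tmap_snd_le hm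
          (fun z hz => (hK' z z hz hz).2.1) (hx.trans (le_max_left _ 1))
        have hg1 := fun x (hx : ‖x‖ ≤ R') => norm_tmap_snd_le hm
          (fun z hz => (hL' z z hz hz).1) (hx.trans (le_max_left _ 1))
        constructor
        · refine max_le_max (hR' t ht _ hx).1 ?_
          refine (norm_fderiv_flow_le hK hL hTφ ha.1 (ha.2.trans hb.2) hf1 hg1
            (fun t ht => (hR' t ht _ hx).1) _ ht).trans ?_
          gcongr
          linarith
        · refine max_le_max (hR' t ht _ hx).2 ?_
          refine (norm_fderiv_flow_le hK hK hTψ continuous_const h01 hf2 hf2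
            (fun t ht => (hR' t ht _ hx).2) _ ht).trans ?_
          gcongr
          linarith
      · filter_upwards [hβ, ha, hTφ, hTψ, hbd', hC] with i hb ha hTφ hTψ hbd' hC R
        obtain ⟨R', hR'⟩ := hbd' R
        obtain ⟨K₁, hK₁, hf₁⟩ := exists_lipschitz_ball hC.1 R'
        obtain ⟨K₂, hK₂, hf₂⟩ := exists_lipschitz_ball hC.2.1 R'
        obtain ⟨L, hL, hg₁⟩ := exists_lipschitz_ball hC.2.2 R'
        have hle : ∀ {h : E → E} {K : ℝ}, (∀ x y, ‖x‖ ≤ R' → ‖y‖ ≤ R' →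
            ‖h x‖ ≤ K ∧ ‖fderiv ℝ h x‖ ≤ K ∧ ‖h x - h y‖ ≤ K * ‖x - y‖) →
            ∀ x, ‖x‖ ≤ R' → ∀ v, ‖fderiv ℝ h x v‖ ≤ K * ‖v‖ := fun hh x hx v =>
          ContinuousLinearMap.le_of_opNorm_le _ (hh x x hx hx).2.1 v
        refine ⟨max R' (Real.exp (1 + (K₁ + L + (K₂ + K₂))) * R), fun t ht z hz => ?_⟩
        have hx := (norm_fst_le z).trans hz
        have hv := (norm_snd_le z).trans hz
        constructor
        · refine max_le_max (hR' t ht _ hx).1 ?_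
          refine (norm_fderiv_flow_le hK₁ hL hTφ ha.1 (ha.2.trans hb.2) (hle hf₁) (hle hg₁)
            (fun t ht => (hR' t ht _ hx).1) _ ht).trans ?_
          exact mul_le_mul (Real.exp_le_exp.2 (by linarith)) hv (norm_nonneg _) (Real.exp_pos _).le
        · refine max_le_max (hR' t ht _ hx).2 ?_
          refine (norm_fderiv_flow_le hK₂ hK₂ hTψ continuous_const h01 (hle hf₂) (hle hf₂)
            (fun t ht => (hR' t ht _ hx).2) _ ht).trans ?_
          exact mul_le_mul (Real.exp_le_exp.2 (by linarith)) hv (norm_nonneg _) (Real.exp_pos _).le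

end Flow

/-! ### Closeness and derivatives -/

section Derivatives

variable {I : Type} {l : Filter I} {β : I → ℝ}
variable {E F : Type} [NormedAddCommGroup E] [NormedSpace ℝ E] [FiniteDimensional ℝ E]
  [NormedAddCommGroup F] [NormedSpace ℝ F] [FiniteDimensional ℝ F]

theorem Close.contDiff {r : ℕ} (hr : 1 ≤ r) {f g : I → E → F} (h : Close l β r f g) :
    ∀ᶠ i in l, ContDiff ℝ r (f i) ∧ ContDiff ℝ r (g i) := by
  induction r, hr using Nat.le_induction generalizing E F with
  | base => simpa using h.2.1
  | succ r hr ih =>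
    filter_upwards [h.2.1, ih h.2.2] with i h1 h2
    have key : ∀ f : E → F, ContDiff ℝ 1 f → ContDiff ℝ r (tmap f) →
        ContDiff ℝ ((r + 1 : ℕ)) f := by
      intro f hf hT
      rw [Nat.cast_add, Nat.cast_one, contDiff_succ_iff_fderiv_apply]
      refine ⟨hf.differentiable one_ne_zero, by simp, fun v => ?_⟩
      exact contDiff_snd.comp (hT.comp (contDiff_id.prodMk contDiff_const))
    exact ⟨key _ h1.1 h2.1, key _ h1.2 h2.2⟩

theorem norm_iteratedFDeriv_fderiv_apply_le {h : E → F} {k : ℕ} (hh : ContDiff ℝ (k + 1 : ℕ) h)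
    {x : E} {C : ℝ} (hC : 0 ≤ C)
    (hb : ∀ v, ‖v‖ ≤ 1 → ‖iteratedFDeriv ℝ k (fun y => fderiv ℝ h y v) x‖ ≤ C) :
    ‖iteratedFDeriv ℝ (k + 1) h x‖ ≤ C := by
  rw [← norm_iteratedFDeriv_fderiv]
  have hc : ContDiff ℝ k (fderiv ℝ h) := hh.fderiv_right (by norm_cast)
  refine ContinuousMultilinearMap.opNorm_le_bound hC fun m => ?_
  refine ContinuousLinearMap.opNorm_le_of_unit_norm (by positivity) fun v hv => ?_
  rw [← iteratedFDeriv_clm_apply_const_apply hc le_rfl]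
  exact ContinuousMultilinearMap.le_of_opNorm_le (hb v hv.le) m

theorem norm_iteratedFDeriv_slice_le {H : E × E → F × F} {k : ℕ} (hH : ContDiff ℝ k H) (x v : E) :
    ‖iteratedFDeriv ℝ k (fun y => (H (y, v)).2) x‖ ≤ ‖iteratedFDeriv ℝ k H (x, v)‖ := by
  have h1 : (fun y => (H (y, v)).2) = (ContinuousLinearMap.snd ℝ F F) ∘
      ((fun z => H (z + (0, v))) ∘ ContinuousLinearMap.inl ℝ E E) := by
    ext y; simp
  have hH' : ContDiff ℝ k (fun z => H (z + (0, v))) := hH.comp (contDiff_id.add contDiff_const)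
  rw [h1]
  refine (ContinuousLinearMap.norm_iteratedFDeriv_comp_left _
    (hH'.comp (ContinuousLinearMap.contDiff _)).contDiffAt le_rfl).trans ?_
  rw [ContinuousLinearMap.iteratedFDeriv_comp_right _ hH' _ le_rfl, iteratedFDeriv_comp_add_right]
  refine (mul_le_of_le_one_left (norm_nonneg _) (ContinuousLinearMap.norm_snd_le _ _ _)).trans ?_
  refine (ContinuousMultilinearMap.norm_compContinuousLinearMap_le _ _).trans ?_
  have : ∏ _i : Fin k, ‖ContinuousLinearMap.inl ℝ E E‖ ≤ 1 :=
    Finset.prod_le_one (fun _ _ => norm_nonneg _)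
      fun _ _ => ContinuousLinearMap.norm_inl_le_one ℝ E E
  simpa using mul_le_of_le_one_right (norm_nonneg (iteratedFDeriv ℝ k H (x, v))) this

/-- Close families have close derivatives. -/
theorem Close.norm_iteratedFDeriv_sub_le (hβ : ∀ᶠ i in l, 0 ≤ β i) {r : ℕ} {f g : I → E → F}
    (h : Close l β r f g) (R : ℝ) : ∃ K : ℝ, 0 ≤ K ∧ ∀ᶠ i in l, ∀ k ≤ r, ∀ x, ‖x‖ ≤ R →
      ‖iteratedFDeriv ℝ k (fun y => f i y - g i y) x‖ ≤ K * β i := by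
  have h0 : ∀ {E F : Type} [NormedAddCommGroup E] [NormedSpace ℝ E] [NormedAddCommGroup F]
      [NormedSpace ℝ F] {f g : I → E → F}, CloseZero l β f g → ∀ R : ℝ, ∃ K : ℝ, 0 ≤ K ∧
      ∀ᶠ i in l, ∀ x, ‖x‖ ≤ R → ‖iteratedFDeriv ℝ 0 (fun y => f i y - g i y) x‖ ≤ K * β i := by
    intro E F _ _ _ _ f g h R
    obtain ⟨K, hK, h⟩ := h R
    refine ⟨K, hK, h.mono fun i hi x hx => ?_⟩
    rw [norm_iteratedFDeriv_zero]
    simpa using (hi x x hx hx).2.2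
  induction r generalizing E F R with
  | zero =>
    obtain ⟨K, hK, h⟩ := h0 h.closeZero R
    refine ⟨K, hK, h.mono fun i hi k hk => ?_⟩
    obtain rfl : k = 0 := by omega
    exact hi
  | succ r ih =>
    obtain ⟨K, hK, h1⟩ := h0 h.closeZero R
    obtain ⟨K', hK', h2⟩ := ih h.2.2 (max R 1)
    refine ⟨max K K', by positivity, ?_⟩
    filter_upwards [h1, h2, h.contDiff (by omega), h.2.1, hβ] with i h1 h2 hc hc1 hb k hk x hx
    obtain _ | k := k
    · exact (h1 x hx).trans (by gcongr; exact le_max_left _ _)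
    · have hc' : ContDiff ℝ (r + 1 : ℕ) (fun y => f i y - g i y) := hc.1.sub hc.2
      refine norm_iteratedFDeriv_fderiv_apply_le (hc'.of_le (by exact_mod_cast hk)) (by positivity)
        fun v hv => ?_
      have hT : ∀ f : E → F, ContDiff ℝ (r + 1 : ℕ) f → ContDiff ℝ k (tmap f) := by
        intro f hf
        have h1 : ContDiff ℝ k (fderiv ℝ f) := hf.fderiv_right (by norm_cast)
        have h2 : ContDiff ℝ k f := hf.of_le (by norm_cast; omega)
        exact (h2.comp contDiff_fst).prodMk ((h1.comp contDiff_fst).clm_apply contDiff_snd)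
      have := norm_iteratedFDeriv_slice_le (H := fun z => tmap (f i) z - tmap (g i) z)
        ((hT _ hc.1).sub (hT _ hc.2)) x v
      have heq : (fun y => fderiv ℝ (fun y => f i y - g i y) y v) =
          fun y => (tmap (f i) (y, v) - tmap (g i) (y, v)).2 := by
        funext y
        rw [fderiv_fun_sub (hc1.1.differentiable one_ne_zero _)
          (hc1.2.differentiable one_ne_zero _)]
        rfl
      rw [heq]
      refine this.trans ((h2 k (by omega) (x, v) (max_le_max hx hv)).trans ?_)
      gcongr
      exact le_max_right _ _

theorem CloseZero.of_iteratedFDeriv_zero {f g : I → E → F} {U : Set E} {ϱ : E → E}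
    (hϱ : ContDiff ℝ 1 ϱ) (hϱU : ∀ x, ϱ x ∈ U) (hβ : ∀ᶠ i in l, 0 ≤ β i) {K : ℝ} (hK : 0 ≤ K)
    (h : ∀ᶠ i in l, ∀ x ∈ U, ∀ y ∈ U, ‖iteratedFDeriv ℝ 0 (f i) x‖ ≤ K ∧
      ‖iteratedFDeriv ℝ 0 (g i) x‖ ≤ K ∧
      ‖iteratedFDeriv ℝ 0 (f i) x - iteratedFDeriv ℝ 0 (g i) y‖ ≤ K * (‖x - y‖ + β i)) :
    CloseZero l β (fun i x => f i (ϱ x)) (fun i x => g i (ϱ x)) := by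
  intro R
  obtain ⟨L, hL, hL'⟩ := exists_lipschitz_ball hϱ R
  refine ⟨K * (L + 1), by positivity, ?_⟩
  filter_upwards [h, hβ] with i hi hb x y hx hy
  obtain ⟨h1, h2, h3⟩ := hi (ϱ x) (hϱU x) (ϱ y) (hϱU y)
  rw [norm_iteratedFDeriv_zero] at h1 h2
  rw [iteratedFDeriv_zero_eq_comp, iteratedFDeriv_zero_eq_comp, Function.comp_apply,
    Function.comp_apply, ← map_sub, LinearIsometryEquiv.norm_map] at h3
  refine ⟨h1.trans (by nlinarith), h2.trans (by nlinarith), h3.trans ?_⟩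
  have := (hL' x y hx hy).2.2
  calc K * (‖ϱ x - ϱ y‖ + β i) ≤ K * (L * ‖x - y‖ + β i) := by gcongr
    _ ≤ K * ((L + 1) * (‖x - y‖ + β i)) := by
      gcongr
      nlinarith [norm_nonneg (x - y)]
    _ = _ := by ring

/-- Families are close if their iterated derivatives are. -/
theorem Close.of_iteratedFDeriv {r : ℕ} {f g : I → E → F} {U : Set E} (hU : IsOpen U) {ϱ : E → E}
    (hϱ : ContDiff ℝ ∞ ϱ) (hϱU : ∀ x, ϱ x ∈ U) (hβ : ∀ᶠ i in l, 0 ≤ β i)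
    (hc : ∀ᶠ i in l, ContDiffOn ℝ r (f i) U ∧ ContDiffOn ℝ r (g i) U) {K : ℝ} (hK : 0 ≤ K)
    (h : ∀ᶠ i in l, ∀ k ≤ r, ∀ x ∈ U, ∀ y ∈ U, ‖iteratedFDeriv ℝ k (f i) x‖ ≤ K ∧
      ‖iteratedFDeriv ℝ k (g i) x‖ ≤ K ∧
      ‖iteratedFDeriv ℝ k (f i) x - iteratedFDeriv ℝ k (g i) y‖ ≤ K * (‖x - y‖ + β i)) :
    Close l β r (fun i x => f i (ϱ x)) (fun i x => g i (ϱ x)) := by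
  have hϱ1 : ContDiff ℝ 1 ϱ := hϱ.of_le (by norm_cast)
  have h0 : CloseZero l β (fun i x => f i (ϱ x)) (fun i x => g i (ϱ x)) :=
    CloseZero.of_iteratedFDeriv_zero hϱ1 hϱU hβ hK (h.mono fun i hi => hi 0 (Nat.zero_le _))
  induction r generalizing F with
  | zero => exact h0
  | succ r ih =>
    have hsm : ∀ {f : E → F}, ContDiffOn ℝ (r + 1 : ℕ) f U → ∀ x,
        DifferentiableAt ℝ f (ϱ x) := fun hf x =>
      (hf.contDiffAt (hU.mem_nhds (hϱU x))).differentiableAt (by simp)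
    refine ⟨h0, ?_, ?_⟩
    · filter_upwards [hc] with i hi
      have key : ∀ {f : E → F}, ContDiffOn ℝ (r + 1 : ℕ) f U →
          ContDiff ℝ 1 (fun x => f (ϱ x)) := fun hf =>
        (hf.of_le (by norm_cast; omega)).comp_contDiff hϱ1 hϱU
      exact ⟨key hi.1, key hi.2⟩
    · have e1 : Close l β r (fun i x => f i (ϱ x)) (fun i x => g i (ϱ x)) := by
        refine ih ?_ ?_ h0
        · filter_upwards [hc] with i hi
          exact ⟨hi.1.of_le (by norm_cast; omega), hi.2.of_le (by norm_cast; omega)⟩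
        · filter_upwards [h] with i hi k hk
          exact hi k (by omega)
      have hd : ∀ᶠ i in l, ∀ k ≤ r, ∀ x ∈ U, ∀ y ∈ U, ‖iteratedFDeriv ℝ k (fderiv ℝ (f i)) x‖ ≤ K ∧
          ‖iteratedFDeriv ℝ k (fderiv ℝ (g i)) x‖ ≤ K ∧
          ‖iteratedFDeriv ℝ k (fderiv ℝ (f i)) x - iteratedFDeriv ℝ k (fderiv ℝ (g i)) y‖ ≤
            K * (‖x - y‖ + β i) := by
        filter_upwards [h] with i hi k hk x hx y hy
        have := hi (k + 1) (by omega) x hx y hy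
        rw [norm_iteratedFDeriv_fderiv, norm_iteratedFDeriv_fderiv]
        refine ⟨this.1, this.2.1, ?_⟩
        have h3 := this.2.2
        rw [iteratedFDeriv_succ_eq_comp_right, iteratedFDeriv_succ_eq_comp_right,
          Function.comp_apply, Function.comp_apply] at h3
        rwa [← dist_eq_norm, LinearIsometryEquiv.dist_map, dist_eq_norm] at h3
      have e2 : Close l β r (fun i x => fderiv ℝ (f i) (ϱ x)) (fun i x => fderiv ℝ (g i) (ϱ x)) := by
        refine ih (f := fun i => fderiv ℝ (f i)) (g := fun i => fderiv ℝ (g i)) ?_ hd ?_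
        · filter_upwards [hc] with i hi
          exact ⟨hi.1.fderiv_of_isOpen hU (by norm_cast),
            hi.2.fderiv_of_isOpen hU (by norm_cast)⟩
        · exact CloseZero.of_iteratedFDeriv_zero hϱ1 hϱU hβ hK
            (hd.mono fun i hi => hi 0 (Nat.zero_le _))
      have hfst : Close l β r (fun _ => (Prod.fst : E × E → E)) (fun _ => Prod.fst) :=
        Close.of_contDiff hβ r contDiff_fst
      have hsnd := Close.of_contDiff hβ r ((ContDiff.tmap hϱ).snd)
      have e3 := Close.map₂ hβ (φ := fun z : (E →L[ℝ] F) × E => z.1 z.2)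
        (contDiff_fst.clm_apply contDiff_snd) (e2.comp hβ hfst) hsnd
      have e4 := (e1.comp hβ hfst).prodMk hβ e3
      have hT : ∀ {f : E → F}, ContDiffOn ℝ (r + 1 : ℕ) f U →
          (fun z : E × E => (f (ϱ z.1), fderiv ℝ f (ϱ z.1) (tmap ϱ z).2)) =
          tmap (fun x => f (ϱ x)) := by
        intro f hf
        funext z
        simp only [tmap]
        rw [fderiv_fun_comp z.1 (hsm hf _) ((hϱ1.differentiable one_ne_zero) _)]
        rfl
      refine e4.congr ?_ ?_
      · filter_upwards [hc] with i hi using hT hi.1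
      · filter_upwards [hc] with i hi using hT hi.2

theorem Close.fderiv_apply (hβ : ∀ᶠ i in l, 0 ≤ β i) {r : ℕ} {f g : I → E → F}
    (h : Close l β (r + 1) f g) (v : E) :
    Close l β r (fun i x => fderiv ℝ (f i) x v) (fun i x => fderiv ℝ (g i) x v) :=
  (h.2.2.comp hβ (Close.of_contDiff hβ r
    (f := fun x : E => (x, v)) (contDiff_id.prodMk contDiff_const))).snd hβ

theorem Close.sum (hβ : ∀ᶠ i in l, 0 ≤ β i) {r : ℕ} {J : Type} (s : Finset J)
    {f g : J → I → E → F} (h : ∀ j ∈ s, Close l β r (f j) (g j)) :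
    Close l β r (fun i x => ∑ j ∈ s, f j i x) (fun i x => ∑ j ∈ s, g j i x) := by
  classical
  induction s using Finset.induction_on with
  | empty => simpa using Close.of_contDiff hβ r (contDiff_const (c := (0 : F)))
  | insert a s ha ih =>
    simp only [Finset.sum_insert ha]
    exact (h a (by simp)).add hβ (ih fun j hj => h j (by simp [hj]))

theorem gradient_eq_sum {d : ℕ} (f : Conf d → ℝ) (x : Conf d) :
    gradient f x = ∑ j, fderiv ℝ f x (EuclideanSpace.basisFun (Fin d) ℝ j) •
      EuclideanSpace.basisFun (Fin d) ℝ j := by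
  conv_lhs => rw [← (EuclideanSpace.basisFun (Fin d) ℝ).sum_repr' (gradient f x)]
  refine Finset.sum_congr rfl fun j _ => ?_
  rw [real_inner_comm, gradient, InnerProductSpace.toDual_symm_apply]

theorem Close.gradient {d : ℕ} (hβ : ∀ᶠ i in l, 0 ≤ β i) {r : ℕ} {f g : I → Conf d → ℝ}
    (h : Close l β (r + 1) f g) :
    Close l β r (fun i => gradient (f i)) (fun i => gradient (g i)) := by
  have := Close.sum hβ Finset.univ (f := fun j i x =>
      fderiv ℝ (f i) x (EuclideanSpace.basisFun (Fin d) ℝ j) • EuclideanSpace.basisFun (Fin d) ℝ j)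
    (g := fun j i x =>
      fderiv ℝ (g i) x (EuclideanSpace.basisFun (Fin d) ℝ j) • EuclideanSpace.basisFun (Fin d) ℝ j)
    (fun j _ => (h.fderiv_apply hβ _).smul hβ (Close.of_contDiff hβ r contDiff_const))
  convert this using 3
  · exact gradient_eq_sum _ _
  · exact gradient_eq_sum _ _

/-- The functions `u ↦ A c^r m(u/c + b)` are small in `C^r`. -/
theorem Close.scaled (hβ : ∀ᶠ i in l, 0 ≤ β i ∧ β i ≤ 1) {r : ℕ} {m : ℝ → ℝ} (hm : ContDiff ℝ ∞ m)
    (hb : ∀ k, ∃ K, ∀ u, |iteratedDeriv k m u| ≤ K) {A c : I → ℝ} {b : ℝ}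
    (hA : ∀ᶠ i in l, |A i| ≤ β i) (hc : ∀ᶠ i in l, 0 < c i ∧ c i ≤ 1) :
    Close l β r (fun i u => A i * c i ^ r * m (u / c i + b)) (fun _ _ => 0) := by
  have hβ0 := hβ.mono fun _ h => h.1
  have h0 : ∀ {m : ℝ → ℝ} (r : ℕ), (∃ K, ∀ u, |iteratedDeriv 0 m u| ≤ K) →
      CloseZero l β (fun i (u : ℝ) => A i * c i ^ r * m (u / c i + b)) (fun _ _ => (0 : ℝ)) := by
    intro m r ⟨K, hK⟩ R
    simp only [iteratedDeriv_zero] at hK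
    have hK0 : 0 ≤ K := (abs_nonneg _).trans (hK 0)
    refine ⟨K, hK0, ?_⟩
    filter_upwards [hβ, hA, hc] with i hb hA hc x y _ _
    have h1 : ‖A i * c i ^ r * m (x / c i + b)‖ ≤ K * β i := by
      rw [norm_mul, norm_mul, Real.norm_eq_abs, Real.norm_eq_abs, Real.norm_eq_abs, abs_pow,
        abs_of_pos hc.1, mul_comm]
      refine mul_le_mul (hK _) ?_ (by have := hc.1; positivity) hK0
      exact (mul_le_of_le_one_right (abs_nonneg _) (pow_le_one₀ hc.1.le hc.2)).trans hA
    refine ⟨h1.trans (mul_le_of_le_one_right hK0 hb.2), by simpa using hK0, ?_⟩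
    rw [sub_zero]
    exact h1.trans (by gcongr; linarith [norm_nonneg (x - y)])
  induction r generalizing m with
  | zero => exact h0 0 (hb 0)
  | succ r ih =>
    have hm1 : ContDiff ℝ 1 m := hm.of_le (by norm_cast)
    refine ⟨h0 _ (hb 0), .of_forall fun i => ⟨by fun_prop, contDiff_const⟩, ?_⟩
    have hm' : ContDiff ℝ ∞ (deriv m) := ((contDiff_infty_iff_deriv).1 hm).2
    have e1 := ih hm hb
    have e2 := ih hm' fun k => by
      obtain ⟨K, hK⟩ := hb (k + 1)
      exact ⟨K, fun u => by rw [← iteratedDeriv_succ']; exact hK u⟩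
    have hfst : Close l β r (fun _ => (Prod.fst : ℝ × ℝ → ℝ)) (fun _ => Prod.fst) :=
      Close.of_contDiff hβ0 r contDiff_fst
    have hsnd : Close l β r (fun _ => (Prod.snd : ℝ × ℝ → ℝ)) (fun _ => Prod.snd) :=
      Close.of_contDiff hβ0 r contDiff_snd
    have hcc : Close l β r (fun i (_ : ℝ × ℝ) => c i) (fun i _ => c i) :=
      Close.const_self hβ0 1 (by
        filter_upwards [hc] with i hi
        rw [Real.norm_of_nonneg hi.1.le]; exact hi.2) r
    refine ((hcc.smul hβ0 (e1.comp hβ0 hfst)).prodMk hβ0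
      ((e2.comp hβ0 hfst).smul hβ0 hsnd)).congr ?_ ?_
    · filter_upwards [hc] with i hi
      funext z
      have hd : HasDerivAt (fun u => A i * c i ^ (r + 1) * m (u / c i + b))
          (A i * c i ^ (r + 1) * (deriv m (z.1 / c i + b) * (1 / c i))) z.1 := by
        refine HasDerivAt.const_mul _ ?_
        exact ((hm1.differentiable one_ne_zero _).hasDerivAt).comp z.1
          (((hasDerivAt_id z.1).div_const (c i)).add_const b)
      simp only [tmap, hd.hasFDerivAt.fderiv, smul_eq_mul]
      refine Prod.ext ?_ ?_
      · simp only; ring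
      · have := hi.1.ne'
        simp
        field_simp
        ring
    · refine .of_forall fun i => ?_
      funext z
      simp [tmap]

end Derivatives

/-! ### Flows of truncated vector fields -/

section CutFlow

variable {E : Type} [NormedAddCommGroup E] [NormedSpace ℝ E] [FiniteDimensional ℝ E]

/-- The vector field `f + a(t) g`, truncated outside of the ball of radius `R` about `c`. -/
def cutField (c : E) (R : ℝ) (f g : E → E) (a : ℝ → ℝ) (t : ℝ) (x : E) : E :=
  f (retr c R x) + a t • g (retr c R x)

open Classical in
/-- The flow of `cutField`. -/
def cutFlow (c : E) (R : ℝ) (f g : E → E) (a : ℝ → ℝ) : ℝ → E → E :=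
  if h : ∃ φ, IsFlow (cutField c R f g a) φ then h.choose else fun _ x => x

theorem isFlow_cutFlow (c : E) {R : ℝ} (hR : 0 < R) {f g : E → E} {a : ℝ → ℝ}
    (hf : ContDiff ℝ 1 f) (hg : ContDiff ℝ 1 g) (ha : Continuous a) :
    IsFlow (cutField c R f g a) (cutFlow c R f g a) := by
  have h : ∃ φ, IsFlow (cutField c R f g a) φ := by
    obtain ⟨Kf, hf1, hf2⟩ := exists_bound_comp_retr hf c hR
    obtain ⟨Kg, hg1, hg2⟩ := exists_bound_comp_retr hg c hR
    obtain ⟨α, hα⟩ := isCompact_Icc.exists_bound_of_continuousOn (ha.continuousOn (s := Icc 0 1))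
    have hα0 : 0 ≤ α := (norm_nonneg _).trans (hα 0 (by simp))
    refine exists_isFlow (K := Kf + α.toNNReal * Kg) (fun t ht => ?_) (fun x => ?_)
      (fun t ht x => ?_)
    · refine hf2.add (LipschitzWith.of_dist_le_mul fun x y => ?_)
      rw [dist_smul₀, NNReal.coe_mul, Real.coe_toNNReal _ hα0, mul_assoc]
      exact mul_le_mul (hα t ht) (hg2.dist_le_mul x y) dist_nonneg hα0
    · exact (continuous_const.add (ha.smul continuous_const)).continuousOn
    · refine (norm_add_le _ _).trans ?_
      rw [norm_smul, NNReal.coe_add, NNReal.coe_mul, Real.coe_toNNReal _ hα0]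
      exact add_le_add (hf1 x) (mul_le_mul (hα t ht) (hg1 x) (norm_nonneg _) hα0)
  rw [cutFlow, dif_pos h]
  exact h.choose_spec

theorem isFlow_cutFlow_zero (c : E) {R : ℝ} (hR : 0 < R) {f : E → E} (hf : ContDiff ℝ 1 f) :
    IsFlow (fun _ x => f (retr c R x)) (cutFlow c R f 0 0) := by
  have := isFlow_cutFlow c hR hf (g := 0) (a := 0) contDiff_const continuous_const
  have h : cutField c R f 0 0 = fun _ x => f (retr c R x) := by
    funext t x; simp [cutField]
  rwa [h] at this

/-- A curve moves by at most the integral of its speed. -/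
theorem norm_sub_le_of_speed {E : Type} [NormedAddCommGroup E] [NormedSpace ℝ E]
    {x x' : ℝ → E} {a : ℝ → ℝ} {M L : ℝ}
    (hx : ∀ t ∈ Icc (0 : ℝ) 1, HasDerivWithinAt x (x' t) (Icc 0 1) t) (ha : Continuous a)
    (hL : 0 ≤ L) (bound : ∀ t ∈ Icc (0 : ℝ) 1, ‖x' t‖ ≤ M + |a t| * L) {t : ℝ}
    (ht : t ∈ Icc (0 : ℝ) 1) :
    ‖x t - x 0‖ ≤ M * t + (∫ s in (0 : ℝ)..1, |a s|) * L := by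
  have hint : ∀ s, HasDerivAt (fun t => ∫ u in (0 : ℝ)..t, |a u|) (|a s|) s := fun s =>
    intervalIntegral.integral_hasDerivAt_right (ha.abs.intervalIntegrable _ _)
      (ha.abs.stronglyMeasurableAtFilter _ _) ha.abs.continuousAt
  have hB : ∀ s, HasDerivAt (fun t => M * t + (∫ u in (0 : ℝ)..t, |a u|) * L)
      (M * 1 + |a s| * L) s := fun s =>
    ((hasDerivAt_id s).const_mul M).add ((hint s).mul_const L)
  have := image_norm_le_of_norm_deriv_right_le_deriv_boundary (f := fun t => x t - x 0)
    (f' := x') (a := 0) (b := 1)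
    (fun s hs => ((hx s hs).continuousWithinAt).sub continuousWithinAt_const)
    (fun s hs => (hasDerivWithinAt_Ici_of_Icc hs (hx s (Ico_subset_Icc_self hs))).sub_const _)
    (by simp) hB (fun s hs => by rw [mul_one]; exact bound s (Ico_subset_Icc_self hs)) ht
  refine this.trans ?_
  gcongr
  exact intervalIntegral.integral_mono_interval le_rfl ht.1 ht.2 (.of_forall fun s => abs_nonneg _)
    (ha.abs.intervalIntegrable _ _)

variable {I : Type} {l : Filter I} {β : I → ℝ}

/-- Flows of close truncated vector fields are close. -/
theorem Close.cutFlow {r : ℕ} {f₁ f₂ g : I → E → E} {a : I → ℝ → ℝ} {c : E} {R : ℝ} (hR : 0 < R)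
    (hβ : ∀ᶠ i in l, 0 ≤ β i ∧ β i ≤ 1) (hf : Close l β r f₁ f₂) (hg : Close l β r g g)
    (hC : ∀ᶠ i in l, ContDiff ℝ 1 (f₁ i) ∧ ContDiff ℝ 1 (f₂ i) ∧ ContDiff ℝ 1 (g i))
    (ha : ∀ᶠ i in l, Continuous (a i) ∧ ∫ s in (0 : ℝ)..1, |a i s| ≤ β i)
    {τ : ℝ} (hτ : τ ∈ Icc (0 : ℝ) 1) :
    Close l β r (fun i => cutFlow c R (f₁ i) (g i) (a i) τ)
      (fun i => cutFlow c R (f₂ i) 0 0 τ) := by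
  have hβ0 : ∀ᶠ i in l, 0 ≤ β i := hβ.mono fun _ h => h.1
  have hretr := Close.of_contDiff (l := l) hβ0 r (contDiff_retr c hR)
  have hφ : ∀ᶠ i in l, IsFlow (fun t x => f₁ i (retr c R x) + a i t • g i (retr c R x))
      (SteepBilliard.cutFlow c R (f₁ i) (g i) (a i)) := by
    filter_upwards [hC, ha] with i hC ha
    exact isFlow_cutFlow c hR hC.1 hC.2.2 ha.1
  have hψ : ∀ᶠ i in l, IsFlow (fun _ x => f₂ i (retr c R x))
      (SteepBilliard.cutFlow c R (f₂ i) 0 0) := by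
    filter_upwards [hC] with i hC
    exact isFlow_cutFlow_zero c hR hC.2.1
  obtain ⟨K, hK, hK'⟩ := hf.closeZero (‖c‖ + R)
  obtain ⟨L, hL, hL'⟩ := hg.closeZero (‖c‖ + R)
  have hrn : ∀ x, ‖retr c R x‖ ≤ ‖c‖ + R := fun x => by
    linarith [norm_retr_sub_lt c x hR, norm_le_norm_add_norm_sub' (retr c R x) c]
  have hmove : ∀ᶠ i in l, ∀ t ∈ Icc (0 : ℝ) 1, ∀ x,
      ‖SteepBilliard.cutFlow c R (f₁ i) (g i) (a i) t x‖ ≤ ‖x‖ + (K + L) ∧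
      ‖SteepBilliard.cutFlow c R (f₂ i) 0 0 t x‖ ≤ ‖x‖ + (K + L) := by
    filter_upwards [hφ, hψ, hK', hL', ha, hβ] with i hφ hψ hK' hL' ha hb t ht x
    constructor
    · have := norm_sub_le_of_speed (M := K) (L := L) (hφ.deriv x) ha.1 hL (fun s hs => by
        refine (norm_add_le _ _).trans (add_le_add (hK' _ _ (hrn _) (hrn x)).1 ?_)
        rw [norm_smul, Real.norm_eq_abs]
        exact mul_le_mul_of_nonneg_left (hL' _ _ (hrn _) (hrn x)).1 (abs_nonneg _)) ht
      rw [hφ.init] at this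
      have h1 : K * t ≤ K := mul_le_of_le_one_right hK ht.2
      have h2 := mul_le_of_le_one_left hL (ha.2.trans hb.2)
      linarith [norm_le_norm_add_norm_sub' (SteepBilliard.cutFlow c R (f₁ i) (g i) (a i) t x) x]
    · have := norm_sub_le_of_speed (M := K) (L := L) (a := 0) (hψ.deriv x) continuous_const hL
        (fun s hs => by simpa using (hK' _ _ (hrn _) (hrn x)).2.1) ht
      rw [hψ.init] at this
      have h1 : K * t ≤ K := mul_le_of_le_one_right hK ht.2
      simp only [Pi.zero_apply, abs_zero, intervalIntegral.integral_zero, zero_mul] at this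
      linarith [norm_le_norm_add_norm_sub' (SteepBilliard.cutFlow c R (f₂ i) 0 0 t x) x]
  refine Close.flow (f₁ := fun i x => f₁ i (retr c R x)) (f₂ := fun i x => f₂ i (retr c R x))
    (g := fun i x => g i (retr c R x)) (a := a)
    (φ := fun i => SteepBilliard.cutFlow c R (f₁ i) (g i) (a i))
    (ψ := fun i => SteepBilliard.cutFlow c R (f₂ i) 0 0)
    (τ := fun _ => τ) hβ (hf.comp hβ0 hretr) (hg.comp hβ0 hretr)
    ha hφ hψ (fun R => ⟨R + (K + L), ?_⟩) ?_ (.of_forall fun _ => hτ)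
  · filter_upwards [hmove] with i hi t ht x hx
    exact ⟨(hi t ht x).1.trans (by gcongr), (hi t ht x).2.trans (by gcongr)⟩
  · filter_upwards [hmove] with i hi R
    exact ⟨R + (K + L), fun t ht x hx => ⟨(hi t ht x).1.trans (by gcongr),
      (hi t ht x).2.trans (by gcongr)⟩⟩

end CutFlow

/-! ### Paths of vector fields -/

section Paths

variable {E : Type} [NormedAddCommGroup E] [NormedSpace ℝ E]

/-- `γ`, on `[a, b]`, is an integral curve of `X` from `x` to `y`, with the property `P`. -/
structure IsPath (X : E → E) (P : ℝ → E → Prop) (a b : ℝ) (x y : E) (γ : ℝ → E) : Prop where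
  le : a ≤ b
  left : γ a = x
  right : γ b = y
  deriv : ∀ t ∈ Icc a b, HasDerivWithinAt γ (X (γ t)) (Icc a b) t
  prop : ∀ t ∈ Icc a b, P t (γ t)

theorem hasDerivWithinAt_concat {γ₁ γ₂ v : ℝ → E} {a b c : ℝ} (hab : a ≤ b) (hbc : b ≤ c)
    (heq : γ₁ b = γ₂ b)
    (h₁ : ∀ t ∈ Icc a b, HasDerivWithinAt γ₁ (v t) (Icc a b) t)
    (h₂ : ∀ t ∈ Icc b c, HasDerivWithinAt γ₂ (v t) (Icc b c) t) {t : ℝ} (ht : t ∈ Icc a c) :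
    HasDerivWithinAt (fun s => if s ≤ b then γ₁ s else γ₂ s) (v t) (Icc a c) t := by
  have e1 : ∀ s ∈ Icc a b, (if s ≤ b then γ₁ s else γ₂ s) = γ₁ s := fun s hs => if_pos hs.2
  have e2 : ∀ s ∈ Icc b c, (if s ≤ b then γ₁ s else γ₂ s) = γ₂ s := by
    intro s hs
    split_ifs with h
    · rw [le_antisymm h hs.1, heq]
    · rfl
  have d1 : ∀ s ∈ Icc a b, HasDerivWithinAt (fun s => if s ≤ b then γ₁ s else γ₂ s) (v s)
      (Icc a b) s := fun s hs => (h₁ s hs).congr_of_mem e1 hs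
  have d2 : ∀ s ∈ Icc b c, HasDerivWithinAt (fun s => if s ≤ b then γ₁ s else γ₂ s) (v s)
      (Icc b c) s := fun s hs => (h₂ s hs).congr_of_mem e2 hs
  rcases lt_trichotomy t b with h | h | h
  · refine (d1 t ⟨ht.1, h.le⟩).mono_of_mem_nhdsWithin ?_
    filter_upwards [self_mem_nhdsWithin, mem_nhdsWithin_of_mem_nhds (Iic_mem_nhds h)]
      with s hs hs' using ⟨hs.1, hs'⟩
  · subst h
    rw [← Icc_union_Icc_eq_Icc hab hbc]
    exact (d1 t ⟨hab, le_rfl⟩).union (d2 t ⟨le_rfl, hbc⟩)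
  · refine (d2 t ⟨h.le, ht.2⟩).mono_of_mem_nhdsWithin ?_
    filter_upwards [self_mem_nhdsWithin, mem_nhdsWithin_of_mem_nhds (Ici_mem_nhds h)]
      with s hs hs' using ⟨hs', hs.2⟩

theorem IsPath.concat {X : E → E} {P : ℝ → E → Prop} {a b c : ℝ} {x y z : E} {γ₁ γ₂ : ℝ → E}
    (h₁ : IsPath X P a b x y γ₁) (h₂ : IsPath X P b c y z γ₂) :
    IsPath X P a c x z (fun s => if s ≤ b then γ₁ s else γ₂ s) := by
  have e2 : ∀ s ∈ Icc b c, (if s ≤ b then γ₁ s else γ₂ s) = γ₂ s := by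
    intro s hs
    split_ifs with h
    · rw [le_antisymm h hs.1, h₁.right, h₂.left]
    · rfl
  refine ⟨h₁.le.trans h₂.le, ?_, ?_, fun t ht => ?_, fun t ht => ?_⟩
  · simp only [h₁.le, if_true, h₁.left]
  · rw [e2 c ⟨h₂.le, le_rfl⟩, h₂.right]
  · refine hasDerivWithinAt_concat (v := fun t => X (if t ≤ b then γ₁ t else γ₂ t)) h₁.le h₂.le
      (h₁.right.trans h₂.left.symm) (fun s hs => ?_) (fun s hs => ?_) ht
    · simp only [hs.2, if_true]; exact h₁.deriv s hs
    · simp only [e2 s hs]; exact h₂.deriv s hs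
  · rcases le_total t b with h | h
    · simp only [h, if_true]; exact h₁.prop t ⟨ht.1, h⟩
    · simp only [e2 t ⟨h, ht.2⟩]; exact h₂.prop t ⟨h, ht.2⟩

theorem IsPath.refl {X : E → E} {P : ℝ → E → Prop} {a : ℝ} {x : E} (h : P a x) :
    IsPath X P a a x x (fun _ => x) := by
  refine ⟨le_rfl, rfl, rfl, fun t ht => ?_, fun t ht => ?_⟩
  · obtain rfl := le_antisymm ht.1 ht.2
    rw [Icc_self]
    exact hasDerivWithinAt_iff_hasFDerivWithinAt.2 (.of_subsingleton subsingleton_singleton)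
  · obtain rfl := le_antisymm ht.1 ht.2
    exact h

/-- A change of the independent variable. -/
theorem exists_isPath_of_reparam {X : E → E} {P : ℝ → E → Prop} {z : ℝ → E} {θ c : ℝ → ℝ}
    (hz : ∀ s ∈ Icc (0 : ℝ) 1, HasDerivWithinAt z (c s • X (z s)) (Icc 0 1) s)
    (hθ : ∀ s ∈ Icc (0 : ℝ) 1, HasDerivWithinAt θ (c s) (Icc 0 1) s)
    (hc : ∀ s ∈ Icc (0 : ℝ) 1, 0 < c s) (hP : ∀ s ∈ Icc (0 : ℝ) 1, P (θ s) (z s)) :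
    ∃ γ, IsPath X P (θ 0) (θ 1) (z 0) (z 1) γ := by
  have hθc : ContinuousOn θ (Icc 0 1) := fun s hs => (hθ s hs).continuousWithinAt
  have hmono : StrictMonoOn θ (Icc 0 1) := by
    refine strictMonoOn_of_deriv_pos (convex_Icc 0 1) hθc fun s hs => ?_
    rw [interior_Icc] at hs
    rw [((hθ s (Ioo_subset_Icc_self hs)).hasDerivAt (Icc_mem_nhds hs.1 hs.2)).deriv]
    exact hc s (Ioo_subset_Icc_self hs)
  have h0 : (0 : ℝ) ∈ Icc (0 : ℝ) 1 := by simp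
  have h1 : (1 : ℝ) ∈ Icc (0 : ℝ) 1 := by simp
  have hsurj : ∀ t ∈ Icc (θ 0) (θ 1), ∃ s ∈ Icc (0 : ℝ) 1, θ s = t := fun t ht =>
    intermediate_value_Icc zero_le_one hθc ht
  choose! σ hσ hθσ using hsurj
  have hσθ : ∀ s ∈ Icc (0 : ℝ) 1, σ (θ s) = s := by
    intro s hs
    have hm : θ s ∈ Icc (θ 0) (θ 1) :=
      ⟨hmono.monotoneOn h0 hs hs.1, hmono.monotoneOn hs h1 hs.2⟩
    exact hmono.injOn (hσ _ hm) hs (hθσ _ hm)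
  have hle : θ 0 ≤ θ 1 := hmono.monotoneOn h0 h1 zero_le_one
  have hσc : ∀ t ∈ Icc (θ 0) (θ 1), Tendsto σ (𝓝[Icc (θ 0) (θ 1)] t) (𝓝[Icc 0 1] (σ t)) := by
    intro t ht
    refine tendsto_nhdsWithin_iff.2 ⟨?_, eventually_mem_nhdsWithin.mono fun u hu => hσ u hu⟩
    refine tendsto_order.2 ⟨fun b hb => ?_, fun b hb => ?_⟩
    · rcases lt_or_ge b 0 with hb0 | hb0
      · filter_upwards [self_mem_nhdsWithin] with u hu using hb0.trans_le (hσ u hu).1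
      · have hbm : b ∈ Icc (0 : ℝ) 1 := ⟨hb0, hb.le.trans (hσ t ht).2⟩
        have : θ b < t := by
          rw [← hθσ t ht]; exact hmono hbm (hσ t ht) hb
        filter_upwards [self_mem_nhdsWithin, mem_nhdsWithin_of_mem_nhds (Ioi_mem_nhds this)]
          with u hu hu'
        rw [mem_Ioi, ← hθσ u hu] at hu'
        exact (hmono.lt_iff_lt hbm (hσ u hu)).1 hu'
    · rcases lt_or_ge 1 b with hb0 | hb0
      · filter_upwards [self_mem_nhdsWithin] with u hu using (hσ u hu).2.trans_lt hb0
      · have hbm : b ∈ Icc (0 : ℝ) 1 := ⟨(hσ t ht).1.trans hb.le, hb0⟩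
        have : t < θ b := by
          conv_lhs => rw [← hθσ t ht]
          exact hmono (hσ t ht) hbm hb
        filter_upwards [self_mem_nhdsWithin, mem_nhdsWithin_of_mem_nhds (Iio_mem_nhds this)]
          with u hu hu'
        rw [mem_Iio, ← hθσ u hu] at hu'
        exact (hmono.lt_iff_lt (hσ u hu) hbm).1 hu'
  refine ⟨fun t => z (σ t), hle, by simp only [hσθ 0 h0], by simp only [hσθ 1 h1],
    fun t ht => ?_, fun t ht => ?_⟩
  · have hne := (hc _ (hσ t ht)).ne'
    have hσd : HasDerivWithinAt σ (c (σ t))⁻¹ (Icc (θ 0) (θ 1)) t := by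
      have := HasFDerivWithinAt.of_local_left_inverse
        (f' := ContinuousLinearEquiv.unitsEquivAut ℝ (Units.mk0 _ hne)) (hσc t ht)
        (hθ _ (hσ t ht)).hasFDerivWithinAt ht
        (eventually_mem_nhdsWithin.mono fun u hu => hθσ u hu)
      simpa [hasDerivWithinAt_iff_hasFDerivWithinAt] using this.hasDerivWithinAt
    have := (hz _ (hσ t ht)).scomp t hσd (fun u hu => hσ u hu)
    rwa [smul_smul, inv_mul_cancel₀ hne, one_smul] at this
  · have := hP _ (hσ t ht)
    rwa [hθσ t ht] at this

end Paths

/-! ### The scales -/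

section Scales

variable {r : ℕ} {α ε : ℝ}

theorem nu_pos (hε : 0 < ε) : 0 < nu r α ε := Real.rpow_pos_of_pos hε _

theorem nu_exponent_pos (hα : 0 < α) : 0 < (r : ℝ) + 2 + 1 / α := by positivity

theorem nu_le_one (hα : 0 < α) (hε : 0 < ε) (hε1 : ε ≤ 1) : nu r α ε ≤ 1 :=
  Real.rpow_le_one hε.le hε1 (one_div_pos.2 (nu_exponent_pos hα)).le

theorem tendsto_nu (hα : 0 < α) : Tendsto (nu r α) (𝓝[>] 0) (𝓝 0) := by
  have h := one_div_pos.2 (nu_exponent_pos (r := r) hα)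
  have := (Real.continuousAt_rpow_const 0 _ (Or.inr h.le)).tendsto
  rw [Real.zero_rpow h.ne'] at this
  exact this.mono_left nhdsWithin_le_nhds

theorem eq_nu_rpow (hα : 0 < α) (hε : 0 < ε) : ε = nu r α ε ^ ((r : ℝ) + 2 + 1 / α) := by
  rw [nu, ← Real.rpow_mul hε.le, one_div_mul_cancel (nu_exponent_pos hα).ne', Real.rpow_one]

theorem eta_eq (hα : 0 < α) (hε : 0 < ε) : eta r α ε = nu r α ε ^ (r + 2) := by
  have hν := nu_pos (r := r) (α := α) hε
  rw [eta, invBarrier]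
  nth_rewrite 1 [eq_nu_rpow (r := r) hα hε]
  rw [Real.rpow_add hν, mul_div_assoc, div_self (Real.rpow_pos_of_pos hν _).ne', mul_one]
  exact_mod_cast Real.rpow_natCast _ (r + 2)

theorem eta_pos (hα : 0 < α) (hε : 0 < ε) : 0 < eta r α ε := by
  rw [eta_eq hα hε]; exact pow_pos (nu_pos hε) _

theorem eventually_nu (hα : 0 < α) : ∀ᶠ ε in 𝓝[>] (0 : ℝ), 0 < ε ∧ 0 < nu r α ε ∧ nu r α ε ≤ 1 := by
  filter_upwards [self_mem_nhdsWithin, Ioo_mem_nhdsGT one_pos] with ε h h'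
  exact ⟨h, nu_pos h, nu_le_one hα h h'.2.le⟩

theorem tendsto_eta (hα : 0 < α) : Tendsto (eta r α) (𝓝[>] 0) (𝓝 0) := by
  have : Tendsto (fun ε => nu r α ε ^ (r + 2)) (𝓝[>] 0) (𝓝 0) := by
    simpa using (tendsto_nu (r := r) hα).pow (r + 2)
  exact this.congr' (by filter_upwards [self_mem_nhdsWithin] with ε h using (eta_eq hα h).symm)

/-- Above this level the force of the barrier is small with its derivatives. -/
def delta (r : ℕ) (α ε : ℝ) : ℝ := nu r α ε ^ (α * ((r : ℝ) + 2) / (α + (r : ℝ) + 1))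

theorem delta_exponent_pos (hα : 0 < α) : 0 < α * ((r : ℝ) + 2) / (α + (r : ℝ) + 1) := by
  positivity

theorem delta_pos (hε : 0 < ε) : 0 < delta r α ε := Real.rpow_pos_of_pos (nu_pos hε) _

theorem delta_le_one (hα : 0 < α) (hε : 0 < ε) (hε1 : ε ≤ 1) : delta r α ε ≤ 1 :=
  Real.rpow_le_one (nu_pos hε).le (nu_le_one hα hε hε1) (delta_exponent_pos hα).le

theorem tendsto_delta (hα : 0 < α) : Tendsto (delta r α) (𝓝[>] 0) (𝓝 0) := by
  have h := delta_exponent_pos (r := r) hα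
  have := (tendsto_nu (r := r) hα).rpow_const (p := α * ((r : ℝ) + 2) / (α + (r : ℝ) + 1))
    (Or.inr h.le)
  rwa [Real.zero_rpow h.ne'] at this

theorem rpow_eq_nu_mul_delta (hα : 0 < α) (hε : 0 < ε) :
    ε ^ α = nu r α ε * delta r α ε ^ (α + (r : ℝ) + 1) := by
  have hν := nu_pos (r := r) (α := α) hε
  nth_rewrite 1 [eq_nu_rpow (r := r) hα hε]
  rw [delta, ← Real.rpow_mul hν.le, ← Real.rpow_mul hν.le, div_mul_cancel₀ _ (by positivity)]
  nth_rewrite 2 [← Real.rpow_one (nu r α ε)]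
  rw [← Real.rpow_add hν]
  congr 1
  field_simp
  ring

theorem nu_le_impactScale (hα : 0 < α) (hε : 0 < ε) (hε1 : ε ≤ 1) :
    nu r α ε ≤ impactScale r α ε := by
  rw [impactScale]
  split_ifs with h
  · exact le_rfl
  · push Not at h
    nth_rewrite 1 [← Real.rpow_one (nu r α ε)]
    refine Real.rpow_le_rpow_of_exponent_ge (nu_pos hε) (nu_le_one hα hε hε1) ?_
    rw [div_le_one (by positivity)]
    nlinarith [(Nat.cast_nonneg r : (0 : ℝ) ≤ r)]

theorem delta_le_impactScale (hα : 0 < α) (hε : 0 < ε) (hε1 : ε ≤ 1) :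
    delta r α ε ≤ impactScale r α ε := by
  rw [impactScale]
  split_ifs with h
  · rw [delta]
    nth_rewrite 2 [← Real.rpow_one (nu r α ε)]
    refine Real.rpow_le_rpow_of_exponent_ge (nu_pos hε) (nu_le_one hα hε hε1) ?_
    rw [le_div_iff₀ (by positivity)]
    nlinarith [(Nat.cast_nonneg r : (0 : ℝ) ≤ r)]
  · exact le_rfl

theorem rpow_le_nu (hα : 0 < α) (hε : 0 < ε) (hε1 : ε ≤ 1) : ε ^ α ≤ nu r α ε := by
  rw [rpow_eq_nu_mul_delta (r := r) hα hε]
  exact mul_le_of_le_one_right (nu_pos hε).le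
    (Real.rpow_le_one (delta_pos hε).le (delta_le_one hα hε hε1) (by positivity))

/-! ### The barrier function and its inverse -/

/-- The strength `-W'(y)` of the force of the barrier. -/
def barrierForce (α ε y : ℝ) : ℝ := α * ε ^ α * y ^ (-α - 1)

theorem barrierForce_pos (hα : 0 < α) (hε : 0 < ε) {y : ℝ} (hy : 0 < y) :
    0 < barrierForce α ε y := by
  unfold barrierForce; positivity

theorem barrier_eq_mul (hε : 0 < ε) {y : ℝ} (hy : 0 < y) :
    barrier α ε y = ε ^ α * y ^ (-α) := by
  rw [barrier, Real.div_rpow hε.le hy.le, Real.rpow_neg hy.le, div_eq_mul_inv]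

theorem hasDerivAt_barrier (hε : 0 < ε) {y : ℝ} (hy : 0 < y) :
    HasDerivAt (barrier α ε) (-barrierForce α ε y) y := by
  have h := ((Real.hasDerivAt_rpow_const (p := -α) (Or.inl hy.ne')).const_mul (ε ^ α))
  refine (h.congr_of_eventuallyEq ?_).congr_deriv ?_
  · filter_upwards [Ioi_mem_nhds hy] with z hz using barrier_eq_mul hε hz
  · rw [barrierForce]; ring

theorem barrier_pos (hε : 0 < ε) {y : ℝ} (hy : 0 < y) : 0 < barrier α ε y :=
  Real.rpow_pos_of_pos (div_pos hε hy) _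

theorem barrier_lt_iff (hα : 0 < α) (hε : 0 < ε) {y z : ℝ} (hy : 0 < y) (hz : 0 < z) :
    barrier α ε y < barrier α ε z ↔ z < y := by
  rw [barrier, barrier, Real.rpow_lt_rpow_iff (div_pos hε hy).le (div_pos hε hz).le hα,
    div_lt_div_iff_of_pos_left hε hy hz]

theorem invBarrier_pos (hε : 0 < ε) {w : ℝ} (hw : 0 < w) : 0 < invBarrier α ε w :=
  div_pos hε (Real.rpow_pos_of_pos hw _)

theorem barrier_invBarrier (hα : 0 < α) (hε : 0 < ε) {w : ℝ} (hw : 0 < w) :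
    barrier α ε (invBarrier α ε w) = w := by
  rw [barrier, invBarrier, div_div_cancel₀ hε.ne', ← Real.rpow_mul hw.le,
    one_div_mul_cancel hα.ne', Real.rpow_one]

theorem barrier_eta (hα : 0 < α) (hε : 0 < ε) : barrier α ε (eta r α ε) = nu r α ε :=
  barrier_invBarrier hα hε (nu_pos hε)

theorem invBarrier_lt (hα : 0 < α) (hε : 0 < ε) {v w : ℝ} (hv : 0 < v) (h : v < w) :
    invBarrier α ε w < invBarrier α ε v := by
  rw [invBarrier, invBarrier]
  have := Real.rpow_lt_rpow hv.le h (one_div_pos.2 hα)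
  exact div_lt_div_of_pos_left hε (Real.rpow_pos_of_pos hv _) this

theorem barrierForce_invBarrier (hα : 0 < α) (hε : 0 < ε) {w : ℝ} (hw : 0 < w) :
    barrierForce α ε (invBarrier α ε w) * (ε / α * w ^ (-(1 / α) - 1)) = 1 := by
  have h1 : 0 < w ^ (1 / α) := Real.rpow_pos_of_pos hw _
  have e1 : ε ^ α = ε ^ (α + 1) / ε := by rw [Real.rpow_add_one hε.ne']; field_simp
  have e2 : (ε / w ^ (1 / α)) ^ (-α - 1) = w ^ (1 + 1 / α) / ε ^ (α + 1) := by
    rw [show -α - 1 = -(α + 1) by ring, Real.rpow_neg (div_pos hε h1).le,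
      Real.div_rpow hε.le h1.le, ← Real.rpow_mul hw.le, inv_div]
    congr 2; field_simp
  have e3 : w ^ (-(1 / α) - 1) = (w ^ (1 + 1 / α))⁻¹ := by
    rw [← Real.rpow_neg hw.le]; congr 1; ring
  have h3 : 0 < w ^ (1 + 1 / α) := Real.rpow_pos_of_pos hw _
  have h4 : 0 < ε ^ (α + 1) := Real.rpow_pos_of_pos hε _
  rw [barrierForce, invBarrier, e1, e2, e3]
  field_simp

theorem hasDerivAt_invBarrier {w : ℝ} (hw : 0 < w) :
    HasDerivAt (invBarrier α ε) (-(ε / α * w ^ (-(1 / α) - 1))) w := by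
  have h := ((Real.hasDerivAt_rpow_const (p := -(1 / α)) (Or.inl hw.ne')).const_mul ε)
  refine (h.congr_of_eventuallyEq ?_).congr_deriv ?_
  · filter_upwards [Ioi_mem_nhds hw] with z hz
    rw [invBarrier, Real.rpow_neg (le_of_lt hz), div_eq_mul_inv]
  · ring

/-- The rate at which the barrier acts while its level moves from `y₀` to `y₁`. -/
def barrierRate (r : ℕ) (α ε y₀ y₁ s : ℝ) : ℝ :=
  (y₁ - y₀) * barrierForce α ε (max (eta r α ε) (y₀ + s * (y₁ - y₀)))

theorem continuous_barrierRate (hα : 0 < α) (hε : 0 < ε) (y₀ y₁ : ℝ) :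
    Continuous (barrierRate r α ε y₀ y₁) := by
  have h : Continuous fun s => max (eta r α ε) (y₀ + s * (y₁ - y₀)) := by fun_prop
  refine continuous_const.mul (continuous_const.mul ?_)
  exact h.rpow_const fun s => Or.inl ((eta_pos hα hε).trans_le (le_max_left _ _)).ne'

theorem level_ge {η y₀ y₁ s : ℝ} (h₀ : η ≤ y₀) (h₁ : η ≤ y₁) (hs : s ∈ Icc (0 : ℝ) 1) :
    η ≤ y₀ + s * (y₁ - y₀) := by
  nlinarith [hs.1, hs.2, mul_nonneg hs.1 (sub_nonneg.2 h₁),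
    mul_nonneg (sub_nonneg.2 hs.2) (sub_nonneg.2 h₀)]

theorem barrierRate_eq {y₀ y₁ s : ℝ} (h₀ : eta r α ε ≤ y₀) (h₁ : eta r α ε ≤ y₁)
    (hs : s ∈ Icc (0 : ℝ) 1) :
    barrierRate r α ε y₀ y₁ s = (y₁ - y₀) * barrierForce α ε (y₀ + s * (y₁ - y₀)) := by
  rw [barrierRate, max_eq_right (level_ge h₀ h₁ hs)]

theorem integral_barrierRate_le (hα : 0 < α) (hε : 0 < ε) {y₀ y₁ : ℝ} (h₀ : eta r α ε ≤ y₀)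
    (h₁ : eta r α ε ≤ y₁) : ∫ s in (0 : ℝ)..1, |barrierRate r α ε y₀ y₁ s| ≤ nu r α ε := by
  have hη := eta_pos (r := r) hα hε
  have hint : ∫ s in (0 : ℝ)..1, barrierRate r α ε y₀ y₁ s = barrier α ε y₀ - barrier α ε y₁ := by
    have := intervalIntegral.integral_eq_sub_of_hasDerivAt (a := 0) (b := 1)
      (f := fun s => -barrier α ε (y₀ + s * (y₁ - y₀))) (f' := barrierRate r α ε y₀ y₁)
      (fun s hs => ?_) ((continuous_barrierRate hα hε y₀ y₁).intervalIntegrable _ _)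
    · rw [this]; simp only [one_mul, zero_mul, add_zero, add_sub_cancel]; ring
    · rw [uIcc_of_le zero_le_one] at hs
      rw [barrierRate_eq h₀ h₁ hs]
      have hd : HasDerivAt (fun s => y₀ + s * (y₁ - y₀)) (1 * (y₁ - y₀)) s :=
        ((hasDerivAt_id s).mul_const _).const_add _
      have := ((hasDerivAt_barrier (α := α) hε (hη.trans_le (level_ge h₀ h₁ hs))).comp s hd).neg
      exact this.congr_deriv (by ring)
  have hle : ∀ y, eta r α ε ≤ y → 0 < barrier α ε y ∧ barrier α ε y ≤ nu r α ε := by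
    intro y hy
    refine ⟨barrier_pos hε (hη.trans_le hy), ?_⟩
    rw [← barrier_eta (r := r) hα hε, ← not_lt, barrier_lt_iff hα hε hη (hη.trans_le hy), not_lt]
    exact hy
  obtain ⟨a1, a2⟩ := hle _ h₀
  obtain ⟨b1, b2⟩ := hle _ h₁
  have hF : ∀ s, 0 ≤ barrierForce α ε (max (eta r α ε) (y₀ + s * (y₁ - y₀))) := fun s =>
    (barrierForce_pos hα hε (hη.trans_le (le_max_left _ _))).le
  rcases le_total y₀ y₁ with h | h
  · have : ∀ s, |barrierRate r α ε y₀ y₁ s| = barrierRate r α ε y₀ y₁ s := fun s =>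
      abs_of_nonneg (mul_nonneg (sub_nonneg.2 h) (hF s))
    simp_rw [this, hint]; linarith
  · have : ∀ s, |barrierRate r α ε y₀ y₁ s| = -barrierRate r α ε y₀ y₁ s := fun s =>
      abs_of_nonpos (mul_nonpos_of_nonpos_of_nonneg (sub_nonpos.2 h) (hF s))
    simp_rw [this, intervalIntegral.integral_neg, hint]; linarith

/-! ### Smooth power profiles -/

/-- A smooth function that equals `u ^ (-γ)` for `u ≥ 1 / 2`. -/
def powProfile (γ u : ℝ) : ℝ := Real.smoothTransition (4 * u - 1) * u ^ (-γ)

theorem powProfile_of_le {γ u : ℝ} (hu : u ≤ 1 / 4) : powProfile γ u = 0 := by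
  rw [powProfile, Real.smoothTransition.zero_of_nonpos (by linarith), zero_mul]

theorem powProfile_of_ge {γ u : ℝ} (hu : 1 / 2 ≤ u) : powProfile γ u = u ^ (-γ) := by
  rw [powProfile, Real.smoothTransition.one_of_one_le (by linarith), one_mul]

theorem contDiff_powProfile (γ : ℝ) : ContDiff ℝ ∞ (powProfile γ) := by
  rw [contDiff_iff_contDiffAt]
  intro u
  rcases lt_or_ge u (1 / 4) with hu | hu
  · refine (contDiffAt_const (c := (0 : ℝ))).congr_of_eventuallyEq ?_
    filter_upwards [Iio_mem_nhds hu] with v hv using powProfile_of_le (le_of_lt hv)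
  · refine ContDiffAt.mul ?_ (contDiffAt_id.rpow_const_of_ne (by simp only [id]; linarith))
    exact Real.smoothTransition.contDiff.contDiffAt.comp u (by fun_prop)

theorem exists_bound_iteratedDeriv_of_eq_rpow (k : ℕ) {h : ℝ → ℝ} {C γ : ℝ} (hγ : 0 ≤ γ)
    (hh : ContDiff ℝ ∞ h) (h0 : ∀ u < 1 / 4, h u = 0) (h1 : ∀ u > 1 / 2, h u = C * u ^ (-γ)) :
    ∃ K, ∀ u, |iteratedDeriv k h u| ≤ K := by
  induction k generalizing h C γ with
  | zero =>
    obtain ⟨K, hK⟩ := (isCompact_Icc (a := (0 : ℝ)) (b := 1)).exists_bound_of_continuousOn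
      hh.continuous.continuousOn
    refine ⟨max (max K |C|) 0, fun u => ?_⟩
    rw [iteratedDeriv_zero]
    rcases lt_or_ge u 0 with hu | hu
    · rw [h0 u (by linarith), abs_zero]; exact le_max_right _ _
    · rcases le_or_gt u 1 with hu1 | hu1
      · exact (hK u ⟨hu, hu1⟩).trans ((le_max_left _ _).trans (le_max_left _ _))
      · rw [h1 u (by linarith), abs_mul, abs_of_pos (Real.rpow_pos_of_pos (by linarith) _)]
        have := Real.rpow_le_one_of_one_le_of_nonpos hu1.le (neg_nonpos.2 hγ)
        exact (mul_le_of_le_one_right (abs_nonneg _) this).trans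
          ((le_max_right _ _).trans (le_max_left _ _))
  | succ k ih =>
    simp_rw [iteratedDeriv_succ']
    refine ih (h := deriv h) (C := -C * γ) (γ := γ + 1) (by linarith)
      (hh.iterate_deriv 1) (fun u hu => ?_) (fun u hu => ?_)
    · have : h =ᶠ[𝓝 u] fun _ => 0 := by filter_upwards [Iio_mem_nhds hu] with v hv using h0 v hv
      rw [this.deriv_eq, deriv_const]
    · have : h =ᶠ[𝓝 u] fun v => C * v ^ (-γ) := by
        filter_upwards [Ioi_mem_nhds hu] with v hv using h1 v hv
      have hu0 : u ≠ 0 := by rintro rfl; norm_num at hu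
      rw [this.deriv_eq, ((Real.hasDerivAt_rpow_const (Or.inl hu0)).const_mul C).deriv,
        show -(γ + 1) = -γ - 1 by ring]
      ring

theorem exists_bound_iteratedDeriv_powProfile {γ : ℝ} (hγ : 0 ≤ γ) (k : ℕ) :
    ∃ K, ∀ u, |iteratedDeriv k (powProfile γ) u| ≤ K :=
  exists_bound_iteratedDeriv_of_eq_rpow k (C := 1) hγ (contDiff_powProfile γ)
    (fun u hu => powProfile_of_le hu.le) (fun u hu => by rw [powProfile_of_ge hu.le, one_mul])

end Scales

/-! ### Stages of an orbit -/

section Stage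

/-- Position, momentum, time, and two parameters: the duration of the stage and an energy. -/
abbrev State (d : ℕ) : Type := Conf d × Conf d × ℝ × ℝ × ℝ

/-- Velocities of position, momentum and time. -/
abbrev Vel (d : ℕ) : Type := Conf d × Conf d × ℝ

variable {d : ℕ}

/-- The velocity of a state whose parameters are constant. -/
def pad (v : Vel d) : State d := (v.1, v.2.1, v.2.2, 0, 0)

theorem contDiff_pad {n : WithTop ℕ∞} : ContDiff ℝ n (pad (d := d)) := by
  unfold pad; fun_prop

theorem norm_pad (v : Vel d) : ‖pad v‖ = ‖v‖ := by
  obtain ⟨a, b, c⟩ := v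
  simp [pad, Prod.norm_def]

theorem smul_pad (c : ℝ) (v : Vel d) : c • pad v = pad (c • v) := by
  simp [pad]

theorem add_pad (v w : Vel d) : pad v + pad w = pad (v + w) := by
  simp [pad]

/-- The vector field `Z`, multiplied by the duration of the stage. -/
def stageField (σ : ℝ) (Z : State d → Vel d) (x : State d) : State d :=
  retr 0 σ x.2.2.2.1 • pad (Z x)

/-- The final state of a stage of duration at most `σ / 2`, with an additional force. -/
def stageFlow (c : State d) (R σ : ℝ) (Z g : State d → Vel d) (a : ℝ → ℝ) : ℝ → State d → State d :=
  cutFlow c R (stageField σ Z) (fun x => pad (g x)) a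

theorem contDiff_stageField {σ : ℝ} (hσ : 0 < σ) {Z : State d → Vel d} (hZ : ContDiff ℝ 1 Z) :
    ContDiff ℝ 1 (stageField σ Z) := by
  have h : ContDiff ℝ 1 (retr (0 : ℝ) σ) := (contDiff_retr 0 hσ).of_le (by norm_cast)
  exact (h.comp (by fun_prop)).smul (contDiff_pad.comp hZ)

theorem _root_.HasDerivWithinAt.fst' {E F : Type} [NormedAddCommGroup E] [NormedSpace ℝ E]
    [NormedAddCommGroup F] [NormedSpace ℝ F] {x : ℝ → E × F} {v : E × F} {s : Set ℝ} {t : ℝ}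
    (h : HasDerivWithinAt x v s t) : HasDerivWithinAt (fun u => (x u).1) v.1 s t :=
  (ContinuousLinearMap.fst ℝ E F).hasFDerivAt.comp_hasDerivWithinAt t h

theorem _root_.HasDerivWithinAt.snd' {E F : Type} [NormedAddCommGroup E] [NormedSpace ℝ E]
    [NormedAddCommGroup F] [NormedSpace ℝ F] {x : ℝ → E × F} {v : E × F} {s : Set ℝ} {t : ℝ}
    (h : HasDerivWithinAt x v s t) : HasDerivWithinAt (fun u => (x u).2) v.2 s t :=
  (ContinuousLinearMap.snd ℝ E F).hasFDerivAt.comp_hasDerivWithinAt t h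

/-- A curve with vanishing derivative is constant. -/
theorem eq_of_hasDerivWithinAt_zero {E : Type} [NormedAddCommGroup E] [NormedSpace ℝ E]
    {x : ℝ → E} (hx : ∀ t ∈ Icc (0 : ℝ) 1, HasDerivWithinAt x 0 (Icc 0 1) t) {t : ℝ}
    (ht : t ∈ Icc (0 : ℝ) 1) : x t = x 0 := by
  have := (convex_Icc (0 : ℝ) 1).norm_image_sub_le_of_norm_hasDerivWithin_le (C := 0) hx
    (by simp) (x := 0) (y := t) (by simp) ht
  rw [zero_mul] at this
  exact sub_eq_zero.1 (norm_le_zero_iff.1 this)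

/-- A curve on `[0, 1]` along which the velocity is `ℓ Z + a g`, with constant parameters. -/
structure IsStage (Z g : State d → Vel d) (a : ℝ → ℝ) (x : ℝ → State d) (x₀ : State d)
    (M : ℝ) : Prop where
  init : x 0 = x₀
  deriv : ∀ s ∈ Icc (0 : ℝ) 1, HasDerivWithinAt x
    (pad (x₀.2.2.2.1 • Z (x s) + a s • g (x s))) (Icc 0 1) s
  dist : ∀ s ∈ Icc (0 : ℝ) 1, ‖x s - x₀‖ ≤ M
  duration : ∀ s ∈ Icc (0 : ℝ) 1, (x s).2.2.2.1 = x₀.2.2.2.1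
  energy : ∀ s ∈ Icc (0 : ℝ) 1, (x s).2.2.2.2 = x₀.2.2.2.2

theorem isStage_stageFlow {c : State d} {R σ K L : ℝ} (hR : 0 < R) (hσ : 0 < σ)
    {Z g : State d → Vel d} {a : ℝ → ℝ} (hZ : ContDiff ℝ 1 Z) (hg : ContDiff ℝ 1 g)
    (ha : Continuous a) (hZK : ∀ x, ‖x - c‖ < R → ‖Z x‖ ≤ K) (hgL : ∀ x, ‖x - c‖ < R → ‖g x‖ ≤ L)
    {x₀ : State d} (hx₀ : ‖x₀ - c‖ ≤ R / 4) (hl : |x₀.2.2.2.1| ≤ σ / 2)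
    (hM : σ * K + (∫ s in (0 : ℝ)..1, |a s|) * L ≤ R / 4) :
    IsStage Z g a (fun s => stageFlow c R σ Z g a s x₀) x₀
      (σ * K + (∫ s in (0 : ℝ)..1, |a s|) * L) := by
  have hF := isFlow_cutFlow c hR (contDiff_stageField hσ hZ) (contDiff_pad.comp hg) ha
  have hK : 0 ≤ K := (norm_nonneg _).trans (hZK c (by simpa using hR))
  have hL : 0 ≤ L := (norm_nonneg _).trans (hgL c (by simpa using hR))
  have hd : ∀ s ∈ Icc (0 : ℝ) 1, HasDerivWithinAt (fun s => stageFlow c R σ Z g a s x₀)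
      (retr 0 σ (retr c R (stageFlow c R σ Z g a s x₀)).2.2.2.1 •
        pad (Z (retr c R (stageFlow c R σ Z g a s x₀))) +
        a s • pad (g (retr c R (stageFlow c R σ Z g a s x₀)))) (Icc 0 1) s := hF.deriv x₀
  have hinit : stageFlow c R σ Z g a 0 x₀ = x₀ := hF.init x₀
  have hlc : ∀ s ∈ Icc (0 : ℝ) 1, (stageFlow c R σ Z g a s x₀).2.2.2.1 = x₀.2.2.2.1 := by
    intro s hs
    have := eq_of_hasDerivWithinAt_zero
      (x := fun s => (stageFlow c R σ Z g a s x₀).2.2.2.1)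
      (fun s hs => by simpa [pad] using (hd s hs).snd'.snd'.snd'.fst') hs
    simpa [hinit] using this
  have hwc : ∀ s ∈ Icc (0 : ℝ) 1, (stageFlow c R σ Z g a s x₀).2.2.2.2 = x₀.2.2.2.2 := by
    intro s hs
    have := eq_of_hasDerivWithinAt_zero
      (x := fun s => (stageFlow c R σ Z g a s x₀).2.2.2.2)
      (fun s hs => by simpa [pad] using (hd s hs).snd'.snd'.snd'.snd') hs
    simpa [hinit] using this
  have hdist : ∀ s ∈ Icc (0 : ℝ) 1, ‖stageFlow c R σ Z g a s x₀ - x₀‖ ≤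
      σ * K + (∫ s in (0 : ℝ)..1, |a s|) * L := by
    intro s hs
    have := norm_sub_le_of_speed (M := σ * K) (L := L) hd ha hL (fun s _ => by
      refine (norm_add_le _ _).trans (add_le_add ?_ ?_)
      · rw [norm_smul, norm_pad]
        refine mul_le_mul ?_ (hZK _ (norm_retr_sub_lt _ _ hR)) (norm_nonneg _) hσ.le
        simpa using (norm_retr_sub_lt (0 : ℝ) _ hσ).le
      · rw [norm_smul, norm_pad, Real.norm_eq_abs]
        exact mul_le_mul_of_nonneg_left (hgL _ (norm_retr_sub_lt _ _ hR)) (abs_nonneg _)) hs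
    rw [hinit] at this
    exact this.trans (add_le_add (mul_le_of_le_one_right (by positivity) hs.2) le_rfl)
  refine ⟨hinit, fun s hs => ?_, hdist, hlc, hwc⟩
  have h1 : retr c R (stageFlow c R σ Z g a s x₀) = stageFlow c R σ Z g a s x₀ := by
    refine retr_eq_self ?_
    have := norm_add_le (stageFlow c R σ Z g a s x₀ - x₀) (x₀ - c)
    rw [sub_add_sub_cancel] at this
    linarith [hdist s hs]
  have h2 : retr 0 σ x₀.2.2.2.1 = x₀.2.2.2.1 := retr_eq_self (by simpa using hl)
  have := hd s hs
  rwa [h1, hlc s hs, h2, smul_pad, smul_pad, add_pad] at this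

variable {I : Type} {l : Filter I} {β : I → ℝ}

theorem Close.stageFlow {r : ℕ} {Z₁ Z₂ g : I → State d → Vel d} {a : I → ℝ → ℝ} {c : State d}
    {R σ : ℝ} (hR : 0 < R) (hσ : 0 < σ)
    (hβ : ∀ᶠ i in l, 0 ≤ β i ∧ β i ≤ 1) (hZ : Close l β r Z₁ Z₂) (hg : Close l β r g g)
    (hC : ∀ᶠ i in l, ContDiff ℝ 1 (Z₁ i) ∧ ContDiff ℝ 1 (Z₂ i) ∧ ContDiff ℝ 1 (g i))
    (ha : ∀ᶠ i in l, Continuous (a i) ∧ ∫ s in (0 : ℝ)..1, |a i s| ≤ β i) :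
    Close l β r (fun i => stageFlow c R σ (Z₁ i) (g i) (a i) 1)
      (fun i => stageFlow c R σ (Z₂ i) 0 0 1) := by
  have hβ0 : ∀ᶠ i in l, 0 ≤ β i := hβ.mono fun _ h => h.1
  have hlc : Close l β r (fun _ (x : State d) => retr 0 σ x.2.2.2.1)
      (fun _ x => retr 0 σ x.2.2.2.1) := by
    refine Close.of_contDiff hβ0 r ?_
    exact (contDiff_retr 0 hσ).comp (by fun_prop)
  have := Close.cutFlow (c := c) (a := a) hR hβ
    (hlc.smul hβ0 (hZ.map hβ0 contDiff_pad)) (hg.map hβ0 contDiff_pad)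
    (hC.mono fun i h => ⟨contDiff_stageField hσ h.1, contDiff_stageField hσ h.2.1,
      contDiff_pad.comp h.2.2⟩) ha (τ := 1) (by simp)
  refine this.congr (.of_forall fun i => rfl) (.of_forall fun i => ?_)
  have h0 : (fun x : State d => pad ((0 : State d → Vel d) x)) = 0 := by
    funext x; simp [pad]
  unfold SteepBilliard.stageFlow
  rw [h0]
  rfl

end Stage

/-! ### The vector fields at the boundary -/

section Fields

variable {d : ℕ}

/-- The gradient of `Q`, truncated away from `q₀`. -/
def cutGrad (Q : Conf d → ℝ) (q₀ : Conf d) (R : ℝ) (x : State d) : Conf d :=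
  gradient Q (retr q₀ R x.1)

/-- The inverse of the rate `⟪p, ∇Q⟫`, truncated away from `k₀`. -/
def invRate (Q : Conf d → ℝ) (q₀ : Conf d) (R k₀ : ℝ) (x : State d) : ℝ :=
  (retr k₀ (|k₀| / 2) ⟪x.2.1, cutGrad Q q₀ R x⟫_ℝ)⁻¹

/-- The motion under the force `F`. -/
def freeField (F : State d → Conf d) (x : State d) : Vel d := (x.2.1, F x, 1)

/-- The force along the gradient. -/
def gradForce (Q : Conf d → ℝ) (q₀ : Conf d) (R : ℝ) (x : State d) : Vel d :=
  (0, cutGrad Q q₀ R x, 0)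

/-- The motion inside of the barrier, in the time in which the momentum changes by the gradient. -/
def innerField (Q : Conf d → ℝ) (q₀ : Conf d) (R : ℝ) (μ : State d → ℝ) (x : State d) : Vel d :=
  (μ x • x.2.1, cutGrad Q q₀ R x, μ x)

/-- The Hamiltonian vector field of the barrier. -/
def barrierField (α ε : ℝ) (Q : Conf d → ℝ) (z : Phase d) : Phase d :=
  (z.2, barrierForce α ε (Q z.1) • gradient Q z.1)

theorem inv_retr_eq {k₀ k : ℝ} (h : |k - k₀| ≤ |k₀| / 4) : (retr k₀ (|k₀| / 2) k)⁻¹ = k⁻¹ := by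
  rw [retr_eq_self (by rw [Real.norm_eq_abs]; linarith)]

theorem retr_rate_ne {k₀ : ℝ} (hk : k₀ ≠ 0) (k : ℝ) : retr k₀ (|k₀| / 2) k ≠ 0 := by
  intro h
  have := norm_retr_sub_lt k₀ k (half_pos (abs_pos.2 hk))
  rw [h, zero_sub, norm_neg, Real.norm_eq_abs] at this
  linarith [abs_pos.2 hk]

theorem contDiff_inv_retr {k₀ : ℝ} (hk : k₀ ≠ 0) :
    ContDiff ℝ ∞ fun k => (retr k₀ (|k₀| / 2) k)⁻¹ :=
  (contDiff_retr k₀ (half_pos (abs_pos.2 hk))).inv (retr_rate_ne hk)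

theorem hasDerivWithinAt_comp_gradient {Q : Conf d → ℝ} {q : ℝ → Conf d} {v : Conf d} {s : Set ℝ}
    {t : ℝ} (hQ : Differentiable ℝ Q) (hq : HasDerivWithinAt q v s t) :
    HasDerivWithinAt (fun u => Q (q u)) ⟪v, gradient Q (q t)⟫_ℝ s t := by
  have h := (hQ (q t)).hasFDerivAt.comp_hasDerivWithinAt t hq
  have e : fderiv ℝ Q (q t) v = ⟪gradient Q (q t), v⟫_ℝ := by
    rw [gradient, InnerProductSpace.toDual_symm_apply]
  rw [real_inner_comm, ← e]
  exact h

/-- Near `(q₀, p₀)`, the rate of `Q` along the motion is near `k₀`. -/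
structure IsWindow (Q : Conf d → ℝ) (q₀ p₀ : Conf d) (R k₀ : ℝ) : Prop where
  diff : Differentiable ℝ Q
  rate : ∀ q p, ‖q - q₀‖ ≤ R / 2 → ‖p - p₀‖ ≤ R / 2 → |⟪p, gradient Q q⟫_ℝ - k₀| ≤ |k₀| / 4

variable {Q : Conf d → ℝ} {q₀ p₀ : Conf d} {R k₀ : ℝ}

theorem IsWindow.cutGrad_eq (h : IsWindow Q q₀ p₀ R k₀) {x : State d} (hx : ‖x.1 - q₀‖ ≤ R / 2) :
    cutGrad Q q₀ R x = gradient Q x.1 := by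
  rw [cutGrad, retr_eq_self hx]

theorem IsWindow.invRate_eq (h : IsWindow Q q₀ p₀ R k₀) {x : State d} (hx : ‖x.1 - q₀‖ ≤ R / 2)
    (hp : ‖x.2.1 - p₀‖ ≤ R / 2) : invRate Q q₀ R k₀ x = (⟪x.2.1, gradient Q x.1⟫_ℝ)⁻¹ := by
  rw [invRate, h.cutGrad_eq hx, inv_retr_eq (h.rate _ _ hx hp)]

theorem IsWindow.rate_ne (h : IsWindow Q q₀ p₀ R k₀) (hk : k₀ ≠ 0) {q p : Conf d}
    (hx : ‖q - q₀‖ ≤ R / 2) (hp : ‖p - p₀‖ ≤ R / 2) : ⟪p, gradient Q q⟫_ℝ ≠ 0 := by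
  intro h0
  have := h.rate _ _ hx hp
  rw [h0, zero_sub, abs_neg] at this
  linarith [abs_pos.2 hk]

theorem IsWindow.rate_bounds (h : IsWindow Q q₀ p₀ R k₀) {q p : Conf d}
    (hx : ‖q - q₀‖ ≤ R / 2) (hp : ‖p - p₀‖ ≤ R / 2) :
    (k₀ < 0 → ⟪p, gradient Q q⟫_ℝ ≤ 3 / 4 * k₀) ∧ (0 < k₀ → 3 / 4 * k₀ ≤ ⟪p, gradient Q q⟫_ℝ) := by
  have := abs_le.1 (h.rate _ _ hx hp)
  constructor <;> intro h0
  · rw [abs_of_neg h0] at this; linarith [this.2]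
  · rw [abs_of_pos h0] at this; linarith [this.1]

theorem IsWindow.mul_inv_pos (h : IsWindow Q q₀ p₀ R k₀) (hk : k₀ ≠ 0) {q p : Conf d}
    (hx : ‖q - q₀‖ ≤ R / 2) (hp : ‖p - p₀‖ ≤ R / 2) {l : ℝ} (hl : 0 < l * k₀) :
    0 < l * (⟪p, gradient Q q⟫_ℝ)⁻¹ := by
  have := h.rate_bounds hx hp
  rcases lt_or_gt_of_ne hk with h0 | h0
  · exact mul_pos_of_neg_of_neg (by nlinarith) (inv_lt_zero.2 (by linarith [this.1 h0]))
  · exact mul_pos (by nlinarith) (inv_pos.2 (by linarith [this.2 h0]))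

theorem IsWindow.abs_inv_le (h : IsWindow Q q₀ p₀ R k₀) (hk : k₀ ≠ 0) {q p : Conf d}
    (hx : ‖q - q₀‖ ≤ R / 2) (hp : ‖p - p₀‖ ≤ R / 2) :
    |(⟪p, gradient Q q⟫_ℝ)⁻¹| ≤ 2 / |k₀| := by
  have h1 := h.rate _ _ hx hp
  have h2 := abs_sub_abs_le_abs_sub k₀ ⟪p, gradient Q q⟫_ℝ
  rw [abs_sub_comm] at h2
  have h3 := abs_pos.2 hk
  rw [abs_inv, inv_eq_one_div]
  rw [div_le_div_iff₀ (by linarith) h3]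
  linarith

/-- Closeness of states implies closeness of position and momentum. -/
theorem norm_pos_le (x y : State d) : ‖x.1 - y.1‖ ≤ ‖x - y‖ := norm_fst_le (x - y)

theorem norm_mom_le (x y : State d) : ‖x.2.1 - y.2.1‖ ≤ ‖x - y‖ :=
  (norm_fst_le (x - y).2).trans (norm_snd_le (x - y))

theorem norm_time_le (x y : State d) : |x.2.2.1 - y.2.2.1| ≤ ‖x - y‖ :=
  (norm_fst_le (x - y).2.2).trans ((norm_snd_le (x - y).2).trans (norm_snd_le (x - y)))

/-- The derivatives along a stage in which the level of `Q` is the independent variable. -/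
structure IsHit (Q : Conf d → ℝ) (F : State d → Conf d) (a : ℝ → ℝ) (x : ℝ → State d)
    (x₀ : State d) : Prop where
  init : x 0 = x₀
  pos : ∀ s ∈ Icc (0 : ℝ) 1, HasDerivWithinAt (fun s => (x s).1)
    ((x₀.2.2.2.1 * (⟪(x s).2.1, gradient Q (x s).1⟫_ℝ)⁻¹) • (x s).2.1) (Icc 0 1) s
  mom : ∀ s ∈ Icc (0 : ℝ) 1, HasDerivWithinAt (fun s => (x s).2.1)
    ((⟪(x s).2.1, gradient Q (x s).1⟫_ℝ)⁻¹ • (x₀.2.2.2.1 • F (x s) + a s • gradient Q (x s).1))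
    (Icc 0 1) s
  time : ∀ s ∈ Icc (0 : ℝ) 1, HasDerivWithinAt (fun s => (x s).2.2.1)
    (x₀.2.2.2.1 * (⟪(x s).2.1, gradient Q (x s).1⟫_ℝ)⁻¹) (Icc 0 1) s
  level : ∀ s ∈ Icc (0 : ℝ) 1, Q (x s).1 = Q x₀.1 + x₀.2.2.2.1 * s

theorem IsStage.isHit (h : IsWindow Q q₀ p₀ R k₀) (hk : k₀ ≠ 0) {F : State d → Conf d} {a : ℝ → ℝ}
    {x : ℝ → State d} {x₀ : State d} {M : ℝ}
    (hx : IsStage (fun x => invRate Q q₀ R k₀ x • freeField F x)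
      (fun x => invRate Q q₀ R k₀ x • gradForce Q q₀ R x) a x x₀ M)
    (hin : ∀ s ∈ Icc (0 : ℝ) 1, ‖(x s).1 - q₀‖ ≤ R / 2 ∧ ‖(x s).2.1 - p₀‖ ≤ R / 2) :
    IsHit Q F a x x₀ := by
  have hpos : ∀ s ∈ Icc (0 : ℝ) 1, HasDerivWithinAt (fun s => (x s).1)
      ((x₀.2.2.2.1 * (⟪(x s).2.1, gradient Q (x s).1⟫_ℝ)⁻¹) • (x s).2.1) (Icc 0 1) s := by
    intro s hs
    refine (hx.deriv s hs).fst'.congr_deriv ?_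
    simp [pad, freeField, gradForce, h.invRate_eq (hin s hs).1 (hin s hs).2, smul_smul]
  refine ⟨hx.init, hpos, fun s hs => ?_, fun s hs => ?_, fun s hs => ?_⟩
  · refine (hx.deriv s hs).snd'.fst'.congr_deriv ?_
    simp only [pad, freeField, gradForce, h.invRate_eq (hin s hs).1 (hin s hs).2,
      h.cutGrad_eq (hin s hs).1, Prod.fst_add, Prod.snd_add, Prod.smul_fst, Prod.smul_snd, smul_add]
    congr 1 <;> exact smul_comm _ _ _
  · refine (hx.deriv s hs).snd'.snd'.fst'.congr_deriv ?_
    simp [pad, freeField, gradForce, h.invRate_eq (hin s hs).1 (hin s hs).2]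
  · have := eq_of_hasDerivWithinAt_zero (x := fun s => Q (x s).1 - x₀.2.2.2.1 * s)
      (fun s hs => ?_) hs
    · simp only [hx.init, mul_zero, sub_zero] at this; linarith
    · have h1 := hasDerivWithinAt_comp_gradient h.diff (hpos s hs)
      have h2 := (hasDerivWithinAt_id s (Icc (0 : ℝ) 1)).const_mul x₀.2.2.2.1
      refine (h1.sub h2).congr_deriv ?_
      rw [real_inner_smul_left, mul_assoc, inv_mul_cancel₀ (h.rate_ne hk (hin s hs).1 (hin s hs).2),
        sub_self]

/-- A stage with the level as independent variable is a part of an orbit. -/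
theorem IsHit.exists_isPath (h : IsWindow Q q₀ p₀ R k₀) (hk : k₀ ≠ 0) {F : State d → Conf d}
    {a : ℝ → ℝ} {x : ℝ → State d} {x₀ : State d} {α ε : ℝ} {P : ℝ → Phase d → Prop}
    (hx : IsHit Q F a x x₀)
    (hin : ∀ s ∈ Icc (0 : ℝ) 1, ‖(x s).1 - q₀‖ ≤ R / 2 ∧ ‖(x s).2.1 - p₀‖ ≤ R / 2)
    (hl : 0 < x₀.2.2.2.1 * k₀)
    (hF : ∀ s ∈ Icc (0 : ℝ) 1, x₀.2.2.2.1 • F (x s) + a s • gradient Q (x s).1 =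
      (x₀.2.2.2.1 * barrierForce α ε (Q (x s).1)) • gradient Q (x s).1)
    (hP : ∀ s ∈ Icc (0 : ℝ) 1, P (x s).2.2.1 ((x s).1, (x s).2.1)) :
    ∃ γ, IsPath (barrierField α ε Q) P x₀.2.2.1 (x 1).2.2.1 (x₀.1, x₀.2.1)
      ((x 1).1, (x 1).2.1) γ := by
  have := exists_isPath_of_reparam (X := barrierField α ε Q) (P := P)
    (z := fun s => ((x s).1, (x s).2.1)) (θ := fun s => (x s).2.2.1)
    (c := fun s => x₀.2.2.2.1 * (⟪(x s).2.1, gradient Q (x s).1⟫_ℝ)⁻¹) (fun s hs => ?_) hx.time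
    (fun s hs => h.mul_inv_pos hk (hin s hs).1 (hin s hs).2 hl) hP
  · simpa [hx.init] using this
  · refine ((hx.pos s hs).prodMk (hx.mom s hs)).congr_deriv ?_
    rw [hF s hs, barrierField, Prod.smul_mk, smul_smul, smul_smul]
    congr 2; ring

/-- The time left until the end of the stage. -/
theorem IsHit.abs_time_sub_le (h : IsWindow Q q₀ p₀ R k₀) (hk : k₀ ≠ 0) {F : State d → Conf d}
    {a : ℝ → ℝ} {x : ℝ → State d} {x₀ : State d} (hx : IsHit Q F a x x₀)
    (hin : ∀ s ∈ Icc (0 : ℝ) 1, ‖(x s).1 - q₀‖ ≤ R / 2 ∧ ‖(x s).2.1 - p₀‖ ≤ R / 2) {s u : ℝ}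
    (hs : s ∈ Icc (0 : ℝ) 1) (hu : u ∈ Icc (0 : ℝ) 1) :
    |(x s).2.2.1 - (x u).2.2.1| ≤ 2 / |k₀| * |Q (x s).1 - Q (x u).1| := by
  have := (convex_Icc (0 : ℝ) 1).norm_image_sub_le_of_norm_hasDerivWithin_le
    (C := |x₀.2.2.2.1| * (2 / |k₀|)) hx.time (fun s hs => by
      rw [Real.norm_eq_abs, abs_mul]
      exact mul_le_mul_of_nonneg_left (h.abs_inv_le hk (hin s hs).1 (hin s hs).2) (abs_nonneg _))
      hu hs
  rw [Real.norm_eq_abs, Real.norm_eq_abs] at this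
  refine this.trans_eq ?_
  rw [hx.level s hs, hx.level u hu, add_sub_add_left_eq_sub, ← mul_sub, abs_mul]
  ring

/-- The time increases along a stage. -/
theorem IsHit.time_mono (h : IsWindow Q q₀ p₀ R k₀) (hk : k₀ ≠ 0) {F : State d → Conf d}
    {a : ℝ → ℝ} {x : ℝ → State d} {x₀ : State d} (hx : IsHit Q F a x x₀)
    (hin : ∀ s ∈ Icc (0 : ℝ) 1, ‖(x s).1 - q₀‖ ≤ R / 2 ∧ ‖(x s).2.1 - p₀‖ ≤ R / 2)
    (hl : 0 < x₀.2.2.2.1 * k₀) : x₀.2.2.1 ≤ (x 1).2.2.1 := by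
  have := monotoneOn_of_deriv_nonneg (convex_Icc (0 : ℝ) 1) (f := fun s => (x s).2.2.1)
    (fun s hs => (hx.time s hs).continuousWithinAt)
    (fun s hs => ((hx.time s (interior_subset hs)).mono interior_subset).differentiableWithinAt)
    (fun s hs => by
      rw [interior_Icc] at hs
      rw [((hx.time s (Ioo_subset_Icc_self hs)).hasDerivAt (Icc_mem_nhds hs.1 hs.2)).deriv]
      have hs' := Ioo_subset_Icc_self hs
      exact (h.mul_inv_pos hk (hin s hs').1 (hin s hs').2 hl).le)
    (a := 0) (b := 1) (by simp) (by simp) zero_le_one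
  simpa [hx.init] using this

/-- Without forces, the motion is along a straight line. -/
theorem IsHit.straight (h : IsWindow Q q₀ p₀ R k₀) {x : ℝ → State d} {x₀ : State d}
    (hx : IsHit Q 0 0 x x₀) {s : ℝ} (hs : s ∈ Icc (0 : ℝ) 1) :
    (x s).2.1 = x₀.2.1 ∧ (x s).1 = x₀.1 + ((x s).2.2.1 - x₀.2.2.1) • x₀.2.1 := by
  have hp : ∀ s ∈ Icc (0 : ℝ) 1, (x s).2.1 = x₀.2.1 := by
    intro s hs
    have := eq_of_hasDerivWithinAt_zero (x := fun s => (x s).2.1)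
      (fun s hs => by simpa using hx.mom s hs) hs
    simpa [hx.init] using this
  refine ⟨hp s hs, ?_⟩
  have := eq_of_hasDerivWithinAt_zero (x := fun s => (x s).1 - (x s).2.2.1 • x₀.2.1)
    (fun s hs => ?_) hs
  · simp only [hx.init] at this
    rw [sub_smul, ← sub_eq_zero]
    rw [← sub_eq_zero] at this
    rw [← this]; abel
  · refine ((hx.pos s hs).sub ((hx.time s hs).smul_const x₀.2.1)).congr_deriv ?_
    rw [hp s hs, sub_self]

/-- A stage inside of the barrier: `Q = 𝒬(W)` along the motion, where `W + p² / 2` is constant. -/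
theorem exists_isPath_inner {α ε ν w : ℝ} (hα : 0 < α) (hε : 0 < ε) (hQ : Differentiable ℝ Q)
    {P : ℝ → Phase d → Prop} {q p : ℝ → Conf d} {t c : ℝ → ℝ}
    (hc : ∀ s ∈ Icc (0 : ℝ) 1, 0 < c s)
    (hW : ∀ s ∈ Icc (0 : ℝ) 1, 0 < ν + w - ‖p s‖ ^ 2 / 2)
    (hq : ∀ s ∈ Icc (0 : ℝ) 1, HasDerivWithinAt q
      ((c s * (ε / α * (ν + w - ‖p s‖ ^ 2 / 2) ^ (-(1 / α) - 1))) • p s) (Icc 0 1) s)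
    (hp : ∀ s ∈ Icc (0 : ℝ) 1, HasDerivWithinAt p (c s • gradient Q (q s)) (Icc 0 1) s)
    (ht : ∀ s ∈ Icc (0 : ℝ) 1, HasDerivWithinAt t
      (c s * (ε / α * (ν + w - ‖p s‖ ^ 2 / 2) ^ (-(1 / α) - 1))) (Icc 0 1) s)
    (h0 : Q (q 0) = invBarrier α ε (ν + w - ‖p 0‖ ^ 2 / 2))
    (hP : ∀ s ∈ Icc (0 : ℝ) 1, Q (q s) = invBarrier α ε (ν + w - ‖p s‖ ^ 2 / 2) →
      P (t s) (q s, p s)) :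
    (∀ s ∈ Icc (0 : ℝ) 1, Q (q s) = invBarrier α ε (ν + w - ‖p s‖ ^ 2 / 2)) ∧
      ∃ γ, IsPath (barrierField α ε Q) P (t 0) (t 1) (q 0, p 0) (q 1, p 1) γ := by
  have hlev : ∀ s ∈ Icc (0 : ℝ) 1, Q (q s) = invBarrier α ε (ν + w - ‖p s‖ ^ 2 / 2) := by
    intro s hs
    have := eq_of_hasDerivWithinAt_zero
      (x := fun s => Q (q s) - invBarrier α ε (ν + w - ‖p s‖ ^ 2 / 2)) (fun s hs => ?_) hs
    · rw [h0, sub_self] at this; linarith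
    · have h1 := hasDerivWithinAt_comp_gradient hQ (hq s hs)
      have h2 : HasDerivWithinAt (fun s => ν + w - ‖p s‖ ^ 2 / 2)
          (-(c s * ⟪p s, gradient Q (q s)⟫_ℝ)) (Icc 0 1) s := by
        have := ((hp s hs).norm_sq.div_const 2).const_sub (ν + w)
        refine this.congr_deriv ?_
        rw [real_inner_smul_right]; ring
      have h3 := (hasDerivAt_invBarrier (α := α) (ε := ε) (hW s hs)).comp_hasDerivWithinAt s h2
      refine (h1.sub h3).congr_deriv ?_
      rw [real_inner_smul_left]; ring
  refine ⟨hlev, exists_isPath_of_reparam (X := barrierField α ε Q) (P := P)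
    (z := fun s => (q s, p s)) (θ := t) (fun s hs => ?_) ht (fun s hs => ?_)
    fun s hs => hP s hs (hlev s hs)⟩
  · refine ((hq s hs).prodMk (hp s hs)).congr_deriv ?_
    rw [barrierField, Prod.smul_mk, smul_smul]
    congr 2
    dsimp only
    rw [hlev s hs, mul_assoc, mul_comm _ (barrierForce _ _ _),
      barrierForce_invBarrier hα hε (hW s hs), mul_one]
  · have := Real.rpow_pos_of_pos (hW s hs) (-(1 / α) - 1)
    have := hc s hs
    positivity

end Fields

/-! ### Families of barriers -/

section Families

variable {d r : ℕ} {α : ℝ}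

/-- The force of the barrier, truncated below the level `delta`. -/
def cutForce (r : ℕ) (α ε : ℝ) (Q : Conf d → ℝ) (q₀ : Conf d) (R : ℝ) (x : State d) : Conf d :=
  (α * (nu r α ε * delta r α ε ^ r * powProfile (α + 1) (Q x.1 / delta r α ε + 0))) •
    cutGrad Q q₀ R x

/-- The inverse of the force inside of the barrier, as a function of the energy, truncated. -/
def cutPush (r : ℕ) (α ε : ℝ) (x : State d) : ℝ :=
  1 / α * (nu r α ε * nu r α ε ^ r *
    powProfile (1 / α + 1) ((x.2.2.2.2 - ‖x.2.1‖ ^ 2 / 2) / nu r α ε + 1))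

theorem cutForce_eq {ε : ℝ} (hα : 0 < α) (hε : 0 < ε) {Q : Conf d → ℝ} {q₀ : Conf d} {R : ℝ}
    {x : State d} (hx : ‖x.1 - q₀‖ ≤ R / 2) (hQ : delta r α ε ≤ Q x.1) :
    cutForce r α ε Q q₀ R x = barrierForce α ε (Q x.1) • gradient Q x.1 := by
  have hδ := delta_pos (r := r) (α := α) hε
  have hν := nu_pos (r := r) (α := α) hε
  have hQ0 := hδ.trans_le hQ
  rw [cutForce, cutGrad, retr_eq_self hx, powProfile_of_ge, barrierForce,
    rpow_eq_nu_mul_delta (r := r) hα hε, add_zero, Real.div_rpow hQ0.le hδ.le,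
    show -(α + 1) = -α - 1 by ring,
    show α + (r : ℝ) + 1 = r - (-α - 1) by ring, Real.rpow_sub hδ (r : ℝ), Real.rpow_natCast]
  · congr 1; ring
  · rw [add_zero, le_div_iff₀ hδ]; linarith

theorem cutPush_eq {ε : ℝ} (hα : 0 < α) (hε : 0 < ε) {x : State d}
    (hx : ‖x.2.1‖ ^ 2 / 2 ≤ x.2.2.2.2) :
    cutPush r α ε x =
      ε / α * (nu r α ε + x.2.2.2.2 - ‖x.2.1‖ ^ 2 / 2) ^ (-(1 / α) - 1) := by
  have hν := nu_pos (r := r) (α := α) hε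
  have hW : 0 < nu r α ε + x.2.2.2.2 - ‖x.2.1‖ ^ 2 / 2 := by linarith
  have h0 : 0 ≤ (x.2.2.2.2 - ‖x.2.1‖ ^ 2 / 2) / nu r α ε := div_nonneg (by linarith) hν.le
  have e : (x.2.2.2.2 - ‖x.2.1‖ ^ 2 / 2) / nu r α ε + 1 =
      (nu r α ε + x.2.2.2.2 - ‖x.2.1‖ ^ 2 / 2) / nu r α ε := by field_simp; ring
  rw [cutPush, powProfile_of_ge (by linarith), e, Real.div_rpow hW.le hν.le,
    show -(1 / α + 1) = -(1 / α) - 1 by ring]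
  have e2 : ε = nu r α ε * nu r α ε ^ r / nu r α ε ^ (-(1 / α) - 1) := by
    nth_rewrite 1 [eq_nu_rpow (r := r) hα hε]
    rw [show (r : ℝ) + 2 + 1 / α = 1 + r - (-(1 / α) - 1) by ring, Real.rpow_sub hν (1 + (r : ℝ)),
      Real.rpow_add hν, Real.rpow_one, Real.rpow_natCast]
  have e3 : ε / α = 1 / α * (nu r α ε * nu r α ε ^ r / nu r α ε ^ (-(1 / α) - 1)) := by
    rw [← e2]; ring
  rw [e3]
  ring

/-- A family of pattern functions near a boundary point, with the limit gradient `g`. -/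
structure LocalBarrier (r : ℕ) (α : ℝ) (Q : ℝ → Conf d → ℝ) (q₀ g : Conf d) : Prop where
  close : Close (𝓝[>] 0) (nu r α) (r + 1) Q Q
  tendsto_Q : Tendsto (fun z : ℝ × Conf d => Q z.1 z.2) (𝓝[>] 0 ×ˢ 𝓝 q₀) (𝓝 0)
  tendsto_grad : Tendsto (fun z : ℝ × Conf d => gradient (Q z.1) z.2) (𝓝[>] 0 ×ˢ 𝓝 q₀) (𝓝 g)
  ne_zero : g ≠ 0

theorem eventually_nu_bounds (hα : 0 < α) : ∀ᶠ ε in 𝓝[>] (0 : ℝ), 0 ≤ nu r α ε ∧ nu r α ε ≤ 1 :=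
  (eventually_nu hα).mono fun _ h => ⟨h.2.1.le, h.2.2⟩

theorem eventually_nu_nonneg (hα : 0 < α) : ∀ᶠ ε in 𝓝[>] (0 : ℝ), 0 ≤ nu r α ε :=
  (eventually_nu hα).mono fun _ h => h.2.1.le

namespace LocalBarrier

variable {Q : ℝ → Conf d → ℝ} {q₀ g : Conf d} (h : LocalBarrier r α Q q₀ g) {R k₀ : ℝ}
include h

theorem differentiable : ∀ᶠ ε in 𝓝[>] (0 : ℝ), Differentiable ℝ (Q ε) :=
  (h.close.contDiff_one (by omega)).mono fun _ hε => hε.1.differentiable one_ne_zero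

theorem close_cutGrad (hα : 0 < α) (hR : 0 < R) : Close (𝓝[>] 0) (nu r α) r
    (fun ε => cutGrad (Q ε) q₀ R) (fun ε => cutGrad (Q ε) q₀ R) := by
  have hβ := eventually_nu_nonneg (r := r) hα
  refine (Close.gradient hβ h.close).comp hβ (f := fun _ (x : State d) => retr q₀ R x.1)
    (f' := fun _ x => retr q₀ R x.1) ?_
  exact Close.of_contDiff hβ r ((contDiff_retr q₀ hR).comp contDiff_fst)

theorem close_invRate (hα : 0 < α) (hR : 0 < R) (hk : k₀ ≠ 0) : Close (𝓝[>] 0) (nu r α) r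
    (fun ε => invRate (Q ε) q₀ R k₀) (fun ε => invRate (Q ε) q₀ R k₀) := by
  have hβ := eventually_nu_nonneg (r := r) hα
  have hp : Close (𝓝[>] 0) (nu r α) r (fun _ (x : State d) => x.2.1) (fun _ x => x.2.1) :=
    Close.of_contDiff hβ r (by fun_prop)
  exact (hp.inner hβ (h.close_cutGrad hα hR)).map hβ
    (φ := fun k => (retr k₀ (|k₀| / 2) k)⁻¹) (contDiff_inv_retr hk)

theorem close_cutForce (hα : 0 < α) (hR : 0 < R) : Close (𝓝[>] 0) (nu r α) r
    (fun ε => cutForce r α ε (Q ε) q₀ R) (fun _ _ => 0) := by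
  have hβ := eventually_nu_nonneg (r := r) hα
  have hs := Close.scaled (A := nu r α) (c := delta r α) (b := 0) (eventually_nu_bounds hα)
    (r := r) (contDiff_powProfile (α + 1))
    (exists_bound_iteratedDeriv_powProfile (by linarith))
    ((eventually_nu hα).mono fun ε h => (abs_of_pos h.2.1).le)
    (by
      filter_upwards [self_mem_nhdsWithin, Ioo_mem_nhdsGT one_pos] with ε h h'
      exact ⟨delta_pos h, delta_le_one hα h h'.2.le⟩)
  have hQ : Close (𝓝[>] 0) (nu r α) r (fun ε (x : State d) => Q ε x.1) (fun ε x => Q ε x.1) :=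
    h.close.of_succ.comp hβ (Close.of_contDiff hβ r contDiff_fst)
  have hα' : Close (𝓝[>] 0) (nu r α) r (fun _ (x : State d) => α) (fun _ _ => α) :=
    Close.of_contDiff hβ r contDiff_const
  refine ((hα'.smul hβ (hs.comp hβ hQ)).smul hβ (h.close_cutGrad hα hR)).congr
    (.of_forall fun ε => rfl) (.of_forall fun ε => ?_)
  funext x
  simp

omit h in
theorem close_cutPush (hα : 0 < α) : Close (𝓝[>] 0) (nu r α) r
    (fun ε => cutPush r α ε (d := d)) (fun _ _ => 0) := by
  have hβ := eventually_nu_nonneg (r := r) hα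
  have hs := Close.scaled (A := nu r α) (c := nu r α) (b := 1) (eventually_nu_bounds hα)
    (r := r) (contDiff_powProfile (1 / α + 1))
    (exists_bound_iteratedDeriv_powProfile (by positivity))
    ((eventually_nu hα).mono fun ε h => (abs_of_pos h.2.1).le)
    ((eventually_nu hα).mono fun ε h => h.2)
  have hu : Close (𝓝[>] 0) (nu r α) r (fun _ (x : State d) => x.2.2.2.2 - ‖x.2.1‖ ^ 2 / 2)
      (fun _ x => x.2.2.2.2 - ‖x.2.1‖ ^ 2 / 2) := by
    refine Close.of_contDiff hβ r ?_
    have : ContDiff ℝ ∞ fun x : State d => ‖x.2.1‖ ^ 2 := ContDiff.norm_sq ℝ (by fun_prop)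
    fun_prop
  have hα' : Close (𝓝[>] 0) (nu r α) r (fun _ (x : State d) => 1 / α) (fun _ _ => 1 / α) :=
    Close.of_contDiff hβ r contDiff_const
  refine (hα'.smul hβ (hs.comp hβ hu)).congr (.of_forall fun ε => rfl) (.of_forall fun ε => ?_)
  funext x
  simp

theorem close_freeField (hα : 0 < α) (hR : 0 < R) : Close (𝓝[>] 0) (nu r α) r
    (fun ε => freeField (cutForce r α ε (Q ε) q₀ R)) (fun _ => freeField 0) := by
  have hβ := eventually_nu_nonneg (r := r) hα
  have hp : Close (𝓝[>] 0) (nu r α) r (fun _ (x : State d) => x.2.1) (fun _ x => x.2.1) :=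
    Close.of_contDiff hβ r (by fun_prop)
  have h1 : Close (𝓝[>] 0) (nu r α) r (fun _ (x : State d) => (1 : ℝ)) (fun _ x => 1) :=
    Close.of_contDiff hβ r contDiff_const
  exact hp.prodMk hβ ((h.close_cutForce hα hR).prodMk hβ h1)

theorem close_gradForce (hα : 0 < α) (hR : 0 < R) : Close (𝓝[>] 0) (nu r α) r
    (fun ε => gradForce (Q ε) q₀ R) (fun ε => gradForce (Q ε) q₀ R) := by
  have hβ := eventually_nu_nonneg (r := r) hα
  have h0 : Close (𝓝[>] 0) (nu r α) r (fun _ (x : State d) => (0 : ℝ)) (fun _ x => 0) :=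
    Close.of_contDiff hβ r contDiff_const
  have h0' : Close (𝓝[>] 0) (nu r α) r (fun _ (x : State d) => (0 : Conf d)) (fun _ x => 0) :=
    Close.of_contDiff hβ r contDiff_const
  exact h0'.prodMk hβ ((h.close_cutGrad hα hR).prodMk hβ h0)

theorem close_innerField (hα : 0 < α) (hR : 0 < R) : Close (𝓝[>] 0) (nu r α) r
    (fun ε => innerField (Q ε) q₀ R (cutPush r α ε)) (fun ε => innerField (Q ε) q₀ R 0) := by
  have hβ := eventually_nu_nonneg (r := r) hα
  have hp : Close (𝓝[>] 0) (nu r α) r (fun _ (x : State d) => x.2.1) (fun _ x => x.2.1) :=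
    Close.of_contDiff hβ r (by fun_prop)
  exact ((close_cutPush hα).smul hβ hp).prodMk hβ
    ((h.close_cutGrad hα hR).prodMk hβ (close_cutPush hα))

/-- Smallness of `Q` and of the distance of its gradient to the limit, near the boundary point. -/
theorem exists_near {e : ℝ} (he : 0 < e) : ∃ ϱ > 0, ∀ᶠ ε in 𝓝[>] (0 : ℝ), ∀ q, ‖q - q₀‖ < ϱ →
    |Q ε q| < e ∧ ‖gradient (Q ε) q - g‖ < e := by
  have h1 := h.tendsto_Q.eventually (Metric.ball_mem_nhds 0 he)
  have h2 := h.tendsto_grad.eventually (Metric.ball_mem_nhds g he)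
  obtain ⟨p, hp, p', hp', H⟩ := eventually_prod_iff.1 (h1.and h2)
  obtain ⟨ϱ, hϱ, hb⟩ := Metric.eventually_nhds_iff.1 hp'
  refine ⟨ϱ, hϱ, hp.mono fun ε hε q hq => ?_⟩
  have := H hε (hb (by rwa [dist_eq_norm]))
  simpa [dist_eq_norm] using this

theorem exists_isWindow {p₀ : Conf d} (hk : ⟪p₀, g⟫_ℝ ≠ 0) : ∃ ϱ > 0, ∀ R ≤ ϱ,
    ∀ᶠ ε in 𝓝[>] (0 : ℝ), IsWindow (Q ε) q₀ p₀ R ⟪p₀, g⟫_ℝ := by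
  have hc : ContinuousAt (fun z : Conf d × Conf d => ⟪z.1, z.2⟫_ℝ) (p₀, g) := by fun_prop
  obtain ⟨e, he, H⟩ := Metric.continuousAt_iff.1 hc (|⟪p₀, g⟫_ℝ| / 4)
    (div_pos (abs_pos.2 hk) (by norm_num))
  obtain ⟨ϱ, hϱ, hn⟩ := h.exists_near he
  refine ⟨min ϱ e, lt_min hϱ he, fun R hR => ?_⟩
  filter_upwards [hn, h.differentiable] with ε hε hd
  refine ⟨hd, fun q p hq hp => ?_⟩
  have hR' := le_min_iff.1 hR
  have hpos : 0 ≤ R := by linarith [norm_nonneg (q - q₀)]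
  have h1 : ‖q - q₀‖ < ϱ := by linarith
  have h2 : ‖p - p₀‖ < e := by linarith
  have := H (x := (p, gradient (Q ε) q)) (by
    rw [Prod.dist_eq, dist_eq_norm, dist_eq_norm]
    exact max_lt h2 (hε q h1).2)
  rw [Real.dist_eq] at this
  exact this.le

end LocalBarrier

end Families

section Entrance

variable {d r : ℕ} {α : ℝ}

theorem stageFlow_zero (c : State d) (R σ : ℝ) (Z g : State d → Vel d) :
    stageFlow c R σ Z g 0 = stageFlow c R σ Z 0 0 := by
  have h : cutField c R (stageField σ Z) (fun x => pad (g x)) 0 =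
      cutField c R (stageField σ Z) (fun x => pad ((0 : State d → Vel d) x)) 0 := by
    funext t x; simp [cutField]
  unfold stageFlow cutFlow
  rw [h]

/-- The stage from one level of `Q` to another, near `(q₀, p₀)`. -/
def hitFlow (Q : Conf d → ℝ) (q₀ p₀ : Conf d) (R σ k₀ : ℝ) (F : State d → Conf d) (a : ℝ → ℝ) :
    ℝ → State d → State d :=
  stageFlow (q₀, p₀, 0, 0, 0) R σ (fun x => invRate Q q₀ R k₀ x • freeField F x)
    (fun x => invRate Q q₀ R k₀ x • gradForce Q q₀ R x) a

theorem norm_state_sub_le {x y : State d} {M : ℝ} (hM : 0 ≤ M) (h1 : ‖x.1 - y.1‖ ≤ M)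
    (h2 : ‖x.2.1 - y.2.1‖ ≤ M) (h3 : |x.2.2.1 - y.2.2.1| ≤ M) (h4 : |x.2.2.2.1 - y.2.2.2.1| ≤ M)
    (h5 : |x.2.2.2.2 - y.2.2.2.2| ≤ M) : ‖x - y‖ ≤ M :=
  max_le h1 (max_le h2 (max_le h3 (max_le h4 h5)))

/-- Position, momentum and time of a state. -/
def State.proj (x : State d) : Phase d × ℝ := ((x.1, x.2.1), x.2.2.1)

theorem contDiff_proj {n : WithTop ℕ∞} : ContDiff ℝ n (State.proj (d := d)) := by
  unfold State.proj; fun_prop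

namespace LocalBarrier

variable {Q : ℝ → Conf d → ℝ} {q₀ g : Conf d} (h : LocalBarrier r α Q q₀ g) {R k₀ : ℝ}
include h

theorem close_hitFlow_force (hr : 1 ≤ r) (hα : 0 < α) (p₀ : Conf d) (hR : 0 < R) {σ : ℝ} (hσ : 0 < σ)
    (hk : k₀ ≠ 0) : Close (𝓝[>] 0) (nu r α) r
    (fun ε => hitFlow (Q ε) q₀ p₀ R σ k₀ (cutForce r α ε (Q ε) q₀ R) 0 1)
    (fun ε => hitFlow (Q ε) q₀ p₀ R σ k₀ 0 0 1) := by
  have hβ := eventually_nu_nonneg (r := r) hα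
  have hZ := (h.close_invRate hα hR hk).smul hβ (h.close_freeField hα hR)
  have h0 : Close (𝓝[>] 0) (nu r α) r (fun _ : ℝ => (0 : State d → Vel d)) (fun _ => 0) :=
    Close.of_contDiff hβ r contDiff_const
  refine (Close.stageFlow (c := (q₀, p₀, 0, 0, 0)) (a := fun _ => 0) hR hσ
    (eventually_nu_bounds hα) hZ h0 ?_ ?_).congr ?_ ?_
  · filter_upwards [hZ.contDiff_one hr] with ε hε using ⟨hε.1, hε.2, contDiff_const⟩
  · filter_upwards [hβ] with ε hε using ⟨continuous_const, by simpa using hε⟩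
  · exact .of_forall fun ε => (congrFun (stageFlow_zero _ _ _ _ _) 1).symm
  · exact .of_forall fun ε => (congrFun (stageFlow_zero _ _ _ _ _) 1).symm

theorem close_hitFlow_rate (hr : 1 ≤ r) (hα : 0 < α) (p₀ : Conf d) (hR : 0 < R) {σ : ℝ} (hσ : 0 < σ)
    (hk : k₀ ≠ 0) {a : ℝ → ℝ → ℝ}
    (ha : ∀ᶠ ε in 𝓝[>] (0 : ℝ), Continuous (a ε) ∧ ∫ s in (0 : ℝ)..1, |a ε s| ≤ nu r α ε) :
    Close (𝓝[>] 0) (nu r α) r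
    (fun ε => hitFlow (Q ε) q₀ p₀ R σ k₀ 0 (a ε) 1)
    (fun ε => hitFlow (Q ε) q₀ p₀ R σ k₀ 0 0 1) := by
  have hβ := eventually_nu_nonneg (r := r) hα
  have hf : Close (𝓝[>] 0) (nu r α) r (fun _ : ℝ => freeField (0 : State d → Conf d))
    (fun _ => freeField 0) := Close.of_contDiff hβ r (by unfold freeField; simp only [Pi.zero_apply]; fun_prop)
  have hZ := (h.close_invRate hα hR hk).smul hβ hf
  have hg := (h.close_invRate hα hR hk).smul hβ (h.close_gradForce hα hR)
  refine (Close.stageFlow (c := (q₀, p₀, 0, 0, 0)) (a := a) hR hσ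
    (eventually_nu_bounds hα) hZ hg ?_ ha).congr (.of_forall fun ε => rfl) ?_
  · filter_upwards [hZ.contDiff_one hr, hg.contDiff_one hr] with ε hε hε' using
      ⟨hε.1, hε.2, hε'.1⟩
  · exact .of_forall fun ε => (congrFun (stageFlow_zero _ _ _ _ _) 1).symm

theorem exists_hit (hr : 1 ≤ r) (hα : 0 < α) (p₀ : Conf d) (hR : 0 < R) (hk : k₀ ≠ 0)
    (hw : ∀ᶠ ε in 𝓝[>] (0 : ℝ), IsWindow (Q ε) q₀ p₀ R k₀) :
    ∃ σ > 0, σ ≤ R / 16 ∧ ∀ᶠ ε in 𝓝[>] (0 : ℝ), ∀ F, (F = 0 ∨ F = cutForce r α ε (Q ε) q₀ R) →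
      ∀ a, Continuous a → ∫ s in (0 : ℝ)..1, |a s| ≤ nu r α ε →
      ∀ x₀ : State d, ‖x₀ - (q₀, p₀, 0, 0, 0)‖ ≤ R / 4 → |x₀.2.2.2.1| ≤ σ / 2 →
      IsHit (Q ε) F a (fun s => hitFlow (Q ε) q₀ p₀ R σ k₀ F a s x₀) x₀ ∧
      (∀ s ∈ Icc (0 : ℝ) 1, ‖hitFlow (Q ε) q₀ p₀ R σ k₀ F a s x₀ - x₀‖ ≤ R / 16) ∧
      ∀ s ∈ Icc (0 : ℝ) 1, ‖(hitFlow (Q ε) q₀ p₀ R σ k₀ F a s x₀).1 - q₀‖ ≤ R / 2 ∧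
        ‖(hitFlow (Q ε) q₀ p₀ R σ k₀ F a s x₀).2.1 - p₀‖ ≤ R / 2 := by
  have hβ := eventually_nu_nonneg (r := r) hα
  set c : State d := (q₀, p₀, 0, 0, 0) with hc
  have hZ := (h.close_invRate hα hR hk).smul hβ (h.close_freeField hα hR)
  have hg := (h.close_invRate hα hR hk).smul hβ (h.close_gradForce hα hR)
  obtain ⟨K, hK, hK'⟩ := hZ.closeZero (‖c‖ + R)
  obtain ⟨L, hL, hL'⟩ := hg.closeZero (‖c‖ + R)
  have hσ : 0 < R / (32 * (K + 1)) := by positivity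
  refine ⟨R / (32 * (K + 1)), hσ, ?_, ?_⟩
  · rw [div_le_div_iff₀ (by positivity) (by norm_num)]; nlinarith
  have hνL : ∀ᶠ ε in 𝓝[>] (0 : ℝ), nu r α ε * L ≤ R / 32 := by
    have : Tendsto (fun ε => nu r α ε * L) (𝓝[>] 0) (𝓝 0) := by
      simpa using (tendsto_nu (r := r) hα).mul_const L
    exact this.eventually (Iic_mem_nhds (by positivity))
  filter_upwards [hw, hK', hL', hνL, hZ.contDiff_one hr, hg.contDiff_one hr] with ε hw hK' hL' hνL
    hZ1 hg1 F hF a ha ha' x₀ hx₀ hl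
  have hball : ∀ x : State d, ‖x - c‖ < R → ‖x‖ ≤ ‖c‖ + R := fun x hx => by
    linarith [norm_le_norm_add_norm_sub' x c]
  have hM : R / (32 * (K + 1)) * K + (∫ s in (0 : ℝ)..1, |a s|) * L ≤ R / 16 := by
    have h1 : R / (32 * (K + 1)) * K ≤ R / 32 := by
      rw [div_mul_eq_mul_div, div_le_div_iff₀ (by positivity) (by norm_num)]; nlinarith
    have h2 := mul_le_mul_of_nonneg_right ha' hL
    linarith
  have hst : IsStage (fun x => invRate (Q ε) q₀ R k₀ x • freeField F x)
      (fun x => invRate (Q ε) q₀ R k₀ x • gradForce (Q ε) q₀ R x) a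
      (fun s => hitFlow (Q ε) q₀ p₀ R (R / (32 * (K + 1))) k₀ F a s x₀) x₀
      (R / (32 * (K + 1)) * K + (∫ s in (0 : ℝ)..1, |a s|) * L) := by
    refine isStage_stageFlow hR hσ ?_ hg1.1 ha ?_
      (fun x hx => (hL' x x (hball x hx) (hball x hx)).1) hx₀ hl (hM.trans (by linarith))
    · rcases hF with rfl | rfl
      exacts [hZ1.2, hZ1.1]
    · rcases hF with rfl | rfl
      exacts [fun x hx => (hK' x x (hball x hx) (hball x hx)).2.1,
        fun x hx => (hK' x x (hball x hx) (hball x hx)).1]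
  have hd : ∀ s ∈ Icc (0 : ℝ) 1,
      ‖hitFlow (Q ε) q₀ p₀ R (R / (32 * (K + 1))) k₀ F a s x₀ - x₀‖ ≤ R / 16 := fun s hs =>
    (hst.dist s hs).trans hM
  have hin : ∀ s ∈ Icc (0 : ℝ) 1,
      ‖(hitFlow (Q ε) q₀ p₀ R (R / (32 * (K + 1))) k₀ F a s x₀).1 - q₀‖ ≤ R / 2 ∧
      ‖(hitFlow (Q ε) q₀ p₀ R (R / (32 * (K + 1))) k₀ F a s x₀).2.1 - p₀‖ ≤ R / 2 := by
    intro s hs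
    have h1 : ‖hitFlow (Q ε) q₀ p₀ R (R / (32 * (K + 1))) k₀ F a s x₀ - c‖ ≤ R / 2 := by
      have := norm_add_le (hitFlow (Q ε) q₀ p₀ R (R / (32 * (K + 1))) k₀ F a s x₀ - x₀) (x₀ - c)
      rw [sub_add_sub_cancel] at this
      linarith [hd s hs]
    exact ⟨(norm_pos_le _ c).trans h1, (norm_mom_le _ c).trans h1⟩
  exact ⟨hst.isHit hw hk hin, hd, hin⟩

end LocalBarrier

theorem IsWindow.line_le {Q : Conf d → ℝ} {q₀ p₀ : Conf d} {R k₀ : ℝ}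
    (h : IsWindow Q q₀ p₀ R k₀) {q p : Conf d} {s t : ℝ} (hst : s ≤ t) (hp : ‖p - p₀‖ ≤ R / 2)
    (hs : ‖q + s • p - q₀‖ ≤ R / 2) (ht : ‖q + t • p - q₀‖ ≤ R / 2) :
    (∀ u ∈ Icc s t, ‖q + u • p - q₀‖ ≤ R / 2) ∧
    (k₀ < 0 → Q (q + t • p) - Q (q + s • p) ≤ 3 / 4 * k₀ * (t - s)) ∧
    (0 < k₀ → 3 / 4 * k₀ * (t - s) ≤ Q (q + t • p) - Q (q + s • p)) := by
  have hin : ∀ u ∈ Icc s t, ‖q + u • p - q₀‖ ≤ R / 2 := by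
    intro u hu
    have hconv : Convex ℝ {u : ℝ | ‖q + u • p - q₀‖ ≤ R / 2} := by
      have e : {u : ℝ | ‖q + u • p - q₀‖ ≤ R / 2} =
          (AffineMap.lineMap q (q + p) : ℝ →ᵃ[ℝ] Conf d) ⁻¹' Metric.closedBall q₀ (R / 2) := by
        ext u
        simp [AffineMap.lineMap_apply, dist_eq_norm, add_comm]
      rw [e]
      exact (convex_closedBall _ _).affine_preimage _
    exact hconv.ordConnected.out hs ht hu
  have hd : ∀ u : ℝ, HasDerivAt (fun u : ℝ => Q (q + u • p)) ⟪p, gradient Q (q + u • p)⟫_ℝ u := by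
    intro u
    have h1 : HasDerivAt (fun u : ℝ => q + u • p) p u := by
      simpa using ((hasDerivAt_id u).smul_const p).const_add q
    have := hasDerivWithinAt_comp_gradient h.diff h1.hasDerivWithinAt (s := univ)
    rwa [hasDerivWithinAt_univ] at this
  have hcont : ContinuousOn (fun u => Q (q + u • p)) (Icc s t) := fun u _ =>
    (hd u).continuousAt.continuousWithinAt
  have hdiff : DifferentiableOn ℝ (fun u => Q (q + u • p)) (interior (Icc s t)) := fun u _ =>
    (hd u).differentiableAt.differentiableWithinAt
  refine ⟨hin, fun hk => ?_, fun hk => ?_⟩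
  · exact (convex_Icc s t).image_sub_le_mul_sub_of_deriv_le hcont hdiff
      (fun u hu => by
        rw [(hd u).deriv]
        exact (h.rate_bounds (hin u (interior_subset hu)) hp).1 hk)
      s (left_mem_Icc.2 hst) t (right_mem_Icc.2 hst) hst
  · exact (convex_Icc s t).mul_sub_le_image_sub_of_le_deriv hcont hdiff
      (fun u hu => by
        rw [(hd u).deriv]
        exact (h.rate_bounds (hin u (interior_subset hu)) hp).2 hk)
      s (left_mem_Icc.2 hst) t (right_mem_Icc.2 hst) hst

theorem Close.tendsto {E F : Type} [NormedAddCommGroup E] [NormedSpace ℝ E] [NormedAddCommGroup F]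
    [NormedSpace ℝ F] {I : Type} {l : Filter I} {β : I → ℝ} {f g : I → E → F} (h : Close l β r f g)
    (hβ : Tendsto β l (𝓝 0)) {x : E} {y : F}
    (hg : Tendsto (fun z : I × E => g z.1 z.2) (l ×ˢ 𝓝 x) (𝓝 y)) :
    Tendsto (fun z : I × E => f z.1 z.2) (l ×ˢ 𝓝 x) (𝓝 y) := by
  obtain ⟨K, hK, H⟩ := h.closeZero (‖x‖ + 1)
  have h1 : Tendsto (fun z : I × E => K * β z.1) (l ×ˢ 𝓝 x) (𝓝 0) := by
    simpa using (hβ.comp tendsto_fst).const_mul K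
  have h2 : Tendsto (fun z : I × E => f z.1 z.2 - g z.1 z.2) (l ×ˢ 𝓝 x) (𝓝 0) := by
    refine squeeze_zero_norm' ?_ h1
    filter_upwards [H.prod_inl (𝓝 x), (Metric.eventually_nhds_iff.2 ⟨1, one_pos, fun y hy => hy⟩ : ∀ᶠ y in 𝓝 x, dist y x < 1).prod_inr l] with z hz hz'
    have : ‖z.2‖ ≤ ‖x‖ + 1 := by
      rw [dist_eq_norm] at hz'
      linarith [norm_le_norm_add_norm_sub' z.2 x]
    simpa using (hz z.2 z.2 this this).2.2
  simpa using h2.add hg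

end Entrance

section Entrance

variable {d r : ℕ} {α : ℝ}

/-- The initial state of the stage from `x` to the level `c` of `Q`. -/
def startHit (c : ℝ) (Q : Conf d → ℝ) (x : Phase d) : State d := (x.1, x.2, 0, c - Q x.1, 0)

/-- The initial state of a stage of duration `l`. -/
def restart (l : ℝ) (x : State d) : State d := (x.1, x.2.1, x.2.2.1, l, 0)

/-- The state at the level `eta`, reached from above through the level `c`. -/
def entrance (Q : Conf d → ℝ) (q₀ p₀ : Conf d) (R σ k₀ c e : ℝ) (F : State d → Conf d) (a : ℝ → ℝ)
    (x : Phase d) : State d :=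
  hitFlow Q q₀ p₀ R σ k₀ 0 a 1 (restart (e - c) (hitFlow Q q₀ p₀ R σ k₀ F 0 1 (startHit c Q x)))

/-- The distance of a path from its limit point, its levels, and the time at which they are low. -/
def EntranceProp (Q : Conf d → ℝ) (z₀ : Phase d) (ϱ e δ C s s' t : ℝ) (y : Phase d) : Prop :=
  ‖y - z₀‖ < ϱ ∧ e ≤ Q y.1 ∧ (t < s → e < Q y.1) ∧ (δ ≤ Q y.1 ∨ |t - s'| ≤ C)

theorem exists_isPath_entrance {Q : Conf d → ℝ} {q₀ p₀ : Conf d} {R k₀ ϱ ε c C s' : ℝ}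
    (hw : IsWindow Q q₀ p₀ R k₀) (hk : k₀ < 0) (hRϱ : R / 2 < ϱ) (hα : 0 < α) (hε : 0 < ε)
    {xA xB : ℝ → State d} {x : Phase d}
    (A : IsHit Q (cutForce r α ε Q q₀ R) 0 xA (startHit c Q x))
    (B : IsHit Q 0 (barrierRate r α ε c (eta r α ε)) xB (restart (eta r α ε - c) (xA 1)))
    (A3 : ∀ s ∈ Icc (0 : ℝ) 1, ‖(xA s).1 - q₀‖ ≤ R / 2 ∧ ‖(xA s).2.1 - p₀‖ ≤ R / 2)
    (B3 : ∀ s ∈ Icc (0 : ℝ) 1, ‖(xB s).1 - q₀‖ ≤ R / 2 ∧ ‖(xB s).2.1 - p₀‖ ≤ R / 2)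
    (A4 : ∀ s ∈ Icc (0 : ℝ) 1, Q (xA s).1 = Q x.1 + (c - Q x.1) * s)
    (B4 : ∀ s ∈ Icc (0 : ℝ) 1, Q (xB s).1 = c + s * (eta r α ε - c))
    (hQc : c < Q x.1) (hηc : eta r α ε < c) (hδc : delta r α ε ≤ c)
    (hC : 2 / |k₀| * delta r α ε + |(xB 1).2.2.1 - s'| ≤ C) :
    ∃ γ, IsPath (barrierField α ε Q) (EntranceProp Q (q₀, p₀) ϱ (eta r α ε) (delta r α ε) C
      (xB 1).2.2.1 s') 0 (xB 1).2.2.1 x ((xB 1).1, (xB 1).2.1) γ := by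
  have hη0 := eta_pos (r := r) hα hε
  have hδ0 := delta_pos (r := r) (α := α) hε
  have hnorm : ∀ x : State d, ‖x.1 - q₀‖ ≤ R / 2 ∧ ‖x.2.1 - p₀‖ ≤ R / 2 →
      ‖((x.1, x.2.1) : Phase d) - (q₀, p₀)‖ < ϱ := fun x hx =>
    (max_le hx.1 hx.2).trans_lt hRϱ
  have hQA : ∀ s ∈ Icc (0 : ℝ) 1, c ≤ Q (xA s).1 := fun s hs => by
    rw [A4 s hs]; nlinarith [hs.1, hs.2]
  have hQB : ∀ s ∈ Icc (0 : ℝ) 1, eta r α ε ≤ Q (xB s).1 := fun s hs => by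
    rw [B4 s hs]; nlinarith [hs.1, hs.2]
  have hQB1 : Q (xB 1).1 = eta r α ε := by rw [B4 1 (by simp)]; ring
  obtain ⟨γ₁, hγ₁⟩ := A.exists_isPath hw hk.ne A3 (α := α) (ε := ε)
    (P := EntranceProp Q (q₀, p₀) ϱ (eta r α ε) (delta r α ε) C (xB 1).2.2.1 s')
    (by
      have : (startHit c Q x).2.2.2.1 = c - Q x.1 := rfl
      rw [this]; nlinarith)
    (fun s hs => by
      rw [cutForce_eq hα hε (A3 s hs).1 (hδc.trans (hQA s hs))]
      simp [smul_smul])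
    (fun s hs => ⟨hnorm _ (A3 s hs), hηc.le.trans (hQA s hs), fun _ => hηc.trans_le (hQA s hs),
      Or.inl (hδc.trans (hQA s hs))⟩)
  obtain ⟨γ₂, hγ₂⟩ := B.exists_isPath hw hk.ne B3 (α := α) (ε := ε)
    (P := EntranceProp Q (q₀, p₀) ϱ (eta r α ε) (delta r α ε) C (xB 1).2.2.1 s')
    (by
      have : (restart (eta r α ε - c) (xA 1)).2.2.2.1 = eta r α ε - c := rfl
      rw [this]; nlinarith)
    (fun s hs => by
      rw [barrierRate_eq hηc.le le_rfl hs, B4 s hs]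
      simp [restart])
    (fun s hs => by
      refine ⟨hnorm _ (B3 s hs), hQB s hs, fun ht => ?_, ?_⟩
      · simp only
        rw [B4 s hs]
        have : s < 1 := lt_of_le_of_ne hs.2 (by rintro rfl; exact lt_irrefl _ ht)
        nlinarith
      · rcases le_or_gt (delta r α ε) (Q (xB s).1) with hle | hlt
        · exact Or.inl hle
        · right
          have h1 := B.abs_time_sub_le hw hk.ne B3 hs (u := 1) (by simp)
          have h2 : |Q (xB s).1 - Q (xB 1).1| ≤ delta r α ε := by
            rw [hQB1, abs_of_nonneg (by linarith [hQB s hs])]; linarith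
          have h3 := abs_sub_le (xB s).2.2.1 (xB 1).2.2.1 s'
          have h4 : 2 / |k₀| * |Q (xB s).1 - Q (xB 1).1| ≤ 2 / |k₀| * delta r α ε :=
            mul_le_mul_of_nonneg_left h2 (by positivity)
          linarith)
  exact ⟨_, hγ₁.concat hγ₂⟩

namespace LocalBarrier

variable {Q : ℝ → Conf d → ℝ} {q₀ g : Conf d} (h : LocalBarrier r α Q q₀ g)
include h

theorem close_entrance (hr : 1 ≤ r) (hα : 0 < α) (p₀ : Conf d) {R σ k₀ c : ℝ} (hR : 0 < R)
    (hσ : 0 < σ) (hk : k₀ ≠ 0) (hc : 0 < c) : Close (𝓝[>] 0) (nu r α) r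
    (fun ε => entrance (Q ε) q₀ p₀ R σ k₀ c (eta r α ε) (cutForce r α ε (Q ε) q₀ R)
      (barrierRate r α ε c (eta r α ε)))
    (fun ε => entrance (Q ε) q₀ p₀ R σ k₀ c (eta r α ε) 0 0) := by
  have hβ := eventually_nu_nonneg (r := r) hα
  have hηc : ∀ᶠ ε in 𝓝[>] (0 : ℝ), eta r α ε ≤ c := (tendsto_eta hα).eventually (Iic_mem_nhds hc)
  have ha : ∀ᶠ ε in 𝓝[>] (0 : ℝ), Continuous (barrierRate r α ε c (eta r α ε)) ∧
      ∫ s in (0 : ℝ)..1, |barrierRate r α ε c (eta r α ε) s| ≤ nu r α ε := by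
    filter_upwards [hηc, self_mem_nhdsWithin] with ε h1 h2
    exact ⟨continuous_barrierRate hα h2 _ _, integral_barrierRate_le hα h2 h1 le_rfl⟩
  have hs : Close (𝓝[>] 0) (nu r α) r (fun ε => startHit c (Q ε)) (fun ε => startHit c (Q ε)) := by
    have hQ : Close (𝓝[>] 0) (nu r α) r (fun ε (x : Phase d) => Q ε x.1) (fun ε x => Q ε x.1) :=
      h.close.of_succ.comp hβ (Close.of_contDiff hβ r contDiff_fst)
    exact Close.map₂ hβ (φ := fun z : Phase d × ℝ => (z.1.1, z.1.2, 0, c - z.2, 0)) (by fun_prop)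
      (Close.of_contDiff hβ r contDiff_id) hQ
  have hrs : Close (𝓝[>] 0) (nu r α) r (fun ε => restart (d := d) (eta r α ε - c))
      (fun ε => restart (eta r α ε - c)) := by
    have hl : Close (𝓝[>] 0) (nu r α) r (fun ε (_ : State d) => eta r α ε - c)
        (fun ε _ => eta r α ε - c) := by
      refine Close.const_self hβ c ?_ r
      filter_upwards [hηc, self_mem_nhdsWithin] with ε h1 h2
      have := eta_pos (r := r) hα h2
      rw [Real.norm_eq_abs, abs_le]; constructor <;> linarith
    exact Close.map₂ hβ (φ := fun z : State d × ℝ => (z.1.1, z.1.2.1, z.1.2.2.1, z.2, 0))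
      (by fun_prop) (Close.of_contDiff hβ r contDiff_id) hl
  exact (h.close_hitFlow_rate hr hα p₀ hR hσ hk ha).comp hβ
    (hrs.comp hβ ((h.close_hitFlow_force hr hα p₀ hR hσ hk).comp hβ hs))

/-- The motion from a point above the boundary to the level `eta`. -/
theorem exists_entrance (hr : 1 ≤ r) (hα : 0 < α) {p₀ : Conf d} (hk : ⟪p₀, g⟫_ℝ < 0) {ϱ : ℝ}
    (hϱ : 0 < ϱ) : ∃ τ₀ > 0, ∀ τ ∈ Ioo 0 τ₀, ∃ H B : ℝ → Phase d → Phase d × ℝ,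
      Close (𝓝[>] 0) (nu r α) r H B ∧
      Tendsto (fun z : ℝ × Phase d => B z.1 z.2) (𝓝[>] 0 ×ˢ 𝓝 (q₀ - τ • p₀, p₀))
        (𝓝 ((q₀, p₀), τ)) ∧
      ∃ C > 0, ∀ᶠ z in 𝓝[>] (0 : ℝ) ×ˢ 𝓝 (q₀ - τ • p₀, p₀),
        (∃ γ, IsPath (barrierField α z.1 (Q z.1)) (EntranceProp (Q z.1) (q₀, p₀) ϱ (eta r α z.1)
            (delta r α z.1) (C * (nu r α z.1 + delta r α z.1)) (H z.1 z.2).2 (B z.1 z.2).2)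
            0 (H z.1 z.2).2 z.2 (H z.1 z.2).1 γ) ∧
        Q z.1 (H z.1 z.2).1.1 = eta r α z.1 ∧ Q z.1 (B z.1 z.2).1.1 = eta r α z.1 ∧
        (B z.1 z.2).1 = (z.2.1 + (B z.1 z.2).2 • z.2.2, z.2.2) ∧
        ∀ t ∈ Ico 0 (B z.1 z.2).2, ‖z.2.1 + t • z.2.2 - q₀‖ < ϱ ∧
          eta r α z.1 < Q z.1 (z.2.1 + t • z.2.2) := by
  have hβ := eventually_nu_nonneg (r := r) hα
  obtain ⟨ϱ₁, hϱ₁, hwin⟩ := h.exists_isWindow hk.ne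
  set k₀ := ⟪p₀, g⟫_ℝ with hk₀
  set R := min ϱ₁ ϱ with hRdef
  have hR : 0 < R := lt_min hϱ₁ hϱ
  have hw := hwin R (min_le_left _ _)
  have hRϱ : R / 2 < ϱ := by linarith [min_le_right ϱ₁ ϱ]
  obtain ⟨σ, hσ, hσR, hhit⟩ := h.exists_hit hr hα p₀ hR hk.ne hw
  obtain ⟨ϱ₂, hϱ₂, hn⟩ := h.exists_near (e := σ / 8) (by positivity)
  have hp0 := norm_nonneg p₀
  refine ⟨min (min R ϱ₂ / (32 * (‖p₀‖ + 1))) (σ / |k₀|), lt_min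
    (div_pos (lt_min hR hϱ₂) (by positivity)) (div_pos hσ (abs_pos.2 hk.ne)), fun τ hτ => ?_⟩
  have hτ1 : τ * (‖p₀‖ + 1) < min R ϱ₂ / 32 := by
    have := hτ.2.trans_le (min_le_left _ _)
    rw [lt_div_iff₀ (by positivity)] at this
    linarith
  have hτ2 : τ * |k₀| < σ := by
    have := hτ.2.trans_le (min_le_right _ _)
    rwa [lt_div_iff₀ (abs_pos.2 hk.ne)] at this
  have hkabs : |k₀| = -k₀ := abs_of_neg hk
  have hkpos : 0 < |k₀| := abs_pos.2 hk.ne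
  set c := -k₀ * τ / 4 with hcdef
  have hc : 0 < c := by have := hτ.1; have := neg_pos.2 hk; positivity
  have hcσ : c < σ / 4 := by rw [hcdef, ← hkabs]; linarith
  obtain ⟨ϱ₃, hϱ₃, hn3⟩ := h.exists_near hc
  set H' := fun ε => entrance (Q ε) q₀ p₀ R σ k₀ c (eta r α ε) (cutForce r α ε (Q ε) q₀ R)
      (barrierRate r α ε c (eta r α ε)) with hH'
  set B' := fun ε => entrance (Q ε) q₀ p₀ R σ k₀ c (eta r α ε) 0 0 with hB'
  have hclose : Close (𝓝[>] 0) (nu r α) r H' B' := h.close_entrance hr hα p₀ hR hσ hk.ne hc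
  have hclose' := hclose.map hβ (contDiff_proj (d := d))
  set xa : Phase d := (q₀ - τ • p₀, p₀) with hxa
  -- the points near `xa`
  have hx : ∀ᶠ x in 𝓝 xa, ‖x.1 - q₀‖ < min R ϱ₂ / 16 ∧ ‖x.2 - p₀‖ < R / 16 ∧
      ‖x.1 + τ • x.2 - q₀‖ < min ϱ₃ (R / 2) := by
    have t1 : Tendsto (fun x : Phase d => ‖x.1 - q₀‖) (𝓝 xa) (𝓝 ‖xa.1 - q₀‖) :=
      (Continuous.tendsto (by fun_prop) _)
    have t2 : Tendsto (fun x : Phase d => ‖x.2 - p₀‖) (𝓝 xa) (𝓝 ‖xa.2 - p₀‖) :=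
      (Continuous.tendsto (by fun_prop) _)
    have t3 : Tendsto (fun x : Phase d => ‖x.1 + τ • x.2 - q₀‖) (𝓝 xa)
        (𝓝 ‖xa.1 + τ • xa.2 - q₀‖) := (Continuous.tendsto (by fun_prop) _)
    refine (t1.eventually_lt_const ?_).and ((t2.eventually_lt_const ?_).and
      (t3.eventually_lt_const ?_))
    · have : ‖xa.1 - q₀‖ = τ * ‖p₀‖ := by
        simp [hxa, norm_smul, abs_of_pos hτ.1]
      have h1 := lt_min hR hϱ₂
      rw [this]; nlinarith [hτ.1]
    · simpa [hxa] using hR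
    · simpa [hxa] using ⟨hϱ₃, hR⟩
  have hδc : ∀ᶠ ε in 𝓝[>] (0 : ℝ), delta r α ε ≤ c :=
    (tendsto_delta hα).eventually (Iic_mem_nhds hc)
  have hηc : ∀ᶠ ε in 𝓝[>] (0 : ℝ), eta r α ε < c := (tendsto_eta hα).eventually (Iio_mem_nhds hc)
  obtain ⟨K, hK, hK'⟩ := hclose'.closeZero (‖xa‖ + 1)
  have hxn : ∀ᶠ x in 𝓝 xa, ‖x‖ ≤ ‖xa‖ + 1 := by
    have : Tendsto (fun x : Phase d => ‖x‖) (𝓝 xa) (𝓝 ‖xa‖) := continuous_norm.tendsto _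
    exact this.eventually (Iic_mem_nhds (by linarith))
  -- the two stages
  have key : ∀ᶠ z in 𝓝[>] (0 : ℝ) ×ˢ 𝓝 xa, ∀ F, (F = 0 ∨ F = cutForce r α z.1 (Q z.1) q₀ R) →
      ∀ a, Continuous a → ∫ s in (0 : ℝ)..1, |a s| ≤ nu r α z.1 →
      ∃ xA xB : ℝ → State d,
        IsHit (Q z.1) F 0 xA (startHit c (Q z.1) z.2) ∧
        IsHit (Q z.1) 0 a xB (restart (eta r α z.1 - c) (xA 1)) ∧
        xB 1 = entrance (Q z.1) q₀ p₀ R σ k₀ c (eta r α z.1) F a z.2 ∧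
        (∀ s ∈ Icc (0 : ℝ) 1, ‖(xA s).1 - q₀‖ ≤ R / 2 ∧ ‖(xA s).2.1 - p₀‖ ≤ R / 2) ∧
        (∀ s ∈ Icc (0 : ℝ) 1, ‖(xB s).1 - q₀‖ ≤ R / 2 ∧ ‖(xB s).2.1 - p₀‖ ≤ R / 2) ∧
        (∀ s ∈ Icc (0 : ℝ) 1, Q z.1 (xA s).1 = Q z.1 z.2.1 + (c - Q z.1 z.2.1) * s) ∧
        (∀ s ∈ Icc (0 : ℝ) 1, Q z.1 (xB s).1 = c + s * (eta r α z.1 - c)) ∧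
        c < Q z.1 z.2.1 := by
    filter_upwards [hx.prod_inr _, hhit.prod_inl _, hn.prod_inl _, hn3.prod_inl _, hηc.prod_inl _,
      hw.prod_inl _, (eventually_nu hα (r := r)).prod_inl _] with z hx hhit hn hn3 hηc hw hν
    intro F hF a ha ha'
    have h1 : |Q z.1 z.2.1| < σ / 8 :=
      (hn _ (hx.1.trans (by linarith [min_le_right R ϱ₂, lt_min hR hϱ₂]))).1
    have hxR : ‖z.2.1 - q₀‖ ≤ R / 16 := hx.1.le.trans (by linarith [min_le_left R ϱ₂])
    have hQc : c < Q z.1 z.2.1 := by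
      have hl := (hw.line_le (q := z.2.1) (p := z.2.2) hτ.1.le (hx.2.1.le.trans (by linarith))
        (by simpa using hxR.trans (by linarith))
        (hx.2.2.le.trans (min_le_right _ _))).2.1 hk
      have h3 := (abs_lt.1 (hn3 _ (hx.2.2.trans_le (min_le_left _ _))).1).1
      rw [zero_smul, add_zero, sub_zero] at hl
      have : 3 / 4 * k₀ * τ = -3 * c := by rw [hcdef]; ring
      linarith
    have hlA : |c - Q z.1 z.2.1| ≤ σ / 2 := by
      rw [abs_le]; rw [abs_lt] at h1; constructor <;> linarith [h1.1, h1.2]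
    have hxA : ‖startHit c (Q z.1) z.2 - (q₀, p₀, 0, 0, 0)‖ ≤ R / 16 := by
      refine norm_state_sub_le (by positivity) hxR hx.2.1.le ?_ ?_ ?_
      · simp [startHit]; positivity
      · simp only [startHit, sub_zero]; linarith
      · simp [startHit]; positivity
    obtain ⟨A1, A2, A3⟩ := hhit F hF 0 continuous_const (by simpa using hν.2.1.le)
      (startHit c (Q z.1) z.2) (hxA.trans (by linarith)) hlA
    have hA1 := A2 1 (by simp)
    have hA1' : ‖(hitFlow (Q z.1) q₀ p₀ R σ k₀ F 0 1 (startHit c (Q z.1) z.2)) -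
        ((q₀, p₀, 0, 0, 0) : State d)‖ ≤ R / 8 := by
      refine (norm_sub_le_norm_sub_add_norm_sub _ (startHit c (Q z.1) z.2) _).trans ?_
      linarith
    have hη0 := eta_pos (r := r) hα hν.1
    have hlB : |eta r α z.1 - c| ≤ σ / 2 := by rw [abs_le]; constructor <;> linarith
    have hxB : ‖restart (eta r α z.1 - c) (hitFlow (Q z.1) q₀ p₀ R σ k₀ F 0 1
        (startHit c (Q z.1) z.2)) - (q₀, p₀, 0, 0, 0)‖ ≤ R / 8 := by
      have m1 := (norm_pos_le _ _).trans hA1'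
      have m2 := (norm_mom_le _ _).trans hA1'
      have m3 := (norm_time_le _ _).trans hA1'
      refine norm_state_sub_le (by positivity) m1 m2 m3 ?_ ?_
      · simp only [restart, sub_zero]; linarith
      · simp [restart]; positivity
    obtain ⟨B1, B2, B3⟩ := hhit 0 (Or.inl rfl) a ha ha' _ (hxB.trans (by linarith)) hlB
    have hA1Q := A1.level 1 (by simp)
    refine ⟨_, _, A1, B1, rfl, A3, B3, fun s hs => A1.level s hs, fun s hs => ?_, hQc⟩
    rw [B1.level s hs]
    have : Q z.1 (restart (eta r α z.1 - c) (hitFlow (Q z.1) q₀ p₀ R σ k₀ F 0 1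
        (startHit c (Q z.1) z.2))).1 = c := by
      refine hA1Q.trans ?_
      simp [startHit]
    rw [this]
    simp only [restart]; ring
  -- the straight motion
  have hb : ∀ᶠ z in 𝓝[>] (0 : ℝ) ×ˢ 𝓝 xa, 0 ≤ (B' z.1 z.2).2.2.1 ∧
      Q z.1 (B' z.1 z.2).1 = eta r α z.1 ∧ (B' z.1 z.2).2.1 = z.2.2 ∧
      (B' z.1 z.2).1 = z.2.1 + (B' z.1 z.2).2.2.1 • z.2.2 ∧
      ‖(B' z.1 z.2).1 - q₀‖ ≤ R / 2 := by
    filter_upwards [key, hw.prod_inl _, (eventually_nu hα (r := r)).prod_inl _, hηc.prod_inl _]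
      with z key hw hν hηc
    obtain ⟨xA, xB, A, B, hB1, A3, B3, A4, B4, hQc⟩ := key 0 (Or.inl rfl) 0 continuous_const
      (by simpa using hν.2.1.le)
    obtain ⟨pA, qA⟩ := A.straight hw (s := 1) (by simp)
    obtain ⟨pB, qB⟩ := B.straight hw (s := 1) (by simp)
    have mA := A.time_mono hw hk.ne A3 (by
      have : (startHit c (Q z.1) z.2).2.2.2.1 = c - Q z.1 z.2.1 := rfl
      rw [this]; nlinarith)
    have mB := B.time_mono hw hk.ne B3 (by
      have : (restart (eta r α z.1 - c) (xA 1)).2.2.2.1 = eta r α z.1 - c := rfl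
      rw [this]; nlinarith)
    simp only [restart] at pB qB mB
    simp only [startHit] at pA qA mA
    have e : B' z.1 z.2 = xB 1 := hB1.symm
    rw [e]
    refine ⟨mA.trans mB, by rw [B4 1 (by simp)]; ring, pB.trans pA, ?_, (B3 1 (by simp)).1⟩
    rw [qB, qA, pA, sub_zero, add_assoc, ← add_smul]
    congr 2; ring
  have hτB : Tendsto (fun z : ℝ × Phase d => (B' z.1 z.2).2.2.1) (𝓝[>] 0 ×ˢ 𝓝 xa) (𝓝 τ) := by
    have t3 : Tendsto (fun z : ℝ × Phase d => Q z.1 (z.2.1 + τ • z.2.2)) (𝓝[>] 0 ×ˢ 𝓝 xa)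
        (𝓝 0) := by
      refine h.tendsto_Q.comp (tendsto_fst.prodMk ?_)
      have : Tendsto (fun x : Phase d => x.1 + τ • x.2) (𝓝 xa) (𝓝 (xa.1 + τ • xa.2)) :=
        Continuous.tendsto (by fun_prop) _
      simp only [hxa, sub_add_cancel] at this
      exact this.comp tendsto_snd
    have t4 : Tendsto (fun z : ℝ × Phase d => 4 / (3 * |k₀|) *
        |Q z.1 (z.2.1 + τ • z.2.2) - eta r α z.1|) (𝓝[>] 0 ×ˢ 𝓝 xa) (𝓝 0) := by
      have := ((t3.sub ((tendsto_eta (r := r) hα).comp tendsto_fst)).abs).const_mul (4 / (3 * |k₀|))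
      simpa using this
    rw [tendsto_iff_norm_sub_tendsto_zero]
    refine squeeze_zero' (.of_forall fun _ => norm_nonneg _) ?_ t4
    filter_upwards [hb, hx.prod_inr _, hw.prod_inl _] with z hb hx hw
    obtain ⟨b1, b2, b3, b4, b5⟩ := hb
    rw [b4] at b2 b5
    have h2 : ‖z.2.1 + τ • z.2.2 - q₀‖ ≤ R / 2 := hx.2.2.le.trans (min_le_right _ _)
    have hp : ‖z.2.2 - p₀‖ ≤ R / 2 := hx.2.1.le.trans (by linarith)
    rw [Real.norm_eq_abs, div_mul_eq_mul_div, le_div_iff₀ (by positivity), hkabs]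
    rcases le_total τ (B' z.1 z.2).2.2.1 with hle | hle
    · have := (hw.line_le hle hp h2 b5).2.1 hk
      rw [b2] at this
      rw [abs_of_nonneg (sub_nonneg.2 hle)]
      linarith [le_abs_self (Q z.1 (z.2.1 + τ • z.2.2) - eta r α z.1)]
    · have := (hw.line_le hle hp b5 h2).2.1 hk
      rw [b2] at this
      rw [abs_of_nonpos (sub_nonpos.2 hle)]
      linarith [neg_abs_le (Q z.1 (z.2.1 + τ • z.2.2) - eta r α z.1)]
  refine ⟨fun ε x => (H' ε x).proj, fun ε x => (B' ε x).proj, hclose', ?_, 2 / |k₀| + K + 1,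
    by positivity, ?_⟩
  · have t1 : Tendsto (fun z : ℝ × Phase d => z.2.1 + (B' z.1 z.2).2.2.1 • z.2.2)
        (𝓝[>] 0 ×ˢ 𝓝 xa) (𝓝 q₀) := by
      have h1 : Tendsto (fun z : ℝ × Phase d => z.2.1) (𝓝[>] (0 : ℝ) ×ˢ 𝓝 xa) (𝓝 xa.1) :=
        (continuous_fst.tendsto _).comp tendsto_snd
      have h2 : Tendsto (fun z : ℝ × Phase d => z.2.2) (𝓝[>] (0 : ℝ) ×ˢ 𝓝 xa) (𝓝 xa.2) :=
        (continuous_snd.tendsto _).comp tendsto_snd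
      have := h1.add (hτB.smul h2)
      simpa [hxa] using this
    have t2 : Tendsto (fun z : ℝ × Phase d => z.2.2) (𝓝[>] (0 : ℝ) ×ˢ 𝓝 xa) (𝓝 p₀) :=
      (continuous_snd.tendsto _).comp tendsto_snd
    refine ((t1.prodMk_nhds t2).prodMk_nhds hτB).congr' ?_
    filter_upwards [hb] with z hb
    simp only [State.proj, hb.2.2.1, hb.2.2.2.1]
  · filter_upwards [key, hb, hx.prod_inr _, hw.prod_inl _, (eventually_nu hα (r := r)).prod_inl _,
      hηc.prod_inl _, hδc.prod_inl _, hK'.prod_inl _, hxn.prod_inr _]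
      with z key hb hx hw hν hηc hδc hK' hxn
    obtain ⟨b1, b2, b3, b4, b5⟩ := hb
    have hη0 := eta_pos (r := r) hα hν.1
    have hδ0 := delta_pos (r := r) (α := α) hν.1
    have hp : ‖z.2.2 - p₀‖ ≤ R / 2 := hx.2.1.le.trans (by linarith)
    obtain ⟨xA, xB, A, B, hB1, A3, B3, A4, B4, hQc⟩ := key _ (Or.inr rfl)
      (barrierRate r α z.1 c (eta r α z.1)) (continuous_barrierRate hα hν.1 _ _)
      (integral_barrierRate_le hα hν.1 hηc.le le_rfl)
    have hclose0 : |(xB 1).2.2.1 - (B' z.1 z.2).2.2.1| ≤ K * nu r α z.1 := by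
      have h1 := (hK' z.2 z.2 hxn hxn).2.2
      rw [sub_self, norm_zero, zero_add] at h1
      rw [hB1]
      exact (norm_snd_le ((H' z.1 z.2).proj - (B' z.1 z.2).proj)).trans h1
    have eH : H' z.1 z.2 = xB 1 := hB1.symm
    simp only [eH, State.proj]
    refine ⟨?_, by rw [B4 1 (by simp)]; ring, b2, by rw [b3, b4], fun t ht => ?_⟩
    · refine exists_isPath_entrance hw hk hRϱ hα hν.1 A B A3 B3 A4 B4 hQc hηc hδc ?_
      have h5 : 0 ≤ 2 / |k₀| * nu r α z.1 := mul_nonneg (by positivity) hν.2.1.le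
      have h6 : 0 ≤ K * delta r α z.1 := mul_nonneg hK hδ0.le
      have e : (2 / |k₀| + K + 1) * (nu r α z.1 + delta r α z.1) =
        2 / |k₀| * delta r α z.1 + K * nu r α z.1 + (2 / |k₀| * nu r α z.1 + K * delta r α z.1 +
          nu r α z.1 + delta r α z.1) := by ring
      rw [e]
      linarith only [hclose0, h5, h6, hν.2.1, hδ0]
    · have hz0 : ‖z.2.1 + (0 : ℝ) • z.2.2 - q₀‖ ≤ R / 2 := by
        rw [zero_smul, add_zero]
        exact hx.1.le.trans (by linarith [min_le_left R ϱ₂])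
      rw [b4] at b2 b5
      have ht' := (hw.line_le b1 hp hz0 b5).1 t ⟨ht.1, ht.2.le⟩
      refine ⟨ht'.trans_lt hRϱ, ?_⟩
      have := (hw.line_le ht.2.le hp ht' b5).2.1 hk
      rw [b2] at this
      have h2 : 0 < 3 / 4 * -k₀ * ((B' z.1 z.2).2.2.1 - t) :=
        mul_pos (mul_pos (by norm_num) (neg_pos.2 hk)) (sub_pos.2 ht.2)
      linarith only [this, h2]

end LocalBarrier

end Entrance

section Reflection

variable {d r : ℕ} {α : ℝ}

theorem eq_reflect {p p' G : Conf d} {c : ℝ} (h : p' = p + c • G) (hn : ‖p'‖ = ‖p‖)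
    (hp : ⟪p, G⟫_ℝ < 0) (hp' : 0 < ⟪p', G⟫_ℝ) : p' = reflect (‖G‖⁻¹ • G) p := by
  have hG : G ≠ 0 := by rintro rfl; simp at hp
  have hG' : 0 < ‖G‖ := norm_pos_iff.2 hG
  have h1 : ‖p'‖ ^ 2 = ‖p‖ ^ 2 + 2 * (c * ⟪p, G⟫_ℝ) + c ^ 2 * ‖G‖ ^ 2 := by
    rw [h, norm_add_sq_real, real_inner_smul_right, norm_smul, mul_pow, Real.norm_eq_abs, sq_abs]
  have hc : c ≠ 0 := by
    rintro rfl
    rw [h, zero_smul, add_zero] at hp'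
    linarith
  have h2 : c * (2 * ⟪p, G⟫_ℝ + c * ‖G‖ ^ 2) = 0 := by rw [hn] at h1; linear_combination -h1
  have h3 : c = -(2 * ⟪p, G⟫_ℝ) / ‖G‖ ^ 2 := by
    have := (mul_eq_zero.1 h2).resolve_left hc
    field_simp
    linarith
  rw [h, reflect, real_inner_smul_right, smul_smul, sub_eq_add_neg, ← neg_smul, h3]
  congr 2
  field_simp

/-- The first stage inside of the barrier. -/
theorem IsStage.inner_bounds {Q : Conf d → ℝ} {q₀ g : Conf d} {R S e e' M : ℝ}
    {μ : State d → ℝ} {G : State d → Vel d} {x : ℝ → State d} {y : Phase d}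
    (hx : IsStage (innerField Q q₀ R μ) G 0 x (y.1, y.2, 0, S, ‖y.2‖ ^ 2 / 2) M)
    (hS : 0 < S) (hG : ∀ s ∈ Icc (0 : ℝ) 1, ‖cutGrad Q q₀ R (x s) - g‖ ≤ e)
    (hμ : ∀ s ∈ Icc (0 : ℝ) 1, ‖μ (x s) • (x s).2.1‖ ≤ e' ∧ |μ (x s)| ≤ e')
    (hb : ⟪y.2, g⟫_ℝ + ‖y.2‖ * e + S * (‖g‖ + e) ^ 2 / 2 < 0) {s : ℝ} (hs : s ∈ Icc (0 : ℝ) 1) :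
    ‖(x s).1 - y.1‖ ≤ S * e' ∧ |(x s).2.2.1| ≤ S * e' ∧
    ‖(x s).2.1 - y.2 - (s * S) • g‖ ≤ s * S * e ∧
    ‖(x s).2.1‖ ^ 2 / 2 ≤ ‖y.2‖ ^ 2 / 2 ∧ (0 < s → ‖(x s).2.1‖ ^ 2 / 2 < ‖y.2‖ ^ 2 / 2) := by
  have he' : 0 ≤ e' := (abs_nonneg _).trans (hμ s hs).2
  have he : 0 ≤ e := (norm_nonneg _).trans (hG s hs)
  have hq : ∀ s ∈ Icc (0 : ℝ) 1, HasDerivWithinAt (fun s => (x s).1)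
      (S • (μ (x s) • (x s).2.1)) (Icc 0 1) s := fun s hs => by
    simpa [pad, innerField] using (hx.deriv s hs).fst'
  have hp : ∀ s ∈ Icc (0 : ℝ) 1, HasDerivWithinAt (fun s => (x s).2.1)
      (S • cutGrad Q q₀ R (x s)) (Icc 0 1) s := fun s hs => by
    simpa [pad, innerField] using (hx.deriv s hs).snd'.fst'
  have ht : ∀ s ∈ Icc (0 : ℝ) 1, HasDerivWithinAt (fun s => (x s).2.2.1)
      (S * μ (x s)) (Icc 0 1) s := fun s hs => by
    simpa [pad, innerField] using (hx.deriv s hs).snd'.snd'.fst'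
  have h0 : (0 : ℝ) ∈ Icc (0 : ℝ) 1 := by simp
  have hSe : S * e' * s ≤ S * e' := mul_le_of_le_one_right (by positivity) hs.2
  have b1 : ‖(x s).1 - y.1‖ ≤ S * e' * s := by
    have := (convex_Icc (0 : ℝ) 1).norm_image_sub_le_of_norm_hasDerivWithin_le (C := S * e') hq
      (fun s hs => by
        rw [norm_smul, Real.norm_of_nonneg hS.le]
        exact mul_le_mul_of_nonneg_left (hμ s hs).1 hS.le) h0 hs
    simpa [hx.init, abs_of_nonneg hs.1] using this
  have b2 : |(x s).2.2.1| ≤ S * e' * s := by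
    have := (convex_Icc (0 : ℝ) 1).norm_image_sub_le_of_norm_hasDerivWithin_le (C := S * e') ht
      (fun s hs => by
        rw [norm_mul, Real.norm_of_nonneg hS.le]
        exact mul_le_mul_of_nonneg_left (hμ s hs).2 hS.le) h0 hs
    simpa [hx.init, abs_of_nonneg hs.1] using this
  have b3 : ‖(x s).2.1 - y.2 - (s * S) • g‖ ≤ s * S * e := by
    have := (convex_Icc (0 : ℝ) 1).norm_image_sub_le_of_norm_hasDerivWithin_le (C := S * e)
      (f := fun s => (x s).2.1 - (s * S) • g)
      (f' := fun s => S • cutGrad Q q₀ R (x s) - (1 * S) • g)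
      (fun s hs => (hp s hs).sub (((hasDerivWithinAt_id s _).mul_const S).smul_const g))
      (fun s hs => by
        rw [one_mul, ← smul_sub, norm_smul, Real.norm_of_nonneg hS.le]
        exact mul_le_mul_of_nonneg_left (hG s hs) hS.le) h0 hs
    simp only [hx.init, zero_mul, zero_smul, sub_zero, Real.norm_of_nonneg hs.1] at this
    rw [sub_right_comm]
    linarith
  have b4 : ‖(x s).2.1‖ ^ 2 / 2 - ‖y.2‖ ^ 2 / 2 ≤
      s * S * (⟪y.2, g⟫_ℝ + ‖y.2‖ * e + S * (‖g‖ + e) ^ 2 / 2) := by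
    set E := (x s).2.1 - y.2 - (s * S) • g with hE
    have e1 : (x s).2.1 = y.2 + ((s * S) • g + E) := by rw [hE]; abel
    have hsS : 0 ≤ s * S := mul_nonneg hs.1 hS.le
    have hD : ‖(s * S) • g + E‖ ≤ s * S * (‖g‖ + e) := by
      refine (norm_add_le _ _).trans ?_
      rw [norm_smul, Real.norm_of_nonneg hsS]
      linarith
    have hD2 : ‖(s * S) • g + E‖ ^ 2 ≤ s * S * (S * (‖g‖ + e) ^ 2) := by
      refine (pow_le_pow_left₀ (norm_nonneg _) hD 2).trans ?_
      have : (s * S * (‖g‖ + e)) ^ 2 = s * (s * S * (S * (‖g‖ + e) ^ 2)) := by ring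
      rw [this]
      exact mul_le_of_le_one_left (by positivity) hs.2
    have hI : ⟪y.2, E⟫_ℝ ≤ ‖y.2‖ * (s * S * e) :=
      (real_inner_le_norm _ _).trans (mul_le_mul_of_nonneg_left b3 (norm_nonneg _))
    rw [e1, norm_add_sq_real, inner_add_right, real_inner_smul_right]
    nlinarith
  refine ⟨b1.trans hSe, b2.trans hSe, b3, ?_, fun h0 => ?_⟩
  · nlinarith [mul_nonneg hs.1 hS.le]
  · have := mul_neg_of_pos_of_neg (mul_pos h0 hS) hb
    linarith

/-- The derivatives along a stage in which the kinetic energy is the independent variable. -/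
theorem IsStage.inner_hit {Q : Conf d → ℝ} {q₀ p₀ : Conf d} {R k₀ M : ℝ}
    (h : IsWindow Q q₀ p₀ R k₀) (hk : k₀ ≠ 0) {μ : State d → ℝ} {G : State d → Vel d}
    {x : ℝ → State d} {x₀ : State d}
    (hx : IsStage (fun x => invRate Q q₀ R k₀ x • innerField Q q₀ R μ x) G 0 x x₀ M)
    (hin : ∀ s ∈ Icc (0 : ℝ) 1, ‖(x s).1 - q₀‖ ≤ R / 2 ∧ ‖(x s).2.1 - p₀‖ ≤ R / 2) :
    (∀ s ∈ Icc (0 : ℝ) 1, HasDerivWithinAt (fun s => (x s).1)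
      ((x₀.2.2.2.1 * (⟪(x s).2.1, gradient Q (x s).1⟫_ℝ)⁻¹ * μ (x s)) • (x s).2.1)
        (Icc 0 1) s) ∧
    (∀ s ∈ Icc (0 : ℝ) 1, HasDerivWithinAt (fun s => (x s).2.1)
      ((x₀.2.2.2.1 * (⟪(x s).2.1, gradient Q (x s).1⟫_ℝ)⁻¹) • gradient Q (x s).1) (Icc 0 1) s) ∧
    (∀ s ∈ Icc (0 : ℝ) 1, HasDerivWithinAt (fun s => (x s).2.2.1)
      (x₀.2.2.2.1 * (⟪(x s).2.1, gradient Q (x s).1⟫_ℝ)⁻¹ * μ (x s)) (Icc 0 1) s) ∧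
    ∀ s ∈ Icc (0 : ℝ) 1, ‖(x s).2.1‖ ^ 2 / 2 = ‖x₀.2.1‖ ^ 2 / 2 + x₀.2.2.2.1 * s := by
  have hmom : ∀ s ∈ Icc (0 : ℝ) 1, HasDerivWithinAt (fun s => (x s).2.1)
      ((x₀.2.2.2.1 * (⟪(x s).2.1, gradient Q (x s).1⟫_ℝ)⁻¹) • gradient Q (x s).1)
      (Icc 0 1) s := by
    intro s hs
    refine (hx.deriv s hs).snd'.fst'.congr_deriv ?_
    simp [pad, innerField, h.invRate_eq (hin s hs).1 (hin s hs).2, h.cutGrad_eq (hin s hs).1,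
      smul_smul]
  refine ⟨fun s hs => ?_, hmom, fun s hs => ?_, fun s hs => ?_⟩
  · refine (hx.deriv s hs).fst'.congr_deriv ?_
    simp [pad, innerField, h.invRate_eq (hin s hs).1 (hin s hs).2, smul_smul, mul_assoc]
  · refine (hx.deriv s hs).snd'.snd'.fst'.congr_deriv ?_
    simp [pad, innerField, h.invRate_eq (hin s hs).1 (hin s hs).2, mul_assoc]
  · have := eq_of_hasDerivWithinAt_zero (x := fun s => ‖(x s).2.1‖ ^ 2 / 2 - x₀.2.2.2.1 * s)
      (fun s hs => ?_) hs
    · simp only [hx.init, mul_zero, sub_zero] at this; linarith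
    · have h1 := (hmom s hs).norm_sq.div_const 2
      have h2 := (hasDerivWithinAt_id s (Icc (0 : ℝ) 1)).const_mul x₀.2.2.2.1
      refine (h1.sub h2).congr_deriv ?_
      have hne := h.rate_ne hk (hin s hs).1 (hin s hs).2
      rw [real_inner_smul_right]
      field_simp
      ring

/-- Inside of the barrier, in the limit of a hard wall, the momentum moves along the gradient. -/
theorem exists_add_smul {G : Conf d} {p : ℝ → Conf d} {c : ℝ → ℝ}
    (hp : ∀ s ∈ Icc (0 : ℝ) 1, HasDerivWithinAt p (c s • G) (Icc 0 1) s) (hG : G ≠ 0) :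
    ∃ a : ℝ, p 1 = p 0 + a • G := by
  have := eq_of_hasDerivWithinAt_zero (x := fun s => p s - (⟪G, p s⟫_ℝ / ‖G‖ ^ 2) • G)
    (fun s hs => ?_) (t := 1) (by simp)
  · refine ⟨⟪G, p 1⟫_ℝ / ‖G‖ ^ 2 - ⟪G, p 0⟫_ℝ / ‖G‖ ^ 2, ?_⟩
    rw [sub_smul]
    rw [← sub_eq_zero] at this ⊢
    rw [← this]; abel
  · have h1 : HasDerivWithinAt (fun s => ⟪G, p s⟫_ℝ) ⟪G, c s • G⟫_ℝ (Icc 0 1) s :=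
      (innerSL ℝ G).hasFDerivAt.comp_hasDerivWithinAt s (hp s hs)
    refine ((hp s hs).sub ((h1.div_const (‖G‖ ^ 2)).smul_const G)).congr_deriv ?_
    have : ‖G‖ ≠ 0 := norm_ne_zero_iff.2 hG
    rw [real_inner_smul_right, real_inner_self_eq_norm_sq, mul_div_assoc, div_self (by positivity),
      mul_one, sub_self]

end Reflection

section Reflection

variable {d r : ℕ} {α : ℝ}

/-- The initial state of the motion inside of the barrier. -/
def reflectStart (S : ℝ) (y : Phase d) : State d := (y.1, y.2, 0, S, ‖y.2‖ ^ 2 / 2)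

/-- The initial state of the stage in which the kinetic energy returns to its initial value. -/
def reflectRestart (x : State d) : State d :=
  (x.1, x.2.1, x.2.2.1, x.2.2.2.2 - ‖x.2.1‖ ^ 2 / 2, x.2.2.2.2)

/-- The first stage inside of the barrier. -/
def pushFlow (Q : Conf d → ℝ) (q₀ p₀ : Conf d) (R' R S : ℝ) (μ : State d → ℝ) :
    ℝ → State d → State d :=
  stageFlow (q₀, p₀, 0, 0, ‖p₀‖ ^ 2 / 2) R (2 * S) (innerField Q q₀ R' μ) 0 0

/-- The second stage inside of the barrier. -/
def returnFlow (Q : Conf d → ℝ) (q₀ p₀ : Conf d) (w R σ k : ℝ) (μ : State d → ℝ) :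
    ℝ → State d → State d :=
  stageFlow (q₀, p₀, 0, 0, w) R σ (fun x => invRate Q q₀ R k x • innerField Q q₀ R μ x) 0 0

/-- The position, the levels and the times on a path inside of the barrier. -/
def ReflectionProp (Q : Conf d → ℝ) (q₀ : Conf d) (ϱ e T t : ℝ) (y : Phase d) : Prop :=
  ‖y.1 - q₀‖ < ϱ ∧ 0 < Q y.1 ∧ Q y.1 ≤ e ∧ (0 < t → t < T → Q y.1 < e)

/-- The two stages of a reflection, for a given inverse force `μ`. -/
structure IsReflection (Q : Conf d → ℝ) (q₀ p₀ : Conf d) (R' R k S : ℝ) (μ : State d → ℝ)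
    (y : Phase d) (x₁ x₂ : ℝ → State d) : Prop where
  window : IsWindow Q q₀ p₀ R k
  stage₁ : ∃ M, IsStage (innerField Q q₀ R' μ) 0 0 x₁ (reflectStart S y) M
  stage₂ : ∃ M, IsStage (fun x => invRate Q q₀ R k x • innerField Q q₀ R μ x) 0 0 x₂
    (reflectRestart (x₁ 1)) M
  near₁ : ∀ s ∈ Icc (0 : ℝ) 1, ‖(x₁ s).1 - q₀‖ ≤ R' / 2 ∧ ‖(x₁ s).1 - q₀‖ ≤ R / 2
  near₂ : ∀ s ∈ Icc (0 : ℝ) 1, ‖(x₂ s).1 - q₀‖ ≤ R / 2 ∧ ‖(x₂ s).2.1 - p₀‖ ≤ R / 2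
  energy : ∀ s ∈ Icc (0 : ℝ) 1, ‖(x₁ s).2.1‖ ^ 2 / 2 ≤ ‖y.2‖ ^ 2 / 2 ∧
    (0 < s → ‖(x₁ s).2.1‖ ^ 2 / 2 < ‖y.2‖ ^ 2 / 2)

theorem IsReflection.final {Q : Conf d → ℝ} {q₀ p₀ : Conf d} {R' R k S : ℝ} (hk : 0 < k)
    {y : Phase d} {x₁ x₂ : ℝ → State d} (hx : IsReflection Q q₀ p₀ R' R k S 0 y x₁ x₂)
    (hy : ⟪y.2, gradient Q y.1⟫_ℝ < 0) :
    (x₂ 1).proj = ((y.1, reflect (‖gradient Q y.1‖⁻¹ • gradient Q y.1) y.2), 0) := by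
  obtain ⟨M₁, h₁⟩ := hx.stage₁
  obtain ⟨M₂, h₂⟩ := hx.stage₂
  have h1 : (1 : ℝ) ∈ Icc (0 : ℝ) 1 := by simp
  have q1 : ∀ s ∈ Icc (0 : ℝ) 1, (x₁ s).1 = y.1 := by
    intro s hs
    have := eq_of_hasDerivWithinAt_zero (x := fun s => (x₁ s).1) (fun s hs => by
      simpa [pad, innerField] using (h₁.deriv s hs).fst') hs
    simpa [h₁.init, reflectStart] using this
  have t1 : ∀ s ∈ Icc (0 : ℝ) 1, (x₁ s).2.2.1 = 0 := by
    intro s hs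
    have := eq_of_hasDerivWithinAt_zero (x := fun s => (x₁ s).2.2.1) (fun s hs => by
      simpa [pad, innerField] using (h₁.deriv s hs).snd'.snd'.fst') hs
    simpa [h₁.init, reflectStart] using this
  obtain ⟨d1, d2, d3, d4⟩ := h₂.inner_hit hx.window hk.ne' hx.near₂
  have q2 : ∀ s ∈ Icc (0 : ℝ) 1, (x₂ s).1 = y.1 := by
    intro s hs
    have := eq_of_hasDerivWithinAt_zero (x := fun s => (x₂ s).1) (fun s hs => by
      simpa using d1 s hs) hs
    rw [this, h₂.init]
    exact q1 1 h1
  have t2 : ∀ s ∈ Icc (0 : ℝ) 1, (x₂ s).2.2.1 = 0 := by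
    intro s hs
    have := eq_of_hasDerivWithinAt_zero (x := fun s => (x₂ s).2.2.1) (fun s hs => by
      simpa using d3 s hs) hs
    rw [this, h₂.init]
    exact t1 1 h1
  have hG : gradient Q y.1 ≠ 0 := by intro h0; rw [h0] at hy; simp at hy
  obtain ⟨a₁, ha₁⟩ := exists_add_smul (G := gradient Q y.1) (p := fun s => (x₁ s).2.1)
    (c := fun _ => S) (fun s hs => by
      have e : cutGrad Q q₀ R' (x₁ s) = gradient Q y.1 := by
        rw [cutGrad, retr_eq_self (hx.near₁ s hs).1, q1 s hs]
      simpa [pad, innerField, e, reflectStart] using (h₁.deriv s hs).snd'.fst') hG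
  obtain ⟨a₂, ha₂⟩ := exists_add_smul (G := gradient Q y.1) (p := fun s => (x₂ s).2.1)
    (fun s hs => by
      have := d2 s hs
      rw [q2 s hs] at this
      exact this) hG
  have e1 : (x₁ 0).2.1 = y.2 := by rw [h₁.init]; rfl
  have e2 : (x₂ 0).2.1 = (x₁ 1).2.1 := by rw [h₂.init]; rfl
  rw [e1] at ha₁
  rw [e2, ha₁, add_assoc, ← add_smul] at ha₂
  have hn : ‖(x₂ 1).2.1‖ = ‖y.2‖ := by
    have := d4 1 h1
    have e3 : (reflectRestart (x₁ 1)).2.2.2.1 = (x₁ 1).2.2.2.2 - ‖(x₁ 1).2.1‖ ^ 2 / 2 := rfl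
    have e4 : (reflectRestart (x₁ 1)).2.1 = (x₁ 1).2.1 := rfl
    have e5 : (x₁ 1).2.2.2.2 = ‖y.2‖ ^ 2 / 2 := h₁.energy 1 h1
    rw [e3, e4, e5] at this
    exact (sq_eq_sq₀ (norm_nonneg _) (norm_nonneg _)).1 (by linarith)
  have hpos := (hx.window.rate_bounds (hx.near₂ 1 h1).1 (hx.near₂ 1 h1).2).2 hk
  rw [q2 1 h1] at hpos
  have := eq_reflect ha₂ hn hy (by linarith)
  rw [State.proj, q2 1 h1, t2 1 h1, this]

theorem IsReflection.exists_isPath {Q : Conf d → ℝ} {q₀ p₀ : Conf d} {R' R k S ϱ ε : ℝ}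
    (hα : 0 < α) (hε : 0 < ε) (hS : 0 < S) (hk : 0 < k) (hR : R / 2 < ϱ)
    {y : Phase d} {x₁ x₂ : ℝ → State d}
    (hx : IsReflection Q q₀ p₀ R' R k S (cutPush r α ε) y x₁ x₂)
    (hy : ⟪y.2, gradient Q y.1⟫_ℝ < 0) (hQ : Q y.1 = eta r α ε) :
    (∃ γ, IsPath (barrierField α ε Q) (ReflectionProp Q q₀ ϱ (eta r α ε) (x₂ 1).2.2.1) 0
      (x₂ 1).2.2.1 y ((x₂ 1).1, (x₂ 1).2.1) γ) ∧ Q (x₂ 1).1 = eta r α ε ∧ 0 < (x₂ 1).2.2.1 := by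
  obtain ⟨M₁, h₁⟩ := hx.stage₁
  obtain ⟨M₂, h₂⟩ := hx.stage₂
  have m0 : (0 : ℝ) ∈ Icc (0 : ℝ) 1 := by simp
  have m1 : (1 : ℝ) ∈ Icc (0 : ℝ) 1 := by simp
  have hν := nu_pos (r := r) (α := α) hε
  obtain ⟨d1, d2, d3, d4⟩ := h₂.inner_hit hx.window hk.ne' hx.near₂
  set w := ‖y.2‖ ^ 2 / 2 with hw
  have w1 : ∀ s ∈ Icc (0 : ℝ) 1, (x₁ s).2.2.2.2 = w := fun s hs => h₁.energy s hs
  have w2 : ∀ s ∈ Icc (0 : ℝ) 1, (x₂ s).2.2.2.2 = w := fun s hs =>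
    (h₂.energy s hs).trans (w1 1 m1)
  set l := w - ‖(x₁ 1).2.1‖ ^ 2 / 2 with hl
  have l0 : 0 < l := by have := (hx.energy 1 m1).2 one_pos; linarith
  have el : (reflectRestart (x₁ 1)).2.2.2.1 = l := by
    change (x₁ 1).2.2.2.2 - ‖(x₁ 1).2.1‖ ^ 2 / 2 = l
    rw [w1 1 m1]
  rw [el] at d1 d2 d3 d4
  have v2 : ∀ s ∈ Icc (0 : ℝ) 1, ‖(x₂ s).2.1‖ ^ 2 / 2 = w - l * (1 - s) := by
    intro s hs
    have : (reflectRestart (x₁ 1)).2.1 = (x₁ 1).2.1 := rfl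
    rw [d4 s hs, this, hl]; ring
  have cp1 : ∀ s ∈ Icc (0 : ℝ) 1, cutPush r α ε (x₁ s) =
      ε / α * (nu r α ε + w - ‖(x₁ s).2.1‖ ^ 2 / 2) ^ (-(1 / α) - 1) := by
    intro s hs
    rw [cutPush_eq hα hε (by rw [w1 s hs]; exact (hx.energy s hs).1), w1 s hs]
  have v2' : ∀ s ∈ Icc (0 : ℝ) 1, ‖(x₂ s).2.1‖ ^ 2 / 2 ≤ w := fun s hs => by
    rw [v2 s hs]; nlinarith [hs.2]
  have cp2 : ∀ s ∈ Icc (0 : ℝ) 1, cutPush r α ε (x₂ s) =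
      ε / α * (nu r α ε + w - ‖(x₂ s).2.1‖ ^ 2 / 2) ^ (-(1 / α) - 1) := by
    intro s hs
    rw [cutPush_eq hα hε (by rw [w2 s hs]; exact v2' s hs), w2 s hs]
  have eη : eta r α ε = invBarrier α ε (nu r α ε) := rfl
  have prop : ∀ (t : ℝ) (q p : Conf d), ‖q - q₀‖ ≤ R / 2 →
      Q q = invBarrier α ε (nu r α ε + w - ‖p‖ ^ 2 / 2) → ‖p‖ ^ 2 / 2 ≤ w →
      (0 < t → t < (x₂ 1).2.2.1 → ‖p‖ ^ 2 / 2 < w) →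
      ReflectionProp Q q₀ ϱ (eta r α ε) (x₂ 1).2.2.1 t (q, p) := by
    intro t q p hq hQ hp hp'
    refine ⟨hq.trans_lt hR, ?_, ?_, fun h1 h2 => ?_⟩
    · simp only [hQ]; exact invBarrier_pos hε (by linarith)
    · simp only [hQ]
      rcases hp.eq_or_lt with h | h
      · rw [h, add_sub_cancel_right]; exact le_rfl
      · rw [eη]; exact (invBarrier_lt hα hε hν (by linarith)).le
    · simp only [hQ]
      rw [eη]; exact invBarrier_lt hα hε hν (by linarith [hp' h1 h2])
  have c2 : ∀ s ∈ Icc (0 : ℝ) 1, 0 < l * (⟪(x₂ s).2.1, gradient Q (x₂ s).1⟫_ℝ)⁻¹ := fun s hs =>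
    hx.window.mul_inv_pos hk.ne' (hx.near₂ s hs).1 (hx.near₂ s hs).2 (mul_pos l0 hk)
  have i1 : x₁ 0 = reflectStart S y := h₁.init
  have i2 : x₂ 0 = reflectRestart (x₁ 1) := h₂.init
  obtain ⟨L1, γ₁, hγ₁⟩ := exists_isPath_inner (w := w) (ν := nu r α ε) hα hε hx.window.diff
    (P := ReflectionProp Q q₀ ϱ (eta r α ε) (x₂ 1).2.2.1)
    (q := fun s => (x₁ s).1) (p := fun s => (x₁ s).2.1) (t := fun s => (x₁ s).2.2.1)
    (c := fun _ => S) (fun _ _ => hS) (fun s hs => by linarith [(hx.energy s hs).1])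
    (fun s hs => by
      rw [← cp1 s hs]
      simpa [pad, innerField, smul_smul, reflectStart] using (h₁.deriv s hs).fst')
    (fun s hs => by
      have e : cutGrad Q q₀ R' (x₁ s) = gradient Q (x₁ s).1 := by
        rw [cutGrad, retr_eq_self (hx.near₁ s hs).1]
      simpa [pad, innerField, e, reflectStart] using (h₁.deriv s hs).snd'.fst')
    (fun s hs => by
      rw [← cp1 s hs]
      simpa [pad, innerField, reflectStart] using (h₁.deriv s hs).snd'.snd'.fst')
    (by simp only [i1, reflectStart]; rw [hQ, ← hw, add_sub_cancel_right, eη])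
    (fun s hs hQs => prop _ _ _ (hx.near₁ s hs).2 hQs (hx.energy s hs).1 fun ht _ =>
      (hx.energy s hs).2 (lt_of_le_of_ne hs.1 (by
        rintro rfl
        simp [i1, reflectStart] at ht)))
  obtain ⟨L2, γ₂, hγ₂⟩ := exists_isPath_inner (w := w) (ν := nu r α ε) hα hε hx.window.diff
    (P := ReflectionProp Q q₀ ϱ (eta r α ε) (x₂ 1).2.2.1)
    (q := fun s => (x₂ s).1) (p := fun s => (x₂ s).2.1) (t := fun s => (x₂ s).2.2.1)
    (c := fun s => l * (⟪(x₂ s).2.1, gradient Q (x₂ s).1⟫_ℝ)⁻¹) c2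
    (fun s hs => by linarith [v2' s hs])
    (fun s hs => by rw [← cp2 s hs]; exact d1 s hs) d2
    (fun s hs => by rw [← cp2 s hs]; exact d3 s hs)
    (by simp only [i2, reflectRestart]; exact L1 1 m1)
    (fun s hs hQs => prop _ _ _ (hx.near₂ s hs).1 hQs (v2' s hs) fun _ ht => by
      have : s < 1 := lt_of_le_of_ne hs.2 (by rintro rfl; exact lt_irrefl _ ht)
      rw [v2 s hs]
      have := mul_pos l0 (sub_pos.2 this)
      linarith)
  simp only [i1, i2, reflectStart, reflectRestart] at hγ₁ hγ₂
  have hex : ∃ γ, IsPath (barrierField α ε Q) (ReflectionProp Q q₀ ϱ (eta r α ε)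
      (x₂ 1).2.2.1) 0 (x₂ 1).2.2.1 y ((x₂ 1).1, (x₂ 1).2.1) γ := ⟨_, hγ₁.concat hγ₂⟩
  obtain ⟨γ, hγ⟩ := hex
  refine ⟨⟨γ, hγ⟩, ?_, lt_of_le_of_ne hγ.le fun h0 => ?_⟩
  · have := L2 1 m1
    rw [this, v2 1 m1, eη]
    congr 1; ring
  · have e := hγ.left.symm.trans ((congrArg γ h0).trans hγ.right)
    have hpos := (hx.window.rate_bounds (hx.near₂ 1 m1).1 (hx.near₂ 1 m1).2).2 hk
    have e1 : y.1 = (x₂ 1).1 := congrArg Prod.fst e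
    have e2 : y.2 = (x₂ 1).2.1 := congrArg Prod.snd e
    rw [e1, e2] at hy
    linarith

end Reflection

section Reflection

variable {d r : ℕ} {α : ℝ}

/-- The final state of the motion inside of the barrier. -/
def reflectionMap (Q : Conf d → ℝ) (q₀ p₀ p₁ : Conf d) (R₁' R₁ S R σ k : ℝ) (μ : State d → ℝ)
    (y : Phase d) : State d :=
  returnFlow Q q₀ p₁ (‖p₀‖ ^ 2 / 2) R σ k μ 1
    (reflectRestart (pushFlow Q q₀ p₀ R₁' R₁ S μ 1 (reflectStart S y)))

theorem exists_isStage_push {Q : Conf d → ℝ} {q₀ p₀ g : Conf d} {R' R S e e' : ℝ}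
    {μ : State d → ℝ} {y : Phase d} (hS : 0 < S) (hRdef : R = 8 * S * (‖g‖ + e + 1) + 4)
    (he'0 : 0 < e') (he'1 : e' ≤ 1) (he : 0 ≤ e)
    (hG : ∀ x : State d, ‖cutGrad Q q₀ R' x - g‖ ≤ e)
    (hμ : ∀ x : State d, ‖x - (q₀, p₀, 0, 0, ‖p₀‖ ^ 2 / 2)‖ < R →
      ‖μ x • x.2.1‖ ≤ e' ∧ |μ x| ≤ e')
    (hZ : ContDiff ℝ 1 (innerField Q q₀ R' μ)) (hyq : ‖y.1 - q₀‖ < 1) (hyp : ‖y.2 - p₀‖ < 1)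
    (hen : |‖y.2‖ ^ 2 / 2 - ‖p₀‖ ^ 2 / 2| ≤ 1)
    (hbr : ⟪y.2, g⟫_ℝ + ‖y.2‖ * e + S * (‖g‖ + e) ^ 2 / 2 < 0) :
    ∃ x₁ : ℝ → State d, x₁ 1 = pushFlow Q q₀ p₀ R' R S μ 1 (reflectStart S y) ∧
      (∃ M, IsStage (innerField Q q₀ R' μ) 0 0 x₁ (reflectStart S y) M) ∧
      (∀ s ∈ Icc (0 : ℝ) 1, (x₁ s).2.2.2.2 = ‖y.2‖ ^ 2 / 2) ∧
      ∀ s ∈ Icc (0 : ℝ) 1, ‖(x₁ s).1 - y.1‖ ≤ S * e' ∧ |(x₁ s).2.2.1| ≤ S * e' ∧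
        ‖(x₁ s).2.1 - y.2 - (s * S) • g‖ ≤ s * S * e ∧
        ‖(x₁ s).2.1‖ ^ 2 / 2 ≤ ‖y.2‖ ^ 2 / 2 ∧
        (0 < s → ‖(x₁ s).2.1‖ ^ 2 / 2 < ‖y.2‖ ^ 2 / 2) := by
  have hSK : S * (‖g‖ + e + 1) = (R - 4) / 8 := by rw [hRdef]; ring
  have hg := norm_nonneg g
  have h0 : 0 < S * (‖g‖ + e + 1) := by positivity
  have hR : 0 < R := by linarith
  have h1R : 1 ≤ R / 4 := by linarith
  have hs1 : ‖reflectStart S y - (q₀, p₀, 0, 0, ‖p₀‖ ^ 2 / 2)‖ ≤ R / 4 := by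
    refine norm_state_sub_le (by positivity) (hyq.le.trans h1R) (hyp.le.trans h1R) ?_ ?_
      (hen.trans h1R)
    · simp only [reflectStart, sub_zero, abs_zero]; positivity
    · simp only [reflectStart, sub_zero, abs_of_pos hS]
      nlinarith
  have st₁ : IsStage (innerField Q q₀ R' μ) 0 0
      (fun s => pushFlow Q q₀ p₀ R' R S μ s (reflectStart S y)) (reflectStart S y)
      (2 * S * (‖g‖ + e + 1) + (∫ s in (0 : ℝ)..1, |(0 : ℝ → ℝ) s|) * 0) := by
    refine isStage_stageFlow hR (by positivity) hZ contDiff_const continuous_const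
      (fun x hx => ?_) (by simp) hs1 ?_ ?_
    · have := hμ x hx
      refine max_le (this.1.trans (by linarith)) (max_le ?_ (this.2.trans (by linarith)))
      have h2 := norm_le_norm_add_norm_sub' (cutGrad Q q₀ R' x) g
      simp only [innerField]
      linarith [hG x]
    · change |S| ≤ _; rw [abs_of_pos hS]; linarith
    · rw [mul_zero, add_zero]; linarith
  obtain ⟨x₁, ex₁, st₁⟩ : ∃ x₁ : ℝ → State d,
      x₁ 1 = pushFlow Q q₀ p₀ R' R S μ 1 (reflectStart S y) ∧
      IsStage (innerField Q q₀ R' μ) 0 0 x₁ (reflectStart S y)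
        (2 * S * (‖g‖ + e + 1) + (∫ s in (0 : ℝ)..1, |(0 : ℝ → ℝ) s|) * 0) := ⟨_, rfl, st₁⟩
  have hin1 : ∀ s ∈ Icc (0 : ℝ) 1, ‖x₁ s - (q₀, p₀, 0, 0, ‖p₀‖ ^ 2 / 2)‖ < R := by
    intro s hs
    have h1 := st₁.dist s hs
    rw [mul_zero, add_zero] at h1
    have := norm_sub_le_norm_sub_add_norm_sub (x₁ s) (reflectStart S y)
      (q₀, p₀, 0, 0, ‖p₀‖ ^ 2 / 2)
    linarith
  refine ⟨x₁, ex₁, ⟨_, st₁⟩, st₁.energy, fun s hs => ?_⟩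
  exact st₁.inner_bounds (y := y) hS (fun s _ => hG _) (fun s hs => hμ _ (hin1 s hs)) hbr hs

theorem exists_isStage_return {Q : Conf d → ℝ} {q₀ p₁ : Conf d} {w w₀ R σ k K : ℝ}
    {μ : State d → ℝ} {x : State d} (hR : 0 < R) (hσ : 0 < σ) (hσR : σ ≤ R / 16)
    (hσK : σ * K ≤ R / 16)
    (hZK : ∀ x : State d, ‖x - (q₀, p₁, 0, 0, w₀)‖ < R →
      ‖invRate Q q₀ R k x • innerField Q q₀ R μ x‖ ≤ K)
    (hZ : ContDiff ℝ 1 fun x => invRate Q q₀ R k x • innerField Q q₀ R μ x)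
    (hx : ‖x.1 - q₀‖ ≤ R / 8) (hp : ‖x.2.1 - p₁‖ ≤ R / 8) (ht : |x.2.2.1| ≤ R / 8)
    (hw : x.2.2.2.2 = w) (hwp : |w - ‖x.2.1‖ ^ 2 / 2| ≤ σ / 2) (hww : |w - w₀| ≤ R / 8) :
    ∃ x₂ : ℝ → State d, x₂ 1 = returnFlow Q q₀ p₁ w₀ R σ k μ 1 (reflectRestart x) ∧
      (∃ M, IsStage (fun x => invRate Q q₀ R k x • innerField Q q₀ R μ x) 0 0 x₂
        (reflectRestart x) M) ∧
      ∀ s ∈ Icc (0 : ℝ) 1, ‖(x₂ s).1 - q₀‖ ≤ R / 2 ∧ ‖(x₂ s).2.1 - p₁‖ ≤ R / 2 := by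
  have hs2 : ‖reflectRestart x - (q₀, p₁, 0, 0, w₀)‖ ≤ R / 8 := by
    refine norm_state_sub_le (by positivity) hx hp ?_ ?_ ?_
    · simpa only [reflectRestart, sub_zero] using ht
    · simp only [reflectRestart, sub_zero, hw]; linarith
    · simpa only [reflectRestart, hw] using hww
  have st₂ : IsStage (fun x => invRate Q q₀ R k x • innerField Q q₀ R μ x) 0 0
      (fun s => returnFlow Q q₀ p₁ w₀ R σ k μ s (reflectRestart x))
      (reflectRestart x) (σ * K + (∫ s in (0 : ℝ)..1, |(0 : ℝ → ℝ) s|) * 0) := by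
    refine isStage_stageFlow hR hσ hZ contDiff_const continuous_const (fun x hx => hZK x hx)
      (by simp) (hs2.trans (by linarith)) ?_ ?_
    · simp only [reflectRestart, hw]; exact hwp
    · rw [mul_zero, add_zero]; linarith
  obtain ⟨x₂, ex₂, st₂⟩ : ∃ x₂ : ℝ → State d,
      x₂ 1 = returnFlow Q q₀ p₁ w₀ R σ k μ 1 (reflectRestart x) ∧
      IsStage (fun x => invRate Q q₀ R k x • innerField Q q₀ R μ x) 0 0 x₂
        (reflectRestart x) (σ * K + (∫ s in (0 : ℝ)..1, |(0 : ℝ → ℝ) s|) * 0) :=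
    ⟨_, rfl, st₂⟩
  have hin2 : ∀ s ∈ Icc (0 : ℝ) 1, ‖x₂ s - (q₀, p₁, 0, 0, w₀)‖ ≤ R / 2 := by
    intro s hs
    have h1 := st₂.dist s hs
    rw [mul_zero, add_zero] at h1
    have := norm_sub_le_norm_sub_add_norm_sub (x₂ s) (reflectRestart x) (q₀, p₁, 0, 0, w₀)
    linarith
  have hin3 : ∀ s ∈ Icc (0 : ℝ) 1, ‖(x₂ s).1 - q₀‖ ≤ R / 2 := fun s hs =>
    (norm_pos_le (x₂ s) (q₀, p₁, 0, 0, w₀)).trans (hin2 s hs)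
  have hin4 : ∀ s ∈ Icc (0 : ℝ) 1, ‖(x₂ s).2.1 - p₁‖ ≤ R / 2 := fun s hs =>
    (norm_mom_le (x₂ s) (q₀, p₁, 0, 0, w₀)).trans (hin2 s hs)
  exact ⟨x₂, ex₂, ⟨_, st₂⟩, fun s hs => ⟨hin3 s hs, hin4 s hs⟩⟩

theorem exists_isReflection_of_bounds {Q : Conf d → ℝ} {q₀ p₀ p₁ g : Conf d}
    {R₁' R₁ R S σ k K e e' e₂ : ℝ} {μ : State d → ℝ} {y : Phase d} (hR₁'0 : 0 < R₁') (hR₁'R : R₁' ≤ R)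
    (hR : 0 < R) (hσ : 0 < σ) (hS : 0 < S) (hR₁def : R₁ = 8 * S * (‖g‖ + e + 1) + 4) (hK : 0 ≤ K)
    (he'0 : 0 < e') (he'1 : e' ≤ 1) (he'S : S * e' ≤ R₁' / 16) (hσR : σ ≤ R / 16)
    (hσK : σ * K ≤ R / 16) (he₂R : e₂ ≤ R / 16) (he₂ : 0 < e₂) (heS : S * e < e₂ / 4) (he : 0 ≤ e)
    (hSg : ‖p₀ + S • g - p₁‖ < e₂ / 4) (hw : IsWindow Q q₀ p₁ R k)
    (hG : ∀ x : State d, ‖cutGrad Q q₀ R₁' x - g‖ ≤ e)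
    (hμ : ∀ x : State d, ‖x - (q₀, p₀, 0, 0, ‖p₀‖ ^ 2 / 2)‖ < R₁ →
      ‖μ x • x.2.1‖ ≤ e' ∧ |μ x| ≤ e')
    (hZK : ∀ x : State d, ‖x - (q₀, p₁, 0, 0, ‖p₀‖ ^ 2 / 2)‖ < R →
      ‖invRate Q q₀ R k x • innerField Q q₀ R μ x‖ ≤ K)
    (hZ₁ : ContDiff ℝ 1 (innerField Q q₀ R₁' μ))
    (hZ₂ : ContDiff ℝ 1 fun x => invRate Q q₀ R k x • innerField Q q₀ R μ x)
    (hyq : ‖y.1 - q₀‖ < R₁' / 16) (hyq1 : ‖y.1 - q₀‖ < 1) (hy2 : ‖y.2 - p₀‖ < e₂ / 4)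
    (hy1 : ‖y.2 - p₀‖ < 1)
    (hendist : ∀ b : Conf d, ‖b - p₁‖ < e₂ → |‖y.2‖ ^ 2 / 2 - ‖b‖ ^ 2 / 2| ≤ σ / 2)
    (henw : |‖y.2‖ ^ 2 / 2 - ‖p₀‖ ^ 2 / 2| ≤ min 1 (R / 16))
    (hbr : ⟪y.2, g⟫_ℝ + ‖y.2‖ * e + S * (‖g‖ + e) ^ 2 / 2 < 0) :
    ∃ x₁ x₂, IsReflection Q q₀ p₁ R₁' R k S μ y x₁ x₂ ∧
      x₂ 1 = reflectionMap Q q₀ p₀ p₁ R₁' R₁ S R σ k μ y := by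
  obtain ⟨x₁, ex₁, st₁, w₁, hb1⟩ := exists_isStage_push (y := y) hS hR₁def he'0 he'1 he hG hμ hZ₁
    hyq1 hy1 (henw.trans (min_le_left _ _)) hbr
  have near1 : ∀ s ∈ Icc (0 : ℝ) 1, ‖(x₁ s).1 - q₀‖ ≤ R₁' / 8 := by
    intro s hs
    have := norm_sub_le_norm_sub_add_norm_sub (x₁ s).1 y.1 q₀
    linarith [(hb1 s hs).1]
  have m1 : (1 : ℝ) ∈ Icc (0 : ℝ) 1 := by simp
  have hp1 : ‖(x₁ 1).2.1 - p₁‖ < e₂ := by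
    have e1 : (x₁ 1).2.1 - p₁ = ((x₁ 1).2.1 - y.2 - (1 * S) • g) + (y.2 - p₀) +
        (p₀ + S • g - p₁) := by
      rw [one_mul]; abel
    rw [e1]
    refine (norm_add_le _ _).trans_lt ?_
    have h1 := norm_add_le ((x₁ 1).2.1 - y.2 - (1 * S) • g) (y.2 - p₀)
    have h2 := (hb1 1 m1).2.2.1
    linarith
  obtain ⟨x₂, ex₂, st₂, near2⟩ := exists_isStage_return (x := x₁ 1) (w₀ := ‖p₀‖ ^ 2 / 2) hR hσ hσR
    hσK hZK hZ₂ ((near1 1 m1).trans (by linarith)) (hp1.le.trans (by linarith))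
    ((hb1 1 m1).2.1.trans (by linarith)) (w₁ 1 m1) (hendist _ hp1)
    (henw.trans ((min_le_right _ _).trans (by linarith)))
  refine ⟨x₁, x₂, ⟨hw, st₁, st₂, fun s hs => ⟨?_, ?_⟩, near2, fun s hs => (hb1 s hs).2.2.2⟩, ?_⟩
  · linarith [near1 s hs]
  · linarith [near1 s hs]
  · rw [ex₂, ex₁, reflectionMap]


namespace LocalBarrier

variable {Q : ℝ → Conf d → ℝ} {q₀ g : Conf d} (h : LocalBarrier r α Q q₀ g)
include h

theorem close_reflectionMap (hr : 1 ≤ r) (hα : 0 < α) (p₀ p₁ : Conf d) {R₁' R₁ S R σ k : ℝ}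
    (hR₁' : 0 < R₁') (hR₁ : 0 < R₁) (hS : 0 < S) (hR : 0 < R) (hσ : 0 < σ) (hk : k ≠ 0) :
    Close (𝓝[>] 0) (nu r α) r
      (fun ε => reflectionMap (Q ε) q₀ p₀ p₁ R₁' R₁ S R σ k (cutPush r α ε))
      (fun ε => reflectionMap (Q ε) q₀ p₀ p₁ R₁' R₁ S R σ k 0) := by
  have hβ := eventually_nu_nonneg (r := r) hα
  have h0 : Close (𝓝[>] 0) (nu r α) r (fun _ : ℝ => (0 : State d → Vel d)) (fun _ => 0) :=
    Close.of_contDiff hβ r contDiff_const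
  have ha : ∀ᶠ ε in 𝓝[>] (0 : ℝ), Continuous (fun _ : ℝ => (0 : ℝ)) ∧
      ∫ s in (0 : ℝ)..1, |(0 : ℝ)| ≤ nu r α ε := by
    filter_upwards [hβ] with ε hε using ⟨continuous_const, by simpa using hε⟩
  have hZ₁ := h.close_innerField hα hR₁'
  have hZ₂ := (h.close_invRate hα hR hk).smul hβ (h.close_innerField hα hR)
  have c₁ := Close.stageFlow (c := (q₀, p₀, 0, 0, ‖p₀‖ ^ 2 / 2)) (a := fun _ _ => 0) hR₁
    (mul_pos two_pos hS) (eventually_nu_bounds hα) hZ₁ h0 (by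
      filter_upwards [hZ₁.contDiff_one hr] with ε hε using ⟨hε.1, hε.2, contDiff_const⟩) ha
  have c₂ := Close.stageFlow (c := (q₀, p₁, 0, 0, ‖p₀‖ ^ 2 / 2)) (a := fun _ _ => 0) hR
    hσ (eventually_nu_bounds hα) hZ₂ h0 (by
      filter_upwards [hZ₂.contDiff_one hr] with ε hε using ⟨hε.1, hε.2, contDiff_const⟩) ha
  have hs : Close (𝓝[>] 0) (nu r α) r (fun _ => reflectStart (d := d) S)
      (fun _ => reflectStart S) := by
    refine Close.of_contDiff hβ r ?_
    have : ContDiff ℝ ∞ fun x : Phase d => ‖x.2‖ ^ 2 := ContDiff.norm_sq ℝ (by fun_prop)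
    unfold reflectStart
    fun_prop
  have hs' : Close (𝓝[>] 0) (nu r α) r (fun _ => reflectRestart (d := d))
      (fun _ => reflectRestart) := by
    refine Close.of_contDiff hβ r ?_
    have : ContDiff ℝ ∞ fun x : State d => ‖x.2.1‖ ^ 2 := ContDiff.norm_sq ℝ (by fun_prop)
    unfold reflectRestart
    fun_prop
  exact c₂.comp hβ (hs'.comp hβ (c₁.comp hβ hs))

theorem eventually_cutPush_le (hα : 0 < α) (R : ℝ) {e : ℝ} (he : 0 < e) :
    ∀ᶠ ε in 𝓝[>] (0 : ℝ), ∀ x : State d, ‖x‖ ≤ R →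
      ‖cutPush r α ε x • x.2.1‖ ≤ e ∧ |cutPush r α ε x| ≤ e := by
  obtain ⟨K, hK, hK'⟩ := (close_cutPush (d := d) (r := r) hα).closeZero R
  have ht : Tendsto (fun ε => K * nu r α ε * (|R| + 1)) (𝓝[>] 0) (𝓝 0) := by
    simpa using ((tendsto_nu (r := r) hα).const_mul K).mul_const (|R| + 1)
  filter_upwards [hK', ht.eventually (Iic_mem_nhds he), eventually_nu_nonneg (r := r) hα]
    with ε hε he' hν x hx
  have h1 := (hε x x hx hx).2.2
  rw [sub_zero, sub_self, norm_zero, zero_add, Real.norm_eq_abs] at h1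
  have h2 : 0 ≤ K * nu r α ε := mul_nonneg hK hν
  have h3 : ‖x.2.1‖ ≤ |R| + 1 := by
    have := (norm_fst_le x.2).trans ((norm_snd_le x).trans hx)
    linarith [le_abs_self R]
  constructor
  · rw [norm_smul, Real.norm_eq_abs]
    exact (mul_le_mul h1 h3 (norm_nonneg _) h2).trans he'
  · refine h1.trans (le_trans ?_ he')
    exact le_mul_of_one_le_right h2 (by linarith [abs_nonneg R])

/-- The motion inside of the barrier. -/
theorem exists_isReflection (hr : 1 ≤ r) (hα : 0 < α) {p₀ : Conf d} (hk : ⟪p₀, g⟫_ℝ < 0) {ϱ : ℝ}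
    (hϱ : 0 < ϱ) : ∃ p₁ R₁' R₁ S R σ k, 0 < R₁' ∧ 0 < R₁ ∧ 0 < S ∧ 0 < R ∧ R / 2 < ϱ ∧ 0 < σ ∧
      0 < k ∧ ∀ᶠ z in 𝓝[>] (0 : ℝ) ×ˢ 𝓝 (q₀, p₀), ∀ μ, (μ = 0 ∨ μ = cutPush r α z.1) →
        ∃ x₁ x₂, IsReflection (Q z.1) q₀ p₁ R₁' R k S μ z.2 x₁ x₂ ∧
          x₂ 1 = reflectionMap (Q z.1) q₀ p₀ p₁ R₁' R₁ S R σ k μ z.2 := by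
  have hβ := eventually_nu_nonneg (r := r) hα
  have hg : 0 < ‖g‖ := norm_pos_iff.2 h.ne_zero
  set k₀ := ⟪p₀, g⟫_ℝ with hk₀
  set S₂ := -(2 * k₀) / ‖g‖ ^ 2 with hS₂
  have S₂pos : 0 < S₂ := div_pos (by linarith) (by positivity)
  have S₂g : S₂ * ‖g‖ ^ 2 = -(2 * k₀) := div_mul_cancel₀ _ (by positivity)
  set p₁ := p₀ + S₂ • g with hp₁
  have hk₁ : ⟪p₁, g⟫_ℝ = -k₀ := by
    rw [hp₁, inner_add_left, real_inner_smul_left, real_inner_self_eq_norm_sq, S₂g]; linarith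
  have hkpos : 0 < ⟪p₁, g⟫_ℝ := by linarith
  have hnp : ‖p₁‖ ^ 2 = ‖p₀‖ ^ 2 := by
    have e : S₂ ^ 2 * ‖g‖ ^ 2 = S₂ * -(2 * k₀) := by rw [← S₂g]; ring
    rw [hp₁, norm_add_sq_real, real_inner_smul_right, norm_smul, mul_pow, Real.norm_eq_abs, sq_abs,
      e, ← hk₀]
    ring
  obtain ⟨ϱ₁, hϱ₁, hwin⟩ := h.exists_isWindow hkpos.ne'
  set R := min ϱ₁ ϱ with hRdef
  have hR : 0 < R := lt_min hϱ₁ hϱ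
  have hw := hwin R (min_le_left _ _)
  have hRϱ : R / 2 < ϱ := by linarith [min_le_right ϱ₁ ϱ]
  have hZ₂ := (h.close_invRate hα hR hkpos.ne').smul hβ (h.close_innerField hα hR)
  obtain ⟨K, hK, hK'⟩ := hZ₂.closeZero (‖((q₀, p₁, 0, 0, ‖p₀‖ ^ 2 / 2) : State d)‖ + R)
  obtain ⟨σ, hσdef⟩ : ∃ σ, σ = R / (16 * (K + 1)) := ⟨_, rfl⟩
  have hσ : 0 < σ := by rw [hσdef]; positivity
  have hσR : σ ≤ R / 16 := by
    rw [hσdef, div_le_div_iff₀ (by positivity) (by norm_num)]; nlinarith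
  have hσK : σ * K ≤ R / 16 := by
    rw [hσdef, div_mul_eq_mul_div, div_le_div_iff₀ (by positivity) (by norm_num)]; nlinarith
  -- the kinetic energies at the ends
  obtain ⟨e₂, he₂, he₂R, hcont⟩ : ∃ e₂ > 0, e₂ ≤ R / 16 ∧ ∀ a b : Conf d, ‖a - p₀‖ < e₂ → ‖b - p₁‖ < e₂ →
      |‖a‖ ^ 2 / 2 - ‖b‖ ^ 2 / 2| ≤ σ / 2 ∧ |‖a‖ ^ 2 / 2 - ‖p₀‖ ^ 2 / 2| ≤ min 1 (R / 16) := by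
    have c1 : Continuous fun z : Conf d × Conf d => |‖z.1‖ ^ 2 / 2 - ‖z.2‖ ^ 2 / 2| := by fun_prop
    have c2 : Continuous fun z : Conf d × Conf d => |‖z.1‖ ^ 2 / 2 - ‖p₀‖ ^ 2 / 2| := by fun_prop
    have t1 := (c1.tendsto (p₀, p₁)).eventually_lt_const (u := σ / 2) (by
      simp only [hnp, sub_self, abs_zero]; positivity)
    have t2 := (c2.tendsto (p₀, p₁)).eventually_lt_const (u := min 1 (R / 16)) (by
      simp only [sub_self, abs_zero]; exact lt_min one_pos (by positivity))
    obtain ⟨e, he, H⟩ := Metric.eventually_nhds_iff.1 (t1.and t2)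
    refine ⟨min e (R / 16), lt_min he (by positivity), min_le_right _ _, fun a b ha hb => ?_⟩
    have := H (y := (a, b)) (by
      rw [Prod.dist_eq, dist_eq_norm, dist_eq_norm]
      exact max_lt (ha.trans_le (min_le_left _ _)) (hb.trans_le (min_le_left _ _)))
    exact ⟨this.1.le, this.2.le⟩
  obtain ⟨κ, hκ, hκS, hκe⟩ : ∃ κ > 0, κ < S₂ ∧ κ * ‖g‖ < e₂ / 4 := by
    refine ⟨min (S₂ / 2) (e₂ / (8 * ‖g‖)), lt_min (by positivity) (by positivity),
      (min_le_left _ _).trans_lt (by linarith), ?_⟩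
    have := mul_le_mul_of_nonneg_right (min_le_right (S₂ / 2) (e₂ / (8 * ‖g‖))) hg.le
    have e : e₂ / (8 * ‖g‖) * ‖g‖ = e₂ / 8 := by field_simp
    linarith
  obtain ⟨S, hSdef⟩ : ∃ S, S = S₂ - κ := ⟨_, rfl⟩
  have hS : 0 < S := by linarith
  obtain ⟨e₃, he₃, hcont3⟩ : ∃ e₃ > 0, ∀ (a : Conf d) (e : ℝ), ‖a - p₀‖ < e₃ → |e| < e₃ →
      ⟪a, g⟫_ℝ + ‖a‖ * e + S * (‖g‖ + e) ^ 2 / 2 < 0 := by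
    have c1 : Continuous fun z : Conf d × ℝ =>
        ⟪z.1, g⟫_ℝ + ‖z.1‖ * z.2 + S * (‖g‖ + z.2) ^ 2 / 2 := by fun_prop
    have t1 := (c1.tendsto (p₀, 0)).eventually_lt_const (u := 0) (by
      simp only [mul_zero, add_zero, ← hk₀]
      have : S * ‖g‖ ^ 2 / 2 = -k₀ - κ * ‖g‖ ^ 2 / 2 := by rw [hSdef]; linarith
      have : 0 < κ * ‖g‖ ^ 2 / 2 := by positivity
      linarith)
    obtain ⟨e, he, H⟩ := Metric.eventually_nhds_iff.1 t1
    refine ⟨e, he, fun a b ha hb => H (y := (a, b)) ?_⟩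
    rw [Prod.dist_eq, dist_eq_norm, dist_zero_right]; exact max_lt ha hb
  obtain ⟨e, he, hee₃, heS⟩ : ∃ e > 0, |e| < e₃ ∧ S * e < e₂ / 4 := by
    refine ⟨min (e₃ / 2) (e₂ / (8 * S)), lt_min (by positivity) (by positivity), ?_, ?_⟩
    · rw [abs_of_pos (lt_min (by positivity) (by positivity))]
      exact (min_le_left _ _).trans_lt (by linarith)
    · have := mul_le_mul_of_nonneg_left (min_le_right (e₃ / 2) (e₂ / (8 * S))) hS.le
      have e : S * (e₂ / (8 * S)) = e₂ / 8 := by field_simp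
      linarith
  obtain ⟨ϱ₂, hϱ₂, hn⟩ := h.exists_near he
  set R₁' := min ϱ₂ R with hR₁'
  have hR₁'0 : 0 < R₁' := lt_min hϱ₂ hR
  obtain ⟨R₁, hR₁def⟩ : ∃ R₁, R₁ = 8 * S * (‖g‖ + e + 1) + 4 := ⟨_, rfl⟩
  have hR₁ : 0 < R₁ := by rw [hR₁def]; positivity
  obtain ⟨e', he'0, he'1, he'S⟩ : ∃ e' > 0, e' ≤ 1 ∧ S * e' ≤ R₁' / 16 := by
    refine ⟨min 1 (R₁' / (16 * S)), lt_min one_pos (by positivity), min_le_left _ _, ?_⟩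
    have := mul_le_mul_of_nonneg_left (min_le_right 1 (R₁' / (16 * S))) hS.le
    have e : S * (R₁' / (16 * S)) = R₁' / 16 := by field_simp
    linarith
  have hmu := h.eventually_cutPush_le hα
    (‖((q₀, p₀, 0, 0, ‖p₀‖ ^ 2 / 2) : State d)‖ + R₁) he'0
  refine ⟨p₁, R₁', R₁, S, R, σ, ⟪p₁, g⟫_ℝ, hR₁'0, hR₁, hS, hR, hRϱ, hσ, hkpos, ?_⟩
  have hy : ∀ᶠ y in 𝓝 ((q₀, p₀) : Phase d), ‖y.1 - q₀‖ < min 1 (R₁' / 16) ∧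
      ‖y.2 - p₀‖ < min 1 (min (e₂ / 4) e₃) := by
    have t1 : Tendsto (fun x : Phase d => ‖x.1 - q₀‖) (𝓝 (q₀, p₀)) (𝓝 ‖q₀ - q₀‖) :=
      Continuous.tendsto (by fun_prop) (q₀, p₀)
    have t2 : Tendsto (fun x : Phase d => ‖x.2 - p₀‖) (𝓝 (q₀, p₀)) (𝓝 ‖p₀ - p₀‖) :=
      Continuous.tendsto (by fun_prop) (q₀, p₀)
    rw [sub_self, norm_zero] at t1 t2
    exact (t1.eventually_lt_const (lt_min one_pos (by positivity))).and
      (t2.eventually_lt_const (lt_min one_pos (lt_min (by positivity) he₃)))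
  have hZ₁ := h.close_innerField hα hR₁'0
  filter_upwards [hy.prod_inr _, hw.prod_inl _, hK'.prod_inl _, hmu.prod_inl _, hn.prod_inl _,
    (hZ₁.contDiff_one hr).prod_inl _, (hZ₂.contDiff_one hr).prod_inl _]
    with z hy hw hK' hmu hn hZ₁ hZ₂ μ hμ
  refine exists_isReflection_of_bounds hR₁'0 (min_le_right _ _) hR hσ hS hR₁def hK he'0 he'1 he'S
    hσR hσK he₂R he₂ heS (p₀ := p₀) (g := g) (e := e) he.le ?_ hw
    (fun x => (hn _ ((norm_retr_sub_lt _ _ hR₁'0).trans_le (min_le_left _ _))).2.le) ?_ ?_ ?_ ?_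
    (hy.1.trans_le (min_le_right _ _)) (hy.1.trans_le (min_le_left _ _))
    (hy.2.trans_le ((min_le_right _ _).trans (min_le_left _ _))) (hy.2.trans_le (min_le_left _ _))
    (fun b hb => (hcont z.2.2 b ?_ hb).1) (hcont z.2.2 p₁ ?_ (by simpa using he₂)).2
    (hcont3 z.2.2 e (hy.2.trans_le ((min_le_right _ _).trans (min_le_right _ _))) hee₃)
  · have e1 : p₀ + S • g - p₁ = (-κ) • g := by
      rw [hp₁, hSdef, sub_smul, neg_smul]; abel
    rw [e1, norm_smul, norm_neg, Real.norm_of_nonneg hκ.le]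
    exact hκe
  · intro x hx
    rcases hμ with rfl | rfl
    · simpa using he'0.le
    · exact hmu x (by
        linarith [norm_le_norm_add_norm_sub' x ((q₀, p₀, 0, 0, ‖p₀‖ ^ 2 / 2) : State d)])
  · intro x hx
    have hx' : ‖x‖ ≤ ‖((q₀, p₁, 0, 0, ‖p₀‖ ^ 2 / 2) : State d)‖ + R := by
      linarith [norm_le_norm_add_norm_sub' x ((q₀, p₁, 0, 0, ‖p₀‖ ^ 2 / 2) : State d)]
    rcases hμ with rfl | rfl
    exacts [(hK' x x hx' hx').2.1, (hK' x x hx' hx').1]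
  · rcases hμ with rfl | rfl
    exacts [hZ₁.2, hZ₁.1]
  · rcases hμ with rfl | rfl
    exacts [hZ₂.2, hZ₂.1]
  · exact hy.2.trans_le ((min_le_right _ _).trans ((min_le_left _ _).trans (by linarith)))
  · exact hy.2.trans_le ((min_le_right _ _).trans ((min_le_left _ _).trans (by linarith)))

/-- The reflection at the barrier. -/
theorem exists_reflection (hr : 1 ≤ r) (hα : 0 < α) {p₀ : Conf d} (hk : ⟪p₀, g⟫_ℝ < 0) {ϱ : ℝ}
    (hϱ : 0 < ϱ) : ∃ H B : ℝ → Phase d → Phase d × ℝ, Close (𝓝[>] 0) (nu r α) r H B ∧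
      Tendsto (fun z : ℝ × Phase d => B z.1 z.2) (𝓝[>] 0 ×ˢ 𝓝 (q₀, p₀))
        (𝓝 ((q₀, reflect (‖g‖⁻¹ • g) p₀), 0)) ∧
      ∀ᶠ z in 𝓝[>] (0 : ℝ) ×ˢ 𝓝 (q₀, p₀),
        B z.1 z.2 = ((z.2.1, reflect (‖gradient (Q z.1) z.2.1‖⁻¹ • gradient (Q z.1) z.2.1) z.2.2),
          0) ∧
        (Q z.1 z.2.1 = eta r α z.1 →
          (∃ γ, IsPath (barrierField α z.1 (Q z.1)) (ReflectionProp (Q z.1) q₀ ϱ (eta r α z.1)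
            (H z.1 z.2).2) 0 (H z.1 z.2).2 z.2 (H z.1 z.2).1 γ) ∧
          Q z.1 (H z.1 z.2).1.1 = eta r α z.1 ∧ 0 < (H z.1 z.2).2) := by
  have hβ := eventually_nu_nonneg (r := r) hα
  obtain ⟨p₁, R₁', R₁, S, R, σ, k, hR₁', hR₁, hS, hR, hRϱ, hσ, hk₁, key⟩ :=
    h.exists_isReflection hr hα hk hϱ
  have hclose := (h.close_reflectionMap hr hα p₀ p₁ hR₁' hR₁ hS hR hσ hk₁.ne').map hβ
    (contDiff_proj (d := d))
  have tG : Tendsto (fun z : ℝ × Phase d => gradient (Q z.1) z.2.1) (𝓝[>] 0 ×ˢ 𝓝 (q₀, p₀))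
      (𝓝 g) := h.tendsto_grad.comp (tendsto_fst.prodMk ((continuous_fst.tendsto (q₀, p₀)).comp
        tendsto_snd))
  have tp : Tendsto (fun z : ℝ × Phase d => z.2.2) (𝓝[>] (0 : ℝ) ×ˢ 𝓝 (q₀, p₀)) (𝓝 p₀) :=
    (continuous_snd.tendsto (q₀, p₀)).comp tendsto_snd
  have tq : Tendsto (fun z : ℝ × Phase d => z.2.1) (𝓝[>] (0 : ℝ) ×ˢ 𝓝 (q₀, p₀)) (𝓝 q₀) :=
    (continuous_fst.tendsto (q₀, p₀)).comp tendsto_snd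
  have hneg : ∀ᶠ z in 𝓝[>] (0 : ℝ) ×ˢ 𝓝 (q₀, p₀), ⟪z.2.2, gradient (Q z.1) z.2.1⟫_ℝ < 0 :=
    (tp.inner tG).eventually_lt_const hk
  have hB : ∀ᶠ z in 𝓝[>] (0 : ℝ) ×ˢ 𝓝 (q₀, p₀),
      (reflectionMap (Q z.1) q₀ p₀ p₁ R₁' R₁ S R σ k 0 z.2).proj =
      ((z.2.1, reflect (‖gradient (Q z.1) z.2.1‖⁻¹ • gradient (Q z.1) z.2.1) z.2.2), 0) := by
    filter_upwards [key, hneg] with z key hneg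
    obtain ⟨x₁, x₂, hx, he⟩ := key 0 (Or.inl rfl)
    rw [← he, hx.final hk₁ hneg]
  refine ⟨_, _, hclose, ?_, ?_⟩
  · have tn := (tG.norm.inv₀ (norm_ne_zero_iff.2 h.ne_zero)).smul tG
    have ti := (Filter.Tendsto.inner (𝕜 := ℝ) tp tn).const_mul (2 : ℝ)
    have := tp.sub (ti.smul tn)
    exact ((tq.prodMk_nhds this).prodMk_nhds tendsto_const_nhds).congr'
      (hB.mono fun z hz => hz.symm)
  · filter_upwards [hB, key, hneg, (eventually_nu hα (r := r)).prod_inl _] with z hB key hneg hz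
    refine ⟨hB, fun hQ => ?_⟩
    obtain ⟨x₁, x₂, hx, he⟩ := key _ (Or.inr rfl)
    have := hx.exists_isPath hα hz.1 hS hk₁ hRϱ hneg hQ
    rwa [he] at this

end LocalBarrier

end Reflection

section TimeFlow

variable {d r : ℕ} {α : ℝ}

/-- The vector field of the motion under the force `f`. -/
def forceField (f : Conf d → Conf d) (z : Phase d) : Phase d := (z.2, f z.1)

/-- The flow of `forceField f`, near `(q₀, p₀)` and for times at most `σ / 2`, as a function of the
initial point and the time. -/
def timeFlow (q₀ p₀ : Conf d) (R σ : ℝ) (f : Conf d → Conf d) (z : Phase d × ℝ) : Phase d :=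
  (stageFlow (q₀, p₀, 0, 0, 0) R σ (freeField fun x => f x.1) 0 0 1
    (z.1.1, z.1.2, 0, z.2, 0)).proj.1

theorem contDiff_freeField {f : Conf d → Conf d} (hf : ContDiff ℝ 1 f) :
    ContDiff ℝ 1 (freeField fun x : State d => f x.1) := by
  have : ContDiff ℝ 1 fun x : State d => f x.1 := hf.comp contDiff_fst
  unfold freeField; fun_prop

/-- Uniqueness of the motion under the force `f`. -/
theorem timeFlow_eq {q₀ p₀ : Conf d} {R σ : ℝ} {f : Conf d → Conf d} (hR : 0 < R) (hσ : 0 < σ)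
    (hσR : σ ≤ R) (hf : ContDiff ℝ 1 f) {γ : ℝ → Phase d} {a b : ℝ}
    (hγ : ∀ t ∈ Icc a b, HasDerivWithinAt γ (forceField f (γ t)) (Icc a b) t)
    (hin : ∀ t ∈ Icc a b, ‖γ t - (q₀, p₀)‖ ≤ R / 2) {u v : ℝ} (hu : u ∈ Icc a b)
    (hv : v ∈ Icc a b) (huv : |v - u| ≤ σ / 2) : timeFlow q₀ p₀ R σ f (γ u, v - u) = γ v := by
  set c : State d := (q₀, p₀, 0, 0, 0) with hc
  set Z : State d → Vel d := freeField fun x => f x.1 with hZ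
  have hZ1 := contDiff_stageField hσ (contDiff_freeField hf)
  have hF := isFlow_cutFlow_zero c hR hZ1
  obtain ⟨K, -, hK⟩ := exists_bound_comp_retr hZ1 c hR
  obtain ⟨L, hL⟩ : ∃ L : ℝ → ℝ, L = fun s => u + s * (v - u) := ⟨_, rfl⟩
  obtain ⟨x, hx⟩ : ∃ x : ℝ → State d, x = fun s => ((γ (L s)).1, (γ (L s)).2, s * (v - u),
    v - u, 0) := ⟨_, rfl⟩
  have hLm : ∀ s ∈ Icc (0 : ℝ) 1, L s ∈ Icc a b := by
    intro s hs
    have := (convex_Icc a b) hu hv (sub_nonneg.2 hs.2) hs.1 (by ring)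
    simp only [smul_eq_mul] at this
    rw [hL]
    convert this using 1
    ring
  have hLd : ∀ s, HasDerivWithinAt L (v - u) (Icc 0 1) s := by
    intro s
    rw [hL]
    simpa using ((hasDerivWithinAt_id s (Icc (0 : ℝ) 1)).mul_const (v - u)).const_add u
  have hxd : ∀ s ∈ Icc (0 : ℝ) 1, HasDerivWithinAt x
      (stageField σ Z (retr c R (x s))) (Icc 0 1) s := by
    intro s hs
    have h1 := (hγ _ (hLm s hs)).scomp s (hLd s) hLm
    have h2 : HasDerivWithinAt (fun s => s * (v - u)) (v - u) (Icc 0 1) s := by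
      simpa using (hasDerivWithinAt_id s (Icc (0 : ℝ) 1)).mul_const (v - u)
    have h3 := (h1.fst').prodMk (h1.snd'.prodMk (h2.prodMk
      (hasDerivWithinAt_const s (Icc (0 : ℝ) 1) ((v - u, 0) : ℝ × ℝ))))
    have hn : ‖x s - c‖ ≤ R / 2 := by
      have h4 := hin _ (hLm s hs)
      rw [hx]
      refine norm_state_sub_le (by positivity) ((norm_fst_le _).trans h4)
        ((norm_snd_le _).trans h4) ?_ ?_ ?_
      · simp only [hc, sub_zero, abs_mul, abs_of_nonneg hs.1]
        have := mul_le_mul_of_nonneg_right hs.2 (abs_nonneg (v - u))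
        linarith
      · simp only [hc, sub_zero]; linarith
      · simp only [hc, sub_zero, abs_zero]; positivity
    rw [retr_eq_self hn, stageField]
    have h5 : retr 0 σ (x s).2.2.2.1 = v - u := by
      rw [hx]; exact retr_eq_self (by simpa using huv)
    rw [h5]
    rw [hx] at *
    refine h3.congr_deriv ?_
    simp [pad, hZ, freeField, forceField]
    rfl
  have key := ODE_solution_unique (v := fun _ x => stageField σ Z (retr c R x)) (K := K)
    (f := fun s => cutFlow c R (stageField σ Z) 0 0 s (x 0)) (g := x) (a := 0) (b := 1)
    (fun _ => hK) (fun s hs => (hF.deriv (x 0) s hs).continuousWithinAt)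
    (fun s hs => hasDerivWithinAt_Ici_of_Icc hs (hF.deriv (x 0) s (Ico_subset_Icc_self hs)))
    (fun s hs => (hxd s hs).continuousWithinAt)
    (fun s hs => hasDerivWithinAt_Ici_of_Icc hs (hxd s (Ico_subset_Icc_self hs)))
    (hF.init (x 0)) (show (1 : ℝ) ∈ Icc (0 : ℝ) 1 by simp)
  have e0 : x 0 = ((γ u).1, (γ u).2, 0, v - u, 0) := by simp [hx, hL]
  have e1 : (x 1).proj.1 = γ v := by simp [hx, hL, State.proj]
  have h0 : (fun x : State d => pad ((0 : State d → Vel d) x)) = 0 := by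
    funext x; simp [pad]
  rw [timeFlow, stageFlow, h0, ← e1, ← key, e0]

/-- Existence of the motion under the force `f`. -/
theorem exists_isPath_timeFlow {q₀ p₀ : Conf d} {R σ K : ℝ} {f : Conf d → Conf d} (hR : 0 < R)
    (hσ : 0 < σ) (hσR : σ ≤ R / 8) (hK : 0 ≤ K) (hσM : σ * (‖p₀‖ + R + K + 1) ≤ R / 8)
    (hf : ContDiff ℝ 1 f)
    (hfK : ∀ q, ‖q - q₀‖ < R → ‖f q‖ ≤ K) {y : Phase d} (hy : ‖y - (q₀, p₀)‖ ≤ R / 8) {l : ℝ}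
    (hl : 0 ≤ l) (hlσ : l ≤ σ / 2) :
    ∃ γ, IsPath (forceField f) (fun _ z => ‖z - y‖ ≤ R / 8) 0 l y
      (timeFlow q₀ p₀ R σ f (y, l)) γ := by
  have hp := norm_nonneg p₀
  have hZK : ∀ x : State d, ‖x - (q₀, p₀, 0, 0, 0)‖ < R →
      ‖freeField (fun x => f x.1) x‖ ≤ ‖p₀‖ + R + K + 1 := fun x hx => by
    have h1 : ‖x.2.1 - p₀‖ ≤ R := (norm_mom_le x (q₀, p₀, 0, 0, 0)).trans hx.le
    have h2 := norm_le_norm_add_norm_sub' x.2.1 p₀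
    have h3 := hfK x.1 ((norm_pos_le x (q₀, p₀, 0, 0, 0)).trans_lt hx)
    refine max_le ?_ (max_le (h3.trans ?_) ?_)
    · simp only [freeField]; linarith
    · linarith
    · simp only [freeField, norm_one]; linarith
  have hx0 : ‖((y.1, y.2, 0, l, 0) : State d) - (q₀, p₀, 0, 0, 0)‖ ≤ R / 4 := by
    refine norm_state_sub_le (by positivity) ?_ ?_ ?_ ?_ ?_
    · exact (norm_fst_le (y - (q₀, p₀))).trans (hy.trans (by linarith))
    · exact (norm_snd_le (y - (q₀, p₀))).trans (hy.trans (by linarith))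
    · simp only [sub_zero, abs_zero]; positivity
    · simp only [sub_zero, abs_of_nonneg hl]; linarith
    · simp only [sub_zero, abs_zero]; positivity
  have st : IsStage (freeField fun x => f x.1) 0 0
      (fun s => stageFlow (q₀, p₀, 0, 0, 0) R σ (freeField fun x => f x.1) 0 0 s
        (y.1, y.2, 0, l, 0)) (y.1, y.2, 0, l, 0) (σ * (‖p₀‖ + R + K + 1) +
        (∫ s in (0 : ℝ)..1, |(0 : ℝ → ℝ) s|) * 0) := by
    refine isStage_stageFlow hR hσ (contDiff_freeField hf) contDiff_const continuous_const hZK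
      (by simp) hx0 ?_ ?_
    · simpa only [abs_of_nonneg hl] using hlσ
    · rw [mul_zero, add_zero]; linarith
  obtain ⟨x, ex, st⟩ : ∃ x : ℝ → State d, timeFlow q₀ p₀ R σ f (y, l) = (x 1).proj.1 ∧ IsStage
      (freeField fun x => f x.1) 0 0 x (y.1, y.2, 0, l, 0) (σ * (‖p₀‖ + R + K + 1) +
        (∫ s in (0 : ℝ)..1, |(0 : ℝ → ℝ) s|) * 0) := ⟨_, rfl, st⟩
  have hz : ∀ s ∈ Icc (0 : ℝ) 1, HasDerivWithinAt (fun s => (x s).proj.1)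
      (l • forceField f (x s).proj.1) (Icc 0 1) s := by
    intro s hs
    have h := st.deriv s hs
    refine (h.fst'.prodMk h.snd'.fst').congr_deriv ?_
    simp [pad, freeField, forceField, State.proj]
  have ht : ∀ s ∈ Icc (0 : ℝ) 1, HasDerivWithinAt (fun s => (x s).2.2.1) l (Icc 0 1) s := by
    intro s hs
    refine (st.deriv s hs).snd'.snd'.fst'.congr_deriv ?_
    simp [pad, freeField]
  have hd : ∀ s ∈ Icc (0 : ℝ) 1, ‖(x s).proj.1 - y‖ ≤ R / 8 := by
    intro s hs
    have h := st.dist s hs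
    rw [mul_zero, add_zero] at h
    have h' := h.trans hσM
    exact max_le ((norm_pos_le (x s) (y.1, y.2, 0, l, 0)).trans h')
      ((norm_mom_le (x s) (y.1, y.2, 0, l, 0)).trans h')
  have e0 : (x 0).proj.1 = y := by rw [st.init]; rfl
  rw [ex]
  rcases hl.eq_or_lt with rfl | hl
  · have := eq_of_hasDerivWithinAt_zero (x := fun s => (x s).proj.1)
      (fun s hs => by simpa using hz s hs) (t := 1) (by simp)
    rw [this, e0]
    exact ⟨_, IsPath.refl (by simp; positivity)⟩
  · obtain ⟨γ, hγ⟩ := exists_isPath_of_reparam (X := forceField f)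
      (P := fun _ z => ‖z - y‖ ≤ R / 8) hz ht (fun _ _ => hl) hd
    have e1 : (x 1).2.2.1 = l := by
      have := eq_of_hasDerivWithinAt_zero (x := fun s => (x s).2.2.1 - s * l)
        (fun s hs => ((ht s hs).sub ((hasDerivWithinAt_id s _).mul_const l)).congr_deriv
          (by simp)) (t := 1) (by simp)
      simp only [st.init, one_mul, zero_mul, sub_zero] at this
      linarith
    have e2 : (x 0).2.2.1 = 0 := by rw [st.init]
    rw [e0, e1, e2] at hγ
    exact ⟨γ, hγ⟩

theorem hasDerivAt_line (y : Phase d) (t : ℝ) :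
    HasDerivAt (fun t : ℝ => ((y.1 + t • y.2, y.2) : Phase d)) (y.2, 0) t := by
  have h1 : HasDerivAt (fun t : ℝ => y.1 + t • y.2) y.2 t := by
    simpa using ((hasDerivAt_id t).smul_const y.2).const_add y.1
  exact h1.prodMk (hasDerivAt_const t y.2)

theorem timeFlow_zero {q₀ p₀ : Conf d} {R σ : ℝ} (hR : 0 < R) (hσ : 0 < σ) (hσR : σ ≤ R / 8)
    (hσM : σ * (‖p₀‖ + R) ≤ R / 8) {y : Phase d} (hy : ‖y - (q₀, p₀)‖ ≤ R / 8) {l : ℝ}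
    (hl : |l| ≤ σ / 2) : timeFlow q₀ p₀ R σ 0 (y, l) = (y.1 + l • y.2, y.2) := by
  have h2 : ‖y.2‖ ≤ ‖p₀‖ + R := by
    have := norm_le_norm_add_norm_sub' y.2 p₀
    have h3 : ‖y.2 - p₀‖ ≤ R / 8 := (norm_snd_le (y - (q₀, p₀))).trans hy
    linarith
  have := timeFlow_eq (q₀ := q₀) (p₀ := p₀) (f := 0) hR hσ (by linarith) contDiff_const
    (γ := fun t => (y.1 + t • y.2, y.2)) (a := min 0 l) (b := max 0 l)
    (fun t ht => (hasDerivAt_line y t).hasDerivWithinAt) (fun t ht => ?_) (u := 0) (v := l)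
    (by simp) (by simp) (by simpa using hl)
  · simpa using this
  · have ht' : |t| ≤ σ := by
      rw [abs_le] at hl ⊢
      rcases le_total 0 l with h | h
      · rw [min_eq_left h, max_eq_right h] at ht; constructor <;> linarith [ht.1, ht.2]
      · rw [min_eq_right h, max_eq_left h] at ht; constructor <;> linarith [ht.1, ht.2]
    have e : ((y.1 + t • y.2, y.2) : Phase d) - (q₀, p₀) = (y - (q₀, p₀)) + (t • y.2, 0) := by
      ext1
      · simp only [Prod.fst_sub, Prod.fst_add]; abel
      · simp
    rw [e]
    refine (norm_add_le _ _).trans ?_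
    have : ‖((t • y.2, 0) : Phase d)‖ ≤ R / 8 := by
      simp only [Prod.norm_def, norm_zero, norm_smul, Real.norm_eq_abs]
      rw [max_eq_left (by positivity)]
      exact (mul_le_mul ht' h2 (norm_nonneg _) hσ.le).trans hσM
    linarith

/-- For families of small forces, `timeFlow` is close to the motion along straight lines. -/
theorem exists_timeFlow (hr : 1 ≤ r) (hα : 0 < α) {f : ℝ → Conf d → Conf d}
    (hf : Close (𝓝[>] 0) (nu r α) r f (fun _ => 0)) (q₀ p₀ : Conf d) {R : ℝ} (hR : 0 < R) :
    ∃ σ > 0, σ ≤ R / 8 ∧ Close (𝓝[>] 0) (nu r α) r (fun ε => timeFlow q₀ p₀ R σ (f ε))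
        (fun _ => timeFlow q₀ p₀ R σ 0) ∧
      (∀ (y : Phase d) (l : ℝ), ‖y - (q₀, p₀)‖ ≤ R / 8 → |l| ≤ σ / 2 →
        timeFlow q₀ p₀ R σ 0 (y, l) = (y.1 + l • y.2, y.2)) ∧
      ∀ᶠ ε in 𝓝[>] (0 : ℝ), ContDiff ℝ 1 (f ε) ∧ ∀ (y : Phase d) (l : ℝ), ‖y - (q₀, p₀)‖ ≤ R / 8 →
        0 ≤ l → l ≤ σ / 2 → ∃ γ, IsPath (forceField (f ε)) (fun _ z => ‖z - y‖ ≤ R / 8) 0 l y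
          (timeFlow q₀ p₀ R σ (f ε) (y, l)) γ := by
  have hβ := eventually_nu_nonneg (r := r) hα
  obtain ⟨K, hK, hK'⟩ := hf.closeZero (‖q₀‖ + R)
  have hp := norm_nonneg p₀
  have hM : 0 < ‖p₀‖ + R + K + 1 := by positivity
  obtain ⟨σ, hσ, hσR, hσM⟩ : ∃ σ > 0, σ ≤ R / 8 ∧ σ * (‖p₀‖ + R + K + 1) ≤ R / 8 := by
    refine ⟨R / 8 / (‖p₀‖ + R + K + 1), by positivity, div_le_self (by positivity)
      (by linarith), (div_mul_cancel₀ _ hM.ne').le⟩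
  have hff : Close (𝓝[>] 0) (nu r α) r (fun ε => freeField fun x : State d => f ε x.1)
      (fun _ => freeField fun x : State d => (0 : Conf d → Conf d) x.1) := by
    have hp : Close (𝓝[>] 0) (nu r α) r (fun _ (x : State d) => x.2.1) (fun _ x => x.2.1) :=
      Close.of_contDiff hβ r (by fun_prop)
    have h1 : Close (𝓝[>] 0) (nu r α) r (fun _ (x : State d) => (1 : ℝ)) (fun _ x => 1) :=
      Close.of_contDiff hβ r contDiff_const
    exact hp.prodMk hβ ((hf.comp hβ (Close.of_contDiff hβ r contDiff_fst)).prodMk hβ h1)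
  refine ⟨σ, hσ, hσR, ?_, fun y l hy hl => timeFlow_zero hR hσ hσR ?_ hy hl, ?_⟩
  · have h0 : Close (𝓝[>] 0) (nu r α) r (fun _ : ℝ => (0 : State d → Vel d)) (fun _ => 0) :=
      Close.of_contDiff hβ r contDiff_const
    have hs := Close.stageFlow (c := (q₀, p₀, 0, 0, 0)) (a := fun _ => 0) hR hσ
      (eventually_nu_bounds hα) hff h0 (by
        filter_upwards [hff.contDiff_one hr] with ε hε using ⟨hε.1, hε.2, contDiff_const⟩)
      (by filter_upwards [hβ] with ε hε using ⟨continuous_const, by simpa using hε⟩)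
    have hi : Close (𝓝[>] 0) (nu r α) r
        (fun _ (z : Phase d × ℝ) => ((z.1.1, z.1.2, 0, z.2, 0) : State d))
        (fun _ z => (z.1.1, z.1.2, 0, z.2, 0)) := Close.of_contDiff hβ r (by fun_prop)
    exact ((hs.comp hβ hi).map hβ (contDiff_proj (d := d))).fst hβ
  · have : σ * (‖p₀‖ + R) ≤ σ * (‖p₀‖ + R + K + 1) := mul_le_mul_of_nonneg_left (by linarith) hσ.le
    linarith
  · filter_upwards [hK', hf.contDiff_one hr] with ε hε hc
    refine ⟨hc.1, fun y l hy hl hlσ => exists_isPath_timeFlow hR hσ hσR hK hσM hc.1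
      (fun q hq => ?_) hy hl hlσ⟩
    have : ‖q‖ ≤ ‖q₀‖ + R := by linarith [norm_le_norm_add_norm_sub' q q₀]
    exact (hε q q this this).1

end TimeFlow

section Exit

variable {d r : ℕ} {α : ℝ}

theorem IsPath.shift {E : Type} [NormedAddCommGroup E] [NormedSpace ℝ E] {X : E → E}
    {P : ℝ → E → Prop} {a b : ℝ} {x y : E} {γ : ℝ → E} (h : IsPath X P a b x y γ) (c : ℝ) :
    IsPath X (fun t => P (t - c)) (a + c) (b + c) x y (fun t => γ (t - c)) := by
  have hm : ∀ t ∈ Icc (a + c) (b + c), t - c ∈ Icc a b := fun t ht =>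
    ⟨by linarith [ht.1], by linarith [ht.2]⟩
  refine ⟨by linarith [h.le], by simp [h.left], by simp [h.right], fun t ht => ?_, fun t ht =>
    h.prop _ (hm t ht)⟩
  have := (h.deriv _ (hm t ht)).scomp t (((hasDerivWithinAt_id t _).sub_const c)) hm
  rw [one_smul] at this
  exact this

theorem IsWindow.level_mono {Q : Conf d → ℝ} {q₀ p₀ : Conf d} {R k₀ a b : ℝ}
    (h : IsWindow Q q₀ p₀ R k₀) (hk : 0 < k₀) {γ : ℝ → Phase d} {v : ℝ → Conf d}
    (hγ : ∀ t ∈ Icc a b, HasDerivWithinAt γ ((γ t).2, v t) (Icc a b) t)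
    (hin : ∀ t ∈ Icc a b, ‖γ t - (q₀, p₀)‖ ≤ R / 2) : MonotoneOn (fun t => Q (γ t).1) (Icc a b) := by
  have hd : ∀ t ∈ Icc a b, HasDerivWithinAt (fun t => Q (γ t).1)
      ⟪(γ t).2, gradient Q (γ t).1⟫_ℝ (Icc a b) t := fun t ht =>
    hasDerivWithinAt_comp_gradient h.diff (hγ t ht).fst'
  refine monotoneOn_of_deriv_nonneg (convex_Icc a b) (fun t ht => (hd t ht).continuousWithinAt)
    (fun t ht => ((hd t (interior_subset ht)).mono interior_subset).differentiableWithinAt)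
    fun t ht => ?_
  have ht' := interior_subset ht
  rw [interior_Icc] at ht
  rw [((hd t ht').hasDerivAt (Icc_mem_nhds ht.1 ht.2)).deriv]
  have := (h.rate_bounds ((norm_fst_le _).trans (hin t ht'))
    ((norm_snd_le _).trans (hin t ht'))).2 hk
  linarith

/-- The state at `y`, at time zero, with the parameter `l`. -/
def liftState (l : ℝ) (y : Phase d) : State d := (y.1, y.2, 0, l, 0)

/-- The force of `cutForce`, as a function of the position. -/
def posForce (r : ℕ) (α ε : ℝ) (Q : Conf d → ℝ) (q₀ : Conf d) (R : ℝ) (q : Conf d) : Conf d :=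
  cutForce r α ε Q q₀ R (q, 0, 0, 0, 0)

/-- The state on the level `eta + l` which is reached from the level `eta`. -/
def rise (Q : Conf d → ℝ) (q₀ p₀ : Conf d) (R σ k₀ l : ℝ) (a : ℝ → ℝ) (y : Phase d) : Phase d × ℝ :=
  (hitFlow Q q₀ p₀ R σ k₀ 0 a 1 (liftState l y)).proj

/-- The state at time `θ` of the motion which starts at the level `eta` at time zero. -/
def exitMap (Q : Conf d → ℝ) (q₀ p₀ : Conf d) (R σ σ' k₀ l : ℝ) (f : Conf d → Conf d) (a : ℝ → ℝ)
    (z : Phase d × ℝ) : Phase d :=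
  timeFlow q₀ p₀ R σ' f
    ((rise Q q₀ p₀ R σ k₀ l a z.1).1, z.2 - (rise Q q₀ p₀ R σ k₀ l a z.1).2)

/-- The distance of a path from its limit point, and its levels. -/
def ExitProp (Q : Conf d → ℝ) (z₀ : Phase d) (ϱ e δ C t : ℝ) (y : Phase d) : Prop :=
  ‖y - z₀‖ < ϱ ∧ e ≤ Q y.1 ∧ (0 < t → e < Q y.1) ∧ (δ ≤ Q y.1 ∨ t ≤ C)

theorem exists_isPath_rise {Q : Conf d → ℝ} {q₀ p₀ : Conf d} {R k₀ ϱ ε c : ℝ}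
    (hw : IsWindow Q q₀ p₀ R k₀) (hk : 0 < k₀) (hRϱ : R / 2 < ϱ) (hα : 0 < α) (hε : 0 < ε)
    {x : ℝ → State d} {y : Phase d}
    (h : IsHit Q 0 (barrierRate r α ε (eta r α ε) c) x (liftState (c - eta r α ε) y))
    (h3 : ∀ s ∈ Icc (0 : ℝ) 1, ‖(x s).1 - q₀‖ ≤ R / 2 ∧ ‖(x s).2.1 - p₀‖ ≤ R / 2)
    (hηc : eta r α ε < c) (hQ : Q y.1 = eta r α ε) :
    (∃ γ, IsPath (barrierField α ε Q) (ExitProp Q (q₀, p₀) ϱ (eta r α ε) (delta r α ε)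
      (2 / k₀ * delta r α ε)) 0 (x 1).2.2.1 y (x 1).proj.1 γ) ∧ Q (x 1).1 = c := by
  have hη0 := eta_pos (r := r) hα hε
  have hlev : ∀ s ∈ Icc (0 : ℝ) 1, Q (x s).1 = eta r α ε + s * (c - eta r α ε) := by
    intro s hs
    rw [h.level s hs]
    simp only [liftState, hQ]; ring
  have hl : (liftState (c - eta r α ε) y).2.2.2.1 = c - eta r α ε := rfl
  refine ⟨?_, by rw [hlev 1 (by simp)]; ring⟩
  refine h.exists_isPath hw hk.ne' h3 (by rw [hl]; exact mul_pos (sub_pos.2 hηc) hk)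
    (fun s hs => ?_) (fun s hs => ?_)
  · rw [barrierRate_eq le_rfl hηc.le hs, hlev s hs]
    simp [liftState]
  · have hQs : eta r α ε ≤ Q (x s).1 := by
      rw [hlev s hs]; nlinarith [hs.1]
    refine ⟨(max_le (h3 s hs).1 (h3 s hs).2).trans_lt hRϱ, hQs, fun ht => ?_, ?_⟩
    · simp only [hlev s hs]
      have : 0 < s := lt_of_le_of_ne hs.1 (by
        rintro rfl
        rw [h.init] at ht
        exact lt_irrefl _ ht)
      nlinarith
    · rcases le_or_gt (delta r α ε) (Q (x s).1) with hle | hlt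
      · exact Or.inl hle
      · right
        have h1 := h.abs_time_sub_le hw hk.ne' h3 hs (u := 0) (by simp)
        have e0 : (x 0).2.2.1 = 0 := by rw [h.init]; rfl
        have e1 : Q (x 0).1 = eta r α ε := by rw [h.init]; exact hQ
        rw [e0, e1, sub_zero, abs_of_nonneg (sub_nonneg.2 hQs), abs_of_pos hk] at h1
        refine (le_abs_self _).trans (h1.trans (mul_le_mul_of_nonneg_left ?_ (by positivity)))
        linarith

theorem posForce_eq {ε : ℝ} (hα : 0 < α) (hε : 0 < ε) {Q : Conf d → ℝ} {q₀ : Conf d} {R : ℝ}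
    {q : Conf d} (hq : ‖q - q₀‖ ≤ R / 2) (hQ : delta r α ε ≤ Q q) :
    posForce r α ε Q q₀ R q = barrierForce α ε (Q q) • gradient Q q :=
  cutForce_eq (x := (q, 0, 0, 0, 0)) hα hε hq hQ

namespace LocalBarrier

variable {Q : ℝ → Conf d → ℝ} {q₀ g : Conf d} (h : LocalBarrier r α Q q₀ g)
include h

theorem close_posForce (hα : 0 < α) {R : ℝ} (hR : 0 < R) : Close (𝓝[>] 0) (nu r α) r
    (fun ε => posForce r α ε (Q ε) q₀ R) (fun _ => 0) :=
  (h.close_cutForce hα hR).comp (eventually_nu_nonneg hα)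
    (Close.of_contDiff (f := fun q : Conf d => ((q, 0, 0, 0, 0) : State d))
      (eventually_nu_nonneg hα) r (by fun_prop))

theorem close_exitMap (hr : 1 ≤ r) (hα : 0 < α) (p₀ : Conf d) {R σ σ' k₀ c : ℝ} (hR : 0 < R)
    (hσ : 0 < σ) (hk : k₀ ≠ 0) (hc : 0 < c)
    (hT : Close (𝓝[>] 0) (nu r α) r (fun ε => timeFlow q₀ p₀ R σ' (posForce r α ε (Q ε) q₀ R))
      (fun _ => timeFlow q₀ p₀ R σ' 0)) : Close (𝓝[>] 0) (nu r α) r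
    (fun ε => exitMap (Q ε) q₀ p₀ R σ σ' k₀ (c - eta r α ε) (posForce r α ε (Q ε) q₀ R)
      (barrierRate r α ε (eta r α ε) c))
    (fun ε => exitMap (Q ε) q₀ p₀ R σ σ' k₀ (c - eta r α ε) 0 0) := by
  have hβ := eventually_nu_nonneg (r := r) hα
  have hηc : ∀ᶠ ε in 𝓝[>] (0 : ℝ), eta r α ε ≤ c := (tendsto_eta hα).eventually (Iic_mem_nhds hc)
  have ha : ∀ᶠ ε in 𝓝[>] (0 : ℝ), Continuous (barrierRate r α ε (eta r α ε) c) ∧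
      ∫ s in (0 : ℝ)..1, |barrierRate r α ε (eta r α ε) c s| ≤ nu r α ε := by
    filter_upwards [hηc, self_mem_nhdsWithin] with ε h1 h2
    exact ⟨continuous_barrierRate hα h2 _ _, integral_barrierRate_le hα h2 le_rfl h1⟩
  have hrs : Close (𝓝[>] 0) (nu r α) r (fun ε => liftState (d := d) (c - eta r α ε))
      (fun ε => liftState (c - eta r α ε)) := by
    have hl : Close (𝓝[>] 0) (nu r α) r (fun ε (_ : Phase d) => c - eta r α ε)
        (fun ε _ => c - eta r α ε) := by
      refine Close.const_self hβ c ?_ r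
      filter_upwards [hηc, self_mem_nhdsWithin] with ε h1 h2
      have := eta_pos (r := r) hα h2
      rw [Real.norm_eq_abs, abs_le]; constructor <;> linarith
    exact Close.map₂ hβ (φ := fun z : Phase d × ℝ => ((z.1.1, z.1.2, 0, z.2, 0) : State d))
      (by fun_prop) (Close.of_contDiff hβ r contDiff_id) hl
  have hrise := ((h.close_hitFlow_rate hr hα p₀ hR hσ hk ha).comp hβ hrs).map hβ
    (contDiff_proj (d := d))
  have hrise' := hrise.comp hβ (Close.of_contDiff (E := Phase d × ℝ) hβ r contDiff_fst)
  have hθ : Close (𝓝[>] 0) (nu r α) r (fun _ (z : Phase d × ℝ) => z.2) (fun _ z => z.2) :=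
    Close.of_contDiff hβ r contDiff_snd
  exact hT.comp hβ (Close.map₂ hβ (φ := fun w : (Phase d × ℝ) × ℝ => (w.1.1, w.2 - w.1.2))
    (by fun_prop) hrise' hθ)

/-- The motion from the level `eta` to a point above the boundary. -/
theorem exists_exit (hr : 1 ≤ r) (hα : 0 < α) {p₀ : Conf d} (hk : 0 < ⟪p₀, g⟫_ℝ) {ϱ : ℝ}
    (hϱ : 0 < ϱ) : ∃ τ₀ > 0, ∀ τ ∈ Ioo 0 τ₀, ∃ H B : ℝ → Phase d × ℝ → Phase d,
      Close (𝓝[>] 0) (nu r α) r H B ∧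
      Tendsto (fun z : ℝ × Phase d × ℝ => B z.1 z.2) (𝓝[>] 0 ×ˢ 𝓝 ((q₀, p₀), τ))
        (𝓝 (q₀ + τ • p₀, p₀)) ∧
      ∃ C > 0, ∀ᶠ z in 𝓝[>] (0 : ℝ) ×ˢ 𝓝 ((q₀, p₀), τ), Q z.1 z.2.1.1 = eta r α z.1 →
        (∃ γ, IsPath (barrierField α z.1 (Q z.1)) (ExitProp (Q z.1) (q₀, p₀) ϱ (eta r α z.1)
            (delta r α z.1) (C * delta r α z.1)) 0 z.2.2 z.2.1 (H z.1 z.2) γ) ∧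
        B z.1 z.2 = (z.2.1.1 + z.2.2 • z.2.1.2, z.2.1.2) ∧
        ∀ t ∈ Ioc 0 z.2.2, ‖z.2.1.1 + t • z.2.1.2 - q₀‖ < ϱ ∧
          eta r α z.1 < Q z.1 (z.2.1.1 + t • z.2.1.2) := by
  have hβ := eventually_nu_nonneg (r := r) hα
  obtain ⟨ϱ₁, hϱ₁, hwin⟩ := h.exists_isWindow hk.ne'
  obtain ⟨k₀, hk₀⟩ : ∃ k₀, k₀ = ⟪p₀, g⟫_ℝ := ⟨_, rfl⟩
  rw [← hk₀] at hk hwin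
  obtain ⟨R, hRdef⟩ : ∃ R, R = min ϱ₁ ϱ := ⟨_, rfl⟩
  have hR : 0 < R := by rw [hRdef]; exact lt_min hϱ₁ hϱ
  have hw := hwin R (by rw [hRdef]; exact min_le_left _ _)
  have hRϱ : R / 2 < ϱ := by linarith [hRdef.trans_le (min_le_right ϱ₁ ϱ)]
  obtain ⟨σ, hσ, hσR, hhit⟩ := h.exists_hit hr hα p₀ hR hk.ne' hw
  obtain ⟨σ', hσ', hσR', hT, hT0, hTp⟩ := exists_timeFlow hr hα (h.close_posForce hα hR) q₀ p₀ hR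
  have hp0 := norm_nonneg p₀
  refine ⟨min (min σ' (σ / k₀)) (R / (32 * (‖p₀‖ + 1 + R))) / 4, by positivity, fun τ hτ => ?_⟩
  have hτ0 := hτ.1
  have hτ1 : 4 * τ < σ' := by
    have := hτ.2
    have h2 := (min_le_left (min σ' (σ / k₀)) (R / (32 * (‖p₀‖ + 1 + R)))).trans
      (min_le_left σ' (σ / k₀))
    linarith
  have hτ2 : 4 * τ * k₀ < σ := by
    rw [← lt_div_iff₀ hk]
    have := hτ.2
    have h2 := (min_le_left (min σ' (σ / k₀)) (R / (32 * (‖p₀‖ + 1 + R)))).trans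
      (min_le_right σ' (σ / k₀))
    linarith
  have hτ3 : 4 * τ * (32 * (‖p₀‖ + 1 + R)) < R := by
    rw [← lt_div_iff₀ (by positivity)]
    have := hτ.2
    have h2 := min_le_right (min σ' (σ / k₀)) (R / (32 * (‖p₀‖ + 1 + R)))
    linarith
  obtain ⟨c, hcdef⟩ : ∃ c, c = k₀ * τ / 4 := ⟨_, rfl⟩
  have hc : 0 < c := by rw [hcdef]; positivity
  have hcσ : c ≤ σ / 4 := by rw [hcdef]; linarith
  obtain ⟨H', hH'⟩ : ∃ H' : ℝ → Phase d × ℝ → Phase d, H' = fun ε => exitMap (Q ε) q₀ p₀ R σ σ' k₀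
    (c - eta r α ε) (posForce r α ε (Q ε) q₀ R) (barrierRate r α ε (eta r α ε) c) := ⟨_, rfl⟩
  obtain ⟨B', hB'⟩ : ∃ B' : ℝ → Phase d × ℝ → Phase d, B' = fun ε => exitMap (Q ε) q₀ p₀ R σ σ' k₀
    (c - eta r α ε) 0 0 := ⟨_, rfl⟩
  have hclose : Close (𝓝[>] 0) (nu r α) r H' B' := by
    rw [hH', hB']; exact h.close_exitMap hr hα p₀ hR hσ hk.ne' hc hT
  -- the points near the initial point
  have hx : ∀ᶠ x : Phase d × ℝ in 𝓝 ((q₀, p₀), τ), ‖x.1 - (q₀, p₀)‖ ≤ R / 64 ∧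
      3 / 4 * τ ≤ x.2 ∧ x.2 ≤ 2 * τ := by
    have t1 : Tendsto (fun x : Phase d × ℝ => ‖x.1 - (q₀, p₀)‖) (𝓝 ((q₀, p₀), τ))
        (𝓝 ‖((q₀, p₀) : Phase d) - (q₀, p₀)‖) := Continuous.tendsto (by fun_prop) ((q₀, p₀), τ)
    have t2 : Tendsto (fun x : Phase d × ℝ => x.2) (𝓝 ((q₀, p₀), τ)) (𝓝 τ) :=
      Continuous.tendsto (by fun_prop) ((q₀, p₀), τ)
    refine (t1.eventually (Iic_mem_nhds ?_)).and
      ((t2.eventually (Ici_mem_nhds ?_)).and (t2.eventually (Iic_mem_nhds ?_)))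
    · rw [sub_self, norm_zero]; positivity
    · linarith
    · linarith
  have hδc : ∀ᶠ ε in 𝓝[>] (0 : ℝ), delta r α ε ≤ c :=
    (tendsto_delta hα).eventually (Iic_mem_nhds hc)
  have hηc : ∀ᶠ ε in 𝓝[>] (0 : ℝ), eta r α ε < c := (tendsto_eta hα).eventually (Iio_mem_nhds hc)
  have key : ∀ᶠ z : ℝ × Phase d × ℝ in 𝓝[>] (0 : ℝ) ×ˢ 𝓝 ((q₀, p₀), τ), ∀ a, Continuous a →
      ∫ s in (0 : ℝ)..1, |a s| ≤ nu r α z.1 →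
      ∃ x : ℝ → State d, IsHit (Q z.1) 0 a x (liftState (c - eta r α z.1) z.2.1) ∧
        (x 1).proj = rise (Q z.1) q₀ p₀ R σ k₀ (c - eta r α z.1) a z.2.1 ∧
        (∀ s ∈ Icc (0 : ℝ) 1, ‖(x s).1 - q₀‖ ≤ R / 2 ∧ ‖(x s).2.1 - p₀‖ ≤ R / 2) ∧
        0 ≤ (x 1).2.2.1 ∧ (x 1).2.2.1 ≤ τ / 2 ∧ ‖(x 1).proj.1 - (q₀, p₀)‖ ≤ R / 8 := by
    filter_upwards [hx.prod_inr _, hhit.prod_inl _, hηc.prod_inl _,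
      hw.prod_inl _, (eventually_nu hα (r := r)).prod_inl _] with z hx hhit hηc hw hν a ha ha'
    have hη0 := eta_pos (r := r) hα hν.1
    have hl : (liftState (c - eta r α z.1) z.2.1).2.2.2.1 = c - eta r α z.1 := rfl
    have hla : |c - eta r α z.1| ≤ σ / 4 := by
      rw [abs_of_pos (by linarith)]; linarith
    have hx0 : ‖liftState (c - eta r α z.1) z.2.1 - (q₀, p₀, 0, 0, 0)‖ ≤ R / 16 := by
      refine norm_state_sub_le (by positivity) ?_ ?_ ?_ ?_ ?_
      · exact (norm_fst_le (z.2.1 - (q₀, p₀))).trans (hx.1.trans (by linarith))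
      · exact (norm_snd_le (z.2.1 - (q₀, p₀))).trans (hx.1.trans (by linarith))
      · simp only [liftState, sub_zero, abs_zero]; positivity
      · simp only [liftState, sub_zero]; linarith
      · simp only [liftState, sub_zero, abs_zero]; positivity
    obtain ⟨x, ex, A1, A2, A3⟩ : ∃ x : ℝ → State d,
        x 1 = hitFlow (Q z.1) q₀ p₀ R σ k₀ 0 a 1 (liftState (c - eta r α z.1) z.2.1) ∧
        IsHit (Q z.1) 0 a x (liftState (c - eta r α z.1) z.2.1) ∧
        (∀ s ∈ Icc (0 : ℝ) 1, ‖x s - liftState (c - eta r α z.1) z.2.1‖ ≤ R / 16) ∧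
        ∀ s ∈ Icc (0 : ℝ) 1, ‖(x s).1 - q₀‖ ≤ R / 2 ∧ ‖(x s).2.1 - p₀‖ ≤ R / 2 :=
      ⟨_, rfl, hhit 0 (Or.inl rfl) a ha ha' (liftState (c - eta r α z.1) z.2.1)
        (hx0.trans (by linarith)) (by rw [hl]; linarith)⟩
    have m1 : (1 : ℝ) ∈ Icc (0 : ℝ) 1 := by simp
    have hmono := A1.time_mono hw hk.ne' A3 (by rw [hl]; exact mul_pos (by linarith) hk)
    have htime := A1.abs_time_sub_le hw hk.ne' A3 m1 (u := 0) (by simp)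
    rw [A1.level 1 m1, A1.level 0 (by simp), add_sub_add_left_eq_sub, hl, mul_one, mul_zero,
      sub_zero, A1.init, abs_of_pos hk, abs_of_pos (by linarith : 0 < c - eta r α z.1)] at htime
    have e0 : (liftState (c - eta r α z.1) z.2.1).2.2.1 = 0 := rfl
    rw [e0] at hmono htime
    have hA := A2 1 m1
    refine ⟨x, A1, by rw [rise, ex], A3, hmono, ?_, ?_⟩
    · have h1 := (le_abs_self _).trans htime
      rw [sub_zero] at h1
      refine h1.trans ?_
      have h2 : 2 / k₀ * c = τ / 2 := by rw [hcdef]; field_simp; norm_num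
      rw [← h2]
      exact mul_le_mul_of_nonneg_left (by linarith) (by positivity)
    · have h1 : ‖x 1 - (q₀, p₀, 0, 0, 0)‖ ≤ R / 8 := by
        have := norm_sub_le_norm_sub_add_norm_sub (x 1) (liftState (c - eta r α z.1) z.2.1)
          (q₀, p₀, 0, 0, 0)
        linarith
      exact max_le ((norm_pos_le (x 1) (q₀, p₀, 0, 0, 0)).trans h1)
        ((norm_mom_le (x 1) (q₀, p₀, 0, 0, 0)).trans h1)
  have hb : ∀ᶠ z : ℝ × Phase d × ℝ in 𝓝[>] (0 : ℝ) ×ˢ 𝓝 ((q₀, p₀), τ),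
      B' z.1 z.2 = (z.2.1.1 + z.2.2 • z.2.1.2, z.2.1.2) := by
    filter_upwards [key, hx.prod_inr _, hw.prod_inl _, (eventually_nu hα (r := r)).prod_inl _]
      with z key hx hw hν
    obtain ⟨x, A, e, A3, t0, t1, hn⟩ := key 0 continuous_const (by simpa using hν.2.1.le)
    obtain ⟨pA, qA⟩ := A.straight hw (s := 1) (by simp)
    rw [hB']
    simp only [exitMap]
    rw [← e, hT0 _ _ hn]
    · simp only [State.proj, liftState] at pA qA ⊢
      rw [qA, pA, sub_zero, add_assoc, ← add_smul, add_sub_cancel]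
    · simp only [State.proj]
      rw [abs_of_nonneg (by linarith [hx.2.1])]
      linarith [hx.2.2]
  refine ⟨H', B', hclose, ?_, 2 / k₀, by positivity, ?_⟩
  · have t1 : Tendsto (fun x : Phase d × ℝ => ((x.1.1 + x.2 • x.1.2, x.1.2) : Phase d))
        (𝓝 ((q₀, p₀), τ)) (𝓝 (q₀ + τ • p₀, p₀)) :=
      Continuous.tendsto (by fun_prop) ((q₀, p₀), τ)
    exact (t1.comp tendsto_snd).congr' (hb.mono fun z hz => hz.symm)
  · filter_upwards [key, hb, hx.prod_inr _, hw.prod_inl _, (eventually_nu hα (r := r)).prod_inl _,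
      hηc.prod_inl _, hδc.prod_inl _, hTp.prod_inl _]
      with z key hb hx hw hν hηc hδc hTp hQ
    have hη0 := eta_pos (r := r) hα hν.1
    obtain ⟨x, A, e, A3, t0, t1, hn⟩ := key _ (continuous_barrierRate hα hν.1 _ _)
      (integral_barrierRate_le hα hν.1 le_rfl hηc.le)
    refine ⟨?_, hb, fun t ht => ?_⟩
    · obtain ⟨⟨γ₁, hγ₁⟩, hc1⟩ := exists_isPath_rise hw hk hRϱ hα hν.1 A A3 hηc hQ
      obtain ⟨γ₂, hγ₂⟩ := hTp.2 (x 1).proj.1 (z.2.2 - (x 1).2.2.1) hn (by linarith [hx.2.1])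
        (by linarith [hx.2.2])
      have e' : H' z.1 z.2 = timeFlow q₀ p₀ R σ' (posForce r α z.1 (Q z.1) q₀ R)
          ((x 1).proj.1, z.2.2 - (x 1).2.2.1) := by
        rw [hH']
        simp only [exitMap]
        rw [← e]
        rfl
      rw [← e'] at hγ₂
      have hin : ∀ t ∈ Icc 0 (z.2.2 - (x 1).2.2.1), ‖γ₂ t - (q₀, p₀)‖ ≤ R / 4 := fun t ht => by
        have := norm_sub_le_norm_sub_add_norm_sub (γ₂ t) (x 1).proj.1 (q₀, p₀)
        have := hγ₂.prop t ht
        linarith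
      have hmono := hw.level_mono hk (v := fun t => posForce r α z.1 (Q z.1) q₀ R (γ₂ t).1)
        hγ₂.deriv (fun t ht => (hin t ht).trans (by linarith))
      have hlev : ∀ t ∈ Icc 0 (z.2.2 - (x 1).2.2.1), c ≤ Q z.1 (γ₂ t).1 := fun t ht => by
        have := hmono (left_mem_Icc.2 hγ₂.le) ht ht.1
        simp only [hγ₂.left] at this
        exact hc1.symm.trans_le this
      have hγ₃ : IsPath (barrierField α z.1 (Q z.1)) (fun t => ExitProp (Q z.1) (q₀, p₀) ϱ
          (eta r α z.1) (delta r α z.1) (2 / k₀ * delta r α z.1) (t + (x 1).2.2.1)) 0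
          (z.2.2 - (x 1).2.2.1) (x 1).proj.1 (H' z.1 z.2) γ₂ := by
        refine ⟨hγ₂.le, hγ₂.left, hγ₂.right, fun t ht => ?_, fun t ht => ?_⟩
        · have := hγ₂.deriv t ht
          rwa [forceField, posForce_eq hα hν.1
            ((norm_fst_le (γ₂ t - (q₀, p₀))).trans ((hin t ht).trans (by linarith)))
            (hδc.trans (hlev t ht))] at this
        · exact ⟨(hin t ht).trans_lt (by linarith), hηc.le.trans (hlev t ht), fun _ =>
            hηc.trans_le (hlev t ht), Or.inl (hδc.trans (hlev t ht))⟩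
      have hγ₄ := hγ₃.shift (x 1).2.2.1
      simp only [zero_add, sub_add_cancel] at hγ₄
      exact ⟨_, hγ₁.concat hγ₄⟩
    · have hθ : 0 ≤ z.2.2 := by linarith [hx.2.1]
      have hq := (norm_fst_le (z.2.1 - (q₀, p₀))).trans hx.1
      have hp := (norm_snd_le (z.2.1 - (q₀, p₀))).trans hx.1
      simp only [Prod.fst_sub, Prod.snd_sub] at hq hp
      have hθR : ‖z.2.1.1 + z.2.2 • z.2.1.2 - q₀‖ ≤ R / 2 := by
        have e1 : z.2.1.1 + z.2.2 • z.2.1.2 - q₀ = (z.2.1.1 - q₀) + z.2.2 • z.2.1.2 := by abel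
        rw [e1]
        refine (norm_add_le _ _).trans ?_
        rw [norm_smul, Real.norm_of_nonneg hθ]
        have h2 := norm_le_norm_add_norm_sub' z.2.1.2 p₀
        have h3 : z.2.2 * ‖z.2.1.2‖ ≤ 2 * τ * (‖p₀‖ + 1 + R) :=
          mul_le_mul hx.2.2 (by linarith) (norm_nonneg _) (by linarith)
        linarith
      have hz0 : ‖z.2.1.1 + (0 : ℝ) • z.2.1.2 - q₀‖ ≤ R / 2 := by
        rw [zero_smul, add_zero]; linarith
      have ht' := (hw.line_le hθ (hp.trans (by linarith)) hz0 hθR).1 t ⟨ht.1.le, ht.2⟩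
      refine ⟨ht'.trans_lt hRϱ, ?_⟩
      have := (hw.line_le ht.1.le (hp.trans (by linarith)) hz0 ht').2.2 hk
      rw [zero_smul, add_zero, hQ, sub_zero] at this
      have h2 : 0 < 3 / 4 * k₀ * t := by have := ht.1; positivity
      linarith

end LocalBarrier

end Exit

/-! ### Inward normals -/

section Normals

variable {d : ℕ}

theorem fderiv_eq_inner (f : Conf d → ℝ) (q v : Conf d) : fderiv ℝ f q v = ⟪gradient f q, v⟫_ℝ := by
  rw [gradient, InnerProductSpace.toDual_symm_apply]

theorem hasDerivAt_comp_line {f : Conf d → ℝ} {q : Conf d} (hf : DifferentiableAt ℝ f q)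
    (v : Conf d) : HasDerivAt (fun t : ℝ => f (q + t • v)) ⟪gradient f q, v⟫_ℝ 0 := by
  have h1 : HasDerivAt (fun t : ℝ => q + t • v) v 0 := by
    simpa using ((hasDerivAt_id (0 : ℝ)).smul_const v).const_add q
  have h2 : HasFDerivAt f (fderiv ℝ f q) (q + (0 : ℝ) • v) := by simpa using hf.hasFDerivAt
  rw [← fderiv_eq_inner]
  exact h2.comp_hasDerivAt 0 h1

theorem tendsto_line (q v : Conf d) : Tendsto (fun t : ℝ => q + t • v) (𝓝[>] 0) (𝓝 q) := by
  have : Continuous fun t : ℝ => q + t • v := by fun_prop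
  simpa using (this.tendsto 0).mono_left nhdsWithin_le_nhds

theorem eventually_lt_line {f : Conf d → ℝ} {q : Conf d} (hf : DifferentiableAt ℝ f q)
    {v : Conf d} (hv : 0 < ⟪gradient f q, v⟫_ℝ) : ∀ᶠ t in 𝓝[>] (0 : ℝ), f q < f (q + t • v) := by
  have h := (hasDerivAt_comp_line hf v).tendsto_slope.mono_left
    (nhdsWithin_mono 0 (fun t (ht : 0 < t) => ht.ne'))
  filter_upwards [h.eventually (lt_mem_nhds hv), self_mem_nhdsWithin] with t ht ht0
  rw [slope_def_field, sub_zero, zero_smul, add_zero] at ht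
  linarith [(div_pos_iff_of_pos_right (show (0 : ℝ) < t from ht0)).1 ht]

theorem eventually_line_lt {f : Conf d → ℝ} {q : Conf d} (hf : DifferentiableAt ℝ f q)
    {v : Conf d} (hv : ⟪gradient f q, v⟫_ℝ < 0) : ∀ᶠ t in 𝓝[>] (0 : ℝ), f (q + t • v) < f q := by
  have h := (hasDerivAt_comp_line hf v).tendsto_slope.mono_left
    (nhdsWithin_mono 0 (fun t (ht : 0 < t) => ht.ne'))
  filter_upwards [h.eventually (gt_mem_nhds hv), self_mem_nhdsWithin] with t ht ht0
  rw [slope_def_field, sub_zero, zero_smul, add_zero] at ht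
  have := (div_neg_iff.1 ht).resolve_left fun h => absurd h.2 (not_lt.2 (le_of_lt ht0))
  linarith [this.1]

/-- A defining function of the region determines the inward normal. -/
theorem IsInwardNormal.gradient_eq {A : Set (Conf d)} {q n : Conf d} (hn : IsInwardNormal A q n)
    {f : Conf d → ℝ} (hf : DifferentiableAt ℝ f q) (hfq : f q = 0)
    (hA : ∀ᶠ x in 𝓝 q, (x ∈ A ↔ 0 ≤ f x)) : gradient f q = ‖gradient f q‖ • n := by
  obtain ⟨h1, g, hg, hgq, ⟨c, hc, hgc⟩, hgA⟩ := hn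
  have key : ∀ v : Conf d, 0 < ⟪n, v⟫_ℝ → 0 ≤ ⟪gradient f q, v⟫_ℝ := by
    intro v hv
    by_contra! hneg
    have e1 := eventually_lt_line (hg.differentiableAt one_ne_zero) (v := v) (by
      rw [hgc, real_inner_smul_left]; exact mul_pos hc hv)
    have e2 := eventually_line_lt hf hneg
    obtain ⟨t, h1, h2, h3, h4⟩ := (e1.and (e2.and
      (((tendsto_line q v).eventually hA).and ((tendsto_line q v).eventually hgA)))).exists
    rw [hgq] at h1
    rw [hfq] at h2
    exact absurd (h3.1 (h4.2 h1.le)) (not_le.2 h2)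
  have hnn : ⟪n, n⟫_ℝ = 1 := by rw [real_inner_self_eq_norm_sq, h1, one_pow]
  obtain ⟨w, hw⟩ : ∃ w, w = gradient f q - ⟪gradient f q, n⟫_ℝ • n := ⟨_, rfl⟩
  have hnw : ⟪n, w⟫_ℝ = 0 := by
    rw [hw, inner_sub_right, real_inner_smul_right, hnn, mul_one, real_inner_comm, sub_self]
  have hfw : ⟪gradient f q, w⟫_ℝ = ‖w‖ ^ 2 := by
    have : gradient f q = w + ⟪gradient f q, n⟫_ℝ • n := by rw [hw]; abel
    nth_rewrite 1 [this]
    rw [inner_add_left, real_inner_smul_left, hnw, mul_zero, add_zero, real_inner_self_eq_norm_sq]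
  have hw0 : w = 0 := by
    by_contra hne
    have hpos : 0 < ‖w‖ ^ 2 := by have := norm_pos_iff.2 hne; positivity
    have := key (n + (-(|⟪gradient f q, n⟫_ℝ| + 1) / ‖w‖ ^ 2) • w) (by
      rw [inner_add_right, real_inner_smul_right, hnw, hnn]; norm_num)
    rw [inner_add_right, real_inner_smul_right, hfw, div_mul_cancel₀ _ hpos.ne'] at this
    linarith [le_abs_self ⟪gradient f q, n⟫_ℝ]
  have e : gradient f q = ⟪gradient f q, n⟫_ℝ • n := by rw [hw] at hw0; exact sub_eq_zero.1 hw0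
  have h0 : 0 ≤ ⟪gradient f q, n⟫_ℝ := key n (by rw [hnn]; exact one_pos)
  have h2 : ‖gradient f q‖ = ⟪gradient f q, n⟫_ℝ := by
    conv_lhs => rw [e, norm_smul, h1, mul_one, Real.norm_of_nonneg h0]
  rw [h2]; exact e

theorem IsInwardNormal.unique {A : Set (Conf d)} {q n n' : Conf d} (hn : IsInwardNormal A q n)
    (hn' : IsInwardNormal A q n') : n = n' := by
  obtain ⟨h1, g, hg, hgq, ⟨c, hc, hgc⟩, hgA⟩ := hn
  have h := hn'.gradient_eq (hg.differentiableAt one_ne_zero) hgq hgA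
  rw [hgc, norm_smul, h1, mul_one, Real.norm_of_nonneg hc.le] at h
  exact smul_right_injective _ hc.ne' h

theorem IsInwardNormal.mem {A : Set (Conf d)} {q n : Conf d} (hn : IsInwardNormal A q n) :
    q ∈ A := by
  obtain ⟨-, g, -, hgq, -, hgA⟩ := hn
  exact hgA.self_of_nhds.2 hgq.ge

theorem IsInwardNormal.notMem_interior {A : Set (Conf d)} {q n : Conf d}
    (hn : IsInwardNormal A q n) : q ∉ interior A := by
  obtain ⟨h1, g, hg, hgq, ⟨c, hc, hgc⟩, hgA⟩ := hn
  intro hq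
  have e1 := eventually_line_lt (hg.differentiableAt one_ne_zero) (v := -n) (by
    rw [hgc, real_inner_smul_left, inner_neg_right, real_inner_self_eq_norm_sq, h1]; linarith)
  obtain ⟨t, ht, h2, h3⟩ := (e1.and (((tendsto_line q (-n)).eventually hgA).and
    ((tendsto_line q (-n)).eventually (mem_interior_iff_mem_nhds.1 hq)))).exists
  have := h2.1 h3
  linarith

theorem isInwardNormal_gradient {A : Set (Conf d)} {q : Conf d} {f : Conf d → ℝ} {c : ℝ}
    (hf : ContDiff ℝ 1 f) (hfq : f q = c) (hne : gradient f q ≠ 0)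
    (hA : ∀ᶠ x in 𝓝 q, (x ∈ A ↔ c ≤ f x)) :
    IsInwardNormal A q (‖gradient f q‖⁻¹ • gradient f q) := by
  have h0 : 0 < ‖gradient f q‖ := norm_pos_iff.2 hne
  have e : gradient (fun x => f x - c) q = gradient f q := by
    rw [gradient, gradient, fderiv_sub_const]
  refine ⟨by rw [norm_smul, norm_inv, norm_norm, inv_mul_cancel₀ h0.ne'], fun x => f x - c,
    (hf.sub contDiff_const).contDiffAt, by simp [hfq], ⟨‖gradient f q‖, h0, ?_⟩, ?_⟩
  · rw [e, smul_smul, mul_inv_cancel₀ h0.ne', one_smul]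
  · filter_upwards [hA] with x hx
    rw [hx, sub_nonneg]

end Normals

/-! ### The pattern function near a boundary point -/

section Chart

variable {d n r : ℕ} {B : BilliardTable d n r} {α : ℝ}

theorem norm_iteratedFDeriv_sub_le {f : Conf d → ℝ} {U : Set (Conf d)} (hU : IsOpen U)
    (hc : Convex ℝ U) {m k : ℕ} (hk : k < m) (hf : ContDiffOn ℝ m f U) {C : ℝ}
    (hC : ∀ x ∈ U, ‖iteratedFDeriv ℝ (k + 1) f x‖ ≤ C) {x y : Conf d} (hx : x ∈ U) (hy : y ∈ U) :
    ‖iteratedFDeriv ℝ k f x - iteratedFDeriv ℝ k f y‖ ≤ C * ‖x - y‖ := by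
  refine hc.norm_image_sub_le_of_norm_fderiv_le (𝕜 := ℝ) (fun z hz => ?_) (fun z hz => ?_) hy hx
  · exact (hf.contDiffAt (hU.mem_nhds hz)).differentiableAt_iteratedFDeriv (by exact_mod_cast hk)
  · rw [fderiv_iteratedFDeriv, Function.comp_apply, LinearIsometryEquiv.norm_map]
    exact hC z hz

/-- A pattern function near a boundary point, normalised to vanish on the boundary surface. -/
structure IsChart (P : PowerLawPotential B α) (Q : ℝ → Conf d → ℝ) (q₀ g : Conf d) : Prop where
  barrier : LocalBarrier r α Q q₀ g
  near : ∃ ϱ > 0, ∀ᶠ ε in 𝓝[>] (0 : ℝ), ∀ q, ‖q - q₀‖ < ϱ →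
    (q ∈ P.Ω ε ↔ 0 < Q ε q) ∧ (q ∈ P.auxTable ε ↔ eta r α ε ≤ Q ε q) ∧ gradient (Q ε) q ≠ 0 ∧
      (0 < Q ε q → gradient (P.V ε) q = -(barrierForce α ε (Q ε q) • gradient (Q ε) q))
  normal : ∀ n, IsInwardNormal B.D q₀ n → g = ‖g‖ • n

theorem BilliardTable.exists_mem_of_normal (B : BilliardTable d n r) {q m : Conf d}
    (h : IsInwardNormal B.D q m) : ∃ i, q ∈ B.Γ i := by
  have : q ∈ frontier B.D := ⟨subset_closure h.mem, h.notMem_interior⟩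
  rw [B.frontier_eq] at this
  simpa using this

variable (P : PowerLawPotential B α)

theorem PowerLawPotential.eventually_mem : ∀ᶠ ε in 𝓝[>] (0 : ℝ), ε ∈ Ioc 0 P.ε₀ :=
  Ioc_mem_nhdsGT P.ε₀_pos

theorem PowerLawPotential.continuousWithinAt_iteratedFDeriv {l : ℕ} (hl : l ≤ r + 1) {q : Conf d}
    (hq : q ∈ P.Dt) : Tendsto (fun x : ℝ × Conf d => iteratedFDeriv ℝ l (P.Q x.1) x.2)
      (𝓝[>] 0 ×ˢ 𝓝 q) (𝓝 (iteratedFDeriv ℝ l (P.Q 0) q)) := by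
  have h := P.continuous_Q l hl (0, q) ⟨⟨le_rfl, P.ε₀_pos.le⟩, hq⟩
  refine h.tendsto.mono_left ?_
  rw [nhdsWithin_prod_eq, P.isOpen_Dt.nhdsWithin_eq hq]
  refine Filter.prod_mono ?_ le_rfl
  rw [← nhdsWithin_Ioc_eq_nhdsGT P.ε₀_pos]
  exact nhdsWithin_mono _ Ioc_subset_Icc_self

theorem PowerLawPotential.tendsto_Q {q : Conf d} (hq : q ∈ P.Dt) :
    Tendsto (fun x : ℝ × Conf d => P.Q x.1 x.2) (𝓝[>] 0 ×ˢ 𝓝 q) (𝓝 (P.Q 0 q)) := by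
  have := ((continuousMultilinearCurryFin0 ℝ (Conf d) ℝ).continuous.tendsto _).comp
    (P.continuousWithinAt_iteratedFDeriv (l := 0) (by omega) hq)
  simpa [Function.comp_def] using this

theorem PowerLawPotential.tendsto_gradient_Q {q : Conf d} (hq : q ∈ P.Dt) :
    Tendsto (fun x : ℝ × Conf d => gradient (P.Q x.1) x.2) (𝓝[>] 0 ×ˢ 𝓝 q)
      (𝓝 (gradient (P.Q 0) q)) := by
  have := ((continuousMultilinearCurryFin1 ℝ (Conf d) ℝ).continuous.tendsto _).comp
    (P.continuousWithinAt_iteratedFDeriv (l := 1) (by omega) hq)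
  have e : ∀ (f : Conf d → ℝ) (x : Conf d), continuousMultilinearCurryFin1 ℝ (Conf d) ℝ
      (iteratedFDeriv ℝ 1 f x) = fderiv ℝ f x := by
    intro f x; ext v; simp [iteratedFDeriv_one_apply]
  simp only [Function.comp_def, e] at this
  exact ((InnerProductSpace.toDual ℝ (Conf d)).symm.continuous.tendsto _).comp this

theorem PowerLawPotential.mem_auxTable_iff (hα : 0 < α) {ε : ℝ} (hε : ε ∈ Ioc 0 P.ε₀) {i : Fin n}
    {q : Conf d} (hq : q ∈ P.N i) {c : ℝ} (hc : 0 < c) :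
    q ∈ P.innerRegion ε c ↔ c ≤ P.Q ε q - P.Qc i := by
  refine ⟨fun h => by linarith [h.2 i hq], fun h => ⟨?_, fun j hj => ?_⟩⟩
  · exact (P.finite_iff ε hε i q hq).2 (by linarith)
  · have hΩ := (P.finite_iff ε hε i q hq).2 (by linarith)
    have h1 := P.barrier_eq ε hε i q hq hΩ
    rw [P.barrier_eq ε hε j q hj hΩ] at h1
    have hj0 := (P.finite_iff ε hε j q hj).1 hΩ
    by_contra! hlt
    have := (barrier_lt_iff hα hε.1 (sub_pos.2 ((P.finite_iff ε hε i q hq).1 hΩ))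
      (sub_pos.2 hj0)).2 (by linarith)
    linarith

theorem PowerLawPotential.exists_isChart (hα : 0 < α) {i : Fin n} {q₀ : Conf d}
    (hq₀ : q₀ ∈ B.Γ i \ B.corners) : ∃ Q g, IsChart P Q q₀ g := by
  have hβ := eventually_nu_nonneg (r := r) hα
  have hN := P.Γ_subset_N i hq₀
  have hDt := P.N_subset i hN
  obtain ⟨L, O, hO, hL⟩ := P.lipschitz_Q i q₀ hq₀
  obtain ⟨C, hC⟩ := P.bounded_Q
  obtain ⟨R, hR, hRN⟩ := Metric.mem_nhds_iff.1 (inter_mem ((P.isOpen_N i).mem_nhds hN) hO)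
  have hmem : ∀ x, retr q₀ R x ∈ Metric.ball q₀ R := fun x => by
    rw [mem_ball_iff_norm]; exact norm_retr_sub_lt q₀ x hR
  have hC0 : 0 ≤ C := (norm_nonneg _).trans (hC 0 ⟨le_rfl, P.ε₀_pos.le⟩ i q₀ hN 0 (by omega))
  have hQsm : ∀ ε ∈ Ioc 0 P.ε₀, ContDiffOn ℝ (r + 1 : ℕ) (P.Q ε) (Metric.ball q₀ R) := fun ε hε =>
    (P.contDiff_Q ε (Ioc_subset_Icc_self hε)).mono fun x hx => P.N_subset i (hRN hx).1
  have hcl : Close (𝓝[>] 0) (nu r α) (r + 1) (fun ε q => P.Q ε (retr q₀ R q))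
      (fun ε q => P.Q ε (retr q₀ R q)) := by
    refine Close.of_iteratedFDeriv (U := Metric.ball q₀ R) Metric.isOpen_ball
      (contDiff_retr q₀ hR) hmem hβ ?_ (K := C + L) (by positivity) ?_
    · filter_upwards [P.eventually_mem] with ε hε using ⟨hQsm ε hε, hQsm ε hε⟩
    · filter_upwards [P.eventually_mem, hβ] with ε hε hν k hk x hx y hy
      have hε' := Ioc_subset_Icc_self hε
      have hLnn : (0 : ℝ) ≤ L := L.2
      have hx' := (hC ε hε' i x (hRN hx).1 k hk).trans (le_add_of_nonneg_right hLnn)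
      refine ⟨hx', hx', ?_⟩
      have hxy := norm_nonneg (x - y)
      have h3 : 0 ≤ (C + L) * nu r α ε := by positivity
      rcases hk.lt_or_eq with hk | rfl
      · have := norm_iteratedFDeriv_sub_le Metric.isOpen_ball (convex_ball q₀ R) hk (hQsm ε hε)
          (fun z hz => hC ε hε' i z (hRN hz).1 (k + 1) hk) hx hy
        nlinarith
      · have := (hL ε hε').dist_le_mul x (hRN hx).2 y (hRN hy).2
        rw [dist_eq_norm, dist_eq_norm] at this
        nlinarith
  obtain ⟨Q, hQ⟩ : ∃ Q : ℝ → Conf d → ℝ, Q = fun ε q => P.Q ε (retr q₀ R q) - P.Qc i := ⟨_, rfl⟩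
  have hQe : ∀ ε q, ‖q - q₀‖ ≤ R / 2 → Q ε q = P.Q ε q - P.Qc i := fun ε q hq => by
    rw [hQ]; simp only [retr_eq_self hq]
  have hgr : ∀ ε q, ‖q - q₀‖ < R / 2 → gradient (Q ε) q = gradient (P.Q ε) q := fun ε q hq => by
    have : Q ε =ᶠ[𝓝 q] fun q => P.Q ε q - P.Qc i := by
      filter_upwards [(isOpen_lt (continuous_norm.comp (continuous_sub_right q₀))
        continuous_const).mem_nhds hq] with x hx using hQe ε x (le_of_lt hx)
    rw [gradient, this.fderiv_eq, fderiv_sub_const, gradient]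
  have hnear : ∀ᶠ z : ℝ × Conf d in 𝓝[>] (0 : ℝ) ×ˢ 𝓝 q₀, ‖z.2 - q₀‖ < R / 2 := by
    have h : ∀ᶠ x in 𝓝 q₀, ‖x - q₀‖ < R / 2 := by
      filter_upwards [Metric.ball_mem_nhds q₀ (half_pos hR)] with x hx
      rwa [← mem_ball_iff_norm]
    exact h.prod_inr _
  have hlev := P.level i q₀ hq₀
  have h0mem : (0 : ℝ) ∈ Icc 0 P.ε₀ := ⟨le_rfl, P.ε₀_pos.le⟩
  have hball : ∀ q, ‖q - q₀‖ < R / 2 → q ∈ P.N i := fun q hq =>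
    (hRN (by rw [mem_ball_iff_norm]; linarith)).1
  refine ⟨Q, gradient (P.Q 0) q₀, ⟨?_, ?_, ?_, P.grad_ne 0 h0mem i q₀ hN⟩,
    ⟨R / 2, half_pos hR, ?_⟩, fun m hm => ?_⟩
  · rw [hQ]
    exact hcl.map hβ (φ := fun y : ℝ => y - P.Qc i) (by fun_prop)
  · have := (P.tendsto_Q hDt).sub_const (P.Qc i)
    rw [hlev, sub_self] at this
    exact this.congr' (hnear.mono fun z hz => (hQe z.1 z.2 hz.le).symm)
  · exact (P.tendsto_gradient_Q hDt).congr' (hnear.mono fun z hz => (hgr z.1 z.2 hz).symm)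
  · filter_upwards [P.eventually_mem] with ε hε q hq
    have hqN := hball q hq
    have hΩ := P.finite_iff ε hε i q hqN
    refine ⟨by rw [hQe ε q hq.le, hΩ, sub_pos], ?_, ?_, fun hpos => ?_⟩
    · rw [hQe ε q hq.le]
      exact P.mem_auxTable_iff hα hε hqN (eta_pos hα hε.1)
    · rw [hgr ε q hq]
      exact P.grad_ne ε (Ioc_subset_Icc_self hε) i q hqN
    · rw [hQe ε q hq.le] at hpos
      have hev : P.V ε =ᶠ[𝓝 q] fun x => SteepBilliard.barrier α ε (P.Q ε x - P.Qc i) := by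
        filter_upwards [(P.isOpen_N i).mem_nhds hqN,
          (P.isOpen_Ω ε hε).mem_nhds (hΩ.2 (sub_pos.1 hpos))] with x h1 h2
        exact P.barrier_eq ε hε i x h1 h2
      have hd : DifferentiableAt ℝ (P.Q ε) q :=
        (((P.contDiff_Q ε (Ioc_subset_Icc_self hε)).contDiffAt
          (P.isOpen_Dt.mem_nhds (P.N_subset i hqN))).differentiableAt (by simp))
      have := ((hasDerivAt_barrier (α := α) hε.1 hpos).comp_hasFDerivAt q
        (hd.hasFDerivAt.sub_const (P.Qc i))).fderiv
      rw [Function.comp_def] at this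
      rw [gradient, hev.fderiv_eq, this, hgr ε q hq, hQe ε q hq.le, gradient, map_smul, neg_smul]
  · have hd : DifferentiableAt ℝ (P.Q 0) q₀ := ((P.contDiff_Q 0 h0mem).contDiffAt
      (P.isOpen_Dt.mem_nhds hDt)).differentiableAt (by simp)
    have e : gradient (fun x => P.Q 0 x - P.Qc i) q₀ = gradient (P.Q 0) q₀ := by
      rw [gradient, gradient, fderiv_sub_const]
    rw [← e]
    refine hm.gradient_eq (hd.sub_const _) (by rw [hlev, sub_self]) ?_
    filter_upwards [(P.isOpen_N i).mem_nhds hN] with x hx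
    rw [P.side i x hx, sub_nonneg]

end Chart

/-! ### The potential near an inner point -/

section Inner

variable {d n r : ℕ} {B : BilliardTable d n r} {α : ℝ} (P : PowerLawPotential B α)

theorem eventually_prod_ball {E : Type} [NormedAddCommGroup E] {l : Filter ℝ} {x : E}
    {p : ℝ × E → Prop} (h : ∀ᶠ z in l ×ˢ 𝓝 x, p z) :
    ∃ R > 0, ∀ᶠ ε in l, ∀ y, ‖y - x‖ < R → p (ε, y) := by
  obtain ⟨pa, ha, pb, hb, hab⟩ := Filter.eventually_prod_iff.1 h
  obtain ⟨R, hR, h⟩ := Metric.eventually_nhds_iff.1 hb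
  exact ⟨R, hR, ha.mono fun ε hε y hy => hab hε (h (by rwa [dist_eq_norm]))⟩

theorem iteratedFDeriv_succ_sub_const (f : Conf d → ℝ) (c : ℝ) (k : ℕ) :
    iteratedFDeriv ℝ (k + 1) (fun x => f x - c) = iteratedFDeriv ℝ (k + 1) f := by
  have h : fderiv ℝ (fun x => f x - c) = fderiv ℝ f := funext fun x => fderiv_sub_const _
  ext x v
  rw [iteratedFDeriv_succ_apply_right, iteratedFDeriv_succ_apply_right]
  exact congrArg (fun g => (iteratedFDeriv ℝ k g x (Fin.init v)) (v (Fin.last k))) h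

theorem BilliardTable.interior_subset (B : BilliardTable d n r) {q : Conf d}
    (hq : q ∈ interior B.D) : q ∈ B.D \ B.corners :=
  ⟨_root_.interior_subset hq, fun h => (B.corners_subset h).2 hq⟩

namespace PowerLawPotential

theorem exists_level_le {q₀ : Conf d} (hq₀ : q₀ ∈ interior B.D) (j : Fin n) :
    ∃ δ > 0, ∀ᶠ z in 𝓝[>] (0 : ℝ) ×ˢ 𝓝 q₀, z.2 ∈ P.N j → P.Qc j + δ ≤ P.Q z.1 z.2 := by
  by_cases h : q₀ ∈ closure (P.N j)
  · have h1 := P.inner_side j q₀ h hq₀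
    refine ⟨(P.Q 0 q₀ - P.Qc j) / 2, by linarith, ?_⟩
    filter_upwards [(P.tendsto_Q (P.diff_subset_Dt (B.interior_subset hq₀))).eventually
      (lt_mem_nhds (show (P.Q 0 q₀ + P.Qc j) / 2 < P.Q 0 q₀ by linarith))] with z hz _
    linarith
  · have h1 : ∀ᶠ q in 𝓝 q₀, q ∈ (closure (P.N j))ᶜ := isClosed_closure.isOpen_compl.mem_nhds h
    exact ⟨1, one_pos, (h1.prod_inr _).mono fun z hz hz' => absurd (subset_closure hz') hz⟩

theorem norm_iteratedFDeriv_levelSurface_le (hα : 0 < α) {δ : ℝ} (hδ : 0 < δ) :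
    ∃ K, 0 ≤ K ∧ ∀ ε ∈ Ioc 0 P.ε₀, ∀ q ∈ P.levelSurface ε δ, ∀ l ≤ r + 1,
      ‖iteratedFDeriv ℝ l (P.V ε) q‖ ≤ K * ε ^ α := by
  obtain ⟨C, hC⟩ := P.bounded_Q
  obtain ⟨φ, hφ⟩ : ∃ φ : ℝ → ℝ, φ = fun y => y ^ (-α) := ⟨_, rfl⟩
  obtain ⟨M, hM⟩ : ∃ M, M = ∑ i ∈ Finset.range (r + 2), ‖iteratedFDerivWithin ℝ i φ (Ioi 0) δ‖ :=
    ⟨_, rfl⟩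
  obtain ⟨D, hD⟩ : ∃ D, D = max C 1 := ⟨_, rfl⟩
  have hD1 : 1 ≤ D := hD ▸ le_max_right _ _
  have hM0 : 0 ≤ M := hM ▸ Finset.sum_nonneg fun _ _ => norm_nonneg _
  refine ⟨(r + 1).factorial * M * D ^ (r + 1), by positivity, fun ε hε q ⟨i, hq, hQ⟩ l hl => ?_⟩
  have hε' := Ioc_subset_Icc_self hε
  obtain ⟨u, hu⟩ : ∃ u : Conf d → ℝ, u = fun x => P.Q ε x - P.Qc i := ⟨_, rfl⟩
  obtain ⟨s, hs⟩ : ∃ s, s = P.N i ∩ P.Ω ε := ⟨_, rfl⟩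
  have hso : IsOpen s := hs ▸ (P.isOpen_N i).inter (P.isOpen_Ω ε hε)
  have hqΩ : q ∈ P.Ω ε := (P.finite_iff ε hε i q hq).2 (by linarith)
  have hqs : q ∈ s := hs ▸ ⟨hq, hqΩ⟩
  have huq : u q = δ := by rw [hu]; simp only [hQ]; ring
  have hmaps : MapsTo u s (Ioi 0) := fun x hx => by
    rw [hs] at hx
    rw [hu]
    exact sub_pos.2 ((P.finite_iff ε hε i x hx.1).1 hx.2)
  have hev : ∀ x ∈ s, P.V ε x = ε ^ α • (φ ∘ u) x := fun x hx => by
    have h0 := hmaps hx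
    rw [hs] at hx
    rw [P.barrier_eq ε hε i x hx.1 hx.2]
    rw [hu] at h0 ⊢
    rw [hφ, smul_eq_mul, barrier_eq_mul hε.1 h0]; rfl
  have hus : ContDiffOn ℝ ((r + 1 : ℕ) : WithTop ℕ∞) u s := by
    rw [hu]
    refine ContDiffOn.sub ((P.contDiff_Q ε hε').mono fun x hx => P.N_subset i ?_) contDiffOn_const
    rw [hs] at hx; exact hx.1
  have hφs : ContDiffOn ℝ ((r + 1 : ℕ) : WithTop ℕ∞) φ (Ioi 0) := by
    rw [hφ]
    exact fun x hx => (contDiffAt_id.rpow_const_of_ne (ne_of_gt hx)).contDiffWithinAt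
  have hcomp := norm_iteratedFDerivWithin_comp_le (n := l) (C := M) (D := D) hφs hus
    (by exact_mod_cast hl) (uniqueDiffOn_Ioi 0) hso.uniqueDiffOn hmaps hqs (fun k hk => by
      rw [huq, hM]
      exact Finset.single_le_sum (f := fun k => ‖iteratedFDerivWithin ℝ k φ (Ioi 0) δ‖)
        (fun _ _ => norm_nonneg _) (Finset.mem_range.2 (by omega))) (fun k hk1 hk => by
      rw [iteratedFDerivWithin_of_isOpen k hso hqs]
      have e : iteratedFDeriv ℝ k u q = iteratedFDeriv ℝ k (P.Q ε) q := by
        obtain ⟨k, rfl⟩ : ∃ k', k = k' + 1 := ⟨k - 1, by omega⟩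
        rw [hu, iteratedFDeriv_succ_sub_const]
      rw [e]
      calc _ ≤ C := hC ε hε' i q hq k (by omega)
        _ ≤ D := hD ▸ le_max_left _ _
        _ ≤ D ^ k := le_self_pow₀ hD1 (by omega))
  have hVs : iteratedFDerivWithin ℝ l (P.V ε) s q =
      ε ^ α • iteratedFDerivWithin ℝ l (φ ∘ u) s q := by
    rw [iteratedFDerivWithin_congr (f := fun x => ε ^ α • (φ ∘ u) x) (fun x hx => hev x hx) hqs]
    exact iteratedFDerivWithin_const_smul_apply (f := φ ∘ u) (a := ε ^ α)
      (((hφs.comp hus hmaps) q hqs).of_le (by exact_mod_cast hl)) hso.uniqueDiffOn hqs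
  rw [← iteratedFDerivWithin_of_isOpen l hso hqs, hVs, norm_smul,
    Real.norm_of_nonneg (Real.rpow_nonneg hε.1.le α), mul_comm]
  refine mul_le_mul_of_nonneg_right (hcomp.trans ?_) (Real.rpow_nonneg hε.1.le α)
  gcongr

/-- Near an inner point the force is small with its derivatives. -/
theorem exists_inner_force (hα : 0 < α) (hP : P.BoundaryDominated) {q₀ : Conf d}
    (hq₀ : q₀ ∈ interior B.D) : ∃ f : ℝ → Conf d → Conf d,
      Close (𝓝[>] 0) (nu r α) r f (fun _ => 0) ∧ ∃ R > 0, ∀ᶠ ε in 𝓝[>] (0 : ℝ), ∀ q, ‖q - q₀‖ < R →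
        q ∈ P.Ω ε ∧ q ∈ interior (P.auxTable ε) ∧ f ε q = -gradient (P.V ε) q := by
  have hβ := eventually_nu_nonneg (r := r) hα
  obtain ⟨ε₁, hε₁, δ₁, hδ₁, hdom⟩ := hP
  choose δ' hδ' hlev using P.exists_level_le hq₀
  obtain ⟨δ, ⟨hδ, hδδ₁⟩, hδδ'⟩ : ∃ δ, δ ∈ Ioo 0 δ₁ ∧ ∀ j, δ ≤ δ' j := by
    have h1 : ∀ᶠ δ in 𝓝[>] (0 : ℝ), δ ∈ Ioo 0 δ₁ := Ioo_mem_nhdsGT hδ₁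
    have h2 : ∀ᶠ δ in 𝓝[>] (0 : ℝ), ∀ j, δ ≤ δ' j := by
      refine eventually_all.2 fun j => ?_
      have : ∀ᶠ δ in 𝓝[>] (0 : ℝ), δ ∈ Ioo 0 (δ' j) := Ioo_mem_nhdsGT (hδ' j)
      exact this.mono fun δ h => h.2.le
    exact (h1.and h2).exists
  obtain ⟨R₁, hR₁, hball⟩ := eventually_prod_ball (eventually_all.2 hlev)
  obtain ⟨R₂, hR₂, hball₂⟩ := Metric.nhds_basis_closedBall.mem_iff.1 (isOpen_interior.mem_nhds hq₀)
  have hΩ := P.interior_domain _ hball₂ (isCompact_closedBall _ _)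
  obtain ⟨R, hR⟩ : ∃ R, R = min R₁ R₂ := ⟨_, rfl⟩
  have hR0 : 0 < R := hR ▸ lt_min hR₁ hR₂
  have hin : ∀ᶠ ε in 𝓝[>] (0 : ℝ), Metric.ball q₀ R ⊆ P.innerRegion ε δ := by
    filter_upwards [hball, hΩ] with ε h1 h2 q hq
    rw [mem_ball_iff_norm] at hq
    refine ⟨h2 (mem_closedBall_iff_norm.2 (hq.le.trans (hR ▸ min_le_right _ _))), fun j hj => ?_⟩
    have := h1 q (hq.trans_le (hR ▸ min_le_left _ _)) j hj
    exact (by linarith [hδδ' j] : P.Qc j + δ ≤ P.Qc j + δ' j).trans this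
  obtain ⟨K, hK, hKV⟩ := P.norm_iteratedFDeriv_levelSurface_le hα hδ
  have hsmall : ∀ᶠ ε in 𝓝[>] (0 : ℝ), ∀ q ∈ Metric.ball q₀ R, ∀ l, 1 ≤ l → l ≤ r + 1 →
      ‖iteratedFDeriv ℝ l (P.V ε) q‖ ≤ K * nu r α ε := by
    filter_upwards [hin, P.eventually_mem, Ioo_mem_nhdsGT (lt_min hε₁ one_pos)]
      with ε h1 h2 h3 q hq l hl1 hl
    have hν : 0 ≤ K * nu r α ε := mul_nonneg hK (nu_pos h2.1).le
    have hle : P.derivSup ε (P.levelSurface ε δ) ≤ ENNReal.ofReal (K * nu r α ε) := by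
      refine iSup₂_le fun x hx => iSup₂_le fun k hk => ?_
      rw [← ofReal_norm]
      refine ENNReal.ofReal_le_ofReal ((hKV ε h2 x hx k (Finset.mem_Icc.1 hk).2).trans ?_)
      exact mul_le_mul_of_nonneg_left (rpow_le_nu hα h2.1 (h3.2.le.trans (min_le_right _ _))) hK
    rw [← hdom ε ⟨h3.1, h3.2.trans_le (min_le_left _ _)⟩ δ ⟨hδ, hδδ₁⟩] at hle
    have h4 : ‖iteratedFDeriv ℝ l (P.V ε) q‖ₑ ≤ P.derivSup ε (P.innerRegion ε δ) :=
      (le_iSup₂ (f := fun k (_ : k ∈ Finset.Icc 1 (r + 1)) => ‖iteratedFDeriv ℝ k (P.V ε) q‖ₑ) l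
        (Finset.mem_Icc.2 ⟨hl1, hl⟩)).trans (le_iSup₂ (f := fun x (_ : x ∈ P.innerRegion ε δ) =>
          ⨆ k ∈ Finset.Icc 1 (r + 1), ‖iteratedFDeriv ℝ k (P.V ε) x‖ₑ) q (h1 hq))
    have := h4.trans hle
    rw [← ofReal_norm] at this
    exact (ENNReal.ofReal_le_ofReal_iff hν).1 this
  have hsm : ∀ᶠ ε in 𝓝[>] (0 : ℝ),
      ContDiffOn ℝ ((r + 1 : ℕ) : WithTop ℕ∞) (P.V ε) (Metric.ball q₀ R) := by
    filter_upwards [hin, P.eventually_mem] with ε h1 h2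
    exact (P.contDiff_V ε h2).mono fun x hx => (h1 hx).1
  have hcl : Close (𝓝[>] 0) (nu r α) (r + 1) (fun ε q => P.V ε (retr q₀ R q) - P.V ε q₀)
      (fun _ _ => 0) := by
    refine Close.of_iteratedFDeriv (f := fun ε q => P.V ε q - P.V ε q₀) (g := fun _ _ => (0 : ℝ))
      (U := Metric.ball q₀ R) Metric.isOpen_ball
      (contDiff_retr q₀ hR0) (fun x => retr_mem_ball q₀ x hR0) hβ ?_ (K := K * (R + 1))
      (by positivity) ?_
    · filter_upwards [hsm] with ε hε
      exact ⟨hε.sub contDiffOn_const, contDiffOn_const⟩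
    · filter_upwards [hsm, hsmall, hβ, (eventually_nu_bounds (r := r) hα)] with ε h1 h2 h3 h4 k hk x hx y hy
      have e0 : iteratedFDeriv ℝ k (fun _ : Conf d => (0 : ℝ)) = fun _ => 0 := by
        exact iteratedFDeriv_fun_zero
      have main : ‖iteratedFDeriv ℝ k (fun q => P.V ε q - P.V ε q₀) x‖ ≤ K * (R + 1) * nu r α ε := by
        rcases k with _ | k
        · rw [norm_iteratedFDeriv_zero]
          have hx0 := (convex_ball q₀ R).norm_image_sub_le_of_norm_fderiv_le (𝕜 := ℝ)
            (f := P.V ε) (C := K * nu r α ε)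
            (fun z hz => (h1.contDiffAt (Metric.isOpen_ball.mem_nhds hz)).differentiableAt (by simp))
            (fun z hz => by
              have := h2 z hz 1 le_rfl (by omega)
              rwa [← norm_fderiv_iteratedFDeriv, norm_fderiv_iteratedFDeriv, 
                norm_iteratedFDeriv_one] at this)
            (Metric.mem_ball_self hR0) hx
          rw [mem_ball_iff_norm] at hx
          have h5 : 0 ≤ K * nu r α ε := mul_nonneg hK h3
          calc _ ≤ K * nu r α ε * ‖x - q₀‖ := hx0
            _ ≤ K * nu r α ε * (R + 1) := by gcongr; linarith
            _ = _ := by ring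
        · rw [iteratedFDeriv_succ_sub_const]
          have h5 : 0 ≤ K * nu r α ε := mul_nonneg hK h3
          calc _ ≤ K * nu r α ε := h2 x hx _ (by omega) hk
            _ ≤ K * nu r α ε * (R + 1) := le_mul_of_one_le_right h5 (by linarith)
            _ = _ := by ring
      rw [e0, norm_zero, sub_zero]
      have h6 : 0 ≤ K * (R + 1) := by positivity
      refine ⟨main.trans (mul_le_of_le_one_right h6 h4.2), h6, main.trans ?_⟩
      gcongr
      linarith [norm_nonneg (x - y)]
  refine ⟨fun ε q => -gradient (fun q => P.V ε (retr q₀ R q) - P.V ε q₀) q, ?_, R / 2, half_pos hR0, ?_⟩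
  · have h1 := (hcl.gradient hβ).map hβ (φ := fun y : Conf d => -y) (by fun_prop)
    refine h1.congr (.of_forall fun ε => rfl) (.of_forall fun ε => ?_)
    funext q
    rw [gradient, fderiv_const_apply, map_zero, neg_zero, Pi.zero_apply]
  · filter_upwards [hin, (tendsto_eta (r := r) hα).eventually (gt_mem_nhds hδ)] with ε h1 h2 q hq
    have hq' : q ∈ Metric.ball q₀ R := by rw [mem_ball_iff_norm]; linarith
    refine ⟨(h1 hq').1, ?_, ?_⟩
    · refine mem_interior.2 ⟨_, fun x hx => ?_, Metric.isOpen_ball, hq'⟩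
      exact ⟨(h1 hx).1, fun i hi => by linarith [(h1 hx).2 i hi]⟩
    · have : (fun q => P.V ε (retr q₀ R q) - P.V ε q₀) =ᶠ[𝓝 q] fun q => P.V ε q - P.V ε q₀ := by
        filter_upwards [(isOpen_lt (continuous_norm.comp (continuous_sub_right q₀))
          continuous_const).mem_nhds hq] with x hx
        rw [retr_eq_self (le_of_lt hx)]
      rw [gradient, this.fderiv_eq, fderiv_sub_const, gradient]

end PowerLawPotential

end Inner

/-! ### Concatenation of orbits -/

section Concat

variable {d : ℕ}

theorem IsPath.isHamiltonianOrbit {Ω : Set (Conf d)} {U : Conf d → ℝ} {T : ℝ} {x y : Phase d}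
    {γ : ℝ → Phase d} (h : IsPath (forceField fun q => -gradient U q) (fun _ y => y.1 ∈ Ω) 0 T x y γ) :
    IsHamiltonianOrbit Ω U T γ :=
  fun t ht => ⟨h.prop t ht, h.deriv t ht⟩

theorem IsHamiltonianOrbit.isPath {Ω : Set (Conf d)} {U : Conf d → ℝ} {T : ℝ} {γ : ℝ → Phase d}
    (h : IsHamiltonianOrbit Ω U T γ) (hT : 0 ≤ T) :
    IsPath (forceField fun q => -gradient U q) (fun _ y => y.1 ∈ Ω) 0 T (γ 0) (γ T) γ :=
  ⟨hT, rfl, rfl, fun t ht => (h t ht).2, fun t ht => (h t ht).1⟩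

/-- The curve `γ₁` up to the time `a`, followed by `γ₂`. -/
def followedBy {E : Type} (a : ℝ) (γ₁ γ₂ : ℝ → E) (t : ℝ) : E := if t ≤ a then γ₁ t else γ₂ (t - a)

theorem followedBy_of_le {E : Type} {a t : ℝ} (γ₁ γ₂ : ℝ → E) (ht : t ≤ a) :
    followedBy a γ₁ γ₂ t = γ₁ t := if_pos ht

theorem followedBy_of_ge {E : Type} {a t : ℝ} {γ₁ γ₂ : ℝ → E} (h : γ₁ a = γ₂ 0) (ht : a ≤ t) :
    followedBy a γ₁ γ₂ t = γ₂ (t - a) := by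
  rcases ht.eq_or_lt with rfl | ht
  · rw [followedBy_of_le _ _ le_rfl, sub_self, h]
  · exact if_neg (not_le.2 ht)

theorem IsHamiltonianOrbit.followedBy {Ω : Set (Conf d)} {U : Conf d → ℝ} {a b : ℝ} (ha : 0 ≤ a)
    (hb : 0 ≤ b) {γ₁ γ₂ : ℝ → Phase d} (h₁ : IsHamiltonianOrbit Ω U a γ₁)
    (h₂ : IsHamiltonianOrbit Ω U b γ₂) (h : γ₁ a = γ₂ 0) :
    IsHamiltonianOrbit Ω U (a + b) (followedBy a γ₁ γ₂) := by
  have e := (h₂.isPath hb).shift a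
  rw [zero_add, add_comm b a, ← h] at e
  exact ((h₁.isPath ha).concat e).isHamiltonianOrbit

theorem IsRegularBilliardOrbit.followedBy {A : Set (Conf d)} {a b : ℝ} (ha : 0 ≤ a)
    (hb : 0 ≤ b) {S₁ S₂ : Finset ℝ} {γ₁ γ₂ : ℝ → Phase d} (h₁ : IsRegularBilliardOrbit A a S₁ γ₁)
    (h₂ : IsRegularBilliardOrbit A b S₂ γ₂) (h : γ₁ a = γ₂ 0) :
    IsRegularBilliardOrbit A (a + b) (S₁ ∪ S₂.map (addRightEmbedding a)) (followedBy a γ₁ γ₂) := by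
  have e1 : ∀ t ≤ a, SteepBilliard.followedBy a γ₁ γ₂ t = γ₁ t := fun t ht => followedBy_of_le _ _ ht
  have e2 : ∀ t, a ≤ t → SteepBilliard.followedBy a γ₁ γ₂ t = γ₂ (t - a) := fun t ht =>
    followedBy_of_ge h ht
  have hS : ∀ {s}, s ∈ S₁ ∪ S₂.map (addRightEmbedding a) ↔ s ∈ S₁ ∨ s - a ∈ S₂ := by
    intro s
    rw [Finset.mem_union, Finset.mem_map]
    refine or_congr_right ⟨?_, fun h => ⟨s - a, h, by simp⟩⟩
    rintro ⟨x, hx, rfl⟩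
    simpa using hx
  have hfree₂ : ∀ x y : ℝ, a ≤ x → x ≤ y → y ≤ a + b → (∀ s ∈ S₂, ¬(x < s + a ∧ s + a ≤ y)) →
      SteepBilliard.followedBy a γ₁ γ₂ y = ((SteepBilliard.followedBy a γ₁ γ₂ x).1 + (y - x) •
        (SteepBilliard.followedBy a γ₁ γ₂ x).2, (SteepBilliard.followedBy a γ₁ γ₂ x).2) := by
    intro x y hx hxy hy hs
    rw [e2 x hx, e2 y (hx.trans hxy), h₂.free (x - a) (y - a) (by linarith) (by linarith)
      (by linarith) fun s hs' hh => hs s hs' ⟨by linarith [hh.1], by linarith [hh.2]⟩]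
    rw [sub_sub_sub_cancel_right]
  refine ⟨fun s hs => ?_, ?_, fun t ht hts => ?_, fun x y hx hxy hy hs => ?_, fun s hs => ?_⟩
  · rcases hS.1 hs with hs | hs
    · have := h₁.times s hs
      exact ⟨this.1, by linarith⟩
    · have := h₂.times _ hs
      exact ⟨by linarith, by linarith⟩
  · have hu : Icc 0 (a + b) = Icc 0 a ∪ Icc a (a + b) :=
      (Icc_union_Icc_eq_Icc ha (le_add_of_nonneg_right hb)).symm
    rw [hu]
    refine ContinuousOn.union_of_isClosed (h₁.continuous_pos.congr fun t ht => ?_)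
      ((h₂.continuous_pos.comp (f := fun t => t - a) (by fun_prop) fun t ht => ?_).congr
        fun t ht => ?_) isClosed_Icc isClosed_Icc
    · rw [e1 t ht.2]
    · exact ⟨sub_nonneg.2 ht.1, by linarith [ht.2]⟩
    · rw [e2 t ht.1]; rfl
  · rw [hS, not_or] at hts
    rcases le_total t a with h | h
    · rw [e1 t h]
      exact h₁.inner t ⟨ht.1, h⟩ hts.1
    · rw [e2 t h]
      exact h₂.inner _ ⟨sub_nonneg.2 h, by linarith [ht.2]⟩ hts.2
  · have hs₁ : ∀ s ∈ S₁, ¬(x < s ∧ s ≤ y) := fun s h => hs s (hS.2 (Or.inl h))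
    have hs₂ : ∀ s ∈ S₂, ¬(x < s + a ∧ s + a ≤ y) := fun s h => hs _ (hS.2 (Or.inr (by simpa)))
    rcases le_total y a with hya | hya
    · rw [e1 y hya, e1 x (hxy.trans hya)]
      exact h₁.free x y hx hxy hya hs₁
    · rcases le_total a x with hxa | hxa
      · exact hfree₂ x y hxa hxy hy hs₂
      · rw [hfree₂ a y le_rfl hya hy fun s h hh => hs₂ s h ⟨hxa.trans_lt hh.1, hh.2⟩, e1 x hxa,
          e1 a le_rfl, h₁.free x a hx hxa le_rfl fun s h hh => hs₁ s h ⟨hh.1, hh.2.trans hya⟩]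
        ext1
        · simp only [add_assoc, ← add_smul]
          ring_nf
        · rfl
  · rcases hS.1 hs with hs | hs
    · obtain ⟨n, p, hn, hp, hpn, hr⟩ := h₁.collision s hs
      have hsa := (h₁.times s hs).2.le
      rw [e1 s hsa]
      refine ⟨n, p, hn, ?_, hpn, hr⟩
      filter_upwards [hp, self_mem_nhdsWithin] with t ht hts
      rw [e1 t ((le_of_lt hts).trans hsa), ht]
    · obtain ⟨n, p, hn, hp, hpn, hr⟩ := h₂.collision _ hs
      have hsa := (h₂.times _ hs).1
      rw [e2 s (by linarith)]
      refine ⟨n, p, hn, ?_, hpn, hr⟩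
      have ht : Tendsto (fun t => t - a) (𝓝[<] s) (𝓝[<] (s - a)) := by
        refine tendsto_nhdsWithin_iff.2 ⟨?_, ?_⟩
        · exact ((continuous_sub_right a).tendsto s).mono_left nhdsWithin_le_nhds
        · filter_upwards [self_mem_nhdsWithin] with t ht using sub_lt_sub_right ht a
      filter_upwards [ht.eventually hp, Ioo_mem_nhdsLT (show a < s by linarith)] with t h1 h2
      rw [e2 t h2.1.le, h1]

end Concat

/-! ### Pairs of flow maps -/

section FlowData

theorem eventually_prod_top {I J : Type} {l : Filter I} {p : I × J → Prop} :
    (∀ᶠ z in l ×ˢ ⊤, p z) ↔ ∀ᶠ i in l, ∀ j, p (i, j) := by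
  rw [← principal_univ, eventually_prod_principal_iff]
  simp

theorem Close.sumElim {I J₁ J₂ : Type} {l : Filter I} {β : I → ℝ} {r : ℕ} {E F : Type}
    [NormedAddCommGroup E] [NormedSpace ℝ E] [NormedAddCommGroup F] [NormedSpace ℝ F]
    (hβ : ∀ᶠ i in l, 0 ≤ β i) {f₁ g₁ : I × J₁ → E → F} {f₂ g₂ : I × J₂ → E → F}
    (h₁ : Close (l ×ˢ ⊤) (fun i => β i.1) r f₁ g₁) (h₂ : Close (l ×ˢ ⊤) (fun i => β i.1) r f₂ g₂) :
    Close (l ×ˢ (⊤ : Filter (J₁ ⊕ J₂))) (fun i => β i.1) r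
      (fun i => Sum.elim (fun j => f₁ (i.1, j)) (fun j => f₂ (i.1, j)) i.2)
      (fun i => Sum.elim (fun j => g₁ (i.1, j)) (fun j => g₂ (i.1, j)) i.2) := by
  have h0 : ∀ {E F : Type} [NormedAddCommGroup E] [NormedAddCommGroup F]
      {f₁ g₁ : I × J₁ → E → F} {f₂ g₂ : I × J₂ → E → F},
      CloseZero (l ×ˢ ⊤) (fun i => β i.1) f₁ g₁ → CloseZero (l ×ˢ ⊤) (fun i => β i.1) f₂ g₂ →
      CloseZero (l ×ˢ (⊤ : Filter (J₁ ⊕ J₂))) (fun i => β i.1)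
        (fun i => Sum.elim (fun j => f₁ (i.1, j)) (fun j => f₂ (i.1, j)) i.2)
        (fun i => Sum.elim (fun j => g₁ (i.1, j)) (fun j => g₂ (i.1, j)) i.2) := by
    intro E F _ _ f₁ g₁ f₂ g₂ h₁ h₂ R
    obtain ⟨K₁, hK₁, h₁⟩ := h₁ R
    obtain ⟨K₂, hK₂, h₂⟩ := h₂ R
    refine ⟨max K₁ K₂, le_max_of_le_left hK₁, ?_⟩
    rw [eventually_prod_top] at h₁ h₂ ⊢
    filter_upwards [h₁, h₂, hβ] with i h₁ h₂ hb j x y hx hy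
    have hxy : 0 ≤ ‖x - y‖ + β i := by positivity
    rcases j with j | j
    · obtain ⟨a, b, c⟩ := h₁ j x y hx hy
      exact ⟨a.trans (le_max_left _ _), b.trans (le_max_left _ _),
        c.trans (mul_le_mul_of_nonneg_right (le_max_left _ _) hxy)⟩
    · obtain ⟨a, b, c⟩ := h₂ j x y hx hy
      exact ⟨a.trans (le_max_right _ _), b.trans (le_max_right _ _),
        c.trans (mul_le_mul_of_nonneg_right (le_max_right _ _) hxy)⟩
  induction r generalizing E F with
  | zero => exact h0 h₁ h₂
  | succ r ih =>
    refine ⟨h0 h₁.1 h₂.1, ?_, ?_⟩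
    · have a := h₁.2.1
      have b := h₂.2.1
      rw [eventually_prod_top] at a b ⊢
      filter_upwards [a, b] with i a b j
      rcases j with j | j
      · exact a j
      · exact b j
    · refine Close.congr (.of_forall ?_) (.of_forall ?_) (ih h₁.2.2 h₂.2.2) <;>
      · rintro ⟨i, j | j⟩ <;> rfl

variable {d n r : ℕ} {B : BilliardTable d n r} {α : ℝ}

/-- The Hamiltonian flow `h` and the billiard flow `b` on `[0, τ]`, for initial points near `y₀`,
with their values `F`, `G` at the time `τ`. Off the impact intervals their germs belong to the close
families `f`, `g`. -/
structure FlowData (P : PowerLawPotential B α) (y₀ y₁ : Phase d) (τ : ℝ) (m : ℕ) where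
  h : ℝ → ℝ → Phase d → Phase d
  b : ℝ → ℝ → Phase d → Phase d
  S : ℝ → Phase d → Finset ℝ
  F : ℝ → Phase d → Phase d
  G : ℝ → Phase d → Phase d
  ι : Type
  f : ℝ × ι → Phase d → Phase d
  g : ℝ × ι → Phase d → Phase d
  nonneg : 0 ≤ τ
  close : Close (𝓝[>] 0) (nu r α) r F G
  tendsto : Tendsto (fun z : ℝ × Phase d => G z.1 z.2) (𝓝[>] 0 ×ˢ 𝓝 y₀) (𝓝 y₁)
  close_germs : Close (𝓝[>] 0 ×ˢ ⊤) (fun i => nu r α i.1) r f g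
  orbits : ∀ᶠ z : ℝ × Phase d in 𝓝[>] 0 ×ˢ 𝓝 y₀, h z.1 0 z.2 = z.2 ∧
    IsHamiltonianOrbit (P.Ω z.1) (P.V z.1) τ (fun t => h z.1 t z.2) ∧ h z.1 τ z.2 = F z.1 z.2 ∧
    b z.1 0 z.2 = z.2 ∧
    IsRegularBilliardOrbit (P.auxTable z.1) τ (S z.1 z.2) (fun t => b z.1 t z.2) ∧
    b z.1 τ z.2 = G z.1 z.2 ∧ (S z.1 z.2).card = m ∧
    (m = 0 → ∀ t ∈ Icc 0 τ, (h z.1 t z.2).1 ∈ interior (P.auxTable z.1))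
  germs : ∀ K : ℝ, ∃ C : ℝ, ∀ᶠ z : ℝ × (Phase d × Phase d) in 𝓝[>] 0 ×ˢ 𝓝 (y₀, y₀),
    ‖z.2.1 - z.2.2‖ ≤ K * nu r α z.1 → ∀ t ∈ Icc 0 τ,
      (∀ s ∈ S z.1 z.2.1, t ∉ Icc (s - C * impactScale r α z.1) (s + C * impactScale r α z.1)) →
        ∃ i, h z.1 t =ᶠ[𝓝 z.2.2] f (z.1, i) ∧ b z.1 t =ᶠ[𝓝 z.2.1] g (z.1, i)

theorem impactScale_nonneg {ε : ℝ} (hε : 0 < ε) : 0 ≤ impactScale r α ε := by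
  rw [impactScale]
  split_ifs
  · exact (nu_pos hε).le
  · exact Real.rpow_nonneg (nu_pos hε).le _

theorem mem_Icc_of_le {s t C C' a : ℝ} (hC : C ≤ C') (ha : 0 ≤ a)
    (h : t ∈ Icc (s - C * a) (s + C * a)) : t ∈ Icc (s - C' * a) (s + C' * a) := by
  have := mul_le_mul_of_nonneg_right hC ha
  exact ⟨by linarith [h.1], by linarith [h.2]⟩

variable {P : PowerLawPotential B α}

theorem FlowData.trans (hr : 1 ≤ r) (hα : 0 < α) {y₀ y₁ y₂ : Phase d} {τ₁ τ₂ : ℝ} {m₁ m₂ : ℕ}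
    (D₁ : FlowData P y₀ y₁ τ₁ m₁) (D₂ : FlowData P y₁ y₂ τ₂ m₂) :
    Nonempty (FlowData P y₀ y₂ (τ₁ + τ₂) (m₁ + m₂)) := by
  have hβ := eventually_nu_nonneg (r := r) hα
  have hG : Tendsto (fun z : ℝ × Phase d => (z.1, D₁.G z.1 z.2)) (𝓝[>] 0 ×ˢ 𝓝 y₀)
    (𝓝[>] 0 ×ˢ 𝓝 y₁) := tendsto_fst.prodMk D₁.tendsto
  have hF₁ := D₁.close.tendsto (tendsto_nu hα) D₁.tendsto
  have hF : Tendsto (fun z : ℝ × Phase d => (z.1, D₁.F z.1 z.2)) (𝓝[>] 0 ×ˢ 𝓝 y₀)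
    (𝓝[>] 0 ×ˢ 𝓝 y₁) := tendsto_fst.prodMk hF₁
  have hβ' : ∀ᶠ i : ℝ × D₂.ι in 𝓝[>] 0 ×ˢ ⊤, 0 ≤ nu r α i.1 := hβ.prod_inl _
  have hfst : Tendsto (Prod.fst : ℝ × D₂.ι → ℝ) (𝓝[>] 0 ×ˢ ⊤) (𝓝[>] 0) := tendsto_fst
  have hcg : Close (𝓝[>] 0 ×ˢ ⊤) (fun i : ℝ × D₂.ι => nu r α i.1) r
      (fun i y => D₂.f i (D₁.F i.1 y)) (fun i y => D₂.g i (D₁.G i.1 y)) :=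
    D₂.close_germs.comp hβ' (D₁.close.comap hfst)
  refine ⟨{
    h := fun ε t y => followedBy τ₁ (fun t => D₁.h ε t y) (fun t => D₂.h ε t (D₁.F ε y)) t
    b := fun ε t y => followedBy τ₁ (fun t => D₁.b ε t y) (fun t => D₂.b ε t (D₁.G ε y)) t
    S := fun ε y => D₁.S ε y ∪ (D₂.S ε (D₁.G ε y)).map (addRightEmbedding τ₁)
    F := fun ε y => D₂.F ε (D₁.F ε y)
    G := fun ε y => D₂.G ε (D₁.G ε y)
    ι := D₁.ι ⊕ D₂.ι
    f := fun i => Sum.elim (fun j => D₁.f (i.1, j)) (fun j y => D₂.f (i.1, j) (D₁.F i.1 y)) i.2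
    g := fun i => Sum.elim (fun j => D₁.g (i.1, j)) (fun j y => D₂.g (i.1, j) (D₁.G i.1 y)) i.2
    nonneg := add_nonneg D₁.nonneg D₂.nonneg
    close := D₂.close.comp hβ D₁.close
    tendsto := D₂.tendsto.comp hG
    close_germs := Close.sumElim hβ D₁.close_germs hcg
    orbits := ?_
    germs := ?_ }⟩
  · filter_upwards [D₁.orbits, hG.eventually D₂.orbits, hF.eventually D₂.orbits] with z h₁ hg hf
    obtain ⟨a1, a2, a3, a4, a5, a6, a7, a8⟩ := h₁
    obtain ⟨-, -, -, b4, b5, b6, b7, -⟩ := hg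
    obtain ⟨c1, c2, c3, -, -, -, -, c8⟩ := hf
    have hh : D₁.h z.1 τ₁ z.2 = D₂.h z.1 0 (D₁.F z.1 z.2) := by rw [a3, c1]
    have hb : D₁.b z.1 τ₁ z.2 = D₂.b z.1 0 (D₁.G z.1 z.2) := by rw [a6, b4]
    have hle : τ₁ ≤ τ₁ + τ₂ := le_add_of_nonneg_right D₂.nonneg
    refine ⟨by rw [followedBy_of_le _ _ D₁.nonneg, a1], a2.followedBy D₁.nonneg D₂.nonneg c2 hh, ?_,
      by rw [followedBy_of_le _ _ D₁.nonneg, a4], a5.followedBy D₁.nonneg D₂.nonneg b5 hb, ?_, ?_, ?_⟩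
    · rw [followedBy_of_ge hh hle, add_sub_cancel_left, c3]
    · rw [followedBy_of_ge hb hle, add_sub_cancel_left, b6]
    · rw [Finset.card_union_of_disjoint, Finset.card_map, a7, b7]
      rw [Finset.disjoint_left]
      intro s hs hs'
      obtain ⟨x, hx, rfl⟩ := Finset.mem_map.1 hs'
      have h1 := (a5.times _ hs).2
      have h2 := (b5.times _ hx).1
      simp only [addRightEmbedding_apply] at h1
      linarith
    · intro hm t ht
      rcases le_total t τ₁ with h | h
      · rw [followedBy_of_le _ _ h]
        exact a8 (by omega) t ⟨ht.1, h⟩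
      · rw [followedBy_of_ge hh h]
        exact c8 (by omega) _ ⟨sub_nonneg.2 h, by linarith [ht.2]⟩
  · intro K
    obtain ⟨L, hL, hcl⟩ := D₁.close.closeZero (‖y₀‖ + 1)
    obtain ⟨C₁, hC₁⟩ := D₁.germs K
    obtain ⟨C₂, hC₂⟩ := D₂.germs (L * (K + 1))
    refine ⟨max C₁ C₂, ?_⟩
    have t1 : Tendsto (fun z : ℝ × (Phase d × Phase d) => (z.1, z.2.1)) (𝓝[>] 0 ×ˢ 𝓝 (y₀, y₀))
        (𝓝[>] 0 ×ˢ 𝓝 y₀) := tendsto_fst.prodMk ((continuous_fst.tendsto (y₀, y₀)).comp tendsto_snd)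
    have t2 : Tendsto (fun z : ℝ × (Phase d × Phase d) => (z.1, z.2.2)) (𝓝[>] 0 ×ˢ 𝓝 (y₀, y₀))
        (𝓝[>] 0 ×ˢ 𝓝 y₀) := tendsto_fst.prodMk ((continuous_snd.tendsto (y₀, y₀)).comp tendsto_snd)
    have t3 : Tendsto (fun z : ℝ × (Phase d × Phase d) => (z.1, (D₁.G z.1 z.2.1, D₁.F z.1 z.2.2)))
        (𝓝[>] 0 ×ˢ 𝓝 (y₀, y₀)) (𝓝[>] 0 ×ˢ 𝓝 (y₁, y₁)) :=
      tendsto_fst.prodMk ((D₁.tendsto.comp t1).prodMk_nhds (hF₁.comp t2))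
    have hbd : ∀ᶠ y in 𝓝 y₀, ‖y‖ ≤ ‖y₀‖ + 1 :=
      (continuous_norm.tendsto y₀).eventually (ge_mem_nhds (lt_add_one _))
    have hε : ∀ᶠ ε in 𝓝[>] (0 : ℝ), 0 < ε := self_mem_nhdsWithin
    filter_upwards [hC₁, t3.eventually hC₂, t1.eventually (hbd.prod_inr _),
      t2.eventually (hbd.prod_inr _), hcl.prod_inl _, hε.prod_inl _, hβ.prod_inl _,
      (D₁.close.contDiff_one hr).prod_inl _]
      with z h1 h2 h3 h4 h5 h6 h7 h12 hK t ht hts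
    have hsc := impactScale_nonneg (r := r) (α := α) h6
    rcases le_or_gt t τ₁ with htτ | htτ
    · obtain ⟨i, hi⟩ := h1 hK t ⟨ht.1, htτ⟩ fun s hs hmem =>
        hts s (Finset.mem_union_left _ hs) (mem_Icc_of_le (le_max_left _ _) hsc hmem)
      refine ⟨Sum.inl i, ?_⟩
      simp only [followedBy_of_le _ _ htτ]
      exact hi
    · have hGF : ‖D₁.G z.1 z.2.1 - D₁.F z.1 z.2.2‖ ≤ L * (K + 1) * nu r α z.1 := by
        have := (h5 z.2.2 z.2.1 h4 h3).2.2
        rw [norm_sub_rev] at this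
        refine this.trans ?_
        rw [norm_sub_rev z.2.2]
        have := mul_le_mul_of_nonneg_left (add_le_add_left hK (nu r α z.1)) hL
        linarith
      obtain ⟨i, hi, hi'⟩ := h2 hGF (t - τ₁) ⟨by linarith, by linarith [ht.2]⟩ fun s hs hmem =>
        hts (s + τ₁) (Finset.mem_union_right _ (Finset.mem_map.2 ⟨s, hs, rfl⟩)) <| by
          have := mem_Icc_of_le (le_max_right C₁ C₂) hsc hmem
          exact ⟨by linarith [this.1], by linarith [this.2]⟩
      refine ⟨Sum.inr i, ?_, ?_⟩
      · have e := h12.1.continuous.continuousAt.eventually hi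
        filter_upwards [e] with y hy
        rw [followedBy, if_neg (not_le.2 htτ)]
        exact hy
      · have e := h12.2.continuous.continuousAt.eventually hi'
        filter_upwards [e] with y hy
        rw [followedBy, if_neg (not_le.2 htτ)]
        exact hy

theorem CrCloseAt.congr_germ {X Y : Type} [NormedAddCommGroup X] [NormedSpace ℝ X]
    [NormedAddCommGroup Y] [NormedSpace ℝ Y] {f g f' g' : X → Y} {x : X} {c : ℝ}
    (h : CrCloseAt r f g x c) (hf : f' =ᶠ[𝓝 x] f) (hg : g' =ᶠ[𝓝 x] g) : CrCloseAt r f' g' x c := by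
  refine ⟨h.1.congr_of_eventuallyEq hf, h.2.1.congr_of_eventuallyEq hg, fun k hk => ?_⟩
  have e : (fun y => f' y - g' y) =ᶠ[𝓝 x] fun y => f y - g y := hf.sub hg
  rw [(e.iteratedFDeriv ℝ k).self_of_nhds]
  exact h.2.2 k hk

theorem FlowData.exists_crCloseAt (hr : 1 ≤ r) (hα : 0 < α) {y₀ y₁ : Phase d} {T : ℝ} {m : ℕ}
    (D : FlowData P y₀ y₁ T m) : ∃ U : Set (Phase d), IsOpen U ∧ y₀ ∈ U ∧ ∃ C > 0, ∃ ε₁ > 0,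
      ∀ ε ∈ Ioo 0 ε₁, ∃ (h b : ℝ → Phase d → Phase d) (S : Phase d → Finset ℝ), ∀ ρ ∈ U,
        h 0 ρ = ρ ∧ IsHamiltonianOrbit (P.Ω ε) (P.V ε) T (fun t => h t ρ) ∧ b 0 ρ = ρ ∧
        IsRegularBilliardOrbit (P.auxTable ε) T (S ρ) (fun t => b t ρ) ∧ (S ρ).card = m ∧
        ∀ t ∈ Icc 0 T, (∀ s ∈ S ρ, t ∉ Icc (s - C * impactScale r α ε) (s + C * impactScale r α ε)) →
          CrCloseAt r (h t) (b t) ρ (C * nu r α ε) := by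
  have hβ := eventually_nu_nonneg (r := r) hα
  obtain ⟨C, hC⟩ := D.germs 0
  obtain ⟨R, hR, hC⟩ := eventually_prod_ball hC
  obtain ⟨R', hR', ho⟩ := eventually_prod_ball D.orbits
  obtain ⟨K, hK, hd⟩ := D.close_germs.norm_iteratedFDeriv_sub_le (hβ.prod_inl _) (‖y₀‖ + R)
  have hs := D.close_germs.contDiff hr
  rw [eventually_prod_top] at hd hs
  have hε : ∀ᶠ ε in 𝓝[>] (0 : ℝ), 0 < ε := self_mem_nhdsWithin
  obtain ⟨ε₁, hε₁, hall⟩ := mem_nhdsGT_iff_exists_Ioo_subset.1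
    (hC.and (ho.and (hd.and (hs.and (hβ.and hε)))))
  refine ⟨Metric.ball y₀ (min R R'), Metric.isOpen_ball, Metric.mem_ball_self (lt_min hR hR'),
    max (max C K) 1, lt_max_of_lt_right one_pos, ε₁, hε₁, fun ε hε => ?_⟩
  obtain ⟨h1, h2, h3, h4, h5, h6⟩ := hall hε
  refine ⟨D.h ε, D.b ε, D.S ε, fun ρ hρ => ?_⟩
  rw [mem_ball_iff_norm] at hρ
  obtain ⟨a1, a2, a3, a4, a5, a6, a7, a8⟩ := h2 ρ (hρ.trans_le (min_le_right _ _))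
  have hρR := hρ.trans_le (min_le_left _ _)
  refine ⟨a1, a2, a4, a5, a7, fun t ht hts => ?_⟩
  obtain ⟨i, hi, hi'⟩ := h1 (ρ, ρ) (by rwa [Prod.mk_sub_mk, Prod.norm_mk, max_self])
    (by simp) t ht fun s hs hmem => hts s hs
      (mem_Icc_of_le ((le_max_left _ _).trans (le_max_left _ _)) (impactScale_nonneg h6) hmem)
  refine CrCloseAt.congr_germ ⟨(h4 i).1.contDiffAt, (h4 i).2.contDiffAt, fun k hk => ?_⟩ hi hi'
  refine (h3 i k hk ρ ?_).trans
    (mul_le_mul_of_nonneg_right ((le_max_right _ _).trans (le_max_left _ _)) h5)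
  have := norm_add_le y₀ (ρ - y₀)
  rw [add_sub_cancel] at this
  linarith

end FlowData

section

variable {d n r : ℕ} {B : BilliardTable d n r} {α : ℝ} {P : PowerLawPotential B α}

theorem eventually_prod_nhds {E : Type} [NormedAddCommGroup E] {l : Filter ℝ} {x : E}
    {p : ℝ × E → Prop} (h : ∀ᶠ z in l ×ˢ 𝓝 x, p z) :
    ∀ᶠ z in l ×ˢ 𝓝 x, ∀ᶠ y in 𝓝 z.2, p (z.1, y) := by
  obtain ⟨pa, ha, pb, hb, hab⟩ := Filter.eventually_prod_iff.1 h
  filter_upwards [ha.prod_inl _, hb.eventually_nhds.prod_inr _] with z h1 h2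
  exact h2.mono fun y hy => hab h1 hy

/-! ### Free motion -/

section Free

theorem Close.slice {E F : Type} [NormedAddCommGroup E] [NormedSpace ℝ E] [FiniteDimensional ℝ E]
    [NormedAddCommGroup F] [NormedSpace ℝ F] {I J : Type} {l : Filter I} {l' : Filter J}
    {β : I → ℝ} (hβ : ∀ᶠ i in l, 0 ≤ β i) {k : ℕ} {f g : I → E × ℝ → F} (h : Close l β k f g)
    {π : J → I} (hπ : Tendsto π l' l) {c : J → ℝ} {K : ℝ} (hc : ∀ j, |c j| ≤ K) :
    Close l' (fun j => β (π j)) k (fun j x => f (π j) (x, c j)) (fun j x => g (π j) (x, c j)) := by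
  have hβ' := hπ.eventually hβ
  exact (h.comap hπ).comp hβ' ((Close.of_contDiff hβ' k contDiff_id).prodMk hβ'
    (Close.const_self hβ' (c := c) K (.of_forall hc) k))

theorem isRegularBilliardOrbit_line {A : Set (Conf d)} {T : ℝ} {y : Phase d} {b : ℝ → Phase d}
    (hb : ∀ t ∈ Icc 0 T, b t = (y.1 + t • y.2, y.2))
    (h : ∀ t ∈ Icc 0 T, y.1 + t • y.2 ∈ interior A) : IsRegularBilliardOrbit A T ∅ b := by
  refine ⟨by simp, ?_, fun t ht _ => ?_, fun a c ha hac hc _ => ?_, by simp⟩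
  · have : ContinuousOn (fun t : ℝ => y.1 + t • y.2) (Icc 0 T) := by fun_prop
    exact this.congr fun t ht => by rw [hb t ht]
  · rw [hb t ht]; exact h t ht
  · rw [hb a ⟨ha, hac.trans hc⟩, hb c ⟨ha.trans hac, hc⟩]
    ext1
    · simp only; module
    · rfl

theorem exists_flowData_near (hr : 1 ≤ r) (hα : 0 < α) (hP : P.BoundaryDominated) {q₀ : Conf d}
    (hq₀ : q₀ ∈ interior B.D) (p₀ : Conf d) : ∃ ϱ > 0, ∃ σ > 0, ∀ y₀ : Phase d,
      ‖y₀ - (q₀, p₀)‖ < ϱ → ∀ τ, 0 ≤ τ → τ ≤ σ →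
        Nonempty (FlowData P y₀ (y₀.1 + τ • y₀.2, y₀.2) τ 0) := by
  have hβ := eventually_nu_nonneg (r := r) hα
  obtain ⟨f, hf, R, hR, hin⟩ := P.exists_inner_force hα hP hq₀
  obtain ⟨σ, hσ, hσR, hcl, hzero, hflow⟩ := exists_timeFlow hr hα hf q₀ p₀ hR
  have hpos : 0 < 8 * (‖p₀‖ + R) := by positivity
  refine ⟨R / 8, by linarith, min (σ / 2) (R / (8 * (‖p₀‖ + R))), lt_min (half_pos hσ) (by positivity),
    fun y₀ hy₀ τ hτ hτσ => ?_⟩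
  have hτ1 := hτσ.trans (min_le_left _ _)
  have hτ2 : τ * (‖p₀‖ + R) ≤ R / 8 := by
    have := hτσ.trans (min_le_right _ _)
    rw [le_div_iff₀ hpos] at this
    linarith
  have hy : ∀ᶠ y in 𝓝 y₀, ‖y - (q₀, p₀)‖ < R / 8 :=
    ((continuous_norm.comp (continuous_sub_right (q₀, p₀))).tendsto y₀).eventually
      (gt_mem_nhds hy₀)
  have hline : ∀ᶠ y in 𝓝 y₀, timeFlow q₀ p₀ R σ 0 (y, τ) = (y.1 + τ • y.2, y.2) :=
    hy.mono fun y hy => hzero y τ hy.le (by rwa [abs_of_nonneg hτ])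
  have hbd : ∀ t ∈ Icc (0 : ℝ) τ, |t| ≤ τ := fun t ht => by rw [abs_of_nonneg ht.1]; exact ht.2
  have htop : Tendsto (Prod.fst : ℝ × Icc (0 : ℝ) τ → ℝ) (𝓝[>] 0 ×ˢ ⊤) (𝓝[>] 0) := tendsto_fst
  refine ⟨{
    h := fun ε t y => timeFlow q₀ p₀ R σ (f ε) (y, t)
    b := fun _ t y => timeFlow q₀ p₀ R σ 0 (y, t)
    S := fun _ _ => ∅
    F := fun ε y => timeFlow q₀ p₀ R σ (f ε) (y, τ)
    G := fun ε y => timeFlow q₀ p₀ R σ 0 (y, τ)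
    ι := Icc (0 : ℝ) τ
    f := fun i y => timeFlow q₀ p₀ R σ (f i.1) (y, i.2)
    g := fun i y => timeFlow q₀ p₀ R σ 0 (y, i.2)
    nonneg := hτ
    close := hcl.slice hβ tendsto_id (c := fun _ => τ) fun _ => le_rfl
    tendsto := ?_
    close_germs := hcl.slice hβ htop (c := fun i => i.2) fun i => hbd i.2 i.2.2
    orbits := ?_
    germs := fun K => ⟨0, .of_forall fun z _ t ht _ => ⟨⟨t, ht⟩, .rfl, .rfl⟩⟩ }⟩
  · have hc : Continuous fun y : Phase d => (y.1 + τ • y.2, y.2) := by fun_prop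
    exact ((hc.tendsto y₀).congr' (hline.mono fun _ h => h.symm)).comp tendsto_snd
  · filter_upwards [hflow.prod_inl _, hin.prod_inl _, hy.prod_inr _] with z h1 h2 hzy
    obtain ⟨hf1, h1⟩ := h1
    obtain ⟨γ, hγ⟩ := h1 z.2 τ hzy.le hτ hτ1
    have hγc : ∀ t ∈ Icc 0 τ, ‖γ t - (q₀, p₀)‖ ≤ R / 4 := fun t ht => by
      have a := hγ.prop t ht
      have b := norm_add_le (γ t - z.2) (z.2 - (q₀, p₀))
      rw [sub_add_sub_cancel] at b
      linarith
    have hγq : ∀ t ∈ Icc 0 τ, ‖(γ t).1 - q₀‖ < R := fun t ht =>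
      ((norm_fst_le (γ t - (q₀, p₀))).trans (hγc t ht)).trans_lt (by linarith)
    have e : ∀ t ∈ Icc 0 τ, timeFlow q₀ p₀ R σ (f z.1) (z.2, t) = γ t := fun t ht => by
      have := timeFlow_eq hR hσ (by linarith) hf1 hγ.deriv
        (fun t ht => (hγc t ht).trans (by linarith)) (left_mem_Icc.2 hτ) ht
        (by rw [sub_zero]; exact (hbd t ht).trans hτ1)
      rwa [hγ.left, sub_zero] at this
    have hl : ∀ t ∈ Icc 0 τ, timeFlow q₀ p₀ R σ 0 (z.2, t) = (z.2.1 + t • z.2.2, z.2.2) :=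
      fun t ht => hzero z.2 t hzy.le ((hbd t ht).trans hτ1)
    refine ⟨by rw [e 0 (left_mem_Icc.2 hτ), hγ.left], fun t ht => ?_, rfl, ?_,
      isRegularBilliardOrbit_line hl fun t ht => ?_, rfl, rfl, fun _ t ht => ?_⟩
    · dsimp only
      rw [e t ht]
      obtain ⟨a1, -, a3⟩ := h2 _ (hγq t ht)
      have := (hγ.deriv t ht).congr (fun s hs => e s hs) (e t ht)
      rw [forceField, a3] at this
      exact ⟨a1, this⟩
    · rw [hl 0 (left_mem_Icc.2 hτ), zero_smul, add_zero]
    · refine (h2 _ ?_).2.1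
      have a := (norm_fst_le (z.2 - (q₀, p₀))).trans hzy.le
      have b := (norm_snd_le (z.2 - (q₀, p₀))).trans hzy.le
      have c := norm_sub_norm_le z.2.2 p₀
      have e' := norm_add_le (z.2.1 - q₀) (t • z.2.2)
      rw [norm_smul, Real.norm_of_nonneg ht.1, sub_add_eq_add_sub] at e'
      have : t * ‖z.2.2‖ ≤ τ * (‖p₀‖ + R) := by
        refine mul_le_mul ht.2 ?_ (norm_nonneg _) hτ
        simp only [Prod.snd_sub] at b
        linarith
      simp only [Prod.fst_sub] at a
      linarith
    · simp only [e t ht]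
      exact (h2 _ (hγq t ht)).2.1

theorem exists_flowData_free (hr : 1 ≤ r) (hα : 0 < α) (hP : P.BoundaryDominated) {q p : Conf d}
    {T : ℝ} (hT : 0 ≤ T) (h : ∀ t ∈ Icc 0 T, q + t • p ∈ interior B.D) :
    Nonempty (FlowData P (q, p) (q + T • p, p) T 0) := by
  choose ϱ hϱ σ hσ hloc using fun t : Icc 0 T => exists_flowData_near hr hα hP (h t t.2) p
  obtain ⟨t, ht0, hmono, ⟨m, hm⟩, hsub⟩ := exists_monotone_Icc_subset_open_cover_Icc hT
    (c := fun i : Icc 0 T => {s : Icc 0 T | |(s : ℝ) - i| < σ i / 2 ∧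
      ‖((q + (s : ℝ) • p, p) : Phase d) - (q + (i : ℝ) • p, p)‖ < ϱ i})
    (fun i => by
      have h1 : Continuous fun s : Icc 0 T => |(s : ℝ) - i| := by fun_prop
      have h2 : Continuous fun s : Icc 0 T =>
        ‖((q + (s : ℝ) • p, p) : Phase d) - (q + (i : ℝ) • p, p)‖ := by fun_prop
      exact (isOpen_lt h1 continuous_const).inter (isOpen_lt h2 continuous_const))
    fun s _ => mem_iUnion.2 ⟨s, by simpa using hσ s, by simpa using hϱ s⟩
  have key : ∀ k, Nonempty (FlowData P (q, p) (q + (t k : ℝ) • p, p) (t k) 0) := by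
    intro k
    induction k with
    | zero =>
      obtain ⟨i, hi⟩ := hsub 0
      have h0 := (hi (left_mem_Icc.2 (hmono (Nat.zero_le 1)))).2
      have := hloc i _ h0 0 le_rfl (hσ i).le
      rw [ht0] at this ⊢
      simpa using this
    | succ k ih =>
      obtain ⟨i, hi⟩ := hsub k
      have hle : t k ≤ t (k + 1) := hmono (Nat.le_succ k)
      have h0 := hi (left_mem_Icc.2 hle)
      have h1 := hi (right_mem_Icc.2 hle)
      have hle' : (t k : ℝ) ≤ t (k + 1) := hle
      obtain ⟨D₁⟩ := ih
      obtain ⟨D₂⟩ := hloc i _ h0.2 (t (k + 1) - t k) (sub_nonneg.2 hle') (by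
        have a := abs_lt.1 h0.1
        have b := abs_lt.1 h1.1
        linarith [a.1, b.2])
      have := D₁.trans hr hα D₂
      simpa only [add_assoc, ← add_smul, add_sub_cancel] using this
  have := key m
  rwa [hm m le_rfl] at this

end Free

/-! ### Passage near a boundary point -/

section Passage

theorem IsChart.mem_interior {P : PowerLawPotential B α} {Q : ℝ → Conf d → ℝ} {q₀ g : Conf d}
    (h : IsChart P Q q₀ g) : ∃ ϱ > 0, ∀ᶠ ε in 𝓝[>] (0 : ℝ), ContDiff ℝ 1 (Q ε) ∧ ∀ q, ‖q - q₀‖ < ϱ →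
      (q ∈ P.Ω ε ↔ 0 < Q ε q) ∧ (q ∈ P.auxTable ε ↔ eta r α ε ≤ Q ε q) ∧
      (eta r α ε < Q ε q → q ∈ interior (P.auxTable ε)) ∧
      (Q ε q = eta r α ε → IsInwardNormal (P.auxTable ε) q
        (‖gradient (Q ε) q‖⁻¹ • gradient (Q ε) q)) ∧ gradient (Q ε) q ≠ 0 ∧
      (0 < Q ε q → ∀ p, barrierField α ε (Q ε) (q, p) =
        forceField (fun q => -gradient (P.V ε) q) (q, p)) := by
  obtain ⟨ϱ, hϱ, hn⟩ := h.near
  refine ⟨ϱ, hϱ, ?_⟩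
  filter_upwards [hn, h.barrier.close.contDiff_one (Nat.le_add_left 1 r)] with ε hn hQ
  refine ⟨hQ.1, fun q hq => ?_⟩
  obtain ⟨h1, h2, h3, h4⟩ := hn q hq
  have hev : ∀ᶠ x in 𝓝 q, ‖x - q₀‖ < ϱ :=
    ((continuous_norm.comp (continuous_sub_right q₀)).tendsto q).eventually (gt_mem_nhds hq)
  refine ⟨h1, h2, fun hlt => ?_, fun he => ?_, h3, fun hpos p => ?_⟩
  · rw [mem_interior_iff_mem_nhds]
    filter_upwards [hev, (hQ.1.continuous.tendsto q).eventually (lt_mem_nhds hlt)] with x hx hx'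
    exact (hn x hx).2.1.2 (le_of_lt hx')
  · exact isInwardNormal_gradient hQ.1 he h3 (hev.mono fun x hx => (hn x hx).2.1)
  · simp only [barrierField, forceField, h4 hpos, neg_neg]

variable {Q : Conf d → ℝ} {q₀ p₀ p₁ : Conf d} {Ω : Set (Conf d)} {U : Conf d → ℝ} {ϱ ε : ℝ}

theorem IsPath.isHamiltonianOrbit_of_barrier {Pr : ℝ → Phase d → Prop} {T : ℝ} {x y : Phase d}
    {γ : ℝ → Phase d} (h : IsPath (barrierField α ε Q) Pr 0 T x y γ)
    (hΩ : ∀ q, ‖q - q₀‖ < ϱ → 0 < Q q → q ∈ Ω ∧ ∀ p, barrierField α ε Q (q, p) =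
      forceField (fun q => -gradient U q) (q, p))
    (hPr : ∀ t ∈ Icc 0 T, Pr t (γ t) → ‖(γ t).1 - q₀‖ < ϱ ∧ 0 < Q (γ t).1) :
    IsHamiltonianOrbit Ω U T γ := fun t ht => by
  obtain ⟨h1, h2⟩ := hPr t ht (h.prop t ht)
  obtain ⟨h3, h4⟩ := hΩ _ h1 h2
  have := h.deriv t ht
  rw [h4] at this
  exact ⟨h3, this⟩

/-- Far from the boundary the motion is given by the smooth flow of the cut-off force. -/
theorem timeFlow_eq_of_barrier {R σ : ℝ} (hα : 0 < α) (hε : 0 < ε) (hR : 0 < R) (hσ : 0 < σ)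
    (hσR : σ ≤ R) (hf : ContDiff ℝ 1 (posForce r α ε Q q₀ R)) {γ : ℝ → Phase d} {T a b : ℝ}
    (hγ : ∀ t ∈ Icc 0 T, HasDerivWithinAt γ (barrierField α ε Q (γ t)) (Icc 0 T) t)
    (ha : 0 ≤ a) (hb : b ≤ T) (hab : a ≤ b) (hba : b - a ≤ σ / 2)
    (hin : ∀ t ∈ Icc a b, ‖γ t - (q₀, p₀)‖ < R / 2 ∧ delta r α ε ≤ Q (γ t).1) :
    timeFlow q₀ p₀ R σ (posForce r α ε Q q₀ R) (γ a, b - a) = γ b ∧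
      timeFlow q₀ p₀ R σ (posForce r α ε Q q₀ R) (γ b, a - b) = γ a := by
  have hd : ∀ t ∈ Icc a b, HasDerivWithinAt γ (forceField (posForce r α ε Q q₀ R) (γ t))
      (Icc a b) t := fun t ht => by
    obtain ⟨h1, h2⟩ := hin t ht
    have := (hγ t ⟨ha.trans ht.1, ht.2.trans hb⟩).mono (Icc_subset_Icc ha hb)
    rwa [barrierField, ← posForce_eq hα hε ((norm_fst_le (γ t - (q₀, p₀))).trans h1.le) h2] at this
  have hin' : ∀ t ∈ Icc a b, ‖γ t - (q₀, p₀)‖ ≤ R / 2 := fun t ht => (hin t ht).1.le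
  exact ⟨timeFlow_eq hR hσ hσR hf hd hin' (left_mem_Icc.2 hab) (right_mem_Icc.2 hab)
      (by rwa [abs_of_nonneg (sub_nonneg.2 hab)]),
    timeFlow_eq hR hσ hσR hf hd hin' (right_mem_Icc.2 hab) (left_mem_Icc.2 hab)
      (by rwa [abs_sub_comm, abs_of_nonneg (sub_nonneg.2 hab)])⟩

/-- The orbit through a collision: entrance, reflection and exit. -/
theorem exists_orbit_of_passage {R σ σ' : ℝ} (hα : 0 < α) (hε : 0 < ε) (hR : 0 < R) (hσ : 0 < σ)
    (hσR : σ ≤ R) (hσ' : 0 < σ') (hσR' : σ' ≤ R) (hϱ : ϱ = R / 2)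
    (hf : ContDiff ℝ 1 (posForce r α ε Q q₀ R))
    (hΩ : ∀ q, ‖q - q₀‖ < ϱ → 0 < Q q → q ∈ Ω ∧ ∀ p, barrierField α ε Q (q, p) =
      forceField (fun q => -gradient U q) (q, p))
    {e Ce Cx s₁ s₂ s₃ s' : ℝ} (he : 0 < e) {y y₁ y₂ y₃ : Phase d} {γ₁ γ₂ γ₃ : ℝ → Phase d}
    (h₁ : IsPath (barrierField α ε Q) (EntranceProp Q (q₀, p₀) ϱ e (delta r α ε) Ce s₁ s') 0 s₁ y y₁ γ₁)
    (h₂ : IsPath (barrierField α ε Q) (ReflectionProp Q q₀ ϱ e s₂) 0 s₂ y₁ y₂ γ₂)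
    (h₃ : IsPath (barrierField α ε Q) (ExitProp Q (q₀, p₁) ϱ e (delta r α ε) Cx) 0 s₃ y₂ y₃ γ₃)
    {T : ℝ} (hT : s₁ + s₂ + s₃ = T) (hTσ : T ≤ σ / 2) (hTσ' : T ≤ σ' / 2) :
    ∃ γ, γ 0 = y ∧ IsHamiltonianOrbit Ω U T γ ∧ γ T = y₃ ∧
      (∀ t, 0 ≤ t → t ≤ s₁ → t < s' - Ce →
        timeFlow q₀ p₀ R σ (posForce r α ε Q q₀ R) (y, t) = γ t) ∧
      ∀ t, t ≤ T → 0 ≤ t - (s₁ + s₂) → Cx < t - (s₁ + s₂) →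
        timeFlow q₀ p₁ R σ' (posForce r α ε Q q₀ R) (y₃, t - T) = γ t := by
  have o₁ := h₁.isHamiltonianOrbit_of_barrier hΩ fun t ht h =>
    ⟨(norm_fst_le (γ₁ t - (q₀, p₀))).trans_lt h.1, he.trans_le h.2.1⟩
  have o₂ := h₂.isHamiltonianOrbit_of_barrier hΩ fun t ht h => ⟨h.1, h.2.1⟩
  have o₃ := h₃.isHamiltonianOrbit_of_barrier hΩ fun t ht h =>
    ⟨(norm_fst_le (γ₃ t - (q₀, p₁))).trans_lt h.1, he.trans_le h.2.1⟩
  have j₂ : γ₂ s₂ = γ₃ 0 := by rw [h₂.right, h₃.left]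
  have j₁ : γ₁ s₁ = followedBy s₂ γ₂ γ₃ 0 := by
    rw [followedBy_of_le _ _ h₂.le, h₁.right, h₂.left]
  have hlast : ∀ t, 0 ≤ t - (s₁ + s₂) →
      followedBy s₁ γ₁ (followedBy s₂ γ₂ γ₃) t = γ₃ (t - (s₁ + s₂)) := fun t ht => by
    rw [followedBy_of_ge j₁ (by linarith [h₂.le]), followedBy_of_ge j₂ (by linarith), sub_sub]
  refine ⟨followedBy s₁ γ₁ (followedBy s₂ γ₂ γ₃), ?_, ?_, ?_, fun t ht hts htC => ?_,
    fun t htT ht htC => ?_⟩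
  · rw [followedBy_of_le _ _ h₁.le, h₁.left]
  · rw [← hT, add_assoc]
    exact o₁.followedBy h₁.le (add_nonneg h₂.le h₃.le) (o₂.followedBy h₂.le h₃.le o₃ j₂) j₁
  · rw [hlast T (by linarith [h₃.le]), ← hT, add_sub_cancel_left, h₃.right]
  · rw [followedBy_of_le _ _ hts]
    have := (timeFlow_eq_of_barrier (p₀ := p₀) hα hε hR hσ hσR hf h₁.deriv le_rfl hts ht
      (by linarith [h₂.le, h₃.le]) fun u hu => ?_).1
    · rwa [h₁.left, sub_zero] at this
    · have := h₁.prop u ⟨hu.1, hu.2.trans hts⟩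
      refine ⟨hϱ ▸ this.1, this.2.2.2.resolve_right fun h => ?_⟩
      linarith [(abs_le.1 h).1, hu.2]
  · rw [hlast t ht]
    have := (timeFlow_eq_of_barrier (p₀ := p₁) hα hε hR hσ' hσR' hf h₃.deriv ht le_rfl (by linarith)
      (by linarith [h₁.le, h₂.le]) fun u hu => ?_).2
    · rw [h₃.right] at this
      rw [← this, ← hT]
      ring_nf
    · have := h₃.prop u ⟨ht.trans hu.1, hu.2⟩
      exact ⟨hϱ ▸ this.1, this.2.2.2.resolve_right fun h => by linarith [hu.1]⟩

/-- The billiard orbit with one collision. -/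
def bounce (θ : ℝ) (m : Conf d) (y : Phase d) (t : ℝ) : Phase d :=
  if t < θ then (y.1 + t • y.2, y.2)
  else (y.1 + θ • y.2 + (t - θ) • reflect m y.2, reflect m y.2)

theorem isRegularBilliardOrbit_bounce {A : Set (Conf d)} {T θ : ℝ} {m : Conf d} {y : Phase d}
    (hθ : 0 < θ) (hθT : θ < T) (hm : IsInwardNormal A (y.1 + θ • y.2) m) (hy : ⟪y.2, m⟫_ℝ < 0)
    (h₁ : ∀ t ∈ Ico 0 θ, y.1 + t • y.2 ∈ interior A)
    (h₂ : ∀ t ∈ Ioc 0 (T - θ), y.1 + θ • y.2 + t • reflect m y.2 ∈ interior A) :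
    IsRegularBilliardOrbit A T {θ} (bounce θ m y) := by
  have e1 : ∀ t < θ, bounce θ m y t = (y.1 + t • y.2, y.2) := fun t ht => if_pos ht
  have e2 : ∀ t, θ ≤ t → bounce θ m y t =
    (y.1 + θ • y.2 + (t - θ) • reflect m y.2, reflect m y.2) := fun t ht => if_neg (not_lt.2 ht)
  refine ⟨by simpa using ⟨hθ, hθT⟩, ?_, fun t ht hts => ?_, fun a b ha hab hb hs => ?_, fun s hs => ?_⟩
  · have : (fun t => (bounce θ m y t).1) = fun t =>
        if t < θ then y.1 + t • y.2 else y.1 + θ • y.2 + (t - θ) • reflect m y.2 := by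
      funext t; rw [bounce]; split_ifs <;> rfl
    rw [this]
    refine (Continuous.if ?_ (by fun_prop) (by fun_prop)).continuousOn
    intro t ht
    have : t = θ := by simpa [show {a | a < θ} = Iio θ from rfl] using ht
    simp [this]
  · rcases lt_trichotomy t θ with h | h | h
    · rw [e1 t h]; exact h₁ t ⟨ht.1, h⟩
    · exact absurd h (by simpa using hts)
    · rw [e2 t h.le]; exact h₂ _ ⟨sub_pos.2 h, by linarith [ht.2]⟩
  · have hs' : ¬(a < θ ∧ θ ≤ b) := hs θ (by simp)
    rcases lt_or_ge a θ with h | h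
    · have hb' : b < θ := by by_contra hc; exact hs' ⟨h, not_lt.1 hc⟩
      rw [e1 a h, e1 b hb']
      ext1
      · simp only; module
      · rfl
    · rw [e2 a h, e2 b (h.trans hab)]
      ext1
      · simp only; module
      · rfl
  · rw [Finset.mem_singleton] at hs
    subst hs
    refine ⟨m, y.2, by rw [e2 s le_rfl]; simpa using hm, ?_, hy, by rw [e2 s le_rfl]⟩
    filter_upwards [self_mem_nhdsWithin] with t ht
    rw [e1 t ht]

end Passage

/-! ### One collision -/

theorem inner_reflect_unit {g : Conf d} (hg : g ≠ 0) (p : Conf d) :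
    ⟪reflect (‖g‖⁻¹ • g) p, g⟫_ℝ = -⟪p, g⟫_ℝ := by
  have h0 : ‖g‖ ≠ 0 := norm_ne_zero_iff.2 hg
  rw [reflect, inner_sub_left, real_inner_smul_left, real_inner_smul_right, real_inner_smul_left,
    real_inner_self_eq_norm_sq]
  field_simp
  ring

theorem bounce_zero {θ : ℝ} (hθ : 0 < θ) (m : Conf d) (y : Phase d) : bounce θ m y 0 = y := by
  rw [bounce, if_pos hθ, zero_smul, add_zero]

theorem eventually_norm_sub_lt {E : Type} [NormedAddCommGroup E] {x c : E} {R : ℝ}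
    (h : ‖x - c‖ < R) : ∀ᶠ y in 𝓝 x, ‖y - c‖ < R :=
  ((continuous_norm.comp (continuous_sub_right c)).tendsto x).eventually (gt_mem_nhds h)

/-- The impact intervals contain the times at which the barrier is felt. -/
theorem impact_interval {K₁ K₂ K C₁ C₂ ν δ L s a b c t : ℝ} (hK₁ : 0 ≤ K₁) (hK₂ : 0 ≤ K₂)
    (hK : 0 ≤ K) (hC₁ : 0 < C₁) (hC₂ : 0 < C₂) (hν : 0 < ν) (hδ : 0 < δ) (hνL : ν ≤ L) (hδL : δ ≤ L)
    (d1 : |a - s| ≤ K₁ * ((K + 1) * ν)) (d2 : |a - b| ≤ K₁ * ν) (d3 : |c - s| ≤ K₂ * ((K + 1) * ν))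
    (ht : t ∉ Icc (s - (K₁ * (K + 1) + K₁ + C₁ * 2 + K₂ * (K + 1) + C₂) * L)
      (s + (K₁ * (K + 1) + K₁ + C₁ * 2 + K₂ * (K + 1) + C₂) * L)) :
    (t < s ∧ t < a ∧ t + C₁ * (ν + δ) < b) ∨ (s < t ∧ c < t - C₂ * δ) := by
  have m1 : K₁ * ((K + 1) * ν) ≤ K₁ * ((K + 1) * L) := by gcongr
  have m2 : K₁ * ν ≤ K₁ * L := by gcongr
  have m3 : K₂ * ((K + 1) * ν) ≤ K₂ * ((K + 1) * L) := by gcongr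
  have m4 : C₁ * (ν + δ) ≤ C₁ * (2 * L) := by gcongr; linarith
  have m5 : C₂ * δ ≤ C₂ * L := by gcongr
  have m6 : 0 ≤ C₂ * δ := by positivity
  have m7 : 0 ≤ C₁ * (ν + δ) := by positivity
  have m8 : 0 ≤ K₁ * ((K + 1) * ν) := by positivity
  have m9 : 0 ≤ K₁ * ν := by positivity
  have m10 : 0 ≤ K₂ * ((K + 1) * ν) := by positivity
  rw [mem_Icc, not_and_or, not_le, not_le] at ht
  rw [abs_le] at d1 d2 d3
  rcases ht with ht | ht
  · exact Or.inl ⟨by linarith, by linarith, by linarith⟩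
  · exact Or.inr ⟨by linarith, by linarith⟩

set_option maxHeartbeats 800000 in
theorem IsChart.exists_flowData (hr : 1 ≤ r) (hα : 0 < α) {Q : ℝ → Conf d → ℝ} {q₀ g : Conf d}
    (hC : IsChart P Q q₀ g) {p₀ p₁ : Conf d} (hk : ⟪p₀, g⟫_ℝ < 0)
    (hp₁ : p₁ = reflect (‖g‖⁻¹ • g) p₀) : ∃ τ₀ > 0, ∀ τ ∈ Ioo 0 τ₀,
      Nonempty (FlowData P (q₀ - τ • p₀, p₀) (q₀ + τ • p₁, p₁) (τ + τ) 1) := by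
  have hβ := eventually_nu_nonneg (r := r) hα
  have hν := tendsto_nu (r := r) hα
  obtain ⟨R, hR, hchart⟩ := hC.mem_interior
  have hk₁ : 0 < ⟪p₁, g⟫_ℝ := by
    rw [hp₁, inner_reflect_unit hC.barrier.ne_zero]; linarith
  obtain ⟨σ, hσ, hσR, hcl, hzero, hflow⟩ := exists_timeFlow hr hα (hC.barrier.close_posForce hα hR)
    q₀ p₀ hR
  obtain ⟨σ', hσ', hσR', hcl', hzero', -⟩ := exists_timeFlow hr hα (hC.barrier.close_posForce hα hR)
    q₀ p₁ hR
  obtain ⟨τa, hτa, hent⟩ := hC.barrier.exists_entrance hr hα hk (half_pos hR)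
  obtain ⟨Hr, Br, cr, tr, fr⟩ := hC.barrier.exists_reflection hr hα hk (half_pos hR)
  obtain ⟨τb, hτb, hexit⟩ := hC.barrier.exists_exit hr hα hk₁ (half_pos hR)
  rw [← hp₁] at tr
  have hden : 0 < 8 * (‖p₀‖ + ‖p₁‖ + 1) := by positivity
  refine ⟨min (min (min τa τb) (min (σ / 4) (σ' / 4))) (R / (8 * (‖p₀‖ + ‖p₁‖ + 1))), ?_,
    fun τ hτ => ?_⟩
  · refine lt_min (lt_min (lt_min hτa hτb) (lt_min ?_ ?_)) ?_ <;> positivity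
  obtain ⟨hτ0, hτ⟩ := hτ
  obtain ⟨⟨⟨h1, h2⟩, h3, h4⟩, h5⟩ : ((τ < τa ∧ τ < τb) ∧ τ < σ / 4 ∧ τ < σ' / 4) ∧
    τ < R / (8 * (‖p₀‖ + ‖p₁‖ + 1)) := by simpa [lt_min_iff] using hτ
  rw [lt_div_iff₀ hden] at h5
  have hn₀ : τ * ‖p₀‖ < R / 8 := by nlinarith [mul_nonneg hτ0.le (norm_nonneg p₁)]
  have hn₁ : τ * ‖p₁‖ < R / 8 := by nlinarith [mul_nonneg hτ0.le (norm_nonneg p₀)]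
  obtain ⟨He, Be, ce, te, C₁, hC₁, fe⟩ := hent τ ⟨hτ0, h1⟩
  obtain ⟨Hx, Bx, cx, tx, C₂, hC₂, fx⟩ := hexit τ ⟨hτ0, h2⟩
  obtain ⟨y₀, hy₀⟩ : ∃ y₀ : Phase d, y₀ = (q₀ - τ • p₀, p₀) := ⟨_, rfl⟩
  obtain ⟨T, hT⟩ : ∃ T, T = τ + τ := ⟨_, rfl⟩
  rw [← hy₀] at te fe
  rw [← hy₀, ← hT]
  -- the composed maps
  obtain ⟨Z, hZ⟩ : ∃ Z : ℝ → Phase d → Phase d × ℝ, Z = fun ε y => Hr ε (He ε y).1 := ⟨_, rfl⟩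
  obtain ⟨W, hW⟩ : ∃ W : ℝ → Phase d → Phase d × ℝ, W = fun ε y => Br ε (Be ε y).1 := ⟨_, rfl⟩
  have cZ : Close (𝓝[>] 0) (nu r α) r Z W := by rw [hZ, hW]; exact cr.comp hβ (ce.fst hβ)
  have cs : Close (𝓝[>] 0) (nu r α) r (fun ε y => (He ε y).2 + (Z ε y).2)
    (fun ε y => (Be ε y).2 + (W ε y).2) := (ce.snd hβ).add hβ (cZ.snd hβ)
  have ca : Close (𝓝[>] 0) (nu r α) r (fun ε y => ((Z ε y).1, T - ((He ε y).2 + (Z ε y).2)))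
      (fun ε y => ((W ε y).1, T - ((Be ε y).2 + (W ε y).2))) :=
    (cZ.fst hβ).prodMk hβ (cs.map hβ (φ := fun s : ℝ => T - s) (by fun_prop))
  have cF := cx.comp hβ ca
  have tBe1 : Tendsto (fun z : ℝ × Phase d => (z.1, (Be z.1 z.2).1)) (𝓝[>] 0 ×ˢ 𝓝 y₀)
    (𝓝[>] 0 ×ˢ 𝓝 (q₀, p₀)) := tendsto_fst.prodMk ((continuous_fst.tendsto _).comp te)
  have tθ : Tendsto (fun z : ℝ × Phase d => (Be z.1 z.2).2) (𝓝[>] 0 ×ˢ 𝓝 y₀) (𝓝 τ) :=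
    (continuous_snd.tendsto _).comp te
  have tHe1 : Tendsto (fun z : ℝ × Phase d => (z.1, (He z.1 z.2).1)) (𝓝[>] 0 ×ˢ 𝓝 y₀)
    (𝓝[>] 0 ×ˢ 𝓝 (q₀, p₀)) :=
    tendsto_fst.prodMk ((continuous_fst.tendsto _).comp (ce.tendsto hν te))
  have tW : Tendsto (fun z : ℝ × Phase d => W z.1 z.2) (𝓝[>] 0 ×ˢ 𝓝 y₀) (𝓝 ((q₀, p₁), 0)) := by
    rw [hW]; exact tr.comp tBe1
  have tBa : Tendsto (fun z : ℝ × Phase d => ((W z.1 z.2).1, T - ((Be z.1 z.2).2 + (W z.1 z.2).2)))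
      (𝓝[>] 0 ×ˢ 𝓝 y₀) (𝓝 ((q₀, p₁), τ)) := by
    have h := ((continuous_fst.tendsto _).comp tW).prodMk_nhds
      ((tθ.add ((continuous_snd.tendsto _).comp tW)).const_sub T)
    have e : T - (τ + 0) = τ := by rw [hT]; ring
    rwa [e] at h
  have tBx : Tendsto (fun z : ℝ × Phase d =>
      (z.1, ((W z.1 z.2).1, T - ((Be z.1 z.2).2 + (W z.1 z.2).2)))) (𝓝[>] 0 ×ˢ 𝓝 y₀)
    (𝓝[>] 0 ×ˢ 𝓝 ((q₀, p₁), τ)) := tendsto_fst.prodMk tBa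
  have tHx : Tendsto (fun z : ℝ × Phase d =>
      (z.1, ((Z z.1 z.2).1, T - ((He z.1 z.2).2 + (Z z.1 z.2).2)))) (𝓝[>] 0 ×ˢ 𝓝 y₀)
    (𝓝[>] 0 ×ˢ 𝓝 ((q₀, p₁), τ)) := tendsto_fst.prodMk (ca.tendsto hν tBa)
  obtain ⟨F, hF⟩ : ∃ F : ℝ → Phase d → Phase d, F = fun ε y =>
    Hx ε ((Z ε y).1, T - ((He ε y).2 + (Z ε y).2)) := ⟨_, rfl⟩
  obtain ⟨G, hG⟩ : ∃ G : ℝ → Phase d → Phase d, G = fun ε y =>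
    Bx ε ((W ε y).1, T - ((Be ε y).2 + (W ε y).2)) := ⟨_, rfl⟩
  have cFG : Close (𝓝[>] 0) (nu r α) r F G := by rw [hF, hG]; exact cF
  have tG : Tendsto (fun z : ℝ × Phase d => G z.1 z.2) (𝓝[>] 0 ×ˢ 𝓝 y₀)
    (𝓝 (q₀ + τ • p₁, p₁)) := by rw [hG]; exact tx.comp tBx
  obtain ⟨m, hm⟩ : ∃ m : ℝ → Phase d → Conf d, m = fun ε y =>
    ‖gradient (Q ε) (Be ε y).1.1‖⁻¹ • gradient (Q ε) (Be ε y).1.1 := ⟨_, rfl⟩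
  have tBq : Tendsto (fun z : ℝ × Phase d => (z.1, (Be z.1 z.2).1.1)) (𝓝[>] 0 ×ˢ 𝓝 y₀)
      (𝓝[>] 0 ×ˢ 𝓝 q₀) :=
    tendsto_fst.prodMk (((continuous_fst.comp continuous_fst).tendsto _).comp te)
  have tinner : Tendsto (fun z : ℝ × Phase d => ⟪z.2.2, gradient (Q z.1) (Be z.1 z.2).1.1⟫_ℝ)
      (𝓝[>] 0 ×ˢ 𝓝 y₀) (𝓝 ⟪p₀, g⟫_ℝ) := by
    have : Tendsto (fun z : ℝ × Phase d => z.2.2) (𝓝[>] 0 ×ˢ 𝓝 y₀) (𝓝 p₀) := by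
      have := (continuous_snd.tendsto y₀).comp
        (tendsto_snd (f := 𝓝[>] (0 : ℝ)) (g := 𝓝 y₀))
      rwa [hy₀] at this ⊢
    exact this.inner (hC.barrier.tendsto_grad.comp tBq)
  have hε : ∀ᶠ ε in 𝓝[>] (0 : ℝ), 0 < ε := self_mem_nhdsWithin
  have hTσ : T ≤ σ / 2 := by linarith
  have hTσ' : T ≤ σ' / 2 := by linarith
  have hnear₀ : ‖y₀ - (q₀, p₀)‖ < R / 8 := by
    rw [hy₀, Prod.mk_sub_mk, sub_self, Prod.norm_mk, norm_zero, sub_sub_cancel_left, norm_neg,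
      norm_smul, Real.norm_of_nonneg hτ0.le, max_eq_left (by positivity)]
    exact hn₀
  have hnear₁ : ‖((q₀ + τ • p₁, p₁) : Phase d) - (q₀, p₁)‖ < R / 8 := by
    rw [Prod.mk_sub_mk, sub_self, Prod.norm_mk, norm_zero, add_sub_cancel_left,
      norm_smul, Real.norm_of_nonneg hτ0.le, max_eq_left (by positivity)]
    exact hn₁
  -- the Hamiltonian orbits
  have hham : ∀ᶠ z : ℝ × Phase d in 𝓝[>] 0 ×ˢ 𝓝 y₀, ∃ γ : ℝ → Phase d, γ 0 = z.2 ∧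
      IsHamiltonianOrbit (P.Ω z.1) (P.V z.1) T γ ∧ γ T = F z.1 z.2 ∧
      (∀ t, 0 ≤ t → t ≤ (He z.1 z.2).2 →
        t < (Be z.1 z.2).2 - C₁ * (nu r α z.1 + delta r α z.1) →
        timeFlow q₀ p₀ R σ (posForce r α z.1 (Q z.1) q₀ R) (z.2, t) = γ t) ∧
      ∀ t, t ≤ T → 0 ≤ t - ((He z.1 z.2).2 + (Z z.1 z.2).2) →
        C₂ * delta r α z.1 < t - ((He z.1 z.2).2 + (Z z.1 z.2).2) →
        timeFlow q₀ p₁ R σ' (posForce r α z.1 (Q z.1) q₀ R) (F z.1 z.2, t - T) = γ t := by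
    filter_upwards [fe, tHe1.eventually fr, tHx.eventually fx, hchart.prod_inl _, hflow.prod_inl _,
      hε.prod_inl _] with z e1 e2 e3 e4 e5 e6
    obtain ⟨⟨γ₁, g₁⟩, a1, -, -, -⟩ := e1
    obtain ⟨⟨γ₂, g₂⟩, a2, -⟩ := e2.2 a1
    obtain ⟨⟨γ₃, g₃⟩, -⟩ := e3 (by rw [hZ]; exact a2)
    rw [hF]
    rw [hZ] at g₃ ⊢
    exact exists_orbit_of_passage hα e6 hR hσ (by linarith) hσ' (by linarith) rfl e5.1
      (fun q hq hQ => ⟨(e4.2 q (by linarith)).1.2 hQ, (e4.2 q (by linarith)).2.2.2.2.2 hQ⟩)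
      (eta_pos hα e6) g₁ g₂ g₃ (by ring) hTσ hTσ'
  obtain ⟨h, hh⟩ := hham.choice
  -- the billiard orbits
  have hbil : ∀ᶠ z : ℝ × Phase d in 𝓝[>] 0 ×ˢ 𝓝 y₀, 0 < (Be z.1 z.2).2 ∧
      IsRegularBilliardOrbit (P.auxTable z.1) T {(Be z.1 z.2).2}
        (bounce (Be z.1 z.2).2 (m z.1 z.2) z.2) ∧
      bounce (Be z.1 z.2).2 (m z.1 z.2) z.2 T = G z.1 z.2 ∧
      (∀ t, 0 ≤ t → t ≤ T → t < (Be z.1 z.2).2 → timeFlow q₀ p₀ R σ 0 (z.2, t) =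
        bounce (Be z.1 z.2).2 (m z.1 z.2) z.2 t) ∧
      (∀ t, 0 ≤ t → t ≤ T → (Be z.1 z.2).2 ≤ t → timeFlow q₀ p₁ R σ' 0 (G z.1 z.2, t - T) =
        bounce (Be z.1 z.2).2 (m z.1 z.2) z.2 t) ∧ (W z.1 z.2).2 = 0 := by
    filter_upwards [fe, tBe1.eventually fr, tBx.eventually fx, hchart.prod_inl _,
      tθ.eventually (lt_mem_nhds hτ0), tθ.eventually (gt_mem_nhds (show τ < T by linarith)),
      tinner.eventually (gt_mem_nhds hk), (eventually_norm_sub_lt hnear₀).prod_inr _,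
      tG.eventually (eventually_norm_sub_lt hnear₁),
      tBq.eventually ((eventually_norm_sub_lt (x := q₀) (c := q₀) (R := R)
        (by simpa using hR)).prod_inr _)]
      with z e1 e2 e3 e4 e5 e6 e7 e8 e9 e10
    obtain ⟨-, -, a2, a3, a4⟩ := e1
    have hq1 : (Be z.1 z.2).1.1 = z.2.1 + (Be z.1 z.2).2 • z.2.2 := by rw [a3]
    have hW' : W z.1 z.2 = ((z.2.1 + (Be z.1 z.2).2 • z.2.2, reflect (m z.1 z.2) z.2.2), 0) := by
      rw [hW, hm]
      dsimp only
      rw [e2.1, ← hq1, a3]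
    have hQW : Q z.1 (W z.1 z.2).1.1 = eta r α z.1 := by rw [hW', ← hq1]; exact a2
    obtain ⟨-, b2, b3⟩ := e3 hQW
    rw [hW', add_zero] at b2 b3
    have hin := e4.2 _ e10
    have hmn : 0 < ‖gradient (Q z.1) (Be z.1 z.2).1.1‖⁻¹ :=
      inv_pos.2 (norm_pos_iff.2 hin.2.2.2.2.1)
    have hG' : G z.1 z.2 = (z.2.1 + (Be z.1 z.2).2 • z.2.2 + (T - (Be z.1 z.2).2) •
        reflect (m z.1 z.2) z.2.2, reflect (m z.1 z.2) z.2.2) := by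
      rw [hG]
      dsimp only
      rw [hW', add_zero]
      exact b2
    refine ⟨e5, isRegularBilliardOrbit_bounce e5 e6 ?_ ?_ (fun t ht => ?_) (fun t ht => ?_), ?_,
      fun t ht0 htT ht => ?_, fun t ht0 htT ht => ?_, by rw [hW']⟩
    · have := hin.2.2.2.1 a2
      rw [← hq1, hm]; exact this
    · rw [hm]
      dsimp only
      rw [real_inner_smul_right]
      exact mul_neg_of_pos_of_neg hmn e7
    · have := a4 t ht
      exact (e4.2 _ (by linarith [this.1])).2.2.1 this.2
    · have := b3 t ht
      exact (e4.2 _ (by linarith [this.1])).2.2.1 this.2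
    · rw [bounce, if_neg (not_lt.2 e6.le), hG']
    · rw [bounce, if_pos ht]
      exact hzero z.2 t e8.le (by rw [abs_of_nonneg ht0]; linarith)
    · rw [bounce, if_neg (not_lt.2 ht), hzero' _ _ e9.le (by rw [abs_le]; constructor <;> linarith),
        hG']
      ext1
      · simp only; module
      · rfl
  have htop : Tendsto (Prod.fst : ℝ × Icc (0 : ℝ) T → ℝ) (𝓝[>] 0 ×ˢ ⊤) (𝓝[>] 0) := tendsto_fst
  have hT0 : 0 ≤ T := by linarith
  have cg₂ : Close (𝓝[>] 0 ×ˢ ⊤) (fun i : ℝ × Icc (0 : ℝ) T => nu r α i.1) r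
      (fun i y => timeFlow q₀ p₁ R σ' (posForce r α i.1 (Q i.1) q₀ R) (F i.1 y, i.2 - T))
      (fun i y => timeFlow q₀ p₁ R σ' 0 (G i.1 y, i.2 - T)) :=
    (hcl'.slice hβ htop (c := fun i => (i.2 : ℝ) - T) (K := T) fun i => by
      have := i.2.2
      rw [abs_le]; constructor <;> linarith [this.1, this.2]).comp (hβ.prod_inl _) (cFG.comap htop)
  have cg₁ := hcl.slice hβ htop (c := fun i => (i.2 : ℝ)) (K := T) fun i => by
    rw [abs_of_nonneg i.2.2.1]; exact i.2.2.2
  refine ⟨{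
    h := fun ε t y => h (ε, y) t
    b := fun ε t y => bounce (Be ε y).2 (m ε y) y t
    S := fun ε y => {(Be ε y).2}
    F := F
    G := G
    ι := Icc (0 : ℝ) T ⊕ Icc (0 : ℝ) T
    f := _
    g := _
    nonneg := hT0
    close := cFG
    tendsto := tG
    close_germs := Close.sumElim hβ cg₁ cg₂
    orbits := ?_
    germs := fun K => ?_ }⟩
  · filter_upwards [hh, hbil] with z a b
    exact ⟨a.1, a.2.1, a.2.2.1, bounce_zero b.1 _ _, b.2.1, b.2.2.1, Finset.card_singleton _,
      fun h => absurd h one_ne_zero⟩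
  · obtain ⟨K₁, hK₁, h₁⟩ := ce.closeZero (‖y₀‖ + 1)
    obtain ⟨K₂, hK₂, h₂⟩ := cs.closeZero (‖y₀‖ + 1)
    have t1 : Tendsto (fun z : ℝ × (Phase d × Phase d) => (z.1, z.2.1)) (𝓝[>] 0 ×ˢ 𝓝 (y₀, y₀))
        (𝓝[>] 0 ×ˢ 𝓝 y₀) := tendsto_fst.prodMk ((continuous_fst.tendsto (y₀, y₀)).comp tendsto_snd)
    have t2 : Tendsto (fun z : ℝ × (Phase d × Phase d) => (z.1, z.2.2)) (𝓝[>] 0 ×ˢ 𝓝 (y₀, y₀))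
        (𝓝[>] 0 ×ˢ 𝓝 y₀) := tendsto_fst.prodMk ((continuous_snd.tendsto (y₀, y₀)).comp tendsto_snd)
    have hbd : ∀ᶠ y in 𝓝 y₀, ‖y‖ ≤ ‖y₀‖ + 1 :=
      (continuous_norm.tendsto y₀).eventually (ge_mem_nhds (lt_add_one _))
    have hε1 : ∀ᶠ ε in 𝓝[>] (0 : ℝ), ε ∈ Ioo 0 1 := Ioo_mem_nhdsGT one_pos
    refine ⟨K₁ * (K + 1) + K₁ + C₁ * 2 + K₂ * (K + 1) + C₂, ?_⟩
    filter_upwards [t2.eventually (eventually_prod_nhds hh), t1.eventually (eventually_prod_nhds hbil),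
      h₁.prod_inl _, h₂.prod_inl _, t1.eventually (hbd.prod_inr _), t2.eventually (hbd.prod_inr _),
      hε1.prod_inl _, (ce.contDiff_one hr).prod_inl _, (cs.contDiff_one hr).prod_inl _]
      with z e1 e2 e3 e4 e5 e6 e7 e8 e9 hKz t ht hts
    have hν0 := nu_pos (r := r) (α := α) e7.1
    have hδ0 := delta_pos (r := r) (α := α) e7.1
    have hνs := nu_le_impactScale (r := r) hα e7.1 e7.2.le
    have hδs := delta_le_impactScale (r := r) hα e7.1 e7.2.le
    obtain ⟨L, hL⟩ : ∃ L, L = impactScale r α z.1 := ⟨_, rfl⟩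
    rw [← hL] at hνs hδs hts
    obtain ⟨s, hs⟩ : ∃ s, s = (Be z.1 z.2.1).2 := ⟨_, rfl⟩
    have hts := hts _ (Finset.mem_singleton_self _)
    have hK : 0 ≤ K := nonneg_of_mul_nonneg_left ((norm_nonneg _).trans hKz) hν0
    rw [norm_sub_rev] at hKz
    have hsum : ∀ κ, 0 ≤ κ → κ * (‖z.2.2 - z.2.1‖ + nu r α z.1) ≤ κ * ((K + 1) * nu r α z.1) :=
      fun κ hκ => by rw [add_mul, one_mul]; gcongr
    have d1 : |(He z.1 z.2.2).2 - s| ≤ K₁ * ((K + 1) * nu r α z.1) := by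
      rw [hs]
      exact ((norm_snd_le (He z.1 z.2.2 - Be z.1 z.2.1)).trans (e3 _ _ e6 e5).2.2).trans (hsum _ hK₁)
    have d2 : |(He z.1 z.2.2).2 - (Be z.1 z.2.2).2| ≤ K₁ * nu r α z.1 := by
      have a := (norm_snd_le (He z.1 z.2.2 - Be z.1 z.2.2)).trans (e3 _ _ e6 e6).2.2
      rwa [sub_self, norm_zero, zero_add] at a
    have d3 : |(He z.1 z.2.2).2 + (Z z.1 z.2.2).2 - s| ≤ K₂ * ((K + 1) * nu r α z.1) := by
      have a := (e4 _ _ e6 e5).2.2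
      rw [e2.self_of_nhds.2.2.2.2.2, add_zero, ← hs] at a
      exact a.trans (hsum _ hK₂)
    have cB : Continuous fun y => (Be z.1 y).2 := e8.2.continuous.snd
    have cH : Continuous fun y => (He z.1 y).2 := e8.1.continuous.snd
    rcases impact_interval hK₁ hK₂ hK hC₁ hC₂ hν0 hδ0 hνs hδs d1 d2 d3 (hs ▸ hts) with
      ⟨k0, k1, k2⟩ | ⟨k0, k1⟩
    · refine ⟨Sum.inl ⟨t, ht⟩, ?_, ?_⟩
      · filter_upwards [e1, (cH.tendsto _).eventually (lt_mem_nhds k1),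
          (cB.tendsto _).eventually (lt_mem_nhds k2)] with y f1 f2 f3
        exact (f1.2.2.2.1 t ht.1 (le_of_lt f2) (lt_sub_iff_add_lt.2 f3)).symm
      · rw [hs] at k0
        filter_upwards [e2, (cB.tendsto _).eventually (lt_mem_nhds k0)] with y f1 f2
        exact (f1.2.2.2.1 t ht.1 ht.2 f2).symm
    · refine ⟨Sum.inr ⟨t, ht⟩, ?_, ?_⟩
      · have m6 : 0 ≤ C₂ * delta r α z.1 := by positivity
        filter_upwards [e1, (e9.1.continuous.tendsto _).eventually (gt_mem_nhds k1)] with y f1 f2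
        exact (f1.2.2.2.2 t ht.2 (by linarith only [f2, m6]) (by linarith only [f2])).symm
      · rw [hs] at k0
        filter_upwards [e2, (cB.tendsto _).eventually (gt_mem_nhds k0)] with y f1 f2
        exact (f1.2.2.2.2.1 t ht.1 ht.2 (le_of_lt f2)).symm

/-! ### Regular billiard orbits -/

theorem PowerLawPotential.exists_isChart_of_normal (P : PowerLawPotential B α) (hα : 0 < α)
    {q m : Conf d} (hm : IsInwardNormal B.D q m) (hq : q ∉ B.corners) :
    ∃ Q g, IsChart P Q q g ∧ 0 < ‖g‖ ∧ g = ‖g‖ • m ∧ ‖g‖⁻¹ • g = m := by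
  obtain ⟨i, hi⟩ := B.exists_mem_of_normal hm
  obtain ⟨Q, g, hC⟩ := P.exists_isChart hα ⟨hi, hq⟩
  have h0 := norm_pos_iff.2 hC.barrier.ne_zero
  have hg := hC.normal m hm
  refine ⟨Q, g, hC, h0, hg, ?_⟩
  nth_rewrite 2 [hg]
  rw [smul_smul, inv_mul_cancel₀ h0.ne', one_smul]

theorem IsRegularBilliardOrbit.left_of_collision {A : Set (Conf d)} {T : ℝ} {S : Finset ℝ}
    {b : ℝ → Phase d} (hb : IsRegularBilliardOrbit A T S b) {s : ℝ} (hs : s ∈ S) {pin : Conf d}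
    (hp : ∀ᶠ t in 𝓝[<] s, (b t).2 = pin) :
    ∀ᶠ t in 𝓝[<] s, 0 < t ∧ (∀ u ∈ S, u < t ∨ s ≤ u) ∧ b t = ((b s).1 - (s - t) • pin, pin) := by
  have hst := hb.times s hs
  have h1 : ∀ᶠ t in 𝓝[<] s, ∀ u ∈ S, u < t ∨ s ≤ u := by
    refine (Finset.eventually_all S).2 fun u hu => ?_
    rcases lt_or_ge u s with h | h
    · filter_upwards [Ioo_mem_nhdsLT h] with t ht using Or.inl ht.1
    · exact .of_forall fun _ => Or.inr h
  filter_upwards [hp, h1, Ioo_mem_nhdsLT hst.1, self_mem_nhdsWithin] with t h2 h3 h4 h5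
  refine ⟨h4.1, h3, Prod.ext ?_ h2⟩
  have hcont := (hb.continuous_pos s ⟨hst.1.le, hst.2.le⟩).mono_left
    (nhdsWithin_mono s (show Ico t s ⊆ Icc 0 T from fun u hu =>
      ⟨h4.1.le.trans hu.1, hu.2.le.trans hst.2.le⟩))
  rw [nhdsWithin_Ico_eq_nhdsLT h4.2] at hcont
  have hl : Tendsto (fun u => (b t).1 + (u - t) • pin) (𝓝[<] s) (𝓝 ((b t).1 + (s - t) • pin)) := by
    have : Continuous fun u : ℝ => (b t).1 + (u - t) • pin := by fun_prop
    exact (this.tendsto s).mono_left nhdsWithin_le_nhds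
  have he : (fun u => (b u).1) =ᶠ[𝓝[<] s] fun u => (b t).1 + (u - t) • pin := by
    filter_upwards [Ioo_mem_nhdsLT h4.2] with u hu
    rw [hb.free t u h4.1.le hu.1.le (hu.2.le.trans hst.2.le) fun v hv hh =>
      (h3 v hv).elim (fun h => absurd h (not_lt.2 hh.1.le)) fun h =>
        absurd (hh.2.trans_lt hu.2) (not_lt.2 h), h2]
  exact eq_sub_of_add_eq (tendsto_nhds_unique (hl.congr' he.symm) hcont)

theorem exists_flowData_orbit (hr : 1 ≤ r) (hα : 0 < α) (hP : P.BoundaryDominated) {T : ℝ}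
    {S : Finset ℝ} {b : ℝ → Phase d} (hb : IsRegularBilliardOrbit B.D T S b)
    (hS : ∀ s ∈ S, (b s).1 ∉ B.corners) {c : ℝ} (hc : c ∈ Icc 0 T) (hcS : c ∉ S) :
    Nonempty (FlowData P (b 0) (b c) c (S.filter (· < c)).card) := by
  obtain ⟨k, hk⟩ : ∃ k, k = (S.filter (· < c)).card := ⟨_, rfl⟩
  induction k using Nat.strong_induction_on generalizing c with
  | _ k ih =>
    -- free motion from `a` to `c`
    have hfree : ∀ a, 0 ≤ a → a ≤ c → (∀ s ∈ S, s < c → s ≤ a) →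
        ∀ t ∈ Icc a c, b t = ((b a).1 + (t - a) • (b a).2, (b a).2) ∧
          (a < t ∨ t ∉ S → (b t).1 ∈ interior B.D) := by
      intro a ha hac has t ht
      refine ⟨hb.free a t ha ht.1 (ht.2.trans hc.2) fun s hs hh => ?_, fun hh =>
        hb.inner t ⟨ha.trans ht.1, ht.2.trans hc.2⟩ fun hts => ?_⟩
      · have hsc := (hh.2.trans ht.2).lt_of_ne fun h => hcS (h ▸ hs)
        exact absurd hh.1 (not_lt.2 (has s hs hsc))
      · rcases hh with hh | hh
        · have hsc := ht.2.lt_of_ne fun h => hcS (h ▸ hts)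
          exact absurd hh (not_lt.2 (has t hts hsc))
        · exact hh hts
    rcases (S.filter (· < c)).eq_empty_or_nonempty with he | hne
    · have hno : ∀ s ∈ S, ¬ s < c := fun s hs hsc => by
        have : s ∈ S.filter (· < c) := Finset.mem_filter.2 ⟨hs, hsc⟩
        rw [he] at this
        simp at this
      have h0 := hfree 0 le_rfl hc.1 fun s hs hsc => absurd hsc (hno s hs)
      have := exists_flowData_free (q := (b 0).1) (p := (b 0).2) hr hα hP hc.1 fun t ht => by
        obtain ⟨h1, h2⟩ := h0 t ht
        have := h2 (Or.inr fun hts => hno t hts (ht.2.lt_of_ne fun h => hcS (h ▸ hts)))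
        rwa [h1, sub_zero] at this
      have e := (h0 c (right_mem_Icc.2 hc.1)).1
      rw [sub_zero] at e
      rwa [he, Finset.card_empty, e]
    · obtain ⟨s, hs⟩ : ∃ s, s = (S.filter (· < c)).max' hne := ⟨_, rfl⟩
      have hsm : s ∈ S.filter (· < c) := hs ▸ Finset.max'_mem _ _
      obtain ⟨hsS, hsc⟩ := Finset.mem_filter.1 hsm
      have hmax : ∀ u ∈ S, u < c → u ≤ s := fun u hu huc =>
        hs ▸ Finset.le_max' _ _ (Finset.mem_filter.2 ⟨hu, huc⟩)
      obtain ⟨m, pin, hm, hpin, hneg, hout⟩ := hb.collision s hsS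
      obtain ⟨Q, g, hC, hg0, hg, hgm⟩ := P.exists_isChart_of_normal hα hm (hS s hsS)
      have hk' : ⟪pin, g⟫_ℝ < 0 := by
        rw [hg, real_inner_smul_right]; exact mul_neg_of_pos_of_neg hg0 hneg
      obtain ⟨τ₀, hτ₀, hstep⟩ := hC.exists_flowData hr hα hk' (p₁ := (b s).2) (by rw [hgm, hout])
      obtain ⟨t, ⟨ht0, hleft, hbt⟩, htl⟩ := ((hb.left_of_collision hsS hpin).and
        (Ioo_mem_nhdsLT (show max (s - τ₀) (s - (c - s)) < s from
          max_lt (by linarith) (by linarith)))).exists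
      have htτ := (le_max_left _ _).trans_lt htl.1
      have htc := (le_max_right _ _).trans_lt htl.1
      have hts := htl.2
      have htS : t ∉ S := fun h => (hleft t h).elim (lt_irrefl t) fun h => absurd hts (not_lt.2 h)
      have hfilter : S.filter (· < c) = insert s (S.filter (· < t)) := by
        ext u
        rw [Finset.mem_insert, Finset.mem_filter, Finset.mem_filter]
        constructor
        · rintro ⟨hu, huc⟩
          rcases hleft u hu with h | h
          · exact Or.inr ⟨hu, h⟩
          · exact Or.inl (le_antisymm (hmax u hu huc) h)
        · rintro (rfl | ⟨hu, hut⟩)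
          · exact ⟨hsS, hsc⟩
          · exact ⟨hu, hut.trans (hts.trans hsc)⟩
      have hcard : (S.filter (· < c)).card = (S.filter (· < t)).card + 1 := by
        rw [hfilter, Finset.card_insert_of_notMem]
        rw [Finset.mem_filter, not_and, not_lt]
        exact fun _ => hts.le
      obtain ⟨D₁⟩ := ih _ (by omega) ⟨ht0.le, by linarith [hc.2]⟩ htS rfl
      rw [hbt] at D₁
      obtain ⟨D₂⟩ := hstep (s - t) ⟨by linarith, by linarith⟩
      have hs0 := (hb.times s hsS).1.le
      have h3 := hfree s hs0 hsc.le hmax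
      obtain ⟨D₃⟩ := exists_flowData_free (q := (b s).1 + (s - t) • (b s).2) (p := (b s).2)
        (T := c - s - (s - t)) hr hα hP (by linarith) fun u hu => by
          obtain ⟨e1, e2⟩ := h3 (s + (s - t) + u) ⟨by linarith [hu.1], by linarith [hu.2]⟩
          have := e2 (Or.inl (by linarith [hu.1]))
          rw [e1] at this
          convert this using 1
          module
      obtain ⟨D₁₂⟩ := D₁.trans hr hα D₂
      have D := D₁₂.trans hr hα D₃
      have e := (h3 c (right_mem_Icc.2 hsc.le)).1
      have e1 : (b s).1 + (s - t) • (b s).2 + (c - s - (s - t)) • (b s).2 =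
        (b s).1 + (c - s) • (b s).2 := by module
      have e2 : t + (s - t + (s - t)) + (c - s - (s - t)) = c := by ring
      rw [e1, ← e, e2, add_zero, ← hcard] at D
      exact D

theorem flow_closeness (hr : 1 ≤ r) (hα : 0 < α) (hP : P.BoundaryDominated) {T : ℝ} (hT : 0 < T)
    {S : Finset ℝ} {b : ℝ → Phase d} (hb : IsRegularBilliardOrbit B.D T S b)
    (hS : ∀ s ∈ S, (b s).1 ∉ B.corners) : Nonempty (FlowData P (b 0) (b T) T S.card) := by
  have h := exists_flowData_orbit hr hα hP hb hS (right_mem_Icc.2 hT.le)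
    fun h => lt_irrefl _ (hb.times T h).2
  rwa [Finset.filter_true_of_mem fun s hs => (hb.times s hs).2] at h

/-! ### The Poincaré map and the billiard map near a regular reflection -/

theorem isHamiltonianFlight_of_parts {Ω A : Set (Conf d)} {U : Conf d → ℝ} {a b c : ℝ}
    {γ₁ γ₂ γ₃ : ℝ → Phase d} (ha : 0 < a) (hb : 0 ≤ b) (hc : 0 ≤ c)
    (h₁ : IsHamiltonianOrbit Ω U a γ₁) (h₂ : IsHamiltonianOrbit Ω U b γ₂)
    (h₃ : IsHamiltonianOrbit Ω U c γ₃) (j₁ : γ₁ a = γ₂ 0) (j₂ : γ₂ b = γ₃ 0)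
    (i₁ : ∀ t ∈ Ioc 0 a, (γ₁ t).1 ∈ interior A) (i₂ : ∀ t ∈ Icc 0 b, (γ₂ t).1 ∈ interior A)
    (i₃ : ∀ t ∈ Ico 0 c, (γ₃ t).1 ∈ interior A) (hout : γ₃ c ∈ outwardSection A) :
    IsHamiltonianFlight Ω U A (γ₁ 0) (γ₃ c) := by
  have j : γ₁ a = followedBy b γ₂ γ₃ 0 := by rw [followedBy_of_le _ _ hb, j₁]
  refine ⟨followedBy a γ₁ (followedBy b γ₂ γ₃), a + (b + c), by linarith,
    h₁.followedBy ha.le (add_nonneg hb hc) (h₂.followedBy hb hc h₃ j₂) j,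
    followedBy_of_le _ _ ha.le, ?_, fun t ht => ?_, hout⟩
  · rw [followedBy_of_ge j (by linarith), followedBy_of_ge j₂ (by linarith)]
    congr 1; ring
  · rcases le_total t a with h | h
    · rw [followedBy_of_le _ _ h]
      exact i₁ t ⟨ht.1, h⟩
    · rw [followedBy_of_ge j h]
      rcases le_total (t - a) b with h' | h'
      · rw [followedBy_of_le _ _ h']
        exact i₂ _ ⟨sub_nonneg.2 h, h'⟩
      · rw [followedBy_of_ge j₂ h']
        exact i₃ _ ⟨sub_nonneg.2 h', by linarith [ht.2]⟩

set_option maxHeartbeats 800000 in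
theorem exists_step_maps (hr : 1 ≤ r) (hα : 0 < α) (hP : P.BoundaryDominated) {q₀ p₀ q₁ m₀ m₁ : Conf d}
    {T : ℝ} (hT : 0 < T) (hq₁ : q₁ = q₀ + T • p₀) (h₀ : IsInwardNormal B.D q₀ m₀)
    (hin : 0 < ⟪p₀, m₀⟫_ℝ) (hc₀ : q₀ ∉ B.corners) (hint : ∀ s ∈ Ioo 0 T, q₀ + s • p₀ ∈ interior B.D)
    (h₁ : IsInwardNormal B.D q₁ m₁) (hout : ⟪p₀, m₁⟫_ℝ < 0) (hc₁ : q₁ ∉ B.corners) :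
    ∃ F G : ℝ → Phase d → Phase d, Close (𝓝[>] 0) (nu r α) r F G ∧
      ∀ᶠ z : ℝ × Phase d in 𝓝[>] 0 ×ˢ 𝓝 (q₀, p₀), z.2 ∈ inwardSection (P.auxTable z.1) →
        IsPoincareStep (P.Ω z.1) (P.V z.1) (P.auxTable z.1) z.2 (F z.1 z.2) ∧
        IsBilliardStep (P.auxTable z.1) z.2 (G z.1 z.2) := by
  have hβ := eventually_nu_nonneg (r := r) hα
  have hν := tendsto_nu (r := r) hα
  obtain ⟨Q, g, hC, hg0, hg, -⟩ := P.exists_isChart_of_normal hα h₀ hc₀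
  obtain ⟨Q', g', hC', hg0', hg', hgm'⟩ := P.exists_isChart_of_normal hα h₁ hc₁
  have hk : 0 < ⟪p₀, g⟫_ℝ := by rw [hg, real_inner_smul_right]; exact mul_pos hg0 hin
  have hk' : ⟪p₀, g'⟫_ℝ < 0 := by
    rw [hg', real_inner_smul_right]; exact mul_neg_of_pos_of_neg hg0' hout
  obtain ⟨R, hR, hchart⟩ := hC.mem_interior
  obtain ⟨R', hR', hchart'⟩ := hC'.mem_interior
  obtain ⟨τa, hτa, hexit⟩ := hC.barrier.exists_exit hr hα hk hR
  obtain ⟨τc, hτc, hent⟩ := hC'.barrier.exists_entrance hr hα hk' hR'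
  obtain ⟨Hr, Br, cr, tr, fr⟩ := hC'.barrier.exists_reflection hr hα hk' hR'
  obtain ⟨a, ha0, ha⟩ : ∃ a, 0 < a ∧ a < min τa (T / 2) := exists_between (lt_min hτa (by linarith))
  obtain ⟨c, hc0, hc⟩ : ∃ c, 0 < c ∧ c < min τc (T / 2) := exists_between (lt_min hτc (by linarith))
  rw [lt_min_iff] at ha hc
  obtain ⟨Hx, Bx, cx, tx, C₂, -, fx⟩ := hexit a ⟨ha0, ha.1⟩
  obtain ⟨He, Be, ce, te, C₁, -, fe⟩ := hent c ⟨hc0, hc.1⟩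
  obtain ⟨L, hL⟩ : ∃ L, L = T - a - c := ⟨_, rfl⟩
  have hL0 : 0 ≤ L := by linarith
  obtain ⟨D⟩ := exists_flowData_free (q := q₀ + a • p₀) (p := p₀) (T := L) hr hα hP hL0
    fun t ht => by
      have := hint (a + t) ⟨by linarith [ht.1], by linarith [ht.2]⟩
      rwa [add_smul, ← add_assoc] at this
  have hend : q₀ + a • p₀ + L • p₀ = q₁ - c • p₀ := by rw [hq₁, hL]; module
  rw [hend] at D
  obtain ⟨y₀, hy₀⟩ : ∃ y₀ : Phase d, y₀ = (q₀, p₀) := ⟨_, rfl⟩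
  obtain ⟨p₁, hp₁⟩ : ∃ p₁, p₁ = reflect (‖g'‖⁻¹ • g') p₀ := ⟨_, rfl⟩
  have hk₁ : 0 < ⟪p₁, g'⟫_ℝ := by rw [hp₁, inner_reflect_unit hC'.barrier.ne_zero]; linarith
  rw [← hp₁] at tr
  rw [← hy₀] at tx fx ⊢
  -- the composed maps
  obtain ⟨X, hX⟩ : ∃ X : ℝ → Phase d → Phase d, X = fun ε y => Hx ε (y, a) := ⟨_, rfl⟩
  obtain ⟨X', hX'⟩ : ∃ X : ℝ → Phase d → Phase d, X = fun ε y => Bx ε (y, a) := ⟨_, rfl⟩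
  obtain ⟨Y, hY⟩ : ∃ Y : ℝ → Phase d → Phase d, Y = fun ε y => D.F ε (X ε y) := ⟨_, rfl⟩
  obtain ⟨Y', hY'⟩ : ∃ Y : ℝ → Phase d → Phase d, Y = fun ε y => D.G ε (X' ε y) := ⟨_, rfl⟩
  obtain ⟨E, hE⟩ : ∃ E : ℝ → Phase d → Phase d × ℝ, E = fun ε y => He ε (Y ε y) := ⟨_, rfl⟩
  obtain ⟨E', hE'⟩ : ∃ E : ℝ → Phase d → Phase d × ℝ, E = fun ε y => Be ε (Y' ε y) := ⟨_, rfl⟩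
  obtain ⟨Z, hZ⟩ : ∃ Z : ℝ → Phase d → Phase d × ℝ, Z = fun ε y => Hr ε (E ε y).1 := ⟨_, rfl⟩
  obtain ⟨Z', hZ'⟩ : ∃ Z : ℝ → Phase d → Phase d × ℝ, Z = fun ε y => Br ε (E' ε y).1 := ⟨_, rfl⟩
  have cX : Close (𝓝[>] 0) (nu r α) r X X' := by
    rw [hX, hX']; exact cx.slice hβ tendsto_id (c := fun _ => a) fun _ => le_rfl
  have cY : Close (𝓝[>] 0) (nu r α) r Y Y' := by rw [hY, hY']; exact D.close.comp hβ cX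
  have cE : Close (𝓝[>] 0) (nu r α) r E E' := by rw [hE, hE']; exact ce.comp hβ cY
  have cZ : Close (𝓝[>] 0) (nu r α) r Z Z' := by rw [hZ, hZ']; exact cr.comp hβ (cE.fst hβ)
  have ta : Tendsto (fun z : ℝ × Phase d => (z.1, (z.2, a))) (𝓝[>] 0 ×ˢ 𝓝 y₀)
    (𝓝[>] 0 ×ˢ 𝓝 (y₀, a)) := tendsto_fst.prodMk (tendsto_snd.prodMk_nhds tendsto_const_nhds)
  have lift : ∀ {G : Type} [NormedAddCommGroup G] {f : ℝ → Phase d → G} {w : G},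
      Tendsto (fun z : ℝ × Phase d => f z.1 z.2) (𝓝[>] 0 ×ˢ 𝓝 y₀) (𝓝 w) →
      Tendsto (fun z : ℝ × Phase d => (z.1, f z.1 z.2)) (𝓝[>] 0 ×ˢ 𝓝 y₀) (𝓝[>] 0 ×ˢ 𝓝 w) :=
    fun h => tendsto_fst.prodMk h
  have lift₁ : ∀ {f : ℝ → Phase d → Phase d × ℝ} {w : Phase d × ℝ},
      Tendsto (fun z : ℝ × Phase d => f z.1 z.2) (𝓝[>] 0 ×ˢ 𝓝 y₀) (𝓝 w) →
      Tendsto (fun z : ℝ × Phase d => (z.1, (f z.1 z.2).1)) (𝓝[>] 0 ×ˢ 𝓝 y₀)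
        (𝓝[>] 0 ×ˢ 𝓝 w.1) := fun h => tendsto_fst.prodMk ((continuous_fst.tendsto _).comp h)
  have tX' : Tendsto (fun z : ℝ × Phase d => X' z.1 z.2) (𝓝[>] 0 ×ˢ 𝓝 y₀)
    (𝓝 (q₀ + a • p₀, p₀)) := by rw [hX']; exact tx.comp ta
  have tX := cX.tendsto hν tX'
  have tY' : Tendsto (fun z : ℝ × Phase d => Y' z.1 z.2) (𝓝[>] 0 ×ˢ 𝓝 y₀)
    (𝓝 (q₁ - c • p₀, p₀)) := by rw [hY']; exact D.tendsto.comp (lift tX')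
  have tY := cY.tendsto hν tY'
  have tE' : Tendsto (fun z : ℝ × Phase d => E' z.1 z.2) (𝓝[>] 0 ×ˢ 𝓝 y₀)
    (𝓝 ((q₁, p₀), c)) := by rw [hE']; exact te.comp (lift tY')
  have tE := cE.tendsto hν tE'
  have tZ' : Tendsto (fun z : ℝ × Phase d => Z' z.1 z.2) (𝓝[>] 0 ×ˢ 𝓝 y₀)
    (𝓝 ((q₁, p₁), 0)) := by rw [hZ']; exact tr.comp (lift₁ tE')
  have tZ := cZ.tendsto hν tZ'
  -- position and direction at the boundary
  have hpos : ∀ {f : ℝ → Phase d → Phase d × ℝ} {p : Conf d} {t : ℝ},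
      Tendsto (fun z : ℝ × Phase d => f z.1 z.2) (𝓝[>] 0 ×ˢ 𝓝 y₀) (𝓝 ((q₁, p), t)) →
      (∀ᶠ z : ℝ × Phase d in 𝓝[>] 0 ×ˢ 𝓝 y₀, ‖(f z.1 z.2).1.1 - q₁‖ < R') ∧
      Tendsto (fun z : ℝ × Phase d => ⟪(f z.1 z.2).1.2, gradient (Q' z.1) (f z.1 z.2).1.1⟫_ℝ)
        (𝓝[>] 0 ×ˢ 𝓝 y₀) (𝓝 ⟪p, g'⟫_ℝ) := fun {f p t} h => by
    have h1 := ((continuous_fst.comp continuous_fst).tendsto ((q₁, p), t)).comp h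
    have h2 := ((continuous_snd.comp continuous_fst).tendsto ((q₁, p), t)).comp h
    exact ⟨h1.eventually (eventually_norm_sub_lt (x := q₁) (by simpa using hR')),
      h2.inner (hC'.barrier.tendsto_grad.comp (tendsto_fst.prodMk h1))⟩
  have hε : ∀ᶠ ε in 𝓝[>] (0 : ℝ), 0 < ε := self_mem_nhdsWithin
  have hnear : ∀ᶠ y : Phase d in 𝓝 y₀, ‖y.1 - q₀‖ < R := by
    have h : Tendsto (fun y : Phase d => y.1) (𝓝 y₀) (𝓝 q₀) := by
      rw [hy₀]; exact continuous_fst.tendsto (q₀, p₀)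
    exact h.eventually (eventually_norm_sub_lt (by simpa using hR))
  refine ⟨fun ε y => (Z ε y).1, fun ε y => (Z' ε y).1, cZ.fst hβ, ?_⟩
  have hham : ∀ᶠ z : ℝ × Phase d in 𝓝[>] 0 ×ˢ 𝓝 y₀, Q z.1 z.2.1 = eta r α z.1 →
      IsPoincareStep (P.Ω z.1) (P.V z.1) (P.auxTable z.1) z.2 (Z z.1 z.2).1 := by
    filter_upwards [ta.eventually fx, (lift tX).eventually D.orbits, (lift tY).eventually fe,
      (lift₁ tE).eventually fr, hchart.prod_inl _, hchart'.prod_inl _, (hpos tE).1, (hpos tZ).1,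
      (hpos tE).2.eventually (gt_mem_nhds hk'), (hpos tZ).2.eventually (lt_mem_nhds hk₁),
      hε.prod_inl _] with z f1 f2 f3 f4 f5 f6 f7 f8 f9 f10 f11 hQ
    obtain ⟨⟨γ₁, g₁⟩, -⟩ := f1 hQ
    obtain ⟨a1, a2, a3, -, -, -, -, a8⟩ := f2
    obtain ⟨⟨γ₃, g₃⟩, b1, -⟩ := f3
    have hE1 : He z.1 (Y z.1 z.2) = E z.1 z.2 := by rw [hE]
    have hZ1 : Hr z.1 (E z.1 z.2).1 = Z z.1 z.2 := by rw [hZ]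
    have hX1 : Hx z.1 (z.2, a) = X z.1 z.2 := by rw [hX]
    have hY1 : D.F z.1 (X z.1 z.2) = Y z.1 z.2 := by rw [hY]
    rw [hE1] at g₃ b1
    rw [hZ1] at f4
    rw [hX1] at g₁
    rw [hY1] at a3
    obtain ⟨⟨γ₄, g₄⟩, d1, d2⟩ := f4.2 b1
    have he := eta_pos (r := r) hα f11
    have o₁ := g₁.isHamiltonianOrbit_of_barrier
      (fun q hq hQ => ⟨(f5.2 q hq).1.2 hQ, (f5.2 q hq).2.2.2.2.2 hQ⟩)
      fun t ht h => ⟨(norm_fst_le (γ₁ t - (q₀, p₀))).trans_lt (hy₀ ▸ h.1), he.trans_le h.2.1⟩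
    have o₃ := g₃.isHamiltonianOrbit_of_barrier
      (fun q hq hQ => ⟨(f6.2 q hq).1.2 hQ, (f6.2 q hq).2.2.2.2.2 hQ⟩)
      fun t ht h => ⟨(norm_fst_le (γ₃ t - (q₁, p₀))).trans_lt h.1, he.trans_le h.2.1⟩
    have o₄ := g₄.isHamiltonianOrbit_of_barrier
      (fun q hq hQ => ⟨(f6.2 q hq).1.2 hQ, (f6.2 q hq).2.2.2.2.2 hQ⟩) fun t ht h => ⟨h.1, h.2.1⟩
    have nE := f6.2 _ f7
    have nZ := f6.2 _ f8
    refine ⟨(E z.1 z.2).1, ?_, γ₄, _, d2, o₄, g₄.left, g₄.right, fun t ht => ?_,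
      _, nZ.2.2.2.1 d1, ?_⟩
    · have := isHamiltonianFlight_of_parts (A := P.auxTable z.1) ha0 hL0 g₃.le o₁ a2 o₃
        (by rw [g₁.right, a1]) (by rw [a3, g₃.left]) (fun t ht => ?_) (fun t ht => a8 rfl t ht)
        (fun t ht => ?_) ?_
      · rwa [g₁.left, g₃.right] at this
      · have h := g₁.prop t ⟨ht.1.le, ht.2⟩
        exact (f5.2 _ ((norm_fst_le (γ₁ t - (q₀, p₀))).trans_lt (hy₀ ▸ h.1))).2.2.1 (h.2.2.1 ht.1)
      · have h := g₃.prop t ⟨ht.1, ht.2.le⟩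
        exact (f6.2 _ ((norm_fst_le (γ₃ t - (q₁, p₀))).trans_lt h.1)).2.2.1 (h.2.2.1 ht.2)
      · rw [g₃.right]
        refine ⟨_, nE.2.2.2.1 b1, ?_⟩
        rw [real_inner_smul_right]
        exact mul_neg_of_pos_of_neg (inv_pos.2 (norm_pos_iff.2 nE.2.2.2.2.1)) f9
    · have h := g₄.prop t ⟨ht.1.le, ht.2.le⟩
      rw [(f6.2 _ h.1).2.1, not_le]
      exact h.2.2.2 ht.1 ht.2
    · rw [real_inner_smul_right]
      exact mul_pos (inv_pos.2 (norm_pos_iff.2 nZ.2.2.2.2.1)) f10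
  have hbil : ∀ᶠ z : ℝ × Phase d in 𝓝[>] 0 ×ˢ 𝓝 y₀, Q z.1 z.2.1 = eta r α z.1 →
      IsBilliardStep (P.auxTable z.1) z.2 (Z' z.1 z.2).1 := by
    filter_upwards [ta.eventually fx, (lift tX').eventually D.orbits, (lift tY').eventually fe,
      (lift₁ tE').eventually fr, hchart.prod_inl _, hchart'.prod_inl _, (hpos tE').1,
      (hpos tE').2.eventually (gt_mem_nhds hk'), 
      ((continuous_snd.tendsto _).comp tE').eventually (lt_mem_nhds hc0)]
      with z f1 f2 f3 f4 f5 f6 f7 f8 f9 hQ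
    obtain ⟨-, a1, a2⟩ := f1 hQ
    obtain ⟨-, -, -, b1, b2, b3, b4, -⟩ := f2
    obtain ⟨-, -, c1, c2, c3⟩ := f3
    have hE1 : Be z.1 (Y' z.1 z.2) = E' z.1 z.2 := by rw [hE']
    have hZ1 : Br z.1 (E' z.1 z.2).1 = Z' z.1 z.2 := by rw [hZ']
    have hX1 : Bx z.1 (z.2, a) = X' z.1 z.2 := by rw [hX']
    have hY1 : D.G z.1 (X' z.1 z.2) = Y' z.1 z.2 := by rw [hY']
    rw [hE1] at c1 c2 c3
    have f4 := f4.1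
    rw [hZ1] at f4
    rw [hX1] at a1
    rw [hY1] at b3
    rw [Finset.card_eq_zero.1 b4] at b2
    obtain ⟨θ, hθ⟩ : ∃ θ, θ = (E' z.1 z.2).2 := ⟨_, rfl⟩
    rw [← hθ] at c2 c3
    have hθ0 : 0 < θ := by rw [hθ]; exact f9
    have hline : ∀ t ∈ Icc 0 L, D.b z.1 t (X' z.1 z.2) = (z.2.1 + (a + t) • z.2.2, z.2.2) := by
      intro t ht
      have := b2.free 0 t le_rfl ht.1 ht.2 (by simp)
      rw [this, b1, a1]
      ext1
      · simp only; module
      · rfl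
    have hY2 : Y' z.1 z.2 = (z.2.1 + (a + L) • z.2.2, z.2.2) := by
      rw [← b3]; exact hline L (right_mem_Icc.2 hL0)
    rw [hY2] at c2 c3
    dsimp only at c2 c3
    have hE2 : (E' z.1 z.2).1 = (z.2.1 + (a + L + θ) • z.2.2, z.2.2) := by
      rw [c2]
      ext1
      · simp only; module
      · rfl
    have nE := f6.2 _ f7
    have hnorm := nE.2.2.2.1 c1
    rw [hE2] at hnorm f8 f4 nE
    dsimp only at hnorm f8 f4 nE
    refine ⟨a + L + θ, by linarith, fun s hs => ?_, _, hnorm, ?_, by rw [f4]⟩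
    · rcases le_total s a with h | h
      · have := a2 s ⟨hs.1, h⟩
        exact (f5.2 _ this.1).2.2.1 this.2
      · rcases le_total (s - a) L with h' | h'
        · have h2 : s - a ∈ Icc 0 L := ⟨sub_nonneg.2 h, h'⟩
          have := b2.inner (s - a) h2 (by simp)
          rwa [hline _ h2, add_sub_cancel] at this
        · have := c3 (s - a - L) ⟨sub_nonneg.2 h', by linarith [hs.2]⟩
          have e : z.2.1 + (a + L) • z.2.2 + (s - a - L) • z.2.2 = z.2.1 + s • z.2.2 := by module
          rw [e] at this
          exact (f6.2 _ this.1).2.2.1 this.2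
    · rw [real_inner_smul_right]
      exact mul_neg_of_pos_of_neg (inv_pos.2 (norm_pos_iff.2 nE.2.2.2.2.1)) f8
  filter_upwards [hham, hbil, hchart.prod_inl _, hnear.prod_inr _] with z f1 f2 f3 f4 hz
  obtain ⟨m, hm, -⟩ := hz
  have hn := f3.2 _ f4
  have hQ : Q z.1 z.2.1 = eta r α z.1 := by
    refine le_antisymm (not_lt.1 fun h => hm.notMem_interior (hn.2.2.1 h)) (hn.2.1.1 hm.mem)
  exact ⟨f1 hQ, f2 hQ⟩

end

/-! ### Uniqueness of the Poincaré map and of the billiard map -/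

section Unique

variable {d : ℕ} {Ω A : Set (Conf d)} {U : Conf d → ℝ}

theorem IsHamiltonianOrbit.mono {T T' : ℝ} (hT : T' ≤ T) {γ : ℝ → Phase d}
    (h : IsHamiltonianOrbit Ω U T γ) : IsHamiltonianOrbit Ω U T' γ := fun t ht =>
  have hs := Icc_subset_Icc_right hT
  ⟨(h t (hs ht)).1, (h t (hs ht)).2.mono hs⟩

theorem IsHamiltonianOrbit.eqOn (hΩ : IsOpen Ω) (hU : ContDiffOn ℝ 2 U Ω) {T : ℝ}
    {γ₁ γ₂ : ℝ → Phase d} (h₁ : IsHamiltonianOrbit Ω U T γ₁) (h₂ : IsHamiltonianOrbit Ω U T γ₂)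
    (h : γ₁ 0 = γ₂ 0) : EqOn γ₁ γ₂ (Icc 0 T) := by
  have c₁ : ContinuousOn γ₁ (Icc 0 T) := fun t ht => (h₁ t ht).2.continuousWithinAt
  have c₂ : ContinuousOn γ₂ (Icc 0 T) := fun t ht => (h₂ t ht).2.continuousWithinAt
  obtain ⟨s, hs⟩ : ∃ s, s = γ₁ '' Icc 0 T ∪ γ₂ '' Icc 0 T := ⟨_, rfl⟩
  have hsc : IsCompact s := hs ▸ (isCompact_Icc.image_of_continuousOn c₁).union
    (isCompact_Icc.image_of_continuousOn c₂)
  have hsΩ : ∀ y ∈ s, y.1 ∈ Ω := by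
    rw [hs]
    rintro y (⟨t, ht, rfl⟩ | ⟨t, ht, rfl⟩)
    · exact (h₁ t ht).1
    · exact (h₂ t ht).1
  have hl : LocallyLipschitzOn s (forceField fun q => -gradient U q) := by
    intro y hy
    have hg : ContDiffAt ℝ 1 (fun q => -gradient U q) y.1 := by
      have := (hU.contDiffAt (hΩ.mem_nhds (hsΩ y hy))).fderiv_right (m := 1) le_rfl
      exact ((InnerProductSpace.toDual ℝ (Conf d)).symm.contDiff.contDiffAt.comp y.1 this).neg
    have : ContDiffAt ℝ 1 (forceField fun q => -gradient U q) y :=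
      contDiffAt_snd.prodMk (hg.comp y contDiffAt_fst)
    obtain ⟨K, t, ht, hK⟩ := this.exists_lipschitzOnWith
    exact ⟨K, t, mem_nhdsWithin_of_mem_nhds ht, hK⟩
  obtain ⟨K, hK⟩ := hl.exists_lipschitzOnWith_of_compact hsc
  refine ODE_solution_unique_of_mem_Icc_right (v := fun _ => forceField fun q => -gradient U q)
    (s := fun _ => s) (K := K) (fun _ _ => hK) c₁ (fun t ht => ?_) (fun t ht => ?_) c₂
    (fun t ht => ?_) (fun t ht => ?_) h
  · exact hasDerivWithinAt_Ici_of_Icc ht (h₁ t (Ico_subset_Icc_self ht)).2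
  · exact hs ▸ Or.inl ⟨t, Ico_subset_Icc_self ht, rfl⟩
  · exact hasDerivWithinAt_Ici_of_Icc ht (h₂ t (Ico_subset_Icc_self ht)).2
  · exact hs ▸ Or.inr ⟨t, Ico_subset_Icc_self ht, rfl⟩

theorem eq_of_first_hit {E : Type} {p : E → Prop} {γ₁ γ₂ : ℝ → E} {a b : ℝ} (ha : 0 < a) (hb : 0 < b)
    (h : ∀ t ∈ Icc 0 (min a b), γ₁ t = γ₂ t) (h₁ : ∀ t ∈ Ioo 0 a, ¬ p (γ₁ t)) (p₁ : p (γ₁ a))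
    (h₂ : ∀ t ∈ Ioo 0 b, ¬ p (γ₂ t)) (p₂ : p (γ₂ b)) : a = b ∧ γ₁ a = γ₂ b := by
  rcases lt_trichotomy a b with hab | rfl | hab
  · rw [min_eq_left hab.le] at h
    exact absurd (h a (right_mem_Icc.2 ha.le) ▸ p₁) (h₂ a ⟨ha, hab⟩)
  · exact ⟨rfl, h a (by rw [min_self]; exact right_mem_Icc.2 ha.le)⟩
  · rw [min_eq_right hab.le] at h
    exact absurd ((h b (right_mem_Icc.2 hb.le)).symm ▸ p₂) (h₁ b ⟨hb, hab⟩)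

theorem IsPoincareStep.unique (hΩ : IsOpen Ω) (hU : ContDiffOn ℝ 2 U Ω) {ρ ρ₁ ρ₂ : Phase d}
    (h₁ : IsPoincareStep Ω U A ρ ρ₁) (h₂ : IsPoincareStep Ω U A ρ ρ₂) : ρ₁ = ρ₂ := by
  obtain ⟨σ₁, ⟨γ₁, a₁, ha₁, o₁, s₁, e₁, i₁, ⟨m₁, hm₁, -⟩⟩, γ₁', a₁', ha₁', o₁', s₁', e₁', i₁', ⟨n₁, hn₁, -⟩⟩ := h₁
  obtain ⟨σ₂, ⟨γ₂, a₂, ha₂, o₂, s₂, e₂, i₂, ⟨m₂, hm₂, -⟩⟩, γ₂', a₂', ha₂', o₂', s₂', e₂', i₂', ⟨n₂, hn₂, -⟩⟩ := h₂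
  have hσ := (eq_of_first_hit (p := fun y : Phase d => y.1 ∉ interior A) ha₁ ha₂
    ((o₁.mono (min_le_left _ _)).eqOn hΩ hU (o₂.mono (min_le_right _ _)) (s₁.trans s₂.symm))
    (fun t ht => not_not.2 (i₁ t ht)) (e₁ ▸ hm₁.notMem_interior)
    (fun t ht => not_not.2 (i₂ t ht)) (e₂ ▸ hm₂.notMem_interior)).2
  rw [e₁, e₂] at hσ
  have hρ := (eq_of_first_hit (p := fun y : Phase d => y.1 ∈ A) ha₁' ha₂'
    ((o₁'.mono (min_le_left _ _)).eqOn hΩ hU (o₂'.mono (min_le_right _ _))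
      (s₁'.trans (hσ.trans s₂'.symm))) i₁' (e₁' ▸ hn₁.mem) i₂' (e₂' ▸ hn₂.mem)).2
  rwa [e₁', e₂'] at hρ

theorem IsBilliardStep.unique {ρ ρ₁ ρ₂ : Phase d} (h₁ : IsBilliardStep A ρ ρ₁)
    (h₂ : IsBilliardStep A ρ ρ₂) : ρ₁ = ρ₂ := by
  obtain ⟨a, ha, i₁, m₁, hm₁, -, rfl⟩ := h₁
  obtain ⟨b, hb, i₂, m₂, hm₂, -, rfl⟩ := h₂
  obtain ⟨rfl, -⟩ := eq_of_first_hit (p := fun q : Conf d => q ∉ interior A) ha hb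
    (fun t _ => rfl) (fun t ht => not_not.2 (i₁ t ht)) hm₁.notMem_interior
    (fun t ht => not_not.2 (i₂ t ht)) hm₂.notMem_interior
  rw [hm₁.unique hm₂]

end Unique

/-! ### Closeness along the cross-section -/

section Section

variable {d n r : ℕ} {B : BilliardTable d n r} {α : ℝ} {P : PowerLawPotential B α}

theorem crCloseAlong_of_maps {X : Type} [NormedAddCommGroup X] [NormedSpace ℝ X] {f g Φ Ψ : X → X}
    (hf : ContDiff ℝ r f) (hg : ContDiff ℝ r g) {x : X} {c : ℝ}
    (h : ∀ k ≤ r, ‖iteratedFDeriv ℝ k (fun y => f y - g y) x‖ ≤ c) {M U : Set X} (hU : U ∈ 𝓝 x)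
    (hΦ : ∀ y ∈ M ∩ U, Φ y = f y) (hΨ : ∀ y ∈ M ∩ U, Ψ y = g y) :
    CrCloseAlong r M Φ Ψ x (r.factorial * c) := by
  intro φ hφ hx hM hder
  have hmem : ∀ᶠ y in 𝓝 0, φ y ∈ M ∩ U := hM.and (hφ.continuousAt.eventually (hx.symm ▸ hU))
  have hc : 0 ≤ c := (norm_nonneg _).trans (h 0 (Nat.zero_le _))
  refine CrCloseAt.congr_germ (f := f ∘ φ) (g := g ∘ φ) ⟨hf.contDiffAt.comp 0 hφ,
    hg.contDiffAt.comp 0 hφ, fun k hk => ?_⟩ (hmem.mono fun y hy => hΦ _ hy)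
    (hmem.mono fun y hy => hΨ _ hy)
  obtain ⟨u, hu, hφu⟩ := hφ.contDiffOn le_rfl (by simp)
  obtain ⟨v, hvu, hvo, h0v⟩ := mem_nhds_iff.1 hu
  have := norm_iteratedFDerivWithin_comp_le (g := fun y => f y - g y) (f := φ) (s := v) (t := univ)
    (n := k) (C := c) (D := 1) (hf.sub hg).contDiffOn (hφu.mono hvu) (by exact_mod_cast hk)
    uniqueDiffOn_univ hvo.uniqueDiffOn (mapsTo_univ _ _) h0v
    (fun i hi => by rw [iteratedFDerivWithin_univ, hx]; exact h i (hi.trans hk))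
    (fun i hi1 hi => by
      rw [iteratedFDerivWithin_of_isOpen i hvo h0v, one_pow]; exact hder i hi1 (hi.trans hk))
  rw [iteratedFDerivWithin_of_isOpen k hvo h0v, one_pow, mul_one] at this
  refine this.trans (mul_le_mul_of_nonneg_right ?_ hc)
  exact_mod_cast Nat.factorial_le hk

theorem CrCloseAlong.mono {X : Type} [NormedAddCommGroup X] [NormedSpace ℝ X] {Φ Ψ : X → X}
    {M : Set X} {x : X} {c c' : ℝ} (h : CrCloseAlong r M Φ Ψ x c) (hc : c ≤ c') :
    CrCloseAlong r M Φ Ψ x c' := fun φ h1 h2 h3 h4 =>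
  ⟨(h φ h1 h2 h3 h4).1, (h φ h1 h2 h3 h4).2.1, fun k hk => ((h φ h1 h2 h3 h4).2.2 k hk).trans hc⟩

theorem map_closeness (hr : 1 ≤ r) (hα : 0 < α) (hP : P.BoundaryDominated) {K : Set (Phase d)}
    (hK : IsCompact K) (hreg : ∀ ρ ∈ K, ρ.1 ∉ B.corners ∧ ρ ∈ inwardSection B.D ∧
      ∃ ρ', IsBilliardStep B.D ρ ρ' ∧ ρ'.1 ∉ B.corners) :
    ∃ U : Set (Phase d), IsOpen U ∧ K ⊆ U ∧ ∃ C > 0, ∃ ε₁ > 0, ∀ ε ∈ Ioo 0 ε₁,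
      ∃ Φ Bε : Phase d → Phase d, ∀ ρ ∈ inwardSection (P.auxTable ε) ∩ U,
        IsPoincareStep (P.Ω ε) (P.V ε) (P.auxTable ε) ρ (Φ ρ) ∧
        IsBilliardStep (P.auxTable ε) ρ (Bε ρ) ∧
        CrCloseAlong r (inwardSection (P.auxTable ε)) Φ Bε ρ (C * nu r α ε) := by
  have hβ := eventually_nu_nonneg (r := r) hα
  obtain ⟨Φ, hΦ⟩ : ∃ Φ : ℝ → Phase d → Phase d, ∀ ε ρ ρ',
      IsPoincareStep (P.Ω ε) (P.V ε) (P.auxTable ε) ρ ρ' →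
      IsPoincareStep (P.Ω ε) (P.V ε) (P.auxTable ε) ρ (Φ ε ρ) :=
    ⟨fun ε ρ => Classical.epsilon (IsPoincareStep (P.Ω ε) (P.V ε) (P.auxTable ε) ρ),
      fun ε ρ ρ' h => Classical.epsilon_spec ⟨ρ', h⟩⟩
  obtain ⟨Ψ, hΨ⟩ : ∃ Ψ : ℝ → Phase d → Phase d, ∀ ε ρ ρ',
      IsBilliardStep (P.auxTable ε) ρ ρ' → IsBilliardStep (P.auxTable ε) ρ (Ψ ε ρ) :=
    ⟨fun ε ρ => Classical.epsilon (IsBilliardStep (P.auxTable ε) ρ),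
      fun ε ρ ρ' h => Classical.epsilon_spec ⟨ρ', h⟩⟩
  suffices H : ∃ U : Set (Phase d), IsOpen U ∧ K ⊆ U ∧ ∃ C > 0, ∀ᶠ ε in 𝓝[>] (0 : ℝ),
      ∀ ρ ∈ inwardSection (P.auxTable ε) ∩ U,
        IsPoincareStep (P.Ω ε) (P.V ε) (P.auxTable ε) ρ (Φ ε ρ) ∧
        IsBilliardStep (P.auxTable ε) ρ (Ψ ε ρ) ∧
        CrCloseAlong r (inwardSection (P.auxTable ε)) (Φ ε) (Ψ ε) ρ (C * nu r α ε) by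
    obtain ⟨U, hU, hKU, C, hC, hev⟩ := H
    obtain ⟨ε₁, hε₁, hall⟩ := mem_nhdsGT_iff_exists_Ioo_subset.1 hev
    exact ⟨U, hU, hKU, C, hC, ε₁, hε₁, fun ε hε => ⟨Φ ε, Ψ ε, hall hε⟩⟩
  refine hK.induction_on (p := fun s => ∃ U : Set (Phase d), IsOpen U ∧ s ⊆ U ∧ ∃ C > 0,
    ∀ᶠ ε in 𝓝[>] (0 : ℝ), ∀ ρ ∈ inwardSection (P.auxTable ε) ∩ U,
      IsPoincareStep (P.Ω ε) (P.V ε) (P.auxTable ε) ρ (Φ ε ρ) ∧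
      IsBilliardStep (P.auxTable ε) ρ (Ψ ε ρ) ∧
      CrCloseAlong r (inwardSection (P.auxTable ε)) (Φ ε) (Ψ ε) ρ (C * nu r α ε)) ?_ ?_ ?_ ?_
  · exact ⟨∅, isOpen_empty, le_rfl, 1, one_pos, .of_forall fun ε ρ hρ => absurd hρ.2 (notMem_empty _)⟩
  · rintro s t hst ⟨U, hU, htU, h⟩
    exact ⟨U, hU, hst.trans htU, h⟩
  · rintro s t ⟨U, hU, hsU, C, hC, h⟩ ⟨U', hU', htU', C', hC', h'⟩
    refine ⟨U ∪ U', hU.union hU', union_subset_union hsU htU', max C C', lt_max_of_lt_left hC, ?_⟩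
    filter_upwards [h, h', hβ] with ε h h' hν ρ hρ
    rcases hρ.2 with hρU | hρU
    · obtain ⟨a, b, c⟩ := h ρ ⟨hρ.1, hρU⟩
      exact ⟨a, b, c.mono (mul_le_mul_of_nonneg_right (le_max_left _ _) hν)⟩
    · obtain ⟨a, b, c⟩ := h' ρ ⟨hρ.1, hρU⟩
      exact ⟨a, b, c.mono (mul_le_mul_of_nonneg_right (le_max_right _ _) hν)⟩
  · rintro ⟨q₀, p₀⟩ hρ
    obtain ⟨hc₀, ⟨m₀, hm₀, hin⟩, ρ', ⟨T, hT, hint, m₁, hm₁, hout, rfl⟩, hc₁⟩ := hreg _ hρ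
    obtain ⟨F, G, hFG, hev⟩ := exists_step_maps hr hα hP hT rfl hm₀ hin hc₀ hint hm₁ hout hc₁
    obtain ⟨R, hR, hev⟩ := eventually_prod_ball hev
    obtain ⟨C, hC, hd⟩ := hFG.norm_iteratedFDeriv_sub_le hβ (‖((q₀, p₀) : Phase d)‖ + R)
    have hball : Metric.ball (q₀, p₀) R ∈ 𝓝 ((q₀, p₀) : Phase d) := Metric.ball_mem_nhds _ hR
    refine ⟨_, mem_nhdsWithin_of_mem_nhds hball, Metric.ball (q₀, p₀) R, Metric.isOpen_ball, le_rfl,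
      r.factorial * (C + 1), by positivity, ?_⟩
    filter_upwards [hev, hd, hFG.contDiff hr, hβ, P.eventually_mem] with ε h1 h2 h3 hν hε
    have hr2 : ((2 : ℕ) : WithTop ℕ∞) ≤ ((r + 1 : ℕ) : WithTop ℕ∞) :=
      Nat.cast_le.2 (Nat.succ_le_succ hr)
    have hU : ContDiffOn ℝ 2 (P.V ε) (P.Ω ε) :=
      (P.contDiff_V ε hε).of_le (by simpa using hr2)
    have hstep : ∀ ρ ∈ inwardSection (P.auxTable ε) ∩ Metric.ball (q₀, p₀) R,
        IsPoincareStep (P.Ω ε) (P.V ε) (P.auxTable ε) ρ (F ε ρ) ∧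
        IsBilliardStep (P.auxTable ε) ρ (G ε ρ) := fun ρ hρ =>
      h1 ρ (mem_ball_iff_norm.1 hρ.2) hρ.1
    intro ρ hρ
    obtain ⟨s1, s2⟩ := hstep ρ hρ
    refine ⟨hΦ _ _ _ s1, hΨ _ _ _ s2, ?_⟩
    rw [mul_assoc]
    refine crCloseAlong_of_maps h3.1 h3.2 (fun k hk => (h2 k hk ρ ?_).trans ?_)
      (Metric.isOpen_ball.mem_nhds hρ.2)
      (fun y hy => (hΦ _ _ _ (hstep y hy).1).unique (P.isOpen_Ω ε hε) hU (hstep y hy).1)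
      (fun y hy => (hΨ _ _ _ (hstep y hy).2).unique (hstep y hy).2)
    · have h5 := mem_ball_iff_norm.1 hρ.2
      have := norm_add_le ((q₀, p₀) : Phase d) (ρ - (q₀, p₀))
      rw [add_sub_cancel] at this
      linarith
    · exact mul_le_mul_of_nonneg_right (by linarith) hν

end Section

end SteepBilliard

end

theorem mainTheorem10 {d n r : ℕ} (hr : 1 ≤ r) {α : ℝ} (hα : 0 < α)
    (B : SteepBilliard.BilliardTable d n r) (P : SteepBilliard.PowerLawPotential B α)
    (hP : P.BoundaryDominated) :
    -- the level of the auxiliary billiard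
    ((fun ε => SteepBilliard.eta r α ε) =O[𝓝[>] (0 : ℝ)]
      (fun ε => SteepBilliard.nu r α ε ^ (r + 2))) ∧
    -- closeness of the flows, near a regular billiard orbit on `[0,T]`, off the impact intervals
    (∀ (T : ℝ) (S₀ : Finset ℝ) (b₀ : ℝ → SteepBilliard.Phase d), 0 < T →
      SteepBilliard.IsRegularBilliardOrbit B.D T S₀ b₀ → ‖(b₀ 0).2‖ = 1 →
      (∀ s ∈ S₀, (b₀ s).1 ∉ B.corners) →
      ∃ U : Set (SteepBilliard.Phase d), IsOpen U ∧ b₀ 0 ∈ U ∧ ∃ C > 0, ∃ ε₁ > 0,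
        ∀ ε ∈ Set.Ioo 0 ε₁,
          ∃ (h b : ℝ → SteepBilliard.Phase d → SteepBilliard.Phase d)
            (S : SteepBilliard.Phase d → Finset ℝ),
            ∀ ρ ∈ U,
              h 0 ρ = ρ ∧
              SteepBilliard.IsHamiltonianOrbit (P.Ω ε) (P.V ε) T (fun t => h t ρ) ∧
              b 0 ρ = ρ ∧
              SteepBilliard.IsRegularBilliardOrbit (P.auxTable ε) T (S ρ) (fun t => b t ρ) ∧
              (S ρ).card = S₀.card ∧
              ∀ t ∈ Set.Icc 0 T,
                (∀ s ∈ S ρ, t ∉ Set.Icc (s - C * SteepBilliard.impactScale r α ε)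
                  (s + C * SteepBilliard.impactScale r α ε)) →
                SteepBilliard.CrCloseAt r (h t) (b t) ρ (C * SteepBilliard.nu r α ε)) ∧
    -- closeness of the Poincaré map and the auxiliary billiard map, near regular reflections
    (∀ K : Set (SteepBilliard.Phase d), IsCompact K →
      (∀ ρ ∈ K, ‖ρ.2‖ = 1 ∧ ρ.1 ∉ B.corners ∧ ρ ∈ SteepBilliard.inwardSection B.D ∧
        ∃ ρ', SteepBilliard.IsBilliardStep B.D ρ ρ' ∧ ρ'.1 ∉ B.corners) →
      ∃ U : Set (SteepBilliard.Phase d), IsOpen U ∧ K ⊆ U ∧ ∃ C > 0, ∃ ε₁ > 0,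
        ∀ ε ∈ Set.Ioo 0 ε₁,
          ∃ Φ Bε : SteepBilliard.Phase d → SteepBilliard.Phase d,
            ∀ ρ ∈ SteepBilliard.inwardSection (P.auxTable ε) ∩ U,
              SteepBilliard.IsPoincareStep (P.Ω ε) (P.V ε) (P.auxTable ε) ρ (Φ ρ) ∧
              SteepBilliard.IsBilliardStep (P.auxTable ε) ρ (Bε ρ) ∧
              SteepBilliard.CrCloseAlong r (SteepBilliard.inwardSection (P.auxTable ε)) Φ Bε ρ
                (C * SteepBilliard.nu r α ε)) :=
  ⟨(EventuallyEq.isBigO (by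
      filter_upwards [self_mem_nhdsWithin] with ε hε using SteepBilliard.eta_eq hα hε)),
    fun _ _ _ hT hb _ hS => by
      obtain ⟨D⟩ := SteepBilliard.flow_closeness hr hα hP hT hb hS
      exact D.exists_crCloseAt hr hα,
    fun _ hK hreg => SteepBilliard.map_closeness hr hα hP hK fun ρ hρ => (hreg ρ hρ).2⟩
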